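/- **Setting.** Let $\omega,\varepsilon_0,\mu_0>0$, $k=\omega\sqrt{\mu_0\varepsilon_0}$, and let $B_r\subset\mathbb R^3$ be the open ball of radius $r>0$ about $0$. Let $\mathbf E^0,\mathbf H^0:B_r\to\mathbb C^3$ be differentiable, not both identically zero, and satisfy in $B_r$ $$\nabla\wedge\mathbf E^0-\mathrm i\omega\mu_0\mathbf H^0=0,\qquad \nabla\wedge\mathbf H^0+\mathrm i\omega\varepsilon_0\mathbf E^0=0 .$$ *Inadmissibility.* For a field $\mathbf V$ that is real-analytic near $0$, let $\mathbf P_n[\mathbf V]$ be the homogeneous part of degree $n$ of its Taylor series at $0$, and let $N_{\mathbf V}$ be the least $n$ with $\mathbf P_n[\mathbf V]\not\equiv0$ ($N_{\mathbf V}=\infty$ if there is none). A pair $(\mathbf E,\mathbf H)$ of fields that are real-analytic near $0$ is *inadmissible* if $N:=\min\{N_{\mathbf E},N_{\mathbf H}\}$ satisfies $1\le N<\infty$ and, for each $\mathbf S\in\{\mathbf E,\mathbf H\}$ with $N_{\mathbf S}=N$, there are polynomials $Q_1,Q_2,Q_3$ with complex coefficients, each homogeneous or zero, such that - if $N$ is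 odd: $\deg Q_j=N-1$ (or $Q_j=0$) and $(\mathbf P_N[\mathbf S])_j=x_jQ_j$ for $j=1,2,3$; - if $N$ is even: $\deg Q_j=N-2$ (or $Q_j=0$) and $(\mathbf P_N[\mathbf S])_j=Q_j\prod_{i\ne j}x_i$ for $j=1,2,3$. *Vector spherical waves.* Let $Y_l^m(\theta,\varphi)=\sqrt{\frac{2l+1}{4\pi}\frac{(l-|m|)!}{(l+|m|)!}}\,P_l^{|m|}(\cos\theta)e^{\mathrm im\varphi}$ for $|m|\le l$, where $P_l^m(t)=(1-t^2)^{m/2}P_l^{(m)}(t)$ and $P_l$ is the Legendre polynomial. Put $\mathbf T_l^m(\hat{\mathbf x})=\frac1{\sqrt{l(l+1)}}\nabla_{\mathrm S}Y_l^m(\hat{\mathbf x})\wedge\hat{\mathbf x}$ for $l\ge1$, where $\nabla_{\mathrm S}$ is the surface gradient on $\mathbb S^2$ and $\hat{\mathbf x}=\mathbf x/|\mathbf x|$, and let $j_l$ be the spherical Bessel functions. For $l\ge0$ and $|m|\le l+1$ put $$\mathbf E_{l,m}(\mathbf x)=j_{l+1}(k|\mathbf x|)\,\mathbf T_{l+1}^m(\hat{\mathbf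 x}),\qquad \mathbf H_{l,m}=-\frac{\mathrm i}{\omega\mu_0}\nabla\wedge\mathbf E_{l,m},$$ $$(\mathbf{EH})_{l,m}=(\mathbf E_{l,m},\mathbf H_{l,m}),\qquad (\mathbf{HE})_{l,m}=\Bigl(-\frac{\mu_0}{\varepsilon_0}\mathbf H_{l,m},\mathbf E_{l,m}\Bigr).$$ **Theorem.** The pair $(\mathbf E^0,\mathbf H^0)$ is inadmissible if and only if there are an integer $l_0\ge1$ and complex numbers $a_{l_0,m},b_{l_0,m}$ (for integers $m$ with $(l_0+1)\bmod 2\le m\le\lfloor (l_0+1)/2\rfloor$) and $a_{l,m},b_{l,m}$ (for $l>l_0$, $|m|\le l+1$) such that $$\sum_{m=(l_0+1)\bmod 2}^{\lfloor (l_0+1)/2\rfloor}\bigl(|a_{l_0,m}|^2+|b_{l_0,m}|^2\bigr)\ne0$$ and, everywhere in $B_r$, $$\begin{aligned}(\mathbf E^0,\mathbf H^0)={}&\sum_{m=(l_0+1)\bmod 2}^{\lfloor (l_0+1)/2\rfloor}a_{l_0,m}\bigl((\mathbf{EH})_{l_0,2m}+(-1)^{l_0+1}(\mathbf{EH})_{l_0,-2m}\bigr)\\&+\sum_{m=(l_0+1)\bmod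 2}^{\lfloor (l_0+1)/2\rfloor}b_{l_0,m}\bigl((\mathbf{HE})_{l_0,2m}+(-1)^{l_0+1}(\mathbf{HE})_{l_0,-2m}\bigr)\\&+\sum_{l>l_0}\ \sum_{|m|\le l+1}\bigl(a_{l,m}(\mathbf{EH})_{l,m}+b_{l,m}(\mathbf{HE})_{l,m}\bigr),\end{aligned}$$ where the series over $l$ converges absolutely at every point of $B_r$. -/

import Mathlib

open scoped BigOperators

noncomputable section

namespace MaxwellCorner

/-- Physical space `ℝ³` with its Euclidean norm. -/
abbrev R3 : Type := EuclideanSpace ℝ (Fin 3)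

/-- Complex vectors with three components. -/
abbrev C3 : Type := Fin 3 → ℂ

/-- The partial derivative `∂_i f` of a complex-valued function on `ℝ³`. -/
def partialDeriv (i : Fin 3) (f : R3 → ℂ) (x : R3) : ℂ :=
  fderiv ℝ f x (EuclideanSpace.single i (1 : ℝ))

/-- The curl `∇ ∧ V` of a complex vector field on `ℝ³`. -/
def curl (V : R3 → C3) (x : R3) : C3 :=
  ![partialDeriv 1 (fun y => V y 2) x - partialDeriv 2 (fun y => V y 1) x,
    partialDeriv 2 (fun y => V y 0) x - partialDeriv 0 (fun y => V y 2) x,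
    partialDeriv 0 (fun y => V y 1) x - partialDeriv 1 (fun y => V y 0) x]

/-- `(E, H)` is a (classical) solution in `U` of the time-harmonic Maxwell system
`∇ ∧ E - i ω μ₀ H = 0`, `∇ ∧ H + i ω ε₀ E = 0`. -/
def IsMaxwellSolution (ω ε₀ μ₀ : ℝ) (U : Set R3) (E H : R3 → C3) : Prop :=
  ∀ x ∈ U, DifferentiableAt ℝ E x ∧ DifferentiableAt ℝ H x ∧
    curl E x - (Complex.I * ω * μ₀) • H x = 0 ∧
    curl H x + (Complex.I * ω * ε₀) • E x = 0

/-! ### Lowest-order homogeneous polynomials and inadmissible pairs -/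

/-- The homogeneous part of degree `n` of the Taylor series of `V` at the origin, that is
`x ↦ ∑_{|α| = n} C_α x ^ α` with `C_α = ∂^α V (0) / α!`, written as `D^n V (0) (x, …, x) / n!`. -/
def taylorPart (V : R3 → C3) (n : ℕ) (x : R3) : C3 :=
  ((n.factorial : ℝ)⁻¹) • iteratedFDeriv ℝ n V 0 (fun _ => x)

/-- The lowest order of the Taylor series of `V` at the origin: the least degree whose homogeneous
part is not identically zero (`⊤` when the whole Taylor series vanishes). -/
def lowestOrder (V : R3 → C3) : ℕ∞ :=
  sInf ((fun n : ℕ => (n : ℕ∞)) '' {n : ℕ | taylorPart V n ≠ 0})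

/-- Condition for odd `N` on a vector polynomial `P`: its `j`-th component is `x_j Q_j`, with `Q_j`
a (possibly zero) homogeneous polynomial of degree `N - 1`. -/
def OddForm (N : ℕ) (P : R3 → C3) : Prop :=
  ∃ Q : Fin 3 → MvPolynomial (Fin 3) ℂ,
    (∀ j, (Q j).IsHomogeneous (N - 1)) ∧
    ∀ (x : R3) (j : Fin 3),
      P x j = (x j : ℂ) * MvPolynomial.eval (fun i => (x i : ℂ)) (Q j)

/-- Condition for even `N` on a vector polynomial `P`: its `j`-th component is
`Q_j ∏_{i ≠ j} x_i`, with `Q_j` a (possibly zero) homogeneous polynomial of degree `N - 2`. -/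
def EvenForm (N : ℕ) (P : R3 → C3) : Prop :=
  ∃ Q : Fin 3 → MvPolynomial (Fin 3) ℂ,
    (∀ j, (Q j).IsHomogeneous (N - 2)) ∧
    ∀ (x : R3) (j : Fin 3),
      P x j = MvPolynomial.eval (fun i => (x i : ℂ)) (Q j) *
        ∏ i ∈ Finset.univ.erase j, (x i : ℂ)

/-- A pair of fields, real-analytic near the origin, is inadmissible. With `N` the smaller of the two
lowest orders, the fields `S` below are those among `E`, `H` whose lowest order is `N`; for them
`taylorPart S N` is the lowest-order homogeneous polynomial. -/
def Inadmissible (E H : R3 → C3) : Prop :=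
  AnalyticAt ℝ E 0 ∧ AnalyticAt ℝ H 0 ∧
  ∃ N : ℕ, (N : ℕ∞) = min (lowestOrder E) (lowestOrder H) ∧ 1 ≤ N ∧
    ∀ S : R3 → C3, (S = E ∨ S = H) → lowestOrder S = N →
      (Odd N → OddForm N (taylorPart S N)) ∧ (Even N → EvenForm N (taylorPart S N))

/-! ### Vector spherical waves -/

/-- The Legendre polynomial `P_l`, by Rodrigues' formula. -/
def legendre (l : ℕ) : Polynomial ℝ :=
  Polynomial.C ((2 ^ l * (l.factorial : ℝ))⁻¹) *
    Polynomial.derivative^[l] ((Polynomial.X ^ 2 - 1) ^ l)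

/-- The associated Legendre function `P_l^m (t) = (1 - t²)^{m/2} d^m P_l / dt^m`. -/
def assocLegendre (l m : ℕ) (t : ℝ) : ℝ :=
  Real.sqrt (1 - t ^ 2) ^ m * (Polynomial.derivative^[m] (legendre l)).eval t

/-- Laplace's spherical harmonic `Y_l^m (θ, φ)`, for `|m| ≤ l`, in angular coordinates. -/
def sphHarmAngle (l : ℕ) (m : ℤ) (θ φ : ℝ) : ℂ :=
  (Real.sqrt ((2 * l + 1) / (4 * Real.pi) *
      (((l - m.natAbs).factorial : ℝ) / ((l + m.natAbs).factorial : ℝ))) : ℂ) *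
    (assocLegendre l m.natAbs (Real.cos θ) : ℂ) * Complex.exp (Complex.I * m * φ)

/-- `Y_l^m` as a function on the unit sphere; a unit vector `x` has polar angle `arccos x₃` and
azimuth `arg (x₁ + i x₂)`. -/
def sphHarm (l : ℕ) (m : ℤ) (x : R3) : ℂ :=
  sphHarmAngle l m (Real.arccos (x 2)) (Complex.arg ((x 0 : ℂ) + Complex.I * (x 1 : ℂ)))

/-- The direction `x / |x|`. -/
def dir (x : R3) : R3 := ‖x‖⁻¹ • x

/-- The surface gradient `∇_S f` at a point `x` of the unit sphere: the gradient at `x` of the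
extension of `f` that is constant along rays. -/
def surfaceGrad (f : R3 → ℂ) (x : R3) : C3 :=
  fun i => partialDeriv i (fun y => f (dir y)) x

/-- A real vector seen as a complex one. -/
def toC3 (x : R3) : C3 := fun i => (x i : ℂ)

/-- `T_l^m = (l (l+1))^{-1/2} ∇_S Y_l^m ∧ x` on the unit sphere, for `l ≥ 1`. -/
def sphT (l : ℕ) (m : ℤ) (x : R3) : C3 :=
  (((Real.sqrt ((l : ℝ) * (l + 1)))⁻¹ : ℝ) : ℂ) •
    crossProduct (surfaceGrad (sphHarm l m) x) (toC3 x)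

/-- The spherical Bessel function `j_l`. -/
def sphBessel (l : ℕ) (t : ℝ) : ℝ :=
  ∑' n : ℕ, (-1) ^ n * (((l + n).factorial : ℝ) * 2 ^ l) /
    ((n.factorial : ℝ) * ((2 * l + 2 * n + 1).factorial : ℝ)) * t ^ (l + 2 * n)

/-- The wave number `k = ω √(μ₀ ε₀)`. -/
def waveNumber (ω ε₀ μ₀ : ℝ) : ℝ := ω * Real.sqrt (μ₀ * ε₀)

/-- `E_{l,m} (x) = j_{l+1} (k |x|) T_{l+1}^m (x / |x|)`; it vanishes at the origin, as `j_{l+1} (0) = 0`. -/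
def waveE (ω ε₀ μ₀ : ℝ) (l : ℕ) (m : ℤ) (x : R3) : C3 :=
  (sphBessel (l + 1) (waveNumber ω ε₀ μ₀ * ‖x‖) : ℂ) • sphT (l + 1) m (dir x)

/-- `H_{l,m} = - (i / (ω μ₀)) ∇ ∧ E_{l,m}`. -/
def waveH (ω ε₀ μ₀ : ℝ) (l : ℕ) (m : ℤ) (x : R3) : C3 :=
  (-(Complex.I / (ω * μ₀))) • curl (waveE ω ε₀ μ₀ l m) x

/-- The six-dimensional field `(EH)_{l,m} = (E_{l,m}, H_{l,m})`. -/
def waveEH (ω ε₀ μ₀ : ℝ) (l : ℕ) (m : ℤ) (x : R3) : C3 × C3 :=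
  (waveE ω ε₀ μ₀ l m x, waveH ω ε₀ μ₀ l m x)

/-- The six-dimensional field `(HE)_{l,m} = (-(μ₀ / ε₀) H_{l,m}, E_{l,m})`. -/
def waveHE (ω ε₀ μ₀ : ℝ) (l : ℕ) (m : ℤ) (x : R3) : C3 × C3 :=
  ((-((μ₀ : ℂ) / ε₀)) • waveH ω ε₀ μ₀ l m x, waveE ω ε₀ μ₀ l m x)

/-- The index range `(l + 1) mod 2 ≤ m ≤ [(l + 1) / 2]` of the lowest-degree part. -/
def leadIndices (l : ℕ) : Finset ℕ := Finset.Icc ((l + 1) % 2) ((l + 1) / 2)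

/-- For a family `W` of six-dimensional fields, the combination
`∑_m c_m (W_{l,2m} + (-1)^{l+1} W_{l,-2m})` over `(l + 1) mod 2 ≤ m ≤ [(l + 1) / 2]`. -/
def leadSum (W : ℕ → ℤ → R3 → C3 × C3) (l : ℕ) (c : ℕ → ℂ) (x : R3) : C3 × C3 :=
  ∑ m ∈ leadIndices l,
    c m • (W l (2 * (m : ℤ)) x + (-1 : ℂ) ^ (l + 1) • W l (-(2 * (m : ℤ))) x)

/-- The degree `l` block `∑_{|m| ≤ l + 1} (a_{l,m} (EH)_{l,m} + b_{l,m} (HE)_{l,m})`. -/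
def waveBlock (ω ε₀ μ₀ : ℝ) (a b : ℕ → ℤ → ℂ) (l : ℕ) (x : R3) : C3 × C3 :=
  ∑ m ∈ Finset.Icc (-((l : ℤ) + 1)) ((l : ℤ) + 1),
    (a l m • waveEH ω ε₀ μ₀ l m x + b l m • waveHE ω ε₀ μ₀ l m x)

end MaxwellCorner

end

noncomputable section
namespace MaxwellCorner

open MvPolynomial (X pderiv)

/-! ### Partial derivatives -/

/-! Everything is reduced to two sequences of harmonic polynomials. Put κ = k², write j_n(t) = t^n
b_n(t²), and for a homogeneous harmonic polynomial P of degree n set M = b_n(κ|x|²) ∇P ∧ x and N =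
curl M. Then curl N = κM (`curl_mField`, `curl_nField`), so suitable combinations of M for A and N
for B (electric part), and of N for A and M for B (magnetic part), solve the Maxwell system. M is
tangential, and x · N = n(n+1) b_n P, so the radial components of such a multipole recover B from E
and A from H. A vector spherical wave is the multipole of one solid harmonic, up to a nonzero factor
(`waveEH_eq`, `waveHE_eq`).

Every solution is a sum of multipoles (`maxwell_expansion`). The fields are only assumed
differentiable, so x · E and x · H are first shown to solve the Helmholtz equation in the sense of
distributions (`weakHelmholtz_radial`). The integral of such a function against a spherical harmonic
over the sphere of radius ρ solves the radial equation weakly and is bounded near 0, hence is a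
multiple of ρ^n b_n(κρ²) (`sphPair_eq`). Completeness of the spherical harmonics and estimates for
harmonic polynomials turn this into a convergent expansion (`helmholtz_expansion`), which defines
the potentials A_n and B_n. The difference between the solution and its multipole series solves the
Maxwell system without radial components, and vanishes by a Gronwall argument along rays
(`maxwell_eq_zero_of_radial`). The potentials of positive degree are unique (`pole_unique`).

Let N + 1 be the lowest degree in which A or B is nonzero. Both fields are analytic at 0, and their
Taylor parts of degree N are nonzero multiples of ∇B_{N+1} for E and ∇A_{N+1} for H
(`hasLead_multipole`). Thus inadmissibility is a divisibility condition on the gradient of a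
harmonic polynomial P of degree N + 1. Harmonicity relates the coefficients of monomials whose
exponents differ by 2, so the condition, which only excludes exponent 1 (N odd) or exponent 0 (N
even), excludes every exponent of the wrong parity (`oddForm_iff`, `evenForm_iff`). It therefore
says that each coordinate reflection multiplies P by (-1)^(N+1).

Reflections permute the solid harmonics up to sign: the one in x₃ selects even orders, the other two
exchange the orders m and -m. Hence the polynomials with this symmetry are exactly the span of the
combinations S_n^{2m} + (-1)^n S_n^{-2m}, n = N + 1 (`exists_lead_sum`), which are independent for m
in the stated range (`linearIndependent_leadSolid`). With l₀ = N this is the asserted form of the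
leading block. No condition falls on the higher degrees, where the waves span all potentials. -/

theorem partialDeriv_eq {f : R3 → ℂ} {f' : R3 →L[ℝ] ℂ} {x : R3} (h : HasFDerivAt f f' x)
    (i : Fin 3) : partialDeriv i f x = f' (EuclideanSpace.single i (1 : ℝ)) := by
  rw [partialDeriv, h.fderiv]

theorem partialDeriv_congr {f g : R3 → ℂ} {x : R3} (h : f =ᶠ[nhds x] g) (i : Fin 3) :
    partialDeriv i f x = partialDeriv i g x := by
  rw [partialDeriv, partialDeriv, h.fderiv_eq]

theorem partialDeriv_add {f g : R3 → ℂ} {x : R3} (hf : DifferentiableAt ℝ f x)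
    (hg : DifferentiableAt ℝ g x) (i : Fin 3) :
    partialDeriv i (fun y => f y + g y) x = partialDeriv i f x + partialDeriv i g x := by
  rw [partialDeriv_eq (hf.hasFDerivAt.fun_add hg.hasFDerivAt)]; rfl

theorem partialDeriv_sub {f g : R3 → ℂ} {x : R3} (hf : DifferentiableAt ℝ f x)
    (hg : DifferentiableAt ℝ g x) (i : Fin 3) :
    partialDeriv i (fun y => f y - g y) x = partialDeriv i f x - partialDeriv i g x := by
  rw [partialDeriv_eq (hf.hasFDerivAt.fun_sub hg.hasFDerivAt)]; rfl

theorem partialDeriv_const_mul {f : R3 → ℂ} {x : R3} (hf : DifferentiableAt ℝ f x) (c : ℂ)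
    (i : Fin 3) : partialDeriv i (fun y => c * f y) x = c * partialDeriv i f x := by
  rw [partialDeriv_eq (hf.hasFDerivAt.const_mul c)]; rfl

theorem partialDeriv_mul {f g : R3 → ℂ} {x : R3} (hf : DifferentiableAt ℝ f x)
    (hg : DifferentiableAt ℝ g x) (i : Fin 3) :
    partialDeriv i (fun y => f y * g y) x
      = partialDeriv i f x * g x + f x * partialDeriv i g x := by
  rw [partialDeriv_eq (hf.hasFDerivAt.fun_mul hg.hasFDerivAt)]
  simp [partialDeriv]; ring

theorem partialDeriv_const (c : ℂ) (i : Fin 3) (x : R3) :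
    partialDeriv i (fun _ => c) x = 0 := by
  rw [partialDeriv_eq (hasFDerivAt_const c x)]; rfl

theorem hasFDerivAt_coord (i : Fin 3) (x : R3) :
    HasFDerivAt (fun y : R3 => ((y i : ℝ) : ℂ))
      (Complex.ofRealCLM.comp (EuclideanSpace.proj i : R3 →L[ℝ] ℝ)) x :=
  (Complex.ofRealCLM.comp (EuclideanSpace.proj i : R3 →L[ℝ] ℝ)).hasFDerivAt

theorem partialDeriv_coord (i j : Fin 3) (x : R3) :
    partialDeriv i (fun y : R3 => ((y j : ℝ) : ℂ)) x = if j = i then 1 else 0 := by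
  rw [partialDeriv_eq (hasFDerivAt_coord j x)]
  by_cases h : j = i <;> simp [h]

/-! ### Polynomials as functions on `ℝ³` -/

/-- Complex polynomials in three variables. -/
abbrev Poly : Type := MvPolynomial (Fin 3) ℂ

/-- The value of a polynomial at a real point. -/
def pev (p : Poly) (x : R3) : ℂ := MvPolynomial.eval (fun i => ((x i : ℝ) : ℂ)) p

@[simp] theorem pev_add (p q : Poly) (x : R3) : pev (p + q) x = pev p x + pev q x := by
  simp [pev]
@[simp] theorem pev_sub (p q : Poly) (x : R3) : pev (p - q) x = pev p x - pev q x := by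
  simp [pev]
@[simp] theorem pev_neg (p : Poly) (x : R3) : pev (-p) x = -pev p x := by
  simp [pev]
@[simp] theorem pev_mul (p q : Poly) (x : R3) : pev (p * q) x = pev p x * pev q x := by
  simp [pev]
@[simp] theorem pev_pow (p : Poly) (k : ℕ) (x : R3) : pev (p ^ k) x = pev p x ^ k := by
  simp [pev]
@[simp] theorem pev_zero (x : R3) : pev 0 x = 0 := by simp [pev]
@[simp] theorem pev_one (x : R3) : pev 1 x = 1 := by simp [pev]
@[simp] theorem pev_natCast (n : ℕ) (x : R3) : pev (n : Poly) x = n := by simp [pev]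
@[simp] theorem pev_X (i : Fin 3) (x : R3) : pev (X i) x = (x i : ℂ) := by simp [pev]
@[simp] theorem pev_C (c : ℂ) (x : R3) : pev (MvPolynomial.C c) x = c := by simp [pev]
@[simp] theorem pev_smul (c : ℂ) (p : Poly) (x : R3) : pev (c • p) x = c * pev p x := by
  simp [pev]
@[simp] theorem pev_sum {ι : Type*} (s : Finset ι) (f : ι → Poly) (x : R3) :
    pev (∑ i ∈ s, f i) x = ∑ i ∈ s, pev (f i) x := by
  simp [pev]

/-- The real points form a product of infinite subsets of ℂ, which is enough to separate complex
polynomials. -/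
theorem pev_injective {p q : Poly} (h : ∀ x, pev p x = pev q x) : p = q := by
  refine MvPolynomial.funext_set (fun _ => Set.range ((↑) : ℝ → ℂ))
    (fun _ => Set.infinite_range_of_injective Complex.ofReal_injective) ?_
  intro z hz
  choose y hy using fun i => hz i (Set.mem_univ i)
  have := h (WithLp.toLp 2 y)
  simpa [pev, hy] using this

theorem contDiff_pev (p : Poly) {n : WithTop ℕ∞} : ContDiff ℝ n (pev p) := by
  induction p using MvPolynomial.induction_on with
  | C a => simpa [funext (pev_C a)] using contDiff_const
  | add p q hp hq => simpa [funext (pev_add p q)] using hp.add hq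
  | mul_X p i hp =>
    have h : ContDiff ℝ n (fun y : R3 => ((y i : ℝ) : ℂ)) :=
      (Complex.ofRealCLM.comp (EuclideanSpace.proj i : R3 →L[ℝ] ℝ)).contDiff
    simpa [funext (pev_mul p (X i))] using hp.mul h

theorem differentiable_pev (p : Poly) : Differentiable ℝ (pev p) :=
  (contDiff_pev p (n := 1)).differentiable (by simp)

theorem continuous_pev (p : Poly) : Continuous (pev p) := (differentiable_pev p).continuous

theorem partialDeriv_pev (p : Poly) (i : Fin 3) (x : R3) :
    partialDeriv i (pev p) x = pev (pderiv i p) x := by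
  induction p using MvPolynomial.induction_on with
  | C a => simp [funext (pev_C a), partialDeriv_const]
  | add p q hp hq =>
    rw [funext (pev_add p q), partialDeriv_add (differentiable_pev p x) (differentiable_pev q x),
      hp, hq]; simp
  | mul_X p j hp =>
    rw [funext (pev_mul p (X j)), partialDeriv_mul (differentiable_pev p x)
      (differentiable_pev _ x), hp, funext (pev_X j), partialDeriv_coord]
    by_cases h : j = i
    · subst h; simp; ring
    · simp [h, MvPolynomial.pderiv_X_of_ne h]; ring

/-- The polynomial `|x|²`. -/
def nsq : Poly := X 0 ^ 2 + X 1 ^ 2 + X 2 ^ 2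

theorem pev_nsq (x : R3) : pev nsq x = ((‖x‖ ^ 2 : ℝ) : ℂ) := by
  rw [EuclideanSpace.norm_sq_eq]
  simp [nsq, Fin.sum_univ_three]

/-- The Laplacian on polynomials. -/
def lap : Poly →ₗ[ℂ] Poly :=
  ∑ i : Fin 3, (pderiv i : Derivation ℂ Poly Poly).toLinearMap ∘ₗ
    (pderiv i : Derivation ℂ Poly Poly).toLinearMap

theorem lap_apply (p : Poly) : lap p =
    pderiv 0 (pderiv 0 p) + pderiv 1 (pderiv 1 p) + pderiv 2 (pderiv 2 p) := by
  simp [lap, Fin.sum_univ_three]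

/-- The space of homogeneous harmonic polynomials of degree `n`. -/
def harm (n : ℕ) : Submodule ℂ Poly :=
  MvPolynomial.homogeneousSubmodule (Fin 3) ℂ n ⊓ LinearMap.ker lap

theorem mem_harm {n : ℕ} {p : Poly} : p ∈ harm n ↔ p.IsHomogeneous n ∧ lap p = 0 := by
  simp [harm]

theorem euler {n : ℕ} {p : Poly} (hp : p.IsHomogeneous n) :
    X 0 * pderiv 0 p + X 1 * pderiv 1 p + X 2 * pderiv 2 p = (n : Poly) * p := by
  have := hp.sum_X_mul_pderiv
  simpa [Fin.sum_univ_three] using this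

theorem pderiv_comm (i j : Fin 3) (p : Poly) :
    pderiv i (pderiv j p) = pderiv j (pderiv i p) := by
  apply pev_injective
  intro x
  induction p using MvPolynomial.induction_on with
  | C a => simp
  | add p q hp hq => simp [hp, hq]
  | mul_X p k hp =>
    simp only [Derivation.leibniz, MvPolynomial.pderiv_X, smul_eq_mul, map_add, pev_add, pev_mul, hp,
      Pi.single_apply]
    have h0 : ∀ (a : Fin 3) (c : Prop) [Decidable c],
        (pderiv a : Derivation ℂ Poly Poly) (if c then 1 else 0) = 0 := fun a c _ => by
      split_ifs <;> simp
    rw [h0, h0]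
    simp only [pev_zero]
    ring

theorem isHomogeneous_pderiv {n : ℕ} {p : Poly} (hp : p.IsHomogeneous n) (i : Fin 3) :
    (pderiv i p).IsHomogeneous (n - 1) := hp.pderiv

theorem pderiv_mem_harm {n : ℕ} {p : Poly} (hp : p ∈ harm n) (i : Fin 3) :
    pderiv i p ∈ harm (n - 1) := by
  rw [mem_harm] at hp ⊢
  refine ⟨hp.1.pderiv, ?_⟩
  rw [lap_apply, pderiv_comm 0 i, pderiv_comm 1 i, pderiv_comm 2 i, pderiv_comm 0 i,
    pderiv_comm 1 i, pderiv_comm 2 i, ← map_add, ← map_add, ← lap_apply, hp.2, map_zero]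

theorem pev_homog {n : ℕ} {p : Poly} (hp : p.IsHomogeneous n) (t : ℝ) (x : R3) :
    pev p (t • x) = (t : ℂ) ^ n * pev p x := by
  rw [pev, pev, MvPolynomial.eval_eq, MvPolynomial.eval_eq, Finset.mul_sum]
  refine Finset.sum_congr rfl fun d hd => ?_
  have hdeg : ∑ i, d i = n := by
    have := hp.degree_eq_sum_deg_support hd
    rw [this]
    exact (Finset.sum_subset (Finset.subset_univ _) fun i _ hi =>
      Finsupp.notMem_support_iff.1 hi).symm
  rw [← hdeg, ← Finset.prod_pow_eq_pow_sum]
  simp only [PiLp.smul_apply, smul_eq_mul, Complex.ofReal_mul, mul_pow, Finset.prod_mul_distrib]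
  have : ∀ f : Fin 3 → ℂ, ∏ i ∈ d.support, f i ^ d i = ∏ i, f i ^ d i := fun f =>
    Finset.prod_subset (Finset.subset_univ _) fun i _ hi => by simp [Finsupp.notMem_support_iff.1 hi]
  rw [this fun _ => (t : ℂ), this fun i => ((x i : ℝ) : ℂ)]
  ring

end MaxwellCorner
end

noncomputable section
namespace MaxwellCorner

open MvPolynomial (X pderiv)

/-! ### The reduced spherical Bessel functions -/

/-- The coefficients of the reduced spherical Bessel function. -/
def besselCoeff (n j : ℕ) : ℝ :=
  (((n + j).factorial : ℝ) * 2 ^ n) / ((j.factorial : ℝ) * ((2 * n + 2 * j + 1).factorial : ℝ))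

/-- The entire function `b_n` with `j_n (t) = t ^ n b_n (t ^ 2)`. -/
def redBessel (n : ℕ) (z : ℝ) : ℝ := ∑' j : ℕ, (-1) ^ j * besselCoeff n j * z ^ j

theorem besselCoeff_pos (n j : ℕ) : 0 < besselCoeff n j := by
  unfold besselCoeff; positivity

/-- Coefficient form of b_n' = -b_{n+1}/2. Together with `besselCoeff_succ_left'` it also produces
the three-term recursion. -/
theorem besselCoeff_succ_left (n j : ℕ) :
    besselCoeff (n + 1) j = 2 * (j + 1) * besselCoeff n (j + 1) := by
  unfold besselCoeff
  rw [show n + 1 + j = n + (j + 1) by ring, show 2 * (n + 1) + 2 * j + 1 = 2 * n + 2 * (j + 1) + 1 by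
    ring, Nat.factorial_succ j]
  push_cast
  field_simp
  ring

theorem besselCoeff_succ_left' (n j : ℕ) :
    (2 * n + 2 * j + 3) * besselCoeff (n + 1) j = besselCoeff n j := by
  unfold besselCoeff
  rw [show n + 1 + j = (n + j) + 1 by ring, show 2 * (n + 1) + 2 * j + 1 = 2 * n + 2 * j + 1 + 1 + 1 by
    ring, Nat.factorial_succ (n + j), Nat.factorial_succ (2 * n + 2 * j + 1 + 1),
    Nat.factorial_succ (2 * n + 2 * j + 1)]
  push_cast
  field_simp
  ring

/-- Eliminating the order n + 1 between the two preceding identities gives 2(j+1)(2n+2j+3) c_{n,j+1}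
= c_{n,j}, hence factorial decay in j relative to c_{n,0}, uniformly in n. All later estimates keep
`besselCoeff n 0` as the only dependence of b_n on n. -/
theorem besselCoeff_le (n j : ℕ) : besselCoeff n j ≤ besselCoeff n 0 / j.factorial := by
  induction j with
  | zero => simp
  | succ j ih =>
    have h1 := besselCoeff_succ_left n j
    have h2 := besselCoeff_succ_left' n j
    have h3 : (2 * n + 2 * j + 3) * (2 * (j + 1)) * besselCoeff n (j + 1) = besselCoeff n j := by
      rw [← h2, h1]; ring
    have hp := besselCoeff_pos n (j + 1)
    have h4 : ((j : ℝ) + 1) * besselCoeff n (j + 1) ≤ besselCoeff n j := by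
      rw [← h3]
      have : (1 : ℝ) * ((j + 1) * besselCoeff n (j + 1)) ≤
          (2 * n + 2 * j + 3) * 2 * ((j + 1) * besselCoeff n (j + 1)) := by
        apply mul_le_mul_of_nonneg_right _ (by positivity)
        have : (0 : ℝ) ≤ n := by positivity
        have : (0 : ℝ) ≤ j := by positivity
        linarith
      linarith
    rw [Nat.factorial_succ, le_div_iff₀ (by positivity)]
    rw [le_div_iff₀ (by positivity)] at ih
    push_cast
    calc besselCoeff n (j + 1) * ((j + 1) * j.factorial)
        = ((j + 1) * besselCoeff n (j + 1)) * j.factorial := by ring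
      _ ≤ besselCoeff n j * j.factorial := by gcongr
      _ ≤ _ := ih

theorem norm_redBessel_term_le (n j : ℕ) {z R : ℝ} (hz : |z| ≤ R) :
    ‖(-1) ^ j * besselCoeff n j * z ^ j‖ ≤ besselCoeff n 0 * (R ^ j / j.factorial) := by
  rw [norm_mul, norm_mul, norm_pow, norm_neg, norm_one, one_pow, one_mul, norm_pow,
    Real.norm_of_nonneg (besselCoeff_pos n j).le, Real.norm_eq_abs]
  calc besselCoeff n j * |z| ^ j ≤ besselCoeff n 0 / j.factorial * R ^ j := by
        gcongr
        · exact div_nonneg (besselCoeff_pos n 0).le (by positivity)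
        · exact besselCoeff_le n j
    _ = _ := by ring

theorem summable_redBessel (n : ℕ) (z : ℝ) :
    Summable fun j : ℕ => (-1) ^ j * besselCoeff n j * z ^ j :=
  Summable.of_norm_bounded ((Real.summable_pow_div_factorial |z|).mul_left _)
    fun j => norm_redBessel_term_le n j le_rfl

theorem abs_redBessel_le (n : ℕ) {z R : ℝ} (hz : |z| ≤ R) :
    |redBessel n z| ≤ besselCoeff n 0 * Real.exp R := by
  rw [← Real.norm_eq_abs]
  refine tsum_of_norm_bounded ?_ fun j => norm_redBessel_term_le n j hz
  rw [Real.exp_eq_exp_ℝ]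
  exact (NormedSpace.expSeries_div_hasSum_exp R).mul_left _

theorem redBessel_zero (n : ℕ) : redBessel n 0 = besselCoeff n 0 := by
  rw [redBessel, tsum_eq_single 0]
  · simp
  · intro j hj; simp [hj]

theorem besselCoeff_succ_zero (n : ℕ) :
    besselCoeff (n + 1) 0 = besselCoeff n 0 / (2 * n + 3) := by
  have := besselCoeff_succ_left' n 0
  rw [eq_div_iff (by positivity), ← this]; push_cast; ring

theorem besselCoeff_succ_zero_le (n : ℕ) : besselCoeff (n + 1) 0 ≤ besselCoeff n 0 := by
  rw [besselCoeff_succ_zero]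
  exact div_le_self (besselCoeff_pos n 0).le (by have : (0 : ℝ) ≤ n := by positivity
                                                 linarith)

/-- Three-term recursion of the reduced spherical Bessel functions. -/
theorem redBessel_recursion (n : ℕ) (z : ℝ) :
    (2 * n + 3) * redBessel (n + 1) z = redBessel n z + z * redBessel (n + 2) z := by
  have h0 := (summable_redBessel n z).hasSum
  have h1 := (summable_redBessel (n + 1) z).hasSum.mul_left (2 * n + 3 : ℝ)
  have h2 := (summable_redBessel (n + 2) z).hasSum.mul_left z
  have h3 := h1.sub h0
  have h4 : HasSum (fun j : ℕ => (2 * n + 3) * ((-1) ^ j * besselCoeff (n + 1) j * z ^ j) -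
      (-1) ^ j * besselCoeff n j * z ^ j) (z * redBessel (n + 2) z) := by
    -- The constant terms of (2n+3) b_{n+1} and b_n cancel, and the coefficient of index j + 1 of
    -- the difference is that of index j of b_{n+2}.
    rw [← hasSum_nat_add_iff' 1]
    have e := besselCoeff_succ_left' n 0
    push_cast at e
    convert! h2 using 1
    · funext j
      have e1 := besselCoeff_succ_left (n + 1) j
      have e2 := besselCoeff_succ_left' n (j + 1)
      rw [e1, ← e2]
      push_cast
      ring
    · simp only [Finset.range_one, Finset.sum_singleton, redBessel]; simp; linarith
  have := h3.unique h4
  have e : ∀ m, ∑' j : ℕ, (-1) ^ j * besselCoeff m j * z ^ j = redBessel m z := fun m => rfl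
  rw [e, e] at this
  linarith

theorem hasDerivAt_redBessel (n : ℕ) (z : ℝ) :
    HasDerivAt (redBessel n) (-(1 / 2) * redBessel (n + 1) z) z := by
  have key : HasDerivAt (fun z => ∑' j : ℕ, (-1) ^ j * besselCoeff n j * z ^ j)
      (∑' j : ℕ, (-1) ^ j * besselCoeff n j * (j * z ^ (j - 1))) z := by
    set R := |z| + 1
    have hu : Summable fun j : ℕ => besselCoeff n 0 * (j * (R ^ (j - 1) / j.factorial)) := by
      apply Summable.mul_left
      rw [← summable_nat_add_iff 1]
      refine (Real.summable_pow_div_factorial R).congr fun j => ?_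
      rw [Nat.factorial_succ]
      push_cast
      have : (j : ℝ) + 1 ≠ 0 := by positivity
      field_simp
    refine hasDerivAt_tsum_of_isPreconnected (t := Metric.ball 0 R) (y₀ := z) hu
      Metric.isOpen_ball (convex_ball _ _).isPreconnected
      (fun j y _ => (hasDerivAt_pow j y).const_mul _) ?_ (by simp [R]) (summable_redBessel n z)
      (by simp [R])
    intro j y hy
    rw [mem_ball_zero_iff] at hy
    rw [norm_mul, norm_mul, norm_pow, norm_neg, norm_one, one_pow, one_mul, norm_mul, norm_pow,
      Real.norm_of_nonneg (besselCoeff_pos n j).le, RCLike.norm_natCast]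
    calc besselCoeff n j * (j * ‖y‖ ^ (j - 1))
        ≤ besselCoeff n 0 / j.factorial * (j * R ^ (j - 1)) := by
          gcongr
          · exact div_nonneg (besselCoeff_pos n 0).le (by positivity)
          · exact besselCoeff_le n j
      _ = _ := by ring
  convert! key using 1
  have h1 := (summable_redBessel (n + 1) z).hasSum.mul_left (-(1 / 2) : ℝ)
  have h2 : HasSum (fun j : ℕ => (-1) ^ j * besselCoeff n j * (j * z ^ (j - 1)))
      (-(1 / 2) * redBessel (n + 1) z) := by
    rw [← hasSum_nat_add_iff' 1]
    convert! h1 using 1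
    · funext j
      rw [besselCoeff_succ_left]
      push_cast
      ring
    · simp [redBessel]
  exact h2.tsum_eq.symm

theorem continuous_redBessel (n : ℕ) : Continuous (redBessel n) :=
  continuous_iff_continuousAt.2 fun z => (hasDerivAt_redBessel n z).continuousAt

theorem sphBessel_eq (n : ℕ) (t : ℝ) : sphBessel n t = t ^ n * redBessel n (t ^ 2) := by
  rw [sphBessel, redBessel, ← tsum_mul_left]
  refine tsum_congr fun j => ?_
  rw [besselCoeff, pow_add, pow_mul]; ring

/-- For large order the reduced spherical Bessel function is comparable to its value at zero. -/
theorem eventually_redBessel_ge (R : ℝ) : ∀ᶠ n : ℕ in Filter.atTop,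
    ∀ z : ℝ, |z| ≤ R → besselCoeff n 0 / 2 ≤ redBessel n z := by
  -- By the mean value inequality b_n moves away from b_n(0) by at most R e^R c_{n+1,0}/2, where
  -- c_{n+1,0} = c_{n,0}/(2n+3). Once R e^R ≤ 2n + 3 this is at most half of b_n(0).
  obtain ⟨N, hN⟩ := exists_nat_gt (R * Real.exp R)
  filter_upwards [Filter.eventually_ge_atTop N] with n hn z hz
  have hR : 0 ≤ R := (abs_nonneg z).trans hz
  have hb : ∀ y ∈ Metric.closedBall (0 : ℝ) R,
      ‖-(1 / 2) * redBessel (n + 1) y‖ ≤ 1 / 2 * (besselCoeff (n + 1) 0 * Real.exp R) := by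
    intro y hy
    rw [mem_closedBall_zero_iff, Real.norm_eq_abs] at hy
    rw [norm_mul, norm_neg, Real.norm_eq_abs, Real.norm_eq_abs]
    gcongr
    · norm_num
    · exact abs_redBessel_le _ hy
  have h := (convex_closedBall (0 : ℝ) R).norm_image_sub_le_of_norm_hasDerivWithin_le
    (fun y _ => (hasDerivAt_redBessel n y).hasDerivWithinAt) hb (x := 0) (y := z) (by simpa)
    (by simpa using hz)
  rw [redBessel_zero, sub_zero, Real.norm_eq_abs, Real.norm_eq_abs] at h
  have h1 : 1 / 2 * (besselCoeff (n + 1) 0 * Real.exp R) * |z| ≤ besselCoeff n 0 / 2 := by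
    rw [besselCoeff_succ_zero]
    have hn' : R * Real.exp R ≤ 2 * n + 3 := by
      have : (N : ℝ) ≤ n := by exact_mod_cast hn
      have : (0 : ℝ) ≤ n := by positivity
      linarith
    have hp := besselCoeff_pos n 0
    calc 1 / 2 * (besselCoeff n 0 / (2 * n + 3) * Real.exp R) * |z|
        ≤ 1 / 2 * (besselCoeff n 0 / (2 * n + 3) * Real.exp R) * R := by gcongr
      _ = besselCoeff n 0 / 2 * ((R * Real.exp R) / (2 * n + 3)) := by ring
      _ ≤ besselCoeff n 0 / 2 * 1 := by
          gcongr
          rw [div_le_one (by positivity)]; exact hn'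
      _ = _ := by ring
  have h2 := (abs_le.1 (h.trans h1)).1
  linarith

/-! ### Radial multiples of polynomials -/

/-- `x ↦ b_n (κ |x|²) q (x)` for a polynomial `q`. -/
def radTerm (κ : ℝ) (n : ℕ) (q : Poly) (x : R3) : ℂ :=
  (redBessel n (κ * ‖x‖ ^ 2) : ℂ) * pev q x

theorem hasFDerivAt_redBessel_norm (κ : ℝ) (n : ℕ) (x : R3) :
    HasFDerivAt (fun y : R3 => ((redBessel n (κ * ‖y‖ ^ 2) : ℝ) : ℂ))
      (Complex.ofRealCLM.comp ((-(1 / 2) * redBessel (n + 1) (κ * ‖x‖ ^ 2)) •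
        (κ • ((2 : ℝ) • (innerSL ℝ x))))) x := by
  have h1 : HasFDerivAt (fun y : R3 => κ * ‖y‖ ^ 2) (κ • ((2 : ℝ) • (innerSL ℝ x))) x := by
    have := ((hasStrictFDerivAt_norm_sq x).hasFDerivAt).const_mul κ
    simpa [two_smul] using this
  exact Complex.ofRealCLM.hasFDerivAt.comp x ((hasDerivAt_redBessel n _).comp_hasFDerivAt x h1)

theorem partialDeriv_redBessel_norm (κ : ℝ) (n : ℕ) (i : Fin 3) (x : R3) :
    partialDeriv i (fun y : R3 => ((redBessel n (κ * ‖y‖ ^ 2) : ℝ) : ℂ)) x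
      = -(κ * (redBessel (n + 1) (κ * ‖x‖ ^ 2) : ℝ) * x i) := by
  rw [partialDeriv_eq (hasFDerivAt_redBessel_norm κ n x)]
  simp [EuclideanSpace.inner_single_right]
  ring

theorem differentiable_radTerm (κ : ℝ) (n : ℕ) (q : Poly) : Differentiable ℝ (radTerm κ n q) :=
  fun x => (hasFDerivAt_redBessel_norm κ n x).differentiableAt.mul (differentiable_pev q x)

theorem partialDeriv_radTerm (κ : ℝ) (n : ℕ) (q : Poly) (i : Fin 3) (x : R3) :
    partialDeriv i (radTerm κ n q) x =
      radTerm κ n (pderiv i q) x - κ * radTerm κ (n + 1) (X i * q) x := by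
  have := partialDeriv_mul (hasFDerivAt_redBessel_norm κ n x).differentiableAt
    (differentiable_pev q x) i
  rw [partialDeriv_redBessel_norm, partialDeriv_pev] at this
  rw [show radTerm κ n q = fun y => ((redBessel n (κ * ‖y‖ ^ 2) : ℝ) : ℂ) * pev q y from rfl, this]
  simp [radTerm]; ring

theorem radTerm_recursion (κ : ℝ) (n : ℕ) (q : Poly) (x : R3) :
    (2 * n + 3) * radTerm κ (n + 1) q x = radTerm κ n q x + κ * radTerm κ (n + 2) (nsq * q) x := by
  have h := redBessel_recursion n (κ * ‖x‖ ^ 2)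
  have h' := congrArg (fun t : ℝ => (t : ℂ)) h
  push_cast at h'
  simp only [radTerm, pev_mul, pev_nsq]
  push_cast
  linear_combination pev q x * h'

@[simp] theorem radTerm_sub (κ : ℝ) (n : ℕ) (p q : Poly) (x : R3) :
    radTerm κ n (p - q) x = radTerm κ n p x - radTerm κ n q x := by simp [radTerm]; ring
@[simp] theorem radTerm_zero (κ : ℝ) (n : ℕ) (x : R3) : radTerm κ n 0 x = 0 := by simp [radTerm]
@[simp] theorem radTerm_smul (κ : ℝ) (n : ℕ) (c : ℂ) (p : Poly) (x : R3) :
    radTerm κ n (c • p) x = c * radTerm κ n p x := by simp [radTerm]; ring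

/-! ### The two families of vector fields -/

/-- The components of `∇P ∧ x`. -/
def rotPoly (P : Poly) : Fin 3 → Poly :=
  ![pderiv 1 P * X 2 - pderiv 2 P * X 1, pderiv 2 P * X 0 - pderiv 0 P * X 2,
    pderiv 0 P * X 1 - pderiv 1 P * X 0]

/-- The first-order part of `curl (b_n ∇P ∧ x)`. -/
def gradPart (n : ℕ) (P : Poly) (i : Fin 3) : Poly := ((n : ℂ) + 1) • pderiv i P

/-- The remainder `n x P - |x|² ∇P` in `curl (b_n ∇P ∧ x)`. -/
def radialPart (n : ℕ) (P : Poly) (i : Fin 3) : Poly := (n : ℂ) • (X i * P) - nsq * pderiv i P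

/-- The field `b_n (κ |x|²) ∇P ∧ x`. -/
def mField (κ : ℝ) (n : ℕ) (P : Poly) (x : R3) : C3 := fun i => radTerm κ n (rotPoly P i) x

/-- The curl of `mField κ n P`. -/
def nField (κ : ℝ) (n : ℕ) (P : Poly) (x : R3) : C3 :=
  fun i => radTerm κ n (gradPart n P i) x + κ * radTerm κ (n + 1) (radialPart n P i) x

theorem differentiable_mField (κ : ℝ) (n : ℕ) (P : Poly) : Differentiable ℝ (mField κ n P) :=
  differentiable_pi.2 fun _ => differentiable_radTerm _ _ _

theorem differentiable_nField (κ : ℝ) (n : ℕ) (P : Poly) : Differentiable ℝ (nField κ n P) :=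
  differentiable_pi.2 fun _ => (differentiable_radTerm _ _ _).add
    ((differentiable_radTerm _ _ _).const_mul _)

theorem partialDeriv_mField (κ : ℝ) (n : ℕ) (P : Poly) (i j : Fin 3) (x : R3) :
    partialDeriv i (fun y => mField κ n P y j) x =
      radTerm κ n (pderiv i (rotPoly P j)) x - κ * radTerm κ (n + 1) (X i * rotPoly P j) x :=
  partialDeriv_radTerm κ n (rotPoly P j) i x

theorem partialDeriv_nField (κ : ℝ) (n : ℕ) (P : Poly) (i j : Fin 3) (x : R3) :
    partialDeriv i (fun y => nField κ n P y j) x =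
      radTerm κ n (pderiv i (gradPart n P j)) x - κ * radTerm κ (n + 1) (X i * gradPart n P j) x +
      κ * (radTerm κ (n + 1) (pderiv i (radialPart n P j)) x -
        κ * radTerm κ (n + 2) (X i * radialPart n P j) x) := by
  rw [← partialDeriv_radTerm, ← partialDeriv_radTerm, ← partialDeriv_const_mul
    (differentiable_radTerm _ _ _ _), ← partialDeriv_add (differentiable_radTerm _ _ _ _)
    ((differentiable_radTerm _ _ _ _).const_mul _)]
  rfl

theorem euler_pderiv {n : ℕ} {P : Poly} (hP : P.IsHomogeneous n) (i : Fin 3) :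
    pderiv i P + (X 0 * pderiv 0 (pderiv i P) + X 1 * pderiv 1 (pderiv i P) +
      X 2 * pderiv 2 (pderiv i P)) = (n : Poly) * pderiv i P := by
  have h := congrArg (pderiv i) (euler hP)
  rw [pderiv_comm 0 i, pderiv_comm 1 i, pderiv_comm 2 i]
  simp only [map_add, Derivation.leibniz, smul_eq_mul, Derivation.map_natCast, mul_zero,
    add_zero] at h
  rw [← h]
  fin_cases i <;> simp [MvPolynomial.pderiv_X] <;> ring

theorem natCast_smul_poly (n : ℕ) (p : Poly) : (n : ℂ) • p = (n : Poly) * p := by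
  rw [MvPolynomial.smul_eq_C_mul, map_natCast]

theorem pderiv_X_ne {i j : Fin 3} (h : j ≠ i) : pderiv i (X j : Poly) = 0 :=
  MvPolynomial.pderiv_X_of_ne h

/-- Where the derivative falls on the polynomial, Euler's identity and harmonicity give curl(∇P ∧ x)
= (n+1)∇P. Where it falls on b_n, it gives -κ b_{n+1} x ∧ (∇P ∧ x), and x ∧ (∇P ∧ x) = |x|²∇P - n P
x by Euler's identity again. -/
theorem curl_mField (κ : ℝ) {n : ℕ} {P : Poly} (hP : P ∈ harm n) (x : R3) :
    curl (mField κ n P) x = nField κ n P x := by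
  obtain ⟨hh, hl⟩ := mem_harm.1 hP
  have e0 := euler_pderiv hh 0
  have e1 := euler_pderiv hh 1
  have e2 := euler_pderiv hh 2
  have e := euler hh
  rw [lap_apply] at hl
  have c1 := pderiv_comm 1 0 P
  have c2 := pderiv_comm 2 0 P
  have c3 := pderiv_comm 2 1 P
  have key : ∀ a b i : Fin 3,
      (pderiv a (rotPoly P b) - pderiv b (rotPoly P a) = gradPart n P i) →
      (X b * rotPoly P a - X a * rotPoly P b = radialPart n P i) →
      partialDeriv a (fun y => mField κ n P y b) x - partialDeriv b (fun y => mField κ n P y a) x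
        = nField κ n P x i := by
    intro a b i h1 h2
    rw [partialDeriv_mField, partialDeriv_mField, nField, ← h1, ← h2, radTerm_sub, radTerm_sub]
    ring
  have n0 : pderiv (0 : Fin 3) (X 1 : Poly) = 0 := pderiv_X_ne (by decide)
  have n1 : pderiv (0 : Fin 3) (X 2 : Poly) = 0 := pderiv_X_ne (by decide)
  have n2 : pderiv (1 : Fin 3) (X 0 : Poly) = 0 := pderiv_X_ne (by decide)
  have n3 : pderiv (1 : Fin 3) (X 2 : Poly) = 0 := pderiv_X_ne (by decide)
  have n4 : pderiv (2 : Fin 3) (X 0 : Poly) = 0 := pderiv_X_ne (by decide)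
  have n5 : pderiv (2 : Fin 3) (X 1 : Poly) = 0 := pderiv_X_ne (by decide)
  funext i
  fin_cases i
  · refine key 1 2 0 ?_ ?_ <;>
    simp [rotPoly, gradPart, radialPart, add_smul, natCast_smul_poly, Derivation.leibniz,
      nsq, n2, n4, c1, c2]
    · linear_combination e0 - X 0 * hl - X 1 * c1 - X 2 * c2
    · linear_combination X 0 * e
  · refine key 2 0 1 ?_ ?_ <;>
    simp [rotPoly, gradPart, radialPart, add_smul, natCast_smul_poly, Derivation.leibniz,
      nsq, n0, n5, c3]
    · linear_combination e1 - X 1 * hl - X 2 * c3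
    · linear_combination X 1 * e
  · refine key 0 1 2 ?_ ?_ <;>
    simp [rotPoly, gradPart, radialPart, add_smul, natCast_smul_poly, Derivation.leibniz,
      nsq, n1, n3]
    · linear_combination e2 - X 2 * hl
    · linear_combination X 2 * e

/-- The curl is sorted by the order of the Bessel factor. Order n contributes the curl of a
gradient, which is zero; orders n+1 and n+2 contribute κ(2n+3) and -κ²|x|² times ∇P ∧ x, and the
three-term recursion merges them into κ b_n. -/
theorem curl_nField (κ : ℝ) {n : ℕ} {P : Poly} (hP : P ∈ harm n) (x : R3) :
    curl (nField κ n P) x = (κ : ℂ) • mField κ n P x := by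
  obtain ⟨hh, -⟩ := mem_harm.1 hP
  have e := euler hh
  have key : ∀ a b i : Fin 3,
      (pderiv a (gradPart n P b) - pderiv b (gradPart n P a) = 0) →
      (pderiv a (radialPart n P b) - pderiv b (radialPart n P a) - (X a * gradPart n P b -
        X b * gradPart n P a) = (2 * n + 3 : ℂ) • rotPoly P i) →
      (X a * radialPart n P b - X b * radialPart n P a = nsq * rotPoly P i) →
      partialDeriv a (fun y => nField κ n P y b) x - partialDeriv b (fun y => nField κ n P y a) x
        = ((κ : ℂ) • mField κ n P x) i := by
    intro a b i h1 h2 h3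
    have r1 := congrArg (fun q => radTerm κ n q x) h1
    have r2 := congrArg (fun q => radTerm κ (n + 1) q x) h2
    have r3 := congrArg (fun q => radTerm κ (n + 2) q x) h3
    simp only [radTerm_sub, radTerm_zero, radTerm_smul] at r1 r2 r3
    rw [partialDeriv_nField, partialDeriv_nField, Pi.smul_apply, smul_eq_mul, mField]
    linear_combination r1 + κ * r2 - κ ^ 2 * r3 + κ * radTerm_recursion κ n (rotPoly P i) x
  have c1 := pderiv_comm 1 0 P
  have c2 := pderiv_comm 2 0 P
  have c3 := pderiv_comm 2 1 P
  have n0 : pderiv (0 : Fin 3) (X 1 : Poly) = 0 := pderiv_X_ne (by decide)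
  have n1 : pderiv (0 : Fin 3) (X 2 : Poly) = 0 := pderiv_X_ne (by decide)
  have n2 : pderiv (1 : Fin 3) (X 0 : Poly) = 0 := pderiv_X_ne (by decide)
  have n3 : pderiv (1 : Fin 3) (X 2 : Poly) = 0 := pderiv_X_ne (by decide)
  have n4 : pderiv (2 : Fin 3) (X 0 : Poly) = 0 := pderiv_X_ne (by decide)
  have n5 : pderiv (2 : Fin 3) (X 1 : Poly) = 0 := pderiv_X_ne (by decide)
  have s : ∀ p : Poly, (2 * n + 3 : ℂ) • p = (2 * n + 3 : Poly) * p := fun p => by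
    rw [MvPolynomial.smul_eq_C_mul]; simp only [map_add, map_mul, map_ofNat, map_natCast]
  funext i
  fin_cases i
  · refine key 1 2 0 ?_ ?_ ?_ <;>
    simp [s, rotPoly, gradPart, radialPart, add_smul, natCast_smul_poly, Derivation.leibniz,
      nsq, n2, n3, n4, n5, c3] <;> ring
  · refine key 2 0 1 ?_ ?_ ?_ <;>
    simp [s, rotPoly, gradPart, radialPart, add_smul, natCast_smul_poly, Derivation.leibniz,
      nsq, n0, n1, n4, n5, c2] <;> ring
  · refine key 0 1 2 ?_ ?_ ?_ <;>
    simp [s, rotPoly, gradPart, radialPart, add_smul, natCast_smul_poly, Derivation.leibniz,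
      nsq, n0, n1, n2, n3, c1] <;> ring

theorem dot_mField (κ : ℝ) (n : ℕ) (P : Poly) (x : R3) :
    ∑ i, (x i : ℂ) * mField κ n P x i = 0 := by
  simp [Fin.sum_univ_three, mField, rotPoly, radTerm]; ring

/-- By Euler's identity the part with b_{n+1} is orthogonal to x. Together with `dot_mField` this
makes the radial component of a multipole a scalar Helmholtz term, from which its potential can be
read off when n ≥ 1. -/
theorem dot_nField (κ : ℝ) {n : ℕ} {P : Poly} (hP : P ∈ harm n) (x : R3) :
    ∑ i, (x i : ℂ) * nField κ n P x i = n * (n + 1) * radTerm κ n P x := by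
  have h := congrArg (fun q => pev q x) (euler (mem_harm.1 hP).1)
  simp only [pev_add, pev_mul, pev_X, pev_natCast] at h
  simp only [Fin.sum_univ_three, nField, gradPart, radialPart, radTerm, nsq, pev_add, pev_pow,
    pev_X, pev_smul, pev_sub, pev_mul]
  linear_combination ((n + 1) * (redBessel n (κ * ‖x‖ ^ 2) : ℂ) - κ * (redBessel (n + 1)
    (κ * ‖x‖ ^ 2) : ℂ) * (x 0 ^ 2 + x 1 ^ 2 + x 2 ^ 2)) * h

end MaxwellCorner
end

noncomputable section
namespace MaxwellCorner

open MvPolynomial (X pderiv)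

/-! ### Maxwell solutions without radial components vanish -/

theorem differentiableAt_apply {V : R3 → C3} {x : R3} (h : DifferentiableAt ℝ V x) (i : Fin 3) :
    DifferentiableAt ℝ (fun y => V y i) x := differentiableAt_pi.1 h i

theorem partialDeriv_apply {V : R3 → C3} {x : R3} (h : DifferentiableAt ℝ V x) (i j : Fin 3) :
    partialDeriv i (fun y => V y j) x = fderiv ℝ V x (EuclideanSpace.single i 1) j := by
  rw [partialDeriv_eq (hasFDerivAt_pi'.1 h.hasFDerivAt j)]; rfl

theorem fderiv_apply_eq_sum {V : R3 → C3} {x : R3} (h : DifferentiableAt ℝ V x) (v : R3)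
    (j : Fin 3) : fderiv ℝ V x v j = ∑ i, (v i : ℂ) * partialDeriv i (fun y => V y j) x := by
  have hv : v = ∑ i, v i • EuclideanSpace.single i (1 : ℝ) := by
    ext k; fin_cases k <;> simp [Fin.sum_univ_three]
  conv_lhs => rw [hv]
  simp [partialDeriv_apply h, Fin.sum_univ_three]

/-- If `x · V` vanishes near `y`, then `V + (y · ∇) V = - y ∧ curl V` at `y`. -/
theorem radial_transport {V : R3 → C3} {y : R3} (hV : DifferentiableAt ℝ V y)
    (h0 : (fun z : R3 => ∑ j, (z j : ℂ) * V z j) =ᶠ[nhds y] fun _ => 0) :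
    V y + fderiv ℝ V y y = -crossProduct (toC3 y) (curl V y) := by
  have hd : ∀ i, V y i + ∑ j, (y j : ℂ) * partialDeriv i (fun z => V z j) y = 0 := by
    intro i
    have h1 := partialDeriv_congr h0 i
    rw [partialDeriv_const] at h1
    have hc : ∀ j, DifferentiableAt ℝ (fun z : R3 => ((z j : ℝ) : ℂ)) y := fun j =>
      (hasFDerivAt_coord j y).differentiableAt
    have hm : ∀ j, DifferentiableAt ℝ (fun z : R3 => ((z j : ℝ) : ℂ) * V z j) y := fun j =>
      (hc j).mul (differentiableAt_apply hV j)
    simp only [Fin.sum_univ_three] at h1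
    rw [partialDeriv_add ((hm 0).fun_add (hm 1)) (hm 2), partialDeriv_add (hm 0) (hm 1)] at h1
    simp only [partialDeriv_mul (hc _) (differentiableAt_apply hV _), partialDeriv_coord] at h1
    rw [Fin.sum_univ_three, ← h1]
    fin_cases i <;> simp <;> ring
  funext i
  rw [Pi.add_apply, fderiv_apply_eq_sum hV, Fin.sum_univ_three]
  have := hd i
  rw [Fin.sum_univ_three] at this
  fin_cases i <;> simp [curl, cross_apply, toC3] at this ⊢ <;> linear_combination this

theorem norm_cross_le (y : R3) (V : C3) : ‖crossProduct (toC3 y) V‖ ≤ 2 * ‖y‖ * ‖V‖ := by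
  have hy : ∀ i, ‖(toC3 y i)‖ ≤ ‖y‖ := fun i => by
    rw [toC3, Complex.norm_real]; exact PiLp.norm_apply_le y i
  have key : ∀ i j k l : Fin 3, ‖toC3 y i * V j - toC3 y k * V l‖ ≤ 2 * ‖y‖ * ‖V‖ := by
    intro i j k l
    calc ‖toC3 y i * V j - toC3 y k * V l‖ ≤ ‖toC3 y i‖ * ‖V j‖ + ‖toC3 y k‖ * ‖V l‖ := by
          rw [← norm_mul, ← norm_mul]; exact norm_sub_le _ _
      _ ≤ ‖y‖ * ‖V‖ + ‖y‖ * ‖V‖ := by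
          gcongr <;> first | exact hy _ | exact norm_le_pi_norm V _
      _ = _ := by ring
  rw [pi_norm_le_iff_of_nonneg (by positivity)]
  intro i
  rw [cross_apply]
  fin_cases i <;> exact key _ _ _ _

theorem hasDerivAt_smul_ray {V : R3 → C3} {x : R3} {t : ℝ} (hV : DifferentiableAt ℝ V (t • x)) :
    HasDerivAt (fun s : ℝ => s • V (s • x)) (V (t • x) + fderiv ℝ V (t • x) (t • x)) t := by
  have h1 : HasDerivAt (fun s : ℝ => s • x) x t := by
    simpa using (hasDerivAt_id t).smul_const x
  have h2 := hV.hasFDerivAt.comp_hasDerivAt t h1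
  have h3 := (hasDerivAt_id t).fun_smul h2
  convert! h3 using 1
  simp [add_comm]

/-- Along the ray t ↦ tx the derivative of t V(tx) is V + (y·∇)V at y = tx, which `radial_transport`
equates with -y ∧ curl V. By the Maxwell system the pair (tE(tx), tH(tx)) thus satisfies a linear
differential inequality, and it vanishes at t = 0. -/
theorem maxwell_eq_zero_of_radial {ω ε₀ μ₀ r : ℝ} {E H : R3 → C3}
    (hsol : IsMaxwellSolution ω ε₀ μ₀ (Metric.ball 0 r) E H)
    (hE : ∀ x ∈ Metric.ball (0 : R3) r, ∑ j, (x j : ℂ) * E x j = 0)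
    (hH : ∀ x ∈ Metric.ball (0 : R3) r, ∑ j, (x j : ℂ) * H x j = 0) :
    ∀ x ∈ Metric.ball (0 : R3) r, E x = 0 ∧ H x = 0 := by
  intro x hx
  have hmem : ∀ t ∈ Set.Icc (0 : ℝ) 1, t • x ∈ Metric.ball (0 : R3) r := by
    intro t ht
    rw [mem_ball_zero_iff] at hx ⊢
    rw [norm_smul, Real.norm_of_nonneg ht.1]
    exact (mul_le_of_le_one_left (norm_nonneg _) ht.2).trans_lt hx
  set f : ℝ → C3 × C3 := fun t => (t • E (t • x), t • H (t • x)) with hf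
  set f' : ℝ → C3 × C3 := fun t =>
    (-crossProduct (toC3 (t • x)) ((Complex.I * ω * μ₀) • H (t • x)),
      -crossProduct (toC3 (t • x)) (-((Complex.I * ω * ε₀) • E (t • x)))) with hf'
  have hder : ∀ t ∈ Set.Icc (0 : ℝ) 1, HasDerivAt f (f' t) t := by
    intro t ht
    obtain ⟨dE, dH, cE, cH⟩ := hsol _ (hmem t ht)
    have hn := Metric.isOpen_ball.mem_nhds (hmem t ht)
    have e1 := radial_transport dE (Filter.eventually_of_mem hn hE)
    have e2 := radial_transport dH (Filter.eventually_of_mem hn hH)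
    rw [sub_eq_zero.1 cE] at e1
    rw [eq_neg_of_add_eq_zero_left cH] at e2
    have d1 := hasDerivAt_smul_ray dE
    have d2 := hasDerivAt_smul_ray dH
    rw [e1] at d1
    rw [e2] at d2
    exact d1.prodMk d2
  set K : ℝ := 2 * ‖x‖ * (|ω| * |μ₀| + |ω| * |ε₀|)
  have hbound : ∀ t ∈ Set.Ico (0 : ℝ) 1, ‖f' t‖ ≤ K * ‖f t‖ + 0 := by
    intro t ht
    have h1 : ∀ (V : C3) (c : ℂ), ‖-crossProduct (toC3 (t • x)) (c • V)‖
        ≤ 2 * ‖x‖ * ‖c‖ * ‖t • V‖ := by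
      intro V c
      rw [norm_neg]
      refine (norm_cross_le _ _).trans (le_of_eq ?_)
      rw [norm_smul, norm_smul, norm_smul]; ring
    have hcE : ‖Complex.I * ω * ε₀‖ = |ω| * |ε₀| := by simp
    have hcH : ‖Complex.I * ω * μ₀‖ = |ω| * |μ₀| := by simp
    have b1 : ‖t • E (t • x)‖ ≤ ‖f t‖ := norm_fst_le (f t)
    have b2 : ‖t • H (t • x)‖ ≤ ‖f t‖ := norm_snd_le (f t)
    rw [add_zero, Prod.norm_def]
    apply max_le
    · refine (h1 _ _).trans ?_
      rw [hcH]
      simp only [K]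
      gcongr
      · have : 0 ≤ |ω| * |ε₀| := by positivity
        linarith
    · simp only [hf']
      rw [← neg_smul]
      refine (h1 _ _).trans ?_
      rw [norm_neg, hcE]
      simp only [K]
      gcongr
      · have : 0 ≤ |ω| * |μ₀| := by positivity
        linarith
  have hgr := norm_le_gronwallBound_of_norm_deriv_right_le
    (fun t ht => (hder t ht).continuousAt.continuousWithinAt)
    (fun t ht => (hder t (Set.Ico_subset_Icc_self ht)).hasDerivWithinAt)
    (δ := 0) (by simp [hf]) hbound 1 (by simp)
  rw [gronwallBound_ε0_δ0] at hgr
  have h1 : f 1 = 0 := by simpa using hgr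
  simpa [hf, Prod.ext_iff] using h1

end MaxwellCorner
end

noncomputable section
namespace MaxwellCorner

open MvPolynomial (X pderiv)
open MeasureTheory

/-! ### The divergence theorem for differentiable fields of bounded support -/

theorem partialDeriv_eq_zero_of_eventuallyEq {f : R3 → ℂ} {x : R3} (h : f =ᶠ[nhds x] fun _ => 0)
    (i : Fin 3) : partialDeriv i f x = 0 := by
  rw [partialDeriv_congr h, partialDeriv_const]

theorem eventually_norm_gt {R : ℝ} {x : R3} (hx : R < ‖x‖) : ∀ᶠ y in nhds x, R < ‖y‖ :=
  continuous_norm.continuousAt.eventually_const_lt hx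

/-- The divergence theorem on the cube [-R, R]³, on whose faces F vanishes, in the version that asks
only for differentiability and integrability of the divergence. Continuity of the partial
derivatives is not available for the fields at hand. -/
theorem integral_divergence_eq_zero {F : R3 → C3} {R : ℝ} (hR : 0 ≤ R) (hd : Differentiable ℝ F)
    (hsupp : ∀ x, R ≤ ‖x‖ → F x = 0)
    (hint : Integrable fun x => ∑ i, partialDeriv i (fun y => F y i) x) :
    ∫ x, ∑ i, partialDeriv i (fun y => F y i) x = 0 := by
  set DF : R3 → ℂ := fun x => ∑ i, partialDeriv i (fun y => F y i) x with hDF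
  have hvol := PiLp.volume_preserving_toLp (Fin 3)
  have hemb : MeasurableEmbedding (WithLp.toLp 2 : (Fin 3 → ℝ) → R3) :=
    (MeasurableEquiv.toLp 2 (Fin 3 → ℝ)).measurableEmbedding
  rw [← hvol.integral_comp hemb DF]
  have hout : ∀ x, R < ‖x‖ → DF x = 0 := by
    intro x hx
    refine Finset.sum_eq_zero fun i _ => partialDeriv_eq_zero_of_eventuallyEq ?_ i
    filter_upwards [eventually_norm_gt hx] with y hy
    rw [hsupp y hy.le]; rfl
  set a : Fin 3 → ℝ := fun _ => -R
  set b : Fin 3 → ℝ := fun _ => R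
  have hIcc : ∀ y : Fin 3 → ℝ, y ∉ Set.Icc a b → DF (WithLp.toLp 2 y) = 0 := by
    intro y hy
    apply hout
    rw [Set.mem_Icc, Pi.le_def, Pi.le_def, ← forall_and, not_forall] at hy
    obtain ⟨i, hi⟩ := hy
    have h1 : R < |y i| := by
      by_contra h
      exact hi (abs_le.1 (not_lt.1 h))
    refine h1.trans_le ?_
    have := PiLp.norm_apply_le (WithLp.toLp 2 y : R3) i
    simpa using this
  rw [← setIntegral_eq_integral_of_forall_compl_eq_zero hIcc]
  set T : (Fin 3 → ℝ) →L[ℝ] R3 := ((EuclideanSpace.equiv (Fin 3) ℝ).symm :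
    (Fin 3 → ℝ) →L[ℝ] R3)
  have hT : ∀ y, T y = WithLp.toLp 2 y := fun y => rfl
  have key := integral_divergence_of_hasFDerivAt_off_countable' (n := 2) a b
    (fun i => by simp only [a, b]; linarith)
    (fun i y => F (T y) i)
    (fun i y => (fderiv ℝ (fun z => F z i) (T y)).comp T) ∅ Set.countable_empty
    (fun i => ((differentiable_pi.1 hd i).continuous.comp T.continuous).continuousOn)
    (fun y _ i => ((differentiable_pi.1 hd i) (T y)).hasFDerivAt.comp y T.hasFDerivAt) ?_
  · have e : ∀ y, DF (WithLp.toLp 2 y) = ∑ i : Fin 3,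
        ((fderiv ℝ (fun z => F z i) (T y)).comp T) (Pi.single i 1) := fun y => rfl
    simp only [e]
    rw [key]
    refine Finset.sum_eq_zero fun i _ => ?_
    have h0 : ∀ (c : ℝ), |c| = R → ∀ x : Fin 2 → ℝ, F (T (i.insertNth c x)) i = 0 := by
      intro c hc x
      rw [hsupp]; · rfl
      have := PiLp.norm_apply_le (T (i.insertNth c x)) i
      rw [hT] at this ⊢
      simpa [hc] using this
    simp only [h0 (a i) (by simp [a, abs_of_nonneg hR]), h0 (b i) (by simp [b, abs_of_nonneg hR]),
      integral_zero, sub_self]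
  · exact ((hvol.integrable_comp_emb hemb).2 hint).integrableOn

/-! ### Test functions and weak solutions of the Helmholtz equation -/

theorem two_le_smooth : (2 : WithTop ℕ∞) ≤ ((⊤ : ℕ∞) : WithTop ℕ∞) := by
  exact WithTop.coe_le_coe.2 (le_top : (2 : ℕ∞) ≤ ⊤)

theorem contDiff_partialDeriv {ψ : R3 → ℂ} (h : ContDiff ℝ (⊤ : ℕ∞) ψ) (i : Fin 3) :
    ContDiff ℝ (⊤ : ℕ∞) (partialDeriv i ψ) :=
  (h.fderiv_right (m := ((⊤ : ℕ∞) : WithTop ℕ∞)) (by simp)).clm_apply contDiff_const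

theorem partialDeriv_comm {ψ : R3 → ℂ} (h : ContDiff ℝ (⊤ : ℕ∞) ψ) (i j : Fin 3) (x : R3) :
    partialDeriv i (partialDeriv j ψ) x = partialDeriv j (partialDeriv i ψ) x := by
  have hs : IsSymmSndFDerivAt ℝ ψ x :=
    (h.contDiffAt).isSymmSndFDerivAt (by simpa [minSmoothness] using two_le_smooth)
  have hd : DifferentiableAt ℝ (fderiv ℝ ψ) x :=
    (((h.of_le two_le_smooth).fderiv_right (m := 1) (by norm_num)).differentiable (by simp)) x
  have e : ∀ a b : Fin 3, partialDeriv a (partialDeriv b ψ) x =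
      fderiv ℝ (fderiv ℝ ψ) x (EuclideanSpace.single a 1) (EuclideanSpace.single b 1) := by
    intro a b
    rw [partialDeriv_eq (f := partialDeriv b ψ)
      (hd.hasFDerivAt.clm_apply (hasFDerivAt_const (EuclideanSpace.single b (1 : ℝ)) x))]
    simp
  rw [e, e]
  exact hs _ _

/-- The Laplacian of a function on `ℝ³`. -/
def laplacian (ψ : R3 → ℂ) (x : R3) : ℂ := ∑ i, partialDeriv i (partialDeriv i ψ) x

/-- Smooth functions supported in a smaller concentric closed ball. -/
def IsTest (r : ℝ) (ψ : R3 → ℂ) : Prop :=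
  ContDiff ℝ (⊤ : ℕ∞) ψ ∧ ∃ s, 0 ≤ s ∧ s < r ∧ ∀ x, s < ‖x‖ → ψ x = 0

/-- Continuous distributional solutions of `Δ f + κ f = 0` in the ball of radius `r`. -/
def WeakHelmholtz (κ r : ℝ) (f : R3 → ℂ) : Prop :=
  ContinuousOn f (Metric.ball 0 r) ∧
    ∀ ψ, IsTest r ψ → ∫ x, f x * (laplacian ψ x + κ * ψ x) = 0

theorem continuous_mul_of_support {f g : R3 → ℂ} {r s : ℝ} (hs : s < r)
    (hf : ContinuousOn f (Metric.ball 0 r)) (hg : Continuous g) (h0 : ∀ x, s < ‖x‖ → g x = 0) :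
    Continuous fun x => f x * g x := by
  rw [continuous_iff_continuousAt]
  intro x
  by_cases hx : x ∈ Metric.ball (0 : R3) r
  · exact (hf.continuousAt (Metric.isOpen_ball.mem_nhds hx)).mul hg.continuousAt
  · have hx' : s < ‖x‖ := by
      rw [mem_ball_zero_iff, not_lt] at hx; linarith
    refine (continuousAt_const (y := (0 : ℂ))).congr ?_
    filter_upwards [eventually_norm_gt hx'] with y hy
    rw [h0 y hy, mul_zero]

theorem integrable_mul_of_support {f g : R3 → ℂ} {r s : ℝ} (hs : s < r)
    (hf : ContinuousOn f (Metric.ball 0 r)) (hg : Continuous g) (h0 : ∀ x, s < ‖x‖ → g x = 0) :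
    Integrable fun x => f x * g x := by
  refine (continuous_mul_of_support hs hf hg h0).integrable_of_hasCompactSupport ?_
  refine HasCompactSupport.of_support_subset_isCompact (isCompact_closedBall (0 : R3) s) ?_
  intro x hx
  rw [mem_closedBall_zero_iff]
  by_contra h
  exact hx (by simp [h0 x (not_le.1 h)])

theorem partialDeriv_support {g : R3 → ℂ} {s : ℝ} (h0 : ∀ x, s < ‖x‖ → g x = 0) (i : Fin 3)
    (x : R3) (hx : s < ‖x‖) : partialDeriv i g x = 0 := by
  refine partialDeriv_eq_zero_of_eventuallyEq ?_ i
  filter_upwards [eventually_norm_gt hx] with y hy using h0 y hy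

theorem differentiable_mul_of_support {f g : R3 → ℂ} {r s : ℝ} (hs : s < r)
    (hf : ∀ x ∈ Metric.ball (0 : R3) r, DifferentiableAt ℝ f x) (hg : Differentiable ℝ g)
    (h0 : ∀ x, s < ‖x‖ → g x = 0) : Differentiable ℝ fun x => f x * g x := by
  intro x
  by_cases hx : x ∈ Metric.ball (0 : R3) r
  · exact (hf x hx).mul (hg x)
  · have hx' : s < ‖x‖ := by
      rw [mem_ball_zero_iff, not_lt] at hx; linarith
    refine (differentiableAt_const (0 : ℂ)).congr_of_eventuallyEq ?_
    filter_upwards [eventually_norm_gt hx'] with y hy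
    rw [h0 y hy, mul_zero]

/-- Integration by parts for the curl of a field that is only differentiable. -/
theorem integral_curl_mul {V W A : R3 → C3} {r s : ℝ} (hs0 : 0 ≤ s) (hs : s < r)
    (hV : ∀ x ∈ Metric.ball (0 : R3) r, DifferentiableAt ℝ V x)
    (hW : ContinuousOn W (Metric.ball 0 r))
    (hc : ∀ x ∈ Metric.ball (0 : R3) r, curl V x = W x)
    (hA : ∀ i, ContDiff ℝ (⊤ : ℕ∞) fun x => A x i) (h0 : ∀ x, s < ‖x‖ → A x = 0) :
    ∫ x, ∑ i, W x i * A x i = ∫ x, ∑ i, V x i * curl A x i := by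
  -- `A` vanishes for ‖x‖ > s only, while the divergence lemma needs vanishing on ‖x‖ ≥ R, so R is
  -- taken strictly above s.
  obtain ⟨t, hst, htr⟩ := exists_between hs
  have h0i : ∀ i x, s < ‖x‖ → A x i = 0 := fun i x hx => by rw [h0 x hx]; rfl
  have hAd : ∀ i, Differentiable ℝ fun x => A x i := fun i => (hA i).differentiable (by simp)
  have hcA : ∀ i, Continuous fun x => curl A x i := by
    have hp : ∀ i j, Continuous (partialDeriv i fun x => A x j) := fun i j =>
      (contDiff_partialDeriv (hA j) i).continuous
    intro i
    fin_cases i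
    · exact (hp 1 2).sub (hp 2 1)
    · exact (hp 2 0).sub (hp 0 2)
    · exact (hp 0 1).sub (hp 1 0)
  have hcA0 : ∀ i x, s < ‖x‖ → curl A x i = 0 := by
    intro i x hx
    have hp : ∀ i j, (partialDeriv i fun x => A x j) x = 0 := fun i j =>
      partialDeriv_support (h0i j) i x hx
    fin_cases i <;> simp [curl, hp]
  have hVc : ∀ i, ContinuousOn (fun x => V x i) (Metric.ball 0 r) := fun i x hx =>
    (differentiableAt_apply (hV x hx) i).continuousAt.continuousWithinAt
  have hWc : ∀ i, ContinuousOn (fun x => W x i) (Metric.ball 0 r) := fun i =>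
    continuousOn_pi.1 hW i
  have i1 : Integrable fun x => ∑ i, W x i * A x i :=
    integrable_finsetSum _ fun i _ => integrable_mul_of_support hs (hWc i) (hAd i).continuous (h0i i)
  have i2 : Integrable fun x => ∑ i, V x i * curl A x i :=
    integrable_finsetSum _ fun i _ => integrable_mul_of_support hs (hVc i) (hcA i) (hcA0 i)
  -- div(V ∧ A) = curl V · A - V · curl A.
  set F : R3 → C3 := fun x => crossProduct (V x) (A x) with hF
  have hm : ∀ i j, Differentiable ℝ fun x => V x i * A x j := fun i j =>
    differentiable_mul_of_support hs (fun x hx => differentiableAt_apply (hV x hx) i) (hAd j) (h0i j)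
  have hFd : Differentiable ℝ F := by
    rw [differentiable_pi]
    intro i
    fin_cases i
    · exact (hm 1 2).sub (hm 2 1)
    · exact (hm 2 0).sub (hm 0 2)
    · exact (hm 0 1).sub (hm 1 0)
  have hdiv : ∀ x, ∑ i, partialDeriv i (fun y => F y i) x =
      ∑ i, W x i * A x i - ∑ i, V x i * curl A x i := by
    intro x
    by_cases hx : x ∈ Metric.ball (0 : R3) r
    · have hp : ∀ a i j, partialDeriv a (fun y => V y i * A y j) x =
          partialDeriv a (fun y => V y i) x * A x j + V x i * partialDeriv a (fun y => A y j) x :=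
        fun a i j => partialDeriv_mul (differentiableAt_apply (hV x hx) i) (hAd j x) a
      have e : ∀ a i j k l, partialDeriv a (fun y => V y i * A y j - V y k * A y l) x =
          partialDeriv a (fun y => V y i) x * A x j + V x i * partialDeriv a (fun y => A y j) x -
          (partialDeriv a (fun y => V y k) x * A x l + V x k * partialDeriv a (fun y => A y l) x) :=
        fun a i j k l => by rw [partialDeriv_sub (hm i j x) (hm k l x), hp, hp]
      have f0 : (fun y => F y 0) = fun y => V y 1 * A y 2 - V y 2 * A y 1 := rfl
      have f1 : (fun y => F y 1) = fun y => V y 2 * A y 0 - V y 0 * A y 2 := rfl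
      have f2 : (fun y => F y 2) = fun y => V y 0 * A y 1 - V y 1 * A y 0 := rfl
      rw [Fin.sum_univ_three, f0, f1, f2, e, e, e, ← hc x hx]
      simp [Fin.sum_univ_three, curl]
      ring
    · have hx' : s < ‖x‖ := by
        rw [mem_ball_zero_iff, not_lt] at hx; linarith
      have hF0 : ∀ i y, s < ‖y‖ → F y i = 0 := fun i y hy => by simp [hF, h0 y hy]
      simp [h0i _ x hx', hcA0 _ x hx', partialDeriv_support (hF0 _) _ x hx']
  have := integral_divergence_eq_zero (hs0.trans hst.le) hFd
    (fun x hx => by simp [hF, h0 x (hst.trans_le hx)])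
    (by simp only [hdiv]; exact i1.sub i2)
  simp only [hdiv] at this
  rw [integral_sub i1 i2, sub_eq_zero] at this
  exact this

theorem isTest_partial_coord {ψ : R3 → ℂ} {x : R3} (h : DifferentiableAt ℝ ψ x) (a b : Fin 3) :
    partialDeriv a (fun y : R3 => (y b : ℂ) * ψ y) x =
      (if b = a then ψ x else 0) + x b * partialDeriv a ψ x := by
  rw [partialDeriv_mul (hasFDerivAt_coord b x).differentiableAt h, partialDeriv_coord]
  split_ifs <;> simp

theorem contDiff_coord (b : Fin 3) : ContDiff ℝ (⊤ : ℕ∞) fun y : R3 => ((y b : ℝ) : ℂ) :=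
  (Complex.ofRealCLM.comp (EuclideanSpace.proj b : R3 →L[ℝ] ℝ)).contDiff

/-- The radial component of a differentiable solution of `curl V = α W`, `curl W = β V` solves the
Helmholtz equation in the sense of distributions. -/
theorem weakHelmholtz_radial {V W : R3 → C3} {α β : ℂ} {κ r : ℝ} (hβ : β ≠ 0)
    (hκ : α * β = κ) (hV : ∀ x ∈ Metric.ball (0 : R3) r, DifferentiableAt ℝ V x)
    (hW : ∀ x ∈ Metric.ball (0 : R3) r, DifferentiableAt ℝ W x)
    (cV : ∀ x ∈ Metric.ball (0 : R3) r, curl V x = α • W x)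
    (cW : ∀ x ∈ Metric.ball (0 : R3) r, curl W x = β • V x) :
    WeakHelmholtz κ r fun x => ∑ j, (x j : ℂ) * V x j := by
  have hVc : ContinuousOn V (Metric.ball 0 r) := fun x hx =>
    (hV x hx).continuousAt.continuousWithinAt
  have hWc : ContinuousOn W (Metric.ball 0 r) := fun x hx =>
    (hW x hx).continuousAt.continuousWithinAt
  have hVi : ∀ i, ContinuousOn (fun x => V x i) (Metric.ball 0 r) := fun i =>
    continuousOn_pi.1 hVc i
  refine ⟨continuousOn_finsetSum _ fun j _ => (contDiff_coord j).continuous.continuousOn.mul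
    (hVi j), ?_⟩
  rintro ψ ⟨hψ, s, hs0, hs, h0⟩
  have d0 : Differentiable ℝ ψ := hψ.differentiable (by simp)
  have hψ1 := fun i => contDiff_partialDeriv hψ i
  have d1 : ∀ i, Differentiable ℝ (partialDeriv i ψ) := fun i => (hψ1 i).differentiable (by simp)
  have z1 : ∀ i x, s < ‖x‖ → partialDeriv i ψ x = 0 := fun i => partialDeriv_support h0 i
  set A : R3 → C3 := fun x i => (x i : ℂ) * ψ x with hA
  have sA : ∀ i, ContDiff ℝ (⊤ : ℕ∞) fun x => A x i := fun i => (contDiff_coord i).mul hψ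
  have zA : ∀ x, s < ‖x‖ → A x = 0 := fun x hx => by funext i; simp [hA, h0 x hx]
  set B : R3 → C3 := fun x => ![(x 2 : ℂ) * partialDeriv 1 ψ x - x 1 * partialDeriv 2 ψ x,
    x 0 * partialDeriv 2 ψ x - x 2 * partialDeriv 0 ψ x,
    x 1 * partialDeriv 0 ψ x - x 0 * partialDeriv 1 ψ x] with hB
  have cA : ∀ x, curl A x = B x := by
    intro x
    have e := fun a b => isTest_partial_coord (d0 x) a b
    funext i
    fin_cases i <;> simp [curl, hA, hB, e]
  have sB : ∀ i, ContDiff ℝ (⊤ : ℕ∞) fun x => B x i := by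
    have hm := fun i j => (contDiff_coord i).mul (hψ1 j)
    intro i
    fin_cases i
    · exact (hm 2 1).sub (hm 1 2)
    · exact (hm 0 2).sub (hm 2 0)
    · exact (hm 1 0).sub (hm 0 1)
  have zB : ∀ x, s < ‖x‖ → B x = 0 := fun x hx => by
    funext i; fin_cases i <;> simp [hB, z1 _ x hx]
  set χ : R3 → ℂ := fun x => ψ x + ((x 0 : ℂ) * partialDeriv 0 ψ x + x 1 * partialDeriv 1 ψ x +
    x 2 * partialDeriv 2 ψ x) with hχ
  have sχ : ContDiff ℝ (⊤ : ℕ∞) χ :=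
    hψ.add ((((contDiff_coord 0).mul (hψ1 0)).add ((contDiff_coord 1).mul (hψ1 1))).add
      ((contDiff_coord 2).mul (hψ1 2)))
  have zχ : ∀ x, s < ‖x‖ → χ x = 0 := fun x hx => by simp [hχ, h0 x hx, z1 _ x hx]
  set G : R3 → C3 := fun x i => partialDeriv i χ x with hG
  have sG : ∀ i, ContDiff ℝ (⊤ : ℕ∞) fun x => G x i := fun i => contDiff_partialDeriv sχ i
  have zG : ∀ x, s < ‖x‖ → G x = 0 := fun x hx => by
    funext i; exact partialDeriv_support zχ i x hx
  have cG : ∀ x, curl G x = 0 := by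
    intro x
    have c := fun i j => partialDeriv_comm sχ i j x
    funext i
    fin_cases i <;> simp [curl, hG, sub_eq_zero] <;> exact c _ _
  -- The identity ΔA = ∇ div A - curl curl A for A = xψ: here ΔA = xΔψ + 2∇ψ, div A = 3ψ + x·∇ψ, B =
  -- curl A, and G is the gradient of χ = ψ + x·∇ψ.
  have ident : ∀ x i, (x i : ℂ) * laplacian ψ x = -curl B x i + G x i := by
    intro x i
    have c := fun i j => partialDeriv_comm hψ i j x
    have m := fun a b c => isTest_partial_coord (d1 c x) a b
    have hm : ∀ b c, DifferentiableAt ℝ (fun y : R3 => (y b : ℂ) * partialDeriv c ψ y) x :=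
      fun b c => (hasFDerivAt_coord b x).differentiableAt.mul (d1 c x)
    have pB : ∀ a b c b' c', partialDeriv a (fun y : R3 => (y b : ℂ) * partialDeriv c ψ y -
        y b' * partialDeriv c' ψ y) x = ((if b = a then partialDeriv c ψ x else 0) +
        x b * partialDeriv a (partialDeriv c ψ) x) - ((if b' = a then partialDeriv c' ψ x else 0) +
        x b' * partialDeriv a (partialDeriv c' ψ) x) := fun a b c b' c' => by
      rw [partialDeriv_sub (hm b c) (hm b' c'), m, m]
    have pG : ∀ a, G x a = partialDeriv a ψ x +
        (((if 0 = a then partialDeriv 0 ψ x else 0) + x 0 * partialDeriv a (partialDeriv 0 ψ) x) +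
        ((if 1 = a then partialDeriv 1 ψ x else 0) + x 1 * partialDeriv a (partialDeriv 1 ψ) x) +
        ((if 2 = a then partialDeriv 2 ψ x else 0) + x 2 * partialDeriv a (partialDeriv 2 ψ) x)) := by
      intro a
      simp only [hG, hχ]
      rw [partialDeriv_add (d0 x) (((hm 0 0).fun_add (hm 1 1)).fun_add (hm 2 2)),
        partialDeriv_add ((hm 0 0).fun_add (hm 1 1)) (hm 2 2), partialDeriv_add (hm 0 0) (hm 1 1),
        m, m, m]
    rw [pG]
    have b0 : (fun y => B y 0) = fun y : R3 => (y 2 : ℂ) * partialDeriv 1 ψ y -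
      y 1 * partialDeriv 2 ψ y := rfl
    have b1 : (fun y => B y 1) = fun y : R3 => (y 0 : ℂ) * partialDeriv 2 ψ y -
      y 2 * partialDeriv 0 ψ y := rfl
    have b2 : (fun y => B y 2) = fun y : R3 => (y 1 : ℂ) * partialDeriv 0 ψ y -
      y 0 * partialDeriv 1 ψ y := rfl
    have c1 := c 1 0
    have c2 := c 2 0
    have c3 := c 2 1
    simp only [curl, b0, b1, b2, pB, laplacian, Fin.sum_univ_three, c1, c2, c3]
    fin_cases i <;> simp [c1, c2, c3] <;> ring
  -- `I1` and `I2` move the two curls onto the fields, so that ∫ V · curl curl A = αβ ∫ V · A, which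
  -- cancels the term with κ. `I3` says that V, being a multiple of a curl, is weakly orthogonal to
  -- gradients.
  have I1 := integral_curl_mul hs0 hs hV (hWc.const_smul α) cV sB zB
  have I2 := integral_curl_mul hs0 hs hW (hVc.const_smul β) cW sA zA
  have I3 := integral_curl_mul hs0 hs hW (hVc.const_smul β) cW sG zG
  simp only [cG, Pi.zero_apply, mul_zero, Finset.sum_const_zero, integral_zero, Pi.smul_apply,
    smul_eq_mul, mul_assoc, ← Finset.mul_sum, cA] at I1 I2 I3
  rw [integral_const_mul] at I1 I2 I3
  have I3' := (mul_eq_zero.1 I3).resolve_left hβ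
  have zcB : ∀ i x, s < ‖x‖ → curl B x i = 0 := by
    intro i x hx
    have hp : ∀ i j, (partialDeriv i fun x => B x j) x = 0 := fun i j =>
      partialDeriv_support (fun y hy => by rw [zB y hy]; rfl) i x hx
    fin_cases i <;> simp [curl, hp]
  have ccB : ∀ i, Continuous fun x => curl B x i := by
    have hp : ∀ i j, Continuous (partialDeriv i fun x => B x j) := fun i j =>
      (contDiff_partialDeriv (sB j) i).continuous
    intro i
    fin_cases i
    · exact (hp 1 2).sub (hp 2 1)
    · exact (hp 2 0).sub (hp 0 2)
    · exact (hp 0 1).sub (hp 1 0)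
  have n1 : Integrable fun x => ∑ i, V x i * curl B x i :=
    integrable_finsetSum _ fun i _ => integrable_mul_of_support hs (hVi i) (ccB i) (zcB i)
  have n2 : Integrable fun x => ∑ i, V x i * G x i :=
    integrable_finsetSum _ fun i _ => integrable_mul_of_support hs (hVi i) (sG i).continuous
      fun x hx => by rw [zG x hx]; rfl
  have n3 : Integrable fun x => ∑ i, V x i * A x i :=
    integrable_finsetSum _ fun i _ => integrable_mul_of_support hs (hVi i) (sA i).continuous
      fun x hx => by rw [zA x hx]; rfl
  have e : ∀ x, (∑ j, (x j : ℂ) * V x j) * (laplacian ψ x + κ * ψ x) =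
      (-∑ i, V x i * curl B x i + ∑ i, V x i * G x i) + κ * ∑ i, V x i * A x i := by
    intro x
    have h := ident x
    simp only [Fin.sum_univ_three, hA]
    linear_combination V x 0 * h 0 + V x 1 * h 1 + V x 2 * h 2
  have n1' : Integrable fun x => -∑ i, V x i * curl B x i := n1.neg
  have n12 : Integrable fun x => -∑ i, V x i * curl B x i + ∑ i, V x i * G x i := n1'.add n2
  simp only [e]
  rw [integral_add n12 (n3.const_mul _), integral_add n1' n2, integral_neg,
    integral_const_mul, I3', ← I1, ← I2, ← hκ]
  ring

/-- Green's identity: p∇ψ - ψ∇p has divergence pΔψ. Harmonic polynomials thereby become Helmholtz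
solutions with κ = 0, and their orthogonality and mean value property are special cases of
`sphPair_eq`. -/
theorem weakHelmholtz_pev {p : Poly} (hp : lap p = 0) (r : ℝ) : WeakHelmholtz 0 r (pev p) := by
  refine ⟨(continuous_pev p).continuousOn, ?_⟩
  rintro ψ ⟨hψ, s, hs0, hs, h0⟩
  have d0 : Differentiable ℝ ψ := hψ.differentiable (by simp)
  have hψ1 := fun i => contDiff_partialDeriv hψ i
  have d1 : ∀ i, Differentiable ℝ (partialDeriv i ψ) := fun i => (hψ1 i).differentiable (by simp)
  have z1 : ∀ i x, s < ‖x‖ → partialDeriv i ψ x = 0 := fun i => partialDeriv_support h0 i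
  set F : R3 → C3 := fun x i => pev p x * partialDeriv i ψ x - pev (pderiv i p) x * ψ x with hF
  have hFd : Differentiable ℝ F := differentiable_pi.2 fun i =>
    ((differentiable_pev p).mul (d1 i)).sub ((differentiable_pev _).mul d0)
  have hdiv : ∀ x, ∑ i, partialDeriv i (fun y => F y i) x =
      pev p x * (laplacian ψ x + (0 : ℝ) * ψ x) := by
    intro x
    have e : ∀ i, partialDeriv i (fun y => F y i) x =
        pev p x * partialDeriv i (partialDeriv i ψ) x - pev (pderiv i (pderiv i p)) x * ψ x := by
      intro i
      simp only [hF]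
      rw [partialDeriv_sub ((differentiable_pev p x).fun_mul (d1 i x))
        ((differentiable_pev _ x).fun_mul (d0 x)), partialDeriv_mul (differentiable_pev p x) (d1 i x),
        partialDeriv_mul (differentiable_pev _ x) (d0 x), partialDeriv_pev, partialDeriv_pev]
      ring
    have hl := congrArg (fun q => pev q x) hp
    simp only [lap_apply, pev_add, pev_zero] at hl
    simp only [e, laplacian, Fin.sum_univ_three]
    push_cast
    linear_combination -ψ x * hl
  have hcl : Continuous (laplacian ψ) := continuous_finsetSum _ fun i _ =>
    (contDiff_partialDeriv (hψ1 i) i).continuous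
  have := integral_divergence_eq_zero (R := s + 1) (by linarith) hFd
    (fun x hx => by
      funext i; simp [hF, h0 x (by linarith), z1 i x (by linarith)])
    (by
      simp only [hdiv]
      refine integrable_mul_of_support hs (continuous_pev p).continuousOn
        (hcl.add (continuous_const.mul hψ.continuous)) fun x hx => ?_
      simp [laplacian, h0 x hx, partialDeriv_support (z1 _) _ x hx])
  simpa only [hdiv] using this

end MaxwellCorner
end

noncomputable section
namespace MaxwellCorner

open MvPolynomial (X pderiv)
open MeasureTheory

/-! ### Polar coordinates -/

/-- The unit sphere of `ℝ³`. -/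
abbrev S2 : Type := Metric.sphere (0 : R3) 1

/-- The surface measure of the unit sphere. -/
abbrev sigma : Measure S2 := (volume : Measure R3).toSphere

/-- Polar coordinates are a measure-preserving homeomorphism of the complement of the origin, a null
set, onto S² × (0, ∞) with density ρ². -/
theorem integral_polar {g : R3 → ℂ} (hg : Integrable g) :
    ∫ x, g x = ∫ ρ in Set.Ioi (0 : ℝ), ρ ^ 2 • ∫ w : S2, g (ρ • (w : R3)) ∂sigma := by
  have hmp := (volume : Measure R3).measurePreserving_homeomorphUnitSphereProd
  have hemb := (homeomorphUnitSphereProd R3).measurableEmbedding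
  set G : S2 × Set.Ioi (0 : ℝ) → ℂ := fun q => g ((q.2 : ℝ) • (q.1 : R3)) with hG
  have hGc : ∀ x : ({0}ᶜ : Set R3), G (homeomorphUnitSphereProd R3 x) = g x := by
    intro x
    simp only [hG, homeomorphUnitSphereProd_apply_fst_coe, homeomorphUnitSphereProd_apply_snd_coe]
    rw [smul_smul, mul_inv_cancel₀ (norm_ne_zero_iff.2 x.2), one_smul]
  have hd : Module.finrank ℝ R3 - 1 = 2 := by simp
  rw [hd] at hmp
  have hint : Integrable G (sigma.prod (Measure.volumeIoiPow 2)) := by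
    rw [← hmp.integrable_comp_emb hemb]
    have : G ∘ (homeomorphUnitSphereProd R3) = g ∘ Subtype.val := funext hGc
    rw [this, ← integrableOn_iff_comap_subtypeVal (measurableSet_singleton _).compl]
    exact hg.integrableOn
  have e1 : ∫ x, g x = ∫ q, G q ∂(sigma.prod (Measure.volumeIoiPow 2)) := by
    rw [← hmp.integral_comp hemb, show ∫ x, g x = ∫ x in {0}ᶜ, g x by
      rw [restrict_compl_singleton], ← integral_subtype_comap (measurableSet_singleton _).compl]
    exact integral_congr_ae (Filter.Eventually.of_forall fun x => (hGc x).symm)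
  rw [e1, integral_prod_symm _ hint, Measure.volumeIoiPow]
  simp only [ENNReal.ofReal]
  rw [integral_withDensity_eq_integral_smul,
    integral_subtype_comap measurableSet_Ioi
      fun a : ℝ => Real.toNNReal (a ^ 2) • ∫ w : S2, g (a • (w : R3)) ∂sigma]
  · refine setIntegral_congr_fun measurableSet_Ioi fun x hx => ?_
    simp only [NNReal.smul_def, Real.coe_toNNReal _ (pow_nonneg (Set.mem_Ioi.1 hx).le 2)]
  · exact (measurable_subtype_coe.pow_const _).real_toNNReal

/-- The pairing of a function on the sphere of radius `ρ` with a polynomial. -/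
def sphPair (f : R3 → ℂ) (p : Poly) (ρ : ℝ) : ℂ :=
  ∫ w : S2, f (ρ • (w : R3)) * pev p w ∂sigma

instance : CompactSpace S2 := isCompact_iff_compactSpace.1 (isCompact_sphere (0 : R3) 1)

theorem norm_smul_S2 (ρ : ℝ) (w : S2) : ‖ρ • (w : R3)‖ = |ρ| := by
  rw [norm_smul, norm_eq_of_mem_sphere w, mul_one, Real.norm_eq_abs]

theorem continuous_on_sphere {f : R3 → ℂ} {r : ℝ} (hf : ContinuousOn f (Metric.ball 0 r)) {ρ : ℝ}
    (hρ : |ρ| < r) : Continuous fun w : S2 => f (ρ • (w : R3)) :=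
  hf.comp_continuous (by fun_prop) fun w => by
    rw [mem_ball_zero_iff, norm_smul_S2]; exact hρ

theorem integrable_S2 {g : S2 → ℂ} (hg : Continuous g) : Integrable g sigma :=
  hg.integrable_of_hasCompactSupport (HasCompactSupport.of_compactSpace g)

theorem continuousOn_sphPair {f : R3 → ℂ} {r : ℝ} (hf : ContinuousOn f (Metric.ball 0 r))
    (p : Poly) : ContinuousOn (sphPair f p) (Set.Ioo (-r) r) := by
  have := continuousOn_integral_of_compact_support (μ := sigma) (s := Set.Ioo (-r) r)
    (f := fun ρ w => f (ρ • ((w : S2) : R3)) * pev p w) (k := Set.univ) isCompact_univ ?_ ?_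
  · exact this
  · refine ContinuousOn.mul (hf.comp (by fun_prop) ?_)
      ((continuous_pev p).comp (by fun_prop)).continuousOn
    rintro ⟨ρ, w⟩ ⟨hρ, -⟩
    rw [mem_ball_zero_iff, norm_smul_S2]
    exact abs_lt.2 hρ
  · intro ρ w _ hw
    exact absurd (Set.mem_univ w) hw

/-! ### Radial test functions -/

theorem hasFDerivAt_comp_normSq {φ : ℝ → ℝ} (hφ : ContDiff ℝ (⊤ : ℕ∞) φ) (x : R3) :
    HasFDerivAt (fun y : R3 => ((φ (‖y‖ ^ 2) : ℝ) : ℂ))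
      (Complex.ofRealCLM.comp (deriv φ (‖x‖ ^ 2) • ((2 : ℝ) • (innerSL ℝ x)))) x := by
  have h1 : HasFDerivAt (fun y : R3 => ‖y‖ ^ 2) ((2 : ℝ) • (innerSL ℝ x)) x := by
    simpa [two_smul] using (hasStrictFDerivAt_norm_sq x).hasFDerivAt
  have h2 : HasDerivAt φ (deriv φ (‖x‖ ^ 2)) (‖x‖ ^ 2) :=
    ((hφ.differentiable (by simp)) _).hasDerivAt
  exact Complex.ofRealCLM.hasFDerivAt.comp x (h2.comp_hasFDerivAt x h1)

theorem partialDeriv_comp_normSq {φ : ℝ → ℝ} (hφ : ContDiff ℝ (⊤ : ℕ∞) φ) (i : Fin 3) (x : R3) :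
    partialDeriv i (fun y : R3 => ((φ (‖y‖ ^ 2) : ℝ) : ℂ)) x
      = 2 * x i * (deriv φ (‖x‖ ^ 2) : ℝ) := by
  rw [partialDeriv_eq (hasFDerivAt_comp_normSq hφ x)]
  simp [EuclideanSpace.inner_single_right]
  ring

theorem contDiff_comp_normSq {φ : ℝ → ℝ} (hφ : ContDiff ℝ (⊤ : ℕ∞) φ) :
    ContDiff ℝ (⊤ : ℕ∞) fun y : R3 => ((φ (‖y‖ ^ 2) : ℝ) : ℂ) :=
  Complex.ofRealCLM.contDiff.comp (hφ.comp (contDiff_norm_sq ℝ))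

theorem contDiff_deriv_infty {φ : ℝ → ℝ} (hφ : ContDiff ℝ (⊤ : ℕ∞) φ) :
    ContDiff ℝ (⊤ : ℕ∞) (deriv φ) := (contDiff_infty_iff_deriv.1 hφ).2

/-- The Laplacian of φ(|x|²) alone gives 4|x|²φ'' + 6φ'. The cross term is 4φ' x·∇p = 4nφ' p by
Euler's identity, and Δp = 0. -/
theorem laplacian_radial_mul {φ : ℝ → ℝ} (hφ : ContDiff ℝ (⊤ : ℕ∞) φ) {n : ℕ} {p : Poly}
    (hp : p ∈ harm n) (x : R3) :
    laplacian (fun y => ((φ (‖y‖ ^ 2) : ℝ) : ℂ) * pev p y) x =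
      ((4 * ‖x‖ ^ 2 * deriv (deriv φ) (‖x‖ ^ 2) + (4 * n + 6) * deriv φ (‖x‖ ^ 2) : ℝ) : ℂ) *
        pev p x := by
  have hφ1 := contDiff_deriv_infty hφ
  have dφ : ∀ y, DifferentiableAt ℝ (fun y : R3 => ((φ (‖y‖ ^ 2) : ℝ) : ℂ)) y := fun y =>
    (hasFDerivAt_comp_normSq hφ y).differentiableAt
  have dφ1 : ∀ y, DifferentiableAt ℝ (fun y : R3 => ((deriv φ (‖y‖ ^ 2) : ℝ) : ℂ)) y := fun y =>
    (hasFDerivAt_comp_normSq hφ1 y).differentiableAt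
  have e1 : ∀ i, partialDeriv i (fun y => ((φ (‖y‖ ^ 2) : ℝ) : ℂ) * pev p y) = fun y =>
      ((deriv φ (‖y‖ ^ 2) : ℝ) : ℂ) * pev ((2 : ℂ) • (X i * p)) y +
      ((φ (‖y‖ ^ 2) : ℝ) : ℂ) * pev (pderiv i p) y := by
    intro i
    funext y
    rw [partialDeriv_mul (dφ y) (differentiable_pev p y), partialDeriv_comp_normSq hφ,
      partialDeriv_pev, pev_smul, pev_mul, pev_X]
    ring
  have hl := congrArg (fun q => pev q x) (mem_harm.1 hp).2
  have he := congrArg (fun q => pev q x) (euler (mem_harm.1 hp).1)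
  have hn := pev_nsq x
  simp only [lap_apply, pev_add, pev_zero, pev_mul, pev_X, pev_natCast, nsq, pev_pow] at hl he hn
  simp only [laplacian, e1]
  have e2 : ∀ i, partialDeriv i (fun y => ((deriv φ (‖y‖ ^ 2) : ℝ) : ℂ) * pev ((2 : ℂ) • (X i * p)) y +
      ((φ (‖y‖ ^ 2) : ℝ) : ℂ) * pev (pderiv i p) y) x =
      4 * x i ^ 2 * (deriv (deriv φ) (‖x‖ ^ 2) : ℝ) * pev p x +
      (deriv φ (‖x‖ ^ 2) : ℝ) * (2 * pev p x + 4 * x i * pev (pderiv i p) x) +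
      (φ (‖x‖ ^ 2) : ℝ) * pev (pderiv i (pderiv i p)) x := by
    intro i
    rw [partialDeriv_add ((dφ1 x).fun_mul (differentiable_pev _ x))
      ((dφ x).fun_mul (differentiable_pev _ x)), partialDeriv_mul (dφ1 x) (differentiable_pev _ x),
      partialDeriv_mul (dφ x) (differentiable_pev _ x), partialDeriv_comp_normSq hφ,
      partialDeriv_comp_normSq hφ1, partialDeriv_pev, partialDeriv_pev]
    simp [Derivation.leibniz]
    ring
  simp only [e2, Fin.sum_univ_three]
  push_cast at hn ⊢
  rw [← hn]
  linear_combination ((φ (‖x‖ ^ 2) : ℝ) : ℂ) * hl + 4 * ((deriv φ (‖x‖ ^ 2) : ℝ) : ℂ) * he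

/-- Testing with φ(|x|²)p turns the weak equation in the ball into a weak ordinary differential
equation for the spherical pairing. The weight ρ^(n+2) combines the volume factor ρ² with the
homogeneity of p. -/
theorem radial_weak {κ r : ℝ} {f : R3 → ℂ} (hf : WeakHelmholtz κ r f) {n : ℕ} {p : Poly}
    (hp : p ∈ harm n) {φ : ℝ → ℝ} (hφ : ContDiff ℝ (⊤ : ℕ∞) φ) {s : ℝ} (hs0 : 0 ≤ s) (hs : s < r)
    (h0 : ∀ t, s ^ 2 < t → φ t = 0) :
    ∫ ρ in Set.Ioi (0 : ℝ), ((ρ ^ (n + 2) * (4 * ρ ^ 2 * deriv (deriv φ) (ρ ^ 2) +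
      (4 * n + 6) * deriv φ (ρ ^ 2) + κ * φ (ρ ^ 2)) : ℝ) : ℂ) * sphPair f p ρ = 0 := by
  set ψ : R3 → ℂ := fun y => ((φ (‖y‖ ^ 2) : ℝ) : ℂ) * pev p y with hψ
  have hψs : ContDiff ℝ (⊤ : ℕ∞) ψ := (contDiff_comp_normSq hφ).mul (contDiff_pev p)
  have hz : ∀ x, s < ‖x‖ → ψ x = 0 := fun x hx => by
    simp only [hψ]
    rw [h0 _ (by gcongr)]; simp
  have hw := hf.2 ψ ⟨hψs, s, hs0, hs, hz⟩
  have hcl : Continuous (laplacian ψ) := continuous_finsetSum _ fun i _ =>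
    (contDiff_partialDeriv (contDiff_partialDeriv hψs i) i).continuous
  have hint : Integrable fun x => f x * (laplacian ψ x + κ * ψ x) := by
    refine integrable_mul_of_support hs hf.1 (hcl.add (continuous_const.mul hψs.continuous))
      fun x hx => ?_
    simp [laplacian, hz x hx, partialDeriv_support (partialDeriv_support hz _) _ x hx]
  rw [integral_polar hint] at hw
  rw [← hw]
  refine setIntegral_congr_fun measurableSet_Ioi fun ρ hρ => ?_
  have hρ0 : (0 : ℝ) < ρ := hρ
  simp only [sphPair, Complex.real_smul]
  rw [← integral_const_mul, ← integral_const_mul]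
  refine integral_congr_ae (Filter.Eventually.of_forall fun w => ?_)
  simp only [hψ, laplacian_radial_mul hφ hp]
  rw [norm_smul_S2, sq_abs, pev_homog (mem_harm.1 hp).1]
  push_cast
  ring

end MaxwellCorner
end

noncomputable section
namespace MaxwellCorner

open MvPolynomial (X pderiv)
open MeasureTheory Set
open scoped Interval

/-! ### Weak derivatives on an interval -/

theorem intervalIntegral_smooth {θ : ℝ → ℝ} (hθ : ContDiff ℝ (⊤ : ℕ∞) θ) (c : ℝ) :
    ContDiff ℝ (⊤ : ℕ∞) (fun x => ∫ t in c..x, θ t) ∧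
      deriv (fun x => ∫ t in c..x, θ t) = θ := by
  have h : ∀ x, HasDerivAt (fun x => ∫ t in c..x, θ t) (θ x) x := fun x =>
    intervalIntegral.integral_hasDerivAt_right (hθ.continuous.intervalIntegrable _ _)
      (hθ.continuous.stronglyMeasurableAtFilter _ _) hθ.continuous.continuousAt
  have hd : deriv (fun x => ∫ t in c..x, θ t) = θ := funext fun x => (h x).deriv
  exact ⟨contDiff_infty_iff_deriv.2 ⟨fun x => (h x).differentiableAt, by rwa [hd]⟩, hd⟩

/-- The du Bois-Reymond lemma: a continuous weak derivative is a derivative. -/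
theorem hasDerivAt_of_weak {a b : ℝ} {w g : ℝ → ℂ} (hw : ContinuousOn w (Ioo a b))
    (hg : ContinuousOn g (Ioo a b))
    (h : ∀ c d, a < c → c < d → d < b → ∀ η : ℝ → ℝ, ContDiff ℝ (⊤ : ℕ∞) η →
      (∀ x, x ∉ Ioo c d → η x = 0) →
      ∫ x in c..d, ((deriv η x : ℝ) : ℂ) * w x + ((η x : ℝ) : ℂ) * g x = 0) :
    ∀ x ∈ Ioo a b, HasDerivAt w (g x) x := by
  intro x hx
  obtain ⟨c, hac, hcx⟩ := exists_between hx.1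
  obtain ⟨d, hxd, hdb⟩ := exists_between hx.2
  have hcd : c < d := hcx.trans hxd
  have hsub : Icc c d ⊆ Ioo a b := fun y hy => ⟨hac.trans_le hy.1, hy.2.trans_lt hdb⟩
  have hwc := hw.mono hsub
  have hgc := hg.mono hsub
  have hgi : ∀ y ∈ Ioo a b, ∀ z ∈ Ioo a b, IntervalIntegrable g volume y z := fun y hy z hz =>
    (hg.mono (ordConnected_Ioo.uIcc_subset hy hz)).intervalIntegrable
  set G : ℝ → ℂ := fun y => ∫ t in x..y, g t with hG
  have hGd : ∀ y ∈ Ioo a b, HasDerivAt G (g y) y := by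
    intro y hy
    have hgy := hg.continuousAt (Ioo_mem_nhds hy.1 hy.2)
    exact intervalIntegral.integral_hasDerivAt_right (hgi x hx y hy)
      (hg.stronglyMeasurableAtFilter isOpen_Ioo y hy) hgy
  have hGc : ContinuousOn G (Icc c d) := fun y hy =>
    (hGd y (hsub hy)).continuousAt.continuousWithinAt
  -- G is a genuine primitive of g, so W has weak derivative zero; it remains to see that W is
  -- constant near x.
  set W : ℝ → ℂ := fun y => w y - G y with hW
  have hWc : ContinuousOn W (Icc c d) := hwc.sub hGc
  have hu : uIcc c d = Icc c d := uIcc_of_le hcd.le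
  have key : ∀ η : ℝ → ℝ, ContDiff ℝ (⊤ : ℕ∞) η → (∀ x, x ∉ Ioo c d → η x = 0) →
      ∫ x in c..d, ((deriv η x : ℝ) : ℂ) * W x = 0 := by
    intro η hη h0
    have h1 := h c d hac hcd hdb η hη h0
    have dη : Continuous fun x => ((deriv η x : ℝ) : ℂ) :=
      Complex.continuous_ofReal.comp (contDiff_deriv_infty hη).continuous
    have cη : Continuous fun x => ((η x : ℝ) : ℂ) := Complex.continuous_ofReal.comp hη.continuous
    have i1 : IntervalIntegrable (fun x => ((deriv η x : ℝ) : ℂ) * W x) volume c d :=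
      (dη.continuousOn.mul (by rwa [hu])).intervalIntegrable
    have i2 : IntervalIntegrable (fun x => ((deriv η x : ℝ) : ℂ) * G x + ((η x : ℝ) : ℂ) * g x)
        volume c d :=
      ((dη.continuousOn.mul (by rwa [hu])).add (cη.continuousOn.mul (by rwa [hu]))).intervalIntegrable
    have h2 : ∫ x in c..d, ((deriv η x : ℝ) : ℂ) * G x + ((η x : ℝ) : ℂ) * g x = 0 := by
      rw [intervalIntegral.integral_eq_sub_of_hasDerivAt (f := fun x => ((η x : ℝ) : ℂ) * G x) _ i2]
      · rw [h0 c (by simp), h0 d (by simp)]; simp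
      · intro y hy
        rw [hu] at hy
        have := ((hη.differentiable (by simp)) y).hasDerivAt.ofReal_comp
        exact this.mul (hGd y (hsub hy))
    have h3 := intervalIntegral.integral_add i1 i2
    rw [h2, add_zero] at h3
    rw [← h3, ← h1]
    congr 1
    funext y
    simp only [hW]; ring
  obtain ⟨η₀, hη₀t, -, hη₀s, hη₀r, hη₀x⟩ :=
    exists_contDiff_tsupport_subset (n := ⊤) (Ioo_mem_nhds hcx hxd)
  have hη₀ : ∀ y, y ∉ Ioo c d → η₀ y = 0 := fun y hy =>
    image_eq_zero_of_notMem_tsupport fun h => hy (hη₀t h)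
  have hη₀p : ∀ y, 0 ≤ η₀ y := fun y => by
    have := hη₀r (mem_range_self y); exact this.1
  set m : ℝ := ∫ y in c..d, η₀ y with hm
  have hmpos : 0 < m := intervalIntegral.integral_pos hcd hη₀s.continuous.continuousOn
    (fun y _ => hη₀p y) ⟨x, ⟨hcx.le, hxd.le⟩, by rw [hη₀x]; norm_num⟩
  set K : ℂ := (∫ y in c..d, ((η₀ y : ℝ) : ℂ) * W y) / m with hK
  have hi : ∀ θ : ℝ → ℝ, Continuous θ →
      IntervalIntegrable (fun y => ((θ y : ℝ) : ℂ) * W y) volume c d := fun θ hθ =>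
    ((Complex.continuous_ofReal.comp hθ).continuousOn.mul (by rwa [hu])).intervalIntegrable
  have hconst : ∀ θ : ℝ → ℝ, ContDiff ℝ (⊤ : ℕ∞) θ → (∀ y, y ∉ Ioo c d → θ y = 0) →
      ∫ y in c..d, ((θ y : ℝ) : ℂ) * (W y - K) = 0 := by
    intro θ hθ h0
    set I : ℝ := ∫ y in c..d, θ y with hI
    -- A primitive of θ is a test function only if θ has integral zero. Subtracting the multiple of
    -- the fixed bump η₀ with the same mass achieves this, at the price of the constant K.
    set θ' : ℝ → ℝ := fun y => θ y - I / m * η₀ y with hθ'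
    have hθ's : ContDiff ℝ (⊤ : ℕ∞) θ' := hθ.sub (contDiff_const.mul hη₀s)
    have hz : ∀ y, y ∉ Ioo c d → θ' y = 0 := fun y hy => by simp [hθ', h0 y hy, hη₀ y hy]
    have hi0 : ∫ y in c..d, θ' y = 0 := by
      simp only [hθ']
      rw [intervalIntegral.integral_sub (hθ.continuous.intervalIntegrable _ _)
        ((hη₀s.continuous.intervalIntegrable _ _).const_mul _),
        intervalIntegral.integral_const_mul, ← hm, ← hI]
      field_simp
      ring
    obtain ⟨s1, s2⟩ := intervalIntegral_smooth hθ's c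
    have k := key _ s1 (by
      intro y hy
      have hzi : ∀ e, (∀ t ∈ uIcc e y, t ∉ Ioo c d) → ∫ t in e..y, θ' t = 0 := fun e he => by
        rw [intervalIntegral.integral_congr (g := fun _ => 0) fun t ht => hz t (he t ht)]; simp
      rcases le_or_gt y c with h1 | h1
      · exact hzi c fun t ht => by
          rw [uIcc_of_ge h1] at ht; exact fun h => absurd h.1 (not_lt.2 ht.2)
      · have h2 : d ≤ y := not_lt.1 fun h2 => hy ⟨h1, h2⟩
        rw [← intervalIntegral.integral_add_adjacent_intervals
          (hθ's.continuous.intervalIntegrable c d) (hθ's.continuous.intervalIntegrable d y), hi0,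
          zero_add]
        exact hzi d fun t ht => by
          rw [uIcc_of_le h2] at ht; exact fun h => absurd h.2 (not_lt.2 ht.1))
    rw [s2] at k
    have e : ∀ y, ((θ' y : ℝ) : ℂ) * W y = ((θ y : ℝ) : ℂ) * W y -
        ((I / m : ℝ) : ℂ) * (((η₀ y : ℝ) : ℂ) * W y) := fun y => by simp only [hθ']; push_cast; ring
    simp only [e] at k
    rw [intervalIntegral.integral_sub (hi θ hθ.continuous) ((hi η₀ hη₀s.continuous).const_mul _),
      intervalIntegral.integral_const_mul, sub_eq_zero] at k
    have e2 : ∀ y, ((θ y : ℝ) : ℂ) * (W y - K) = ((θ y : ℝ) : ℂ) * W y - ((θ y : ℝ) : ℂ) * K :=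
      fun y => by ring
    simp only [e2]
    have hiK : IntervalIntegrable (fun y => ((θ y : ℝ) : ℂ) * K) volume c d :=
      ((Complex.continuous_ofReal.comp hθ.continuous).mul continuous_const).intervalIntegrable _ _
    rw [intervalIntegral.integral_sub (hi θ hθ.continuous) hiK,
      k, intervalIntegral.integral_mul_const, intervalIntegral.integral_ofReal, ← hI, hK]
    push_cast
    ring
  have hWK : ContinuousOn (fun y => W y - K) (Ioo c d) :=
    (hWc.mono Ioo_subset_Icc_self).sub continuousOn_const
  have hae := isOpen_Ioo.ae_eq_zero_of_integral_contDiff_smul_eq_zero (μ := volume)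
    (hWK.locallyIntegrableOn measurableSet_Ioo) (by
      intro θ hθ _ hsupp
      have h0 : ∀ y, y ∉ Ioo c d → θ y = 0 := fun y hy =>
        image_eq_zero_of_notMem_tsupport fun h => hy (hsupp h)
      rw [← hconst θ hθ h0, intervalIntegral.integral_of_le hcd.le,
        setIntegral_eq_integral_of_forall_compl_eq_zero]
      · simp only [Complex.real_smul]
      · intro y hy
        rw [h0 y fun h => hy (Ioo_subset_Ioc_self h)]; simp)
  have hEq : EqOn (fun y => W y - K) (fun _ => 0) (Ioo c d) :=
    Measure.eqOn_open_of_ae_eq ((ae_restrict_iff' measurableSet_Ioo).2 hae) isOpen_Ioo hWK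
      continuousOn_const
  refine ((hGd x hx).add_const K).congr_of_eventuallyEq ?_
  filter_upwards [Ioo_mem_nhds hcx hxd] with y hy
  have := hEq hy
  simp only [hW] at this
  linear_combination this

/-! ### Spherical means of Helmholtz solutions -/

theorem hasDerivAt_redBessel_sq (κ : ℝ) (n : ℕ) (ρ : ℝ) :
    HasDerivAt (fun t : ℝ => redBessel n (κ * t ^ 2)) (-κ * ρ * redBessel (n + 1) (κ * ρ ^ 2)) ρ := by
  have h1 : HasDerivAt (fun t : ℝ => κ * t ^ 2) (κ * (2 * ρ)) ρ := by
    simpa using (hasDerivAt_pow 2 ρ).const_mul κ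
  convert! (hasDerivAt_redBessel n (κ * ρ ^ 2)).comp ρ h1 using 1
  ring

theorem hasDerivAt_comp_sq {φ : ℝ → ℝ} (hφ : ContDiff ℝ (⊤ : ℕ∞) φ) (y : ℝ) :
    HasDerivAt (fun t : ℝ => φ (t ^ 2)) (2 * y * deriv φ (y ^ 2)) y := by
  convert! ((hφ.differentiable (by simp)) (y ^ 2)).hasDerivAt.comp y (hasDerivAt_pow 2 y) using 1
  simp
  ring

/-- The spherical means satisfy the radial Helmholtz equation in first-order form. -/
theorem hasDerivAt_sphPair_div {κ r : ℝ} {f : R3 → ℂ} (hf : WeakHelmholtz κ r f) {n : ℕ} {p : Poly}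
    (hp : p ∈ harm n) {V : ℝ → ℂ} (hV0 : V 0 = 0)
    (hV : ∀ ρ ∈ Ioo (-r) r, HasDerivAt V ((ρ : ℂ) ^ (n + 2) * sphPair f p ρ) ρ) :
    ∀ ρ ∈ Ioo 0 r, HasDerivAt (fun t : ℝ => sphPair f p t / (t : ℂ) ^ n)
      (-κ * V ρ / (ρ : ℂ) ^ (2 * n + 2)) ρ := by
  have hc := continuousOn_sphPair hf.1 p
  have hpow : ∀ k : ℕ, Continuous fun t : ℝ => (t : ℂ) ^ k := fun k =>
    Complex.continuous_ofReal.pow k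
  have hsub : Ioo 0 r ⊆ Ioo (-r) r := fun y hy => ⟨by linarith [hy.1, hy.2], hy.2⟩
  have hVc : ContinuousOn V (Ioo (-r) r) := fun y hy => (hV y hy).continuousAt.continuousWithinAt
  refine hasDerivAt_of_weak ((hc.mono hsub).div (hpow n).continuousOn fun y hy => ?_)
    ((continuousOn_const.mul (hVc.mono hsub)).div (hpow _).continuousOn fun y hy => ?_) ?_
  · exact pow_ne_zero _ (Complex.ofReal_ne_zero.2 hy.1.ne')
  · exact pow_ne_zero _ (Complex.ofReal_ne_zero.2 hy.1.ne')
  intro c d hc0 hcd hdr η hη h0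
  have hd0 : 0 < d := hc0.trans hcd
  -- χ is to be φ'. With η(ρ) = 2ρ^(2n+3) χ(ρ²), the second-order part of the radial operator
  -- becomes ρ^(-2n-2) η'(ρ). It is smooth at 0 because η vanishes below c, and φ, integrated from
  -- d², vanishes beyond d² and is constant near 0.
  set χ : ℝ → ℝ := fun s => η (√s) / (2 * √s ^ (2 * n + 3)) with hχ
  have hχs : ContDiff ℝ (⊤ : ℕ∞) χ := by
    rw [contDiff_iff_contDiffAt]
    intro s
    rcases lt_or_ge s (c ^ 2) with hs | hs
    · refine (contDiffAt_const (c := (0 : ℝ))).congr_of_eventuallyEq ?_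
      filter_upwards [Iio_mem_nhds hs] with t ht
      have : √t < c := (Real.sqrt_lt' hc0).2 ht
      simp [hχ, h0 (√t) fun h => absurd h.1 (not_lt.2 this.le)]
    · have hs0 : 0 < s := lt_of_lt_of_le (by positivity) hs
      have hq : ContDiffAt ℝ (⊤ : ℕ∞) (fun t => √t) s := Real.contDiffAt_sqrt hs0.ne'
      refine (hη.contDiffAt.comp s hq).div (contDiffAt_const.mul (hq.pow _)) ?_
      have := Real.sqrt_pos.2 hs0
      positivity
  obtain ⟨φs, φd⟩ := intervalIntegral_smooth hχs (d ^ 2)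
  set φ : ℝ → ℝ := fun x => ∫ t in (d ^ 2)..x, χ t with hφ
  have χ0 : ∀ t, d ^ 2 ≤ t → χ t = 0 := by
    intro t ht
    have : d ≤ √t := Real.le_sqrt_of_sq_le ht
    simp [hχ, h0 (√t) fun h => absurd h.2 (not_lt.2 this)]
  have φ0 : ∀ t, d ^ 2 ≤ t → φ t = 0 := by
    intro t ht
    simp only [hφ]
    rw [intervalIntegral.integral_congr (g := fun _ => 0) fun y hy => ?_]; · simp
    rw [uIcc_of_le ht] at hy
    exact χ0 y hy.1
  have hη_eq : ∀ ρ, 0 < ρ → η ρ = 2 * ρ ^ (2 * n + 3) * χ (ρ ^ 2) := by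
    intro ρ hρ
    simp only [hχ, Real.sqrt_sq hρ.le]
    field_simp
  have hη_d : ∀ ρ, 0 < ρ → deriv η ρ =
      ρ ^ (2 * n + 2) * (4 * ρ ^ 2 * deriv χ (ρ ^ 2) + (4 * n + 6) * χ (ρ ^ 2)) := by
    intro ρ hρ
    have h1 := hasDerivAt_comp_sq hχs ρ
    have h2 := ((hasDerivAt_pow (2 * n + 3) ρ).const_mul 2).mul h1
    have h3 : HasDerivAt η _ ρ := h2.congr_of_eventuallyEq (by
      filter_upwards [Ioi_mem_nhds hρ] with t ht using hη_eq t ht)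
    rw [h3.deriv]
    rw [show 2 * n + 3 - 1 = 2 * n + 2 by omega]
    push_cast
    ring
  have hrad := radial_weak hf hp φs hd0.le hdr fun t ht => φ0 t ht.le
  rw [φd] at hrad
  set J : ℝ → ℂ := fun ρ => ((ρ ^ (n + 2) * (4 * ρ ^ 2 * deriv χ (ρ ^ 2) +
      (4 * n + 6) * χ (ρ ^ 2) + κ * φ (ρ ^ 2)) : ℝ) : ℂ) * sphPair f p ρ with hJ
  -- L is the derivative of φ(ρ²)V(ρ), whose boundary values at 0 and d are zero. Subtracting κL
  -- from J trades the remaining φ for its derivative, that is for η.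
  set L : ℝ → ℂ := fun ρ => ((2 * ρ * χ (ρ ^ 2) : ℝ) : ℂ) * V ρ +
    ((φ (ρ ^ 2) : ℝ) : ℂ) * ((ρ : ℂ) ^ (n + 2) * sphPair f p ρ) with hL
  have hIcc : Icc 0 d ⊆ Ioo (-r) r := fun y hy => ⟨by linarith [hy.1], by linarith [hy.2]⟩
  have hud : uIcc 0 d = Icc 0 d := uIcc_of_le hd0.le
  have χc := hχs.continuous
  have χ'c := (contDiff_deriv_infty hχs).continuous
  have φc := φs.continuous
  have hJi : IntervalIntegrable J volume 0 d := by
    refine (ContinuousOn.mul (Continuous.continuousOn ?_) ?_).intervalIntegrable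
    · fun_prop
    · rw [hud]; exact hc.mono hIcc
  have hLi : IntervalIntegrable L volume 0 d := by
    refine ContinuousOn.intervalIntegrable ?_
    rw [hud]
    refine ContinuousOn.add (ContinuousOn.mul (Continuous.continuousOn (by fun_prop))
      (hVc.mono hIcc)) (ContinuousOn.mul (Continuous.continuousOn (by fun_prop))
      ((hpow _).continuousOn.mul (hc.mono hIcc)))
  have hLz : ∫ ρ in (0 : ℝ)..d, L ρ = 0 := by
    rw [intervalIntegral.integral_eq_sub_of_hasDerivAt
      (f := fun ρ => ((φ (ρ ^ 2) : ℝ) : ℂ) * V ρ) _ hLi]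
    · rw [φ0 (d ^ 2) le_rfl, hV0]; simp
    · intro y hy
      rw [hud] at hy
      have h1 : HasDerivAt (fun t : ℝ => φ (t ^ 2)) (2 * y * χ (y ^ 2)) y := by
        have := hasDerivAt_comp_sq φs y
        rwa [φd] at this
      exact h1.ofReal_comp.mul (hV y (hIcc hy))
  have hJz : ∫ ρ in (0 : ℝ)..d, J ρ = 0 := by
    rw [← hrad, intervalIntegral.integral_of_le hd0.le]
    symm
    refine setIntegral_eq_of_subset_of_forall_sdiff_eq_zero measurableSet_Ioi
      Ioc_subset_Ioi_self fun ρ hρ => ?_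
    have hρd : d < ρ := not_le.1 fun h => hρ.2 ⟨hρ.1, h⟩
    have hq : d ^ 2 < ρ ^ 2 := by gcongr
    have hχd : deriv χ (ρ ^ 2) = 0 := by
      have : χ =ᶠ[nhds (ρ ^ 2)] fun _ => 0 := by
        filter_upwards [Ioi_mem_nhds hq] with t ht using χ0 t (le_of_lt ht)
      rw [this.deriv_eq]; simp
    simp [hχd, χ0 _ hq.le, φ0 _ hq.le]
  have hsum := intervalIntegral.integral_sub hJi (hLi.const_mul (κ : ℂ))
  rw [hJz, intervalIntegral.integral_const_mul, hLz, mul_zero, sub_zero] at hsum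
  have hpt : ∀ ρ, 0 < ρ → J ρ - κ * L ρ = ((deriv η ρ : ℝ) : ℂ) * (sphPair f p ρ / (ρ : ℂ) ^ n) +
      ((η ρ : ℝ) : ℂ) * (-κ * V ρ / (ρ : ℂ) ^ (2 * n + 2)) := by
    intro ρ hρ
    have hρ' : (ρ : ℂ) ≠ 0 := Complex.ofReal_ne_zero.2 hρ.ne'
    rw [hη_d ρ hρ, hη_eq ρ hρ]
    simp only [hJ, hL]
    push_cast
    field_simp
    ring
  rw [← hsum, intervalIntegral.integral_of_le hcd.le, intervalIntegral.integral_of_le hd0.le]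
  symm
  have hIoc : ∫ ρ in Ioc c d, ((deriv η ρ : ℝ) : ℂ) * (sphPair f p ρ / (ρ : ℂ) ^ n) +
      ((η ρ : ℝ) : ℂ) * (-κ * V ρ / (ρ : ℂ) ^ (2 * n + 2)) = ∫ ρ in Ioc c d, (J ρ - κ * L ρ) :=
    setIntegral_congr_fun measurableSet_Ioc fun ρ hρ => (hpt ρ (hc0.trans hρ.1)).symm
  rw [hIoc]
  refine setIntegral_eq_of_subset_of_forall_sdiff_eq_zero measurableSet_Ioc
    (Ioc_subset_Ioc_left hc0.le) fun ρ hρ => ?_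
  have hρc : ρ ≤ c := not_lt.1 fun h => hρ.2 ⟨h, hρ.1.2⟩
  have hη0 : η ρ = 0 := h0 ρ fun h => absurd h.1 (not_lt.2 hρc)
  have hη0' : deriv η ρ = 0 := by
    have hcl : IsClosed {y | deriv η y = 0} :=
      isClosed_eq (contDiff_deriv_infty hη).continuous continuous_const
    have hlt : Iio c ⊆ {y | deriv η y = 0} := by
      intro y hy
      have : η =ᶠ[nhds y] fun _ => 0 := by
        filter_upwards [Iio_mem_nhds hy] with t ht
        exact h0 t fun h => absurd h.1 (not_lt.2 (le_of_lt ht))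
      simp [this.deriv_eq]
    have := closure_minimal hlt hcl
    rw [closure_Iio] at this
    exact this hρc
  rw [hpt ρ hρ.1.1, hη0, hη0']
  simp

/-- The pairing of a Helmholtz solution with a spherical harmonic of degree `n` on the sphere of
radius `ρ` is a multiple of the spherical Bessel function of order `n`. -/
theorem sphPair_eq {κ r : ℝ} (hr : 0 < r) {f : R3 → ℂ} (hf : WeakHelmholtz κ r f) {n : ℕ}
    {p : Poly} (hp : p ∈ harm n) :
    ∃ A : ℂ, ∀ ρ ∈ Ico 0 r, sphPair f p ρ = A * (ρ : ℂ) ^ n * (redBessel n (κ * ρ ^ 2) : ℝ) := by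
  set c := sphPair f p with hcdef
  have hc : ContinuousOn c (Ioo (-r) r) := continuousOn_sphPair hf.1 p
  have hpow : ∀ k : ℕ, Continuous fun t : ℝ => (t : ℂ) ^ k := fun k =>
    Complex.continuous_ofReal.pow k
  have hsub : Ioo 0 r ⊆ Ioo (-r) r := fun y hy => ⟨by linarith [hy.1, hy.2], hy.2⟩
  have h0m : (0 : ℝ) ∈ Ioo (-r) r := ⟨by linarith, hr⟩
  set v : ℝ → ℂ := fun t => (t : ℂ) ^ (n + 2) * c t with hv
  have hvc : ContinuousOn v (Ioo (-r) r) := (hpow _).continuousOn.mul hc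
  set V : ℝ → ℂ := fun ρ => ∫ t in (0 : ℝ)..ρ, v t with hVdef
  have hV : ∀ ρ ∈ Ioo (-r) r, HasDerivAt V ((ρ : ℂ) ^ (n + 2) * c ρ) ρ := by
    intro y hy
    exact intervalIntegral.integral_hasDerivAt_right
      ((hvc.mono (ordConnected_Ioo.uIcc_subset h0m hy)).intervalIntegrable)
      (hvc.stronglyMeasurableAtFilter isOpen_Ioo y hy)
      (hvc.continuousAt (Ioo_mem_nhds hy.1 hy.2))
  have hV0 : V 0 = 0 := by simp [hVdef]
  set w : ℝ → ℂ := fun t => c t / (t : ℂ) ^ n with hw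
  have hwd : ∀ ρ ∈ Ioo 0 r, HasDerivAt w (-κ * V ρ / (ρ : ℂ) ^ (2 * n + 2)) ρ :=
    hasDerivAt_sphPair_div hf hp hV0 hV
  have hcw : ∀ ρ : ℝ, 0 < ρ → c ρ = (ρ : ℂ) ^ n * w ρ := by
    intro ρ hρ
    have : (ρ : ℂ) ≠ 0 := Complex.ofReal_ne_zero.2 hρ.ne'
    simp only [hw]; field_simp
  have hVw : ∀ ρ ∈ Ioo 0 r, HasDerivAt V ((ρ : ℂ) ^ (2 * n + 2) * w ρ) ρ := by
    intro ρ hρ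
    convert! hV ρ (hsub hρ) using 1
    rw [hcw ρ hρ.1]; ring
  set γ : ℕ → ℝ → ℂ := fun k t => ((redBessel k (κ * t ^ 2) : ℝ) : ℂ) with hγ
  have hγd : ∀ k ρ, HasDerivAt (γ k) (-κ * ρ * γ (k + 1) ρ) ρ := by
    intro k ρ
    convert! (hasDerivAt_redBessel_sq κ k ρ).ofReal_comp using 1
    simp [hγ]
  have hγc : ∀ k, Continuous (γ k) := fun k =>
    continuous_iff_continuousAt.2 fun y => (hγd k y).continuousAt
  -- (w, V) and (γ_n, U) solve the same first-order system w' = -κV/ρ^(2n+2), V' = ρ^(2n+2) w. For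
  -- the second pair this is the derivative formula and the three-term recursion of b_n.
  set U : ℝ → ℂ := fun t => (t : ℂ) ^ (2 * n + 3) * γ (n + 1) t with hU
  have hUd : ∀ ρ : ℝ, HasDerivAt U ((ρ : ℂ) ^ (2 * n + 2) * γ n ρ) ρ := by
    intro ρ
    have h1 : HasDerivAt (fun t : ℝ => (t : ℂ) ^ (2 * n + 3))
        (((2 * n + 3 : ℕ) : ℂ) * (ρ : ℂ) ^ (2 * n + 2)) ρ := by
      simpa using (hasDerivAt_pow (2 * n + 3) (ρ : ℂ)).comp_ofReal
    have hrec := congrArg (fun t : ℝ => (t : ℂ)) (redBessel_recursion n (κ * ρ ^ 2))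
    push_cast at hrec
    convert! h1.mul (hγd (n + 1) ρ) using 1
    simp only [hγ]
    push_cast
    linear_combination -(ρ : ℂ) ^ (2 * n + 2) * hrec
  -- The Wronskian D of the two pairs is constant. Its limit at 0 is zero: the division by ρ^n in w
  -- is absorbed by U, as the expression D', continuous at 0, shows. This replaces a separate
  -- discussion of the singular second solution.
  have hUV : ∀ ρ ∈ Ioo 0 r, w ρ * U ρ = γ n ρ * V ρ := by
    set D : ℝ → ℂ := fun ρ => w ρ * U ρ - γ n ρ * V ρ with hD
    have hDd : ∀ ρ ∈ Ioo 0 r, HasDerivAt D 0 ρ := by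
      intro ρ hρ
      have hρ' : (ρ : ℂ) ≠ 0 := Complex.ofReal_ne_zero.2 hρ.1.ne'
      convert! ((hwd ρ hρ).mul (hUd ρ)).sub ((hγd n ρ).mul (hVw ρ hρ)) using 1
      simp only [hU]
      field_simp
      ring
    set D' : ℝ → ℂ := fun ρ => (ρ : ℂ) ^ (n + 3) * γ (n + 1) ρ * c ρ - γ n ρ * V ρ with hD'
    have hVc : ContinuousOn V (Ioo (-r) r) := fun y hy => (hV y hy).continuousAt.continuousWithinAt
    have hD'c : ContinuousAt D' 0 := by
      have : ContinuousOn D' (Ioo (-r) r) :=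
        (((hpow _).mul (hγc _)).continuousOn.mul hc).sub ((hγc n).continuousOn.mul hVc)
      exact this.continuousAt (Ioo_mem_nhds h0m.1 h0m.2)
    have hD'0 : D' 0 = 0 := by simp [hD', hV0]
    have hDD' : ∀ ρ, 0 < ρ → D ρ = D' ρ := by
      intro ρ hρ
      simp only [hD, hD', hU, hcw ρ hρ]; ring
    intro ρ hρ
    have hconst : ∀ y ∈ Ioo 0 r, D y = D ρ := by
      intro y hy
      exact isOpen_Ioo.is_const_of_deriv_eq_zero isPreconnected_Ioo
        (fun z hz => (hDd z hz).differentiableAt.differentiableWithinAt)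
        (fun z hz => (hDd z hz).deriv) hy hρ
    have hlim : Filter.Tendsto D' (nhdsWithin 0 (Ioi 0)) (nhds (D ρ)) := by
      refine tendsto_const_nhds.congr' ?_
      filter_upwards [Ioo_mem_nhdsGT hr] with y hy
      rw [← hDD' y hy.1, hconst y hy]
    have := tendsto_nhds_unique hlim (hD'c.tendsto.mono_left nhdsWithin_le_nhds)
    rw [hD'0] at this
    exact sub_eq_zero.1 this
  have hγ0 : γ n 0 ≠ 0 := by
    simp only [hγ, ne_eq, Complex.ofReal_eq_zero]
    rw [show κ * 0 ^ 2 = 0 by ring, redBessel_zero]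
    exact (besselCoeff_pos n 0).ne'
  -- Near 0, where γ_n has no zero, the vanishing Wronskian makes w/γ_n constant; this defines A.
  obtain ⟨e, he0, hee⟩ : ∃ e, 0 < e ∧ ∀ y, |y| < e → γ n y ≠ 0 := by
    have := (hγc n).continuousAt.eventually_ne hγ0
    obtain ⟨e, he, h⟩ := Metric.eventually_nhds_iff.1 this
    exact ⟨e, he, fun y hy => h (by simpa using hy)⟩
  set s := min e r with hs
  have hs0 : 0 < s := lt_min he0 hr
  have hsr : Ioo 0 s ⊆ Ioo 0 r := Ioo_subset_Ioo_right (min_le_right _ _)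
  have hγs : ∀ y ∈ Ioo 0 s, γ n y ≠ 0 := fun y hy =>
    hee y (by rw [abs_of_pos hy.1]; exact hy.2.trans_le (min_le_left _ _))
  set A : ℂ := w (s / 2) / γ n (s / 2) with hA
  have hs2 : s / 2 ∈ Ioo 0 s := ⟨by linarith, by linarith⟩
  have hAs : ∀ y ∈ Ioo 0 s, w y = A * γ n y := by
    intro y hy
    have hd : ∀ z ∈ Ioo 0 s, HasDerivAt (fun t => w t / γ n t) 0 z := by
      intro z hz
      have hz' : (z : ℂ) ≠ 0 := Complex.ofReal_ne_zero.2 hz.1.ne'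
      convert! (hwd z (hsr hz)).div (hγd n z) (hγs z hz) using 1
      have h1 := hUV z (hsr hz)
      simp only [hU] at h1
      have hne := hγs z hz
      symm
      rw [div_eq_zero_iff]
      left
      field_simp
      have h2 : (z : ℂ) ^ (2 * n + 2) * z = (z : ℂ) ^ (2 * n + 3) := by ring
      linear_combination (κ : ℂ) * h1
    have := isOpen_Ioo.is_const_of_deriv_eq_zero isPreconnected_Ioo
        (fun z hz => (hd z hz).differentiableAt.differentiableWithinAt)
        (fun z hz => (hd z hz).deriv) hy hs2
    change w y / γ n y = A at this
    rw [div_eq_iff (hγs y hy)] at this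
    rw [this]
  have hVs : ∀ y ∈ Ioo 0 s, V y = A * U y := by
    intro y hy
    have h1 := hUV y (hsr hy)
    rw [hAs y hy] at h1
    apply mul_left_cancel₀ (hγs y hy)
    rw [← h1]; ring
  have hmain : ∀ ρ ∈ Ioo 0 r, w ρ = A * γ n ρ := by
    intro b hb
    rcases lt_or_ge b s with hbs | hbs
    · exact hAs b ⟨hb.1, hbs⟩
    -- Farther out γ_n may vanish, so the identity is continued by uniqueness for the linear system,
    -- started at s/2, where its coefficients are already regular.
    set F : ℝ → ℂ × ℂ := fun t => (w t - A * γ n t, V t - A * U t) with hF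
    set F' : ℝ → ℂ × ℂ := fun t => (-κ * (V t - A * U t) / (t : ℂ) ^ (2 * n + 2),
      (t : ℂ) ^ (2 * n + 2) * (w t - A * γ n t)) with hF'
    have hI : ∀ t ∈ Icc (s / 2) b, t ∈ Ioo 0 r := fun t ht =>
      ⟨by linarith [ht.1], ht.2.trans_lt hb.2⟩
    have hFd : ∀ t ∈ Icc (s / 2) b, HasDerivAt F (F' t) t := by
      intro t ht
      have ht' : (t : ℂ) ≠ 0 := Complex.ofReal_ne_zero.2 (hI t ht).1.ne'
      refine HasDerivAt.prodMk ?_ ?_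
      · convert! (hwd t (hI t ht)).sub ((hγd n t).const_mul A) using 1
        simp only [hU]
        field_simp
        ring
      · convert! (hVw t (hI t ht)).sub ((hUd t).const_mul A) using 1
        ring
    set K : ℝ := |κ| / (s / 2) ^ (2 * n + 2) + b ^ (2 * n + 2) with hK
    have hb0 : 0 < b := hb.1
    have hbound : ∀ t ∈ Ico (s / 2) b, ‖F' t‖ ≤ K * ‖F t‖ := by
      intro t ht
      have ht0 : 0 < t := (hI t ⟨ht.1, ht.2.le⟩).1
      have p1 : 0 ≤ |κ| / (s / 2) ^ (2 * n + 2) := by positivity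
      have p2 : 0 ≤ b ^ (2 * n + 2) := by positivity
      rw [Prod.norm_def (x := F' t)]
      apply max_le
      · simp only [hF', norm_div, norm_mul, norm_neg, norm_pow, Complex.norm_real,
          Real.norm_eq_abs, abs_of_pos ht0]
        calc |κ| * ‖V t - A * U t‖ / t ^ (2 * n + 2)
            = |κ| / t ^ (2 * n + 2) * ‖V t - A * U t‖ := by ring
          _ ≤ |κ| / (s / 2) ^ (2 * n + 2) * ‖F t‖ := by
              gcongr
              · exact ht.1
              · exact norm_snd_le (F t)
          _ ≤ K * ‖F t‖ := by
              gcongr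
              simp only [hK]; linarith
      · simp only [hF', norm_mul, norm_pow, Complex.norm_real, Real.norm_eq_abs, abs_of_pos ht0]
        calc t ^ (2 * n + 2) * ‖w t - A * γ n t‖ ≤ b ^ (2 * n + 2) * ‖F t‖ := by
              gcongr
              · exact ht.2.le
              · exact norm_fst_le (F t)
          _ ≤ K * ‖F t‖ := by
              gcongr
              simp only [hK]; linarith
    have hz := eq_zero_of_abs_deriv_le_mul_abs_self_of_eq_zero_right
      (fun t ht => (hFd t ht).continuousAt.continuousWithinAt)
      (fun t ht => (hFd t (Ico_subset_Icc_self ht)).hasDerivWithinAt)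
      (by simp [hF, hAs _ hs2, hVs _ hs2]) hbound b ⟨by linarith, le_rfl⟩
    exact sub_eq_zero.1 (congrArg Prod.fst hz)
  refine ⟨A, fun ρ hρ => ?_⟩
  rcases eq_or_lt_of_le hρ.1 with h | h
  · have hlim : Filter.Tendsto c (nhdsWithin 0 (Ioi 0)) (nhds (A * ((0 : ℝ) : ℂ) ^ n * γ n 0)) := by
      have hcont : Continuous fun t : ℝ => A * (t : ℂ) ^ n * γ n t :=
        (continuous_const.mul (hpow n)).mul (hγc n)
      refine ((hcont.tendsto 0).mono_left nhdsWithin_le_nhds).congr' ?_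
      filter_upwards [Ioo_mem_nhdsGT hr] with y hy
      rw [hcw y hy.1, hmain y hy]; ring
    have h2 := (hc.continuousAt (Ioo_mem_nhds h0m.1 h0m.2)).tendsto.mono_left
      (nhdsWithin_le_nhds (s := Ioi 0))
    rw [← h]
    exact tendsto_nhds_unique h2 hlim
  · rw [hcw ρ h, hmain ρ ⟨h, hρ.2⟩]; ring

end MaxwellCorner
end

noncomputable section
namespace MaxwellCorner

open MvPolynomial (X pderiv)
open MeasureTheory Set

/-! ### Algebra of harmonic polynomials -/

instance finiteDimensional_harm (n : ℕ) : FiniteDimensional ℂ (harm n) := by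
  have : FiniteDimensional ℂ (MvPolynomial.homogeneousSubmodule (Fin 3) ℂ n) :=
    Module.Finite.iff_fg.2 (MvPolynomial.homogeneousSubmodule_fg _ _ n)
  exact Submodule.finiteDimensional_of_le inf_le_left

/-- The polynomial with conjugate coefficients. -/
def conjPoly (p : Poly) : Poly := MvPolynomial.map (starRingEnd ℂ) p

theorem pev_conjPoly (p : Poly) (x : R3) : pev (conjPoly p) x = (starRingEnd ℂ) (pev p x) := by
  rw [conjPoly, pev, pev, MvPolynomial.eval_map, ← MvPolynomial.coe_eval₂Hom,
    MvPolynomial.coe_eval₂Hom, MvPolynomial.eval, MvPolynomial.coe_eval₂Hom,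
    MvPolynomial.eval₂_comp_left]
  simp [Function.comp_def]

theorem lap_conjPoly (p : Poly) : lap (conjPoly p) = conjPoly (lap p) := by
  simp only [lap_apply, conjPoly, MvPolynomial.pderiv_map, map_add]

theorem conjPoly_mem_harm {n : ℕ} {p : Poly} (hp : p ∈ harm n) : conjPoly p ∈ harm n := by
  rw [mem_harm] at hp ⊢
  exact ⟨hp.1.map _, by rw [lap_conjPoly, hp.2, conjPoly, map_zero]⟩

/-- The polynomial `y ↦ p (x + δ y)`. -/
def affinePoly (x : R3) (δ : ℝ) (p : Poly) : Poly :=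
  MvPolynomial.bind₁ (fun i => MvPolynomial.C (x i : ℂ) + MvPolynomial.C (δ : ℂ) * X i) p

theorem pev_affinePoly (x : R3) (δ : ℝ) (p : Poly) (y : R3) :
    pev (affinePoly x δ p) y = pev p (x + δ • y) := by
  rw [affinePoly]
  induction p using MvPolynomial.induction_on with
  | C a => simp [MvPolynomial.algebraMap_eq]
  | add p q hp hq => simp [hp, hq]
  | mul_X p i hp => simp [hp]

theorem pderiv_affinePoly (x : R3) (δ : ℝ) (p : Poly) (i : Fin 3) :
    pderiv i (affinePoly x δ p) = MvPolynomial.C (δ : ℂ) * affinePoly x δ (pderiv i p) := by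
  rw [affinePoly, affinePoly]
  induction p using MvPolynomial.induction_on with
  | C a => simp [MvPolynomial.algebraMap_eq]
  | add p q hp hq => simp [hp, hq]; ring
  | mul_X p j hp =>
    by_cases h : j = i
    · subst h
      simp [hp, Derivation.leibniz]
      ring
    · simp [hp, Derivation.leibniz, pderiv_X_ne h]
      ring

theorem lap_affinePoly (x : R3) (δ : ℝ) {p : Poly} (hp : lap p = 0) :
    lap (affinePoly x δ p) = 0 := by
  have h : ∀ i, pderiv i (pderiv i (affinePoly x δ p)) =
      MvPolynomial.C (δ : ℂ) ^ 2 * affinePoly x δ (pderiv i (pderiv i p)) := fun i => by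
    rw [pderiv_affinePoly, MvPolynomial.pderiv_C_mul, pderiv_affinePoly]; ring
  rw [lap_apply, h, h, h, ← mul_add, ← mul_add]
  have e : affinePoly x δ (pderiv 0 (pderiv 0 p)) + affinePoly x δ (pderiv 1 (pderiv 1 p)) +
      affinePoly x δ (pderiv 2 (pderiv 2 p)) = affinePoly x δ (lap p) := by
    rw [lap_apply]; simp [affinePoly]
  rw [e, hp, affinePoly, map_zero, mul_zero]

theorem isHomogeneous_nsq : nsq.IsHomogeneous 2 := by
  rw [nsq]
  exact ((MvPolynomial.isHomogeneous_X_pow 0 2).add (MvPolynomial.isHomogeneous_X_pow 1 2)).add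
    (MvPolynomial.isHomogeneous_X_pow 2 2)

theorem pderiv_nsq (i : Fin 3) : pderiv i nsq = 2 * X i := by
  fin_cases i <;> simp [nsq, Derivation.leibniz_pow]

/-- The factor is positive, so Δ can be inverted on products of powers of |x|² and harmonic
polynomials; this drives the decomposition below. -/
theorem lap_nsq_pow_mul {m : ℕ} {h : Poly} (hh : h ∈ harm m) (j : ℕ) :
    lap (nsq ^ (j + 1) * h) = (2 * (j + 1) * (2 * j + 2 * m + 3) : ℕ) • (nsq ^ j * h) := by
  have he := euler (mem_harm.1 hh).1
  have hl := (mem_harm.1 hh).2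
  rw [lap_apply] at hl
  have hd : ∀ i : Fin 3, pderiv i (pderiv i (nsq ^ (j + 1) * h)) =
      4 * ((j : Poly) + 1) * (j : Poly) * (nsq ^ (j - 1) * X i ^ 2) * h +
      2 * ((j : Poly) + 1) * nsq ^ j * h + 4 * ((j : Poly) + 1) * nsq ^ j * (X i * pderiv i h) + nsq ^ (j + 1) * pderiv i (pderiv i h) := by
    intro i
    have h1 : pderiv i (nsq ^ (j + 1)) = 2 * ((j : Poly) + 1) * (nsq ^ j * X i) := by
      rw [MvPolynomial.pderiv_pow, pderiv_nsq, Nat.add_sub_cancel]; push_cast; ring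
    have h2 : pderiv i (2 * ((j : Poly) + 1)) = 0 := by
      have : (2 * ((j : Poly) + 1)) = MvPolynomial.C (2 * ((j : ℂ) + 1)) := by
        simp only [map_mul, map_add, map_natCast, map_ofNat, map_one]
      rw [this, MvPolynomial.pderiv_C]
    rw [MvPolynomial.pderiv_mul, h1, map_add, MvPolynomial.pderiv_mul (g := pderiv i h), h1,
      MvPolynomial.pderiv_mul (g := h), MvPolynomial.pderiv_mul (f := 2 * ((j : Poly) + 1)), h2,
      MvPolynomial.pderiv_mul (g := X i), MvPolynomial.pderiv_X_self, MvPolynomial.pderiv_pow,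
      pderiv_nsq]
    ring
  have hj : (j : Poly) * (nsq ^ (j - 1) * nsq) = j * nsq ^ j := by
    cases j with
    | zero => simp
    | succ j => rw [Nat.add_sub_cancel, ← pow_succ]
  have hn : nsq = X 0 ^ 2 + X 1 ^ 2 + X 2 ^ 2 := rfl
  rw [lap_apply, hd, hd, hd, nsmul_eq_mul]
  push_cast
  linear_combination 4 * ((j : Poly) + 1) * nsq ^ j * he + nsq ^ (j + 1) * hl +
    4 * ((j : Poly) + 1) * h * hj - 4 * ((j : Poly) + 1) * (j : Poly) * nsq ^ (j - 1) * h * hn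

/-- The span of the products of powers of `|x|²` and harmonic polynomials. -/
def fischer (n : ℕ) : Submodule ℂ Poly :=
  Submodule.span ℂ {q | ∃ j m h, m + 2 * j = n ∧ h ∈ harm m ∧ q = nsq ^ j * h}

/-- By induction Δp lies in the span in degree n - 2, and there Δs = Δp can be solved termwise with
s in the span in degree n. What is left, p - s, is harmonic. -/
theorem homogeneous_mem_fischer : ∀ (n : ℕ) (p : Poly), p.IsHomogeneous n → p ∈ fischer n := by
  intro n
  induction n using Nat.strong_induction_on with
  | _ n ih =>
    intro p hp
    have hlow : lap p = 0 → p ∈ fischer n := fun h =>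
      Submodule.subset_span ⟨0, n, p, by simp, mem_harm.2 ⟨hp, h⟩, by simp⟩
    rcases lt_or_ge n 2 with hn | hn
    · have hdeg : ∀ i j, pderiv i (pderiv j p) = 0 := by
        intro i j
        have h1 : (pderiv j p).IsHomogeneous 0 := by
          have := isHomogeneous_pderiv hp j
          rwa [show n - 1 = 0 by omega] at this
        have h2 := (MvPolynomial.totalDegree_zero_iff_isHomogeneous _).2 h1
        rw [MvPolynomial.totalDegree_eq_zero_iff_eq_C.1 h2, MvPolynomial.pderiv_C]
      exact hlow (by rw [lap_apply]; simp [hdeg])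
    · have h1 : (lap p).IsHomogeneous (n - 2) := by
        rw [lap_apply]
        have := fun i => isHomogeneous_pderiv (isHomogeneous_pderiv hp i) i
        exact ((this 0).add (this 1)).add (this 2)
      have key : ∀ q ∈ fischer (n - 2), ∃ s ∈ fischer n, lap s = q ∧ s.IsHomogeneous n := by
        intro q hq
        induction hq using Submodule.span_induction with
        | mem q hq =>
          obtain ⟨j, m, h, hm, hh, rfl⟩ := hq
          set c : ℂ := ((2 * (j + 1) * (2 * j + 2 * m + 3) : ℕ) : ℂ) with hc
          have hc0 : c ≠ 0 := by rw [hc, Nat.cast_ne_zero]; positivity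
          have hmem : nsq ^ (j + 1) * h ∈ fischer n :=
            Submodule.subset_span ⟨j + 1, m, h, by omega, hh, rfl⟩
          refine ⟨c⁻¹ • (nsq ^ (j + 1) * h), Submodule.smul_mem _ _ hmem, ?_, ?_⟩
          · rw [map_smul, lap_nsq_pow_mul hh, ← Nat.cast_smul_eq_nsmul ℂ, smul_smul, ← hc,
              inv_mul_cancel₀ hc0, one_smul]
          · rw [MvPolynomial.smul_eq_C_mul]
            refine MvPolynomial.IsHomogeneous.C_mul ?_ _
            have := (isHomogeneous_nsq.pow (j + 1)).mul (mem_harm.1 hh).1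
            rwa [show 2 * (j + 1) + m = n by omega] at this
        | zero => exact ⟨0, Submodule.zero_mem _, by simp, MvPolynomial.isHomogeneous_zero _ _ _⟩
        | add q q' _ _ hq hq' =>
          obtain ⟨s, h1, h2, h3⟩ := hq
          obtain ⟨s', h1', h2', h3'⟩ := hq'
          exact ⟨s + s', Submodule.add_mem _ h1 h1', by rw [map_add, h2, h2'], h3.add h3'⟩
        | smul c q _ hq =>
          obtain ⟨s, h1, h2, h3⟩ := hq
          exact ⟨c • s, Submodule.smul_mem _ _ h1, by rw [map_smul, h2], by
            rw [MvPolynomial.smul_eq_C_mul]; exact h3.C_mul _⟩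
      obtain ⟨s, hs, hs1, hs2⟩ := key _ (ih (n - 2) (by omega) _ h1)
      have h2 : p - s ∈ fischer n :=
        Submodule.subset_span ⟨0, n, p - s, by simp,
          mem_harm.2 ⟨hp.sub hs2, by rw [map_sub, hs1, sub_self]⟩, by simp⟩
      simpa using Submodule.add_mem _ h2 hs

/-- A linear functional on polynomials that only depends on the values on the unit sphere and that
kills the harmonic polynomials is zero. -/
theorem linear_eq_zero_of_harm (L : Poly →ₗ[ℂ] ℂ)
    (hL : ∀ p q : Poly, (∀ w : S2, pev p w = pev q w) → L p = L q)
    (h0 : ∀ n, ∀ p ∈ harm n, L p = 0) (p : Poly) : L p = 0 := by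
  have h1 : ∀ n, ∀ q ∈ fischer n, L q = 0 := by
    intro n q hq
    induction hq using Submodule.span_induction with
    | mem q hq =>
      obtain ⟨j, m, h, -, hh, rfl⟩ := hq
      rw [hL (nsq ^ j * h) h fun w => ?_, h0 m h hh]
      rw [pev_mul, pev_pow, pev_nsq, mem_sphere_zero_iff_norm.1 w.2]; simp
    | zero => simp
    | add q q' _ _ hq hq' => rw [map_add, hq, hq', add_zero]
    | smul c q _ hq => rw [map_smul, hq, smul_zero]
  rw [← MvPolynomial.sum_homogeneousComponent p, map_sum]
  exact Finset.sum_eq_zero fun i _ => h1 i _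
    (homogeneous_mem_fischer i _ (MvPolynomial.homogeneousComponent_isHomogeneous i p))

end MaxwellCorner
end

noncomputable section
namespace MaxwellCorner

open MvPolynomial (X pderiv)
open MeasureTheory Set

/-! ### Orthogonality and mean values -/

theorem one_mem_harm : (1 : Poly) ∈ harm 0 :=
  mem_harm.2 ⟨MvPolynomial.isHomogeneous_one _ _, by simp [lap_apply]⟩

theorem sphPair_pev {n : ℕ} {p : Poly} (hp : p.IsHomogeneous n) (q : Poly) (ρ : ℝ) :
    sphPair (pev p) q ρ = (ρ : ℂ) ^ n * ∫ w : S2, pev p w * pev q w ∂sigma := by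
  rw [sphPair, ← integral_const_mul]
  refine integral_congr_ae (Filter.Eventually.of_forall fun w => ?_)
  simp only [pev_homog hp, mul_assoc]

/-- The pairing of p with q over the sphere of radius ρ scales like ρ^n by homogeneity of p, and
like ρ^m by `sphPair_eq` with κ = 0. Comparing ρ = 1 and ρ = 1/2 forces it to vanish. -/
theorem harm_orthogonal {n m : ℕ} (hnm : n ≠ m) {p q : Poly} (hp : p ∈ harm n) (hq : q ∈ harm m) :
    ∫ w : S2, pev p w * pev q w ∂sigma = 0 := by
  obtain ⟨A, hA⟩ := sphPair_eq two_pos (weakHelmholtz_pev (mem_harm.1 hp).2 2) hq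
  have h1 := hA 1 ⟨by norm_num, by norm_num⟩
  have h2 := hA (1 / 2) ⟨by norm_num, by norm_num⟩
  rw [sphPair_pev (mem_harm.1 hp).1] at h1 h2
  set J := ∫ w : S2, pev p w * pev q w ∂sigma
  simp only [zero_mul] at h1 h2
  have h3 : (((1 / 2 : ℝ) : ℂ) ^ n - ((1 / 2 : ℝ) : ℂ) ^ m) * J = 0 := by
    have : J = A * (redBessel m 0 : ℝ) := by simpa using h1
    rw [sub_mul, h2, this]; ring
  refine (mul_eq_zero.1 h3).resolve_left fun h => hnm ?_
  have h4 : (1 / 2 : ℝ) ^ n = (1 / 2 : ℝ) ^ m := by exact_mod_cast sub_eq_zero.1 h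
  exact pow_right_injective₀ (by norm_num) (by norm_num) h4

/-- For κ = 0 the pairing with the constant polynomial 1 is independent of ρ, and its value at ρ = 0
is known. -/
theorem harm_mean_value {p : Poly} (hp : lap p = 0) {ρ : ℝ} (hρ : 0 ≤ ρ) :
    ∫ w : S2, pev p (ρ • (w : R3)) ∂sigma = pev p 0 * ((sigma.real univ : ℝ) : ℂ) := by
  obtain ⟨A, hA⟩ := sphPair_eq (by linarith : 0 < ρ + 1) (weakHelmholtz_pev hp (ρ + 1)) one_mem_harm
  have h1 := hA ρ ⟨hρ, by linarith⟩
  have h2 := hA 0 ⟨le_rfl, by linarith⟩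
  rw [pow_zero, mul_one, zero_mul] at h1 h2
  rw [← h2] at h1
  simpa [sphPair, mul_comm] using h1

/-- A smooth radial bump function supported in the unit ball. -/
def bump (x : R3) : ℂ := ((Real.smoothTransition (1 - ‖x‖ ^ 2) : ℝ) : ℂ)

theorem contDiff_bump : ContDiff ℝ (⊤ : ℕ∞) bump :=
  contDiff_comp_normSq (φ := fun t => Real.smoothTransition (1 - t))
    (Real.smoothTransition.contDiff.comp (contDiff_const.sub contDiff_id))

theorem continuous_bump : Continuous bump := contDiff_bump.continuous

theorem bump_eq_zero {x : R3} (hx : 1 ≤ ‖x‖) : bump x = 0 := by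
  rw [bump, Real.smoothTransition.zero_of_nonpos (by nlinarith), Complex.ofReal_zero]

theorem norm_bump (x : R3) : ‖bump x‖ = Real.smoothTransition (1 - ‖x‖ ^ 2) := by
  rw [bump, Complex.norm_real, Real.norm_of_nonneg (Real.smoothTransition.nonneg _)]

theorem norm_bump_le (x : R3) : ‖bump x‖ ≤ 1 := by
  rw [norm_bump]; exact Real.smoothTransition.le_one _

theorem hasCompactSupport_of_norm {F : Type*} [Zero F] {g : R3 → F} {R : ℝ}
    (h : ∀ x, R < ‖x‖ → g x = 0) :
    HasCompactSupport g :=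
  HasCompactSupport.intro (isCompact_closedBall (0 : R3) R) fun x hx =>
    h x (by simpa using hx)

theorem integrable_mul_bump {g : R3 → ℂ} (hg : Continuous g) :
    Integrable fun x => g x * bump x :=
  (hg.mul continuous_bump).integrable_of_hasCompactSupport
    (hasCompactSupport_of_norm (R := 1) fun x hx => by simp [bump_eq_zero hx.le])

/-- The total mass of the bump function. -/
def bumpMass : ℝ := ∫ x : R3, ‖bump x‖

theorem integrable_bump : Integrable bump := by
  simpa using integrable_mul_bump continuous_const (g := fun _ => 1)

theorem bumpMass_pos : 0 < bumpMass := by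
  rw [bumpMass, integral_pos_iff_support_of_nonneg (fun x => norm_nonneg _) integrable_bump.norm]
  have h : Metric.ball (0 : R3) 1 ⊆ Function.support fun x => ‖bump x‖ := by
    intro x hx
    rw [mem_ball_zero_iff] at hx
    rw [Function.mem_support, norm_bump]
    exact (Real.smoothTransition.pos_of_pos (by nlinarith [norm_nonneg x])).ne'
  exact (Metric.measure_ball_pos volume 0 one_pos).trans_le (measure_mono h)

theorem integral_bump : ∫ x, bump x = ((bumpMass : ℝ) : ℂ) := by
  rw [bumpMass, ← integral_complex_ofReal]
  exact integral_congr_ae (Filter.Eventually.of_forall fun x => by simp only [norm_bump]; rfl)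

/-- The bump is radial, so the mean value property applies on every sphere; the case p = 1
identifies the constant. -/
theorem integral_harm_mul_bump {p : Poly} (hp : lap p = 0) :
    ∫ x, pev p x * bump x = pev p 0 * ((bumpMass : ℝ) : ℂ) := by
  have key : ∀ q : Poly, lap q = 0 → ∫ x, pev q x * bump x = pev q 0 *
      ∫ ρ in Ioi (0 : ℝ), ((ρ ^ 2 * Real.smoothTransition (1 - ρ ^ 2) * sigma.real univ : ℝ) : ℂ) := by
    intro q hq
    rw [integral_polar (integrable_mul_bump (continuous_pev q)), ← integral_const_mul]
    refine setIntegral_congr_fun measurableSet_Ioi fun ρ hρ => ?_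
    have h1 : ∀ w : S2, pev q (ρ • (w : R3)) * bump (ρ • (w : R3)) =
        pev q (ρ • (w : R3)) * ((Real.smoothTransition (1 - ρ ^ 2) : ℝ) : ℂ) := fun w => by
      rw [bump, norm_smul_S2, sq_abs]
    simp only [h1]
    rw [integral_mul_const, harm_mean_value hq (le_of_lt hρ), Complex.real_smul]
    push_cast; ring
  have h1 := key 1 (mem_harm.1 one_mem_harm).2
  simp only [pev_one, one_mul] at h1
  rw [key p hp, ← h1, integral_bump]

theorem integrable_partialDeriv_bump (i : Fin 3) : Integrable (partialDeriv i bump) :=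
  (contDiff_partialDeriv contDiff_bump i).continuous.integrable_of_hasCompactSupport
    (hasCompactSupport_of_norm (R := 1)
      fun x hx => partialDeriv_support (fun _ hy => bump_eq_zero hy.le) i x hx)

/-- A bound for the `L¹` norms of the derivatives of the bump function. -/
def bumpDeriv : ℝ := ∑ i, ∫ x : R3, ‖partialDeriv i bump x‖

theorem bumpDeriv_nonneg : 0 ≤ bumpDeriv :=
  Finset.sum_nonneg fun _ _ => integral_nonneg fun _ => norm_nonneg _

/-- Interior gradient estimate: ∂_i p is harmonic, so its value at x is its average against the bump
rescaled to radius δ, and integration by parts moves the derivative onto the bump at the cost 1/δ.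
-/
theorem norm_pev_pderiv_le {p : Poly} (hp : lap p = 0) {x : R3} {δ M : ℝ} (hδ : 0 < δ)
    (hM : ∀ y : R3, ‖y‖ ≤ 1 → ‖pev p (x + δ • y)‖ ≤ M) (i : Fin 3) :
    ‖pev (pderiv i p) x‖ ≤ bumpDeriv / bumpMass * M / δ := by
  set q := affinePoly x δ p with hq
  have hM0 : 0 ≤ M := (norm_nonneg _).trans (hM 0 (by simp))
  have hl : lap q = 0 := lap_affinePoly x δ hp
  have hli : lap (pderiv i q) = 0 := by
    rw [lap_apply] at hl
    rw [lap_apply, pderiv_comm 0 i, pderiv_comm 1 i, pderiv_comm 2 i, pderiv_comm 0 i,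
      pderiv_comm 1 i, pderiv_comm 2 i, ← map_add, ← map_add, hl, map_zero]
  have h1 := integral_harm_mul_bump hli
  have h0 : pev (pderiv i q) 0 = δ * pev (pderiv i p) x := by
    rw [hq, pderiv_affinePoly, pev_mul, pev_C, pev_affinePoly]; simp
  have h2 : ∫ y, pev (pderiv i q) y * bump y = -∫ y, pev q y * partialDeriv i bump y := by
    have hint2 : Integrable fun y => pev q y * partialDeriv i bump y :=
      ((continuous_pev q).mul (contDiff_partialDeriv contDiff_bump i).continuous
        ).integrable_of_hasCompactSupport (hasCompactSupport_of_norm (R := 1)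
          fun x hx => by
            have := partialDeriv_support (g := bump) (fun _ hy => bump_eq_zero hy.le) i x hx
            simp [this])
    have := integral_mul_fderiv_eq_neg_fderiv_mul_of_integrable (μ := volume) (f := pev q)
      (g := bump) (v := EuclideanSpace.single i (1 : ℝ))
      (by
        have := integrable_mul_bump (continuous_pev (pderiv i q))
        simpa only [← partialDeriv_pev, partialDeriv] using this)
      hint2 (integrable_mul_bump (continuous_pev q)) (fun x _ => differentiable_pev q x)
      (fun x _ => contDiff_bump.differentiable (by simp) x)
    have h' : ∀ y, pev (pderiv i q) y = fderiv ℝ (pev q) y (EuclideanSpace.single i (1 : ℝ)) :=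
      fun y => (partialDeriv_pev q i y).symm
    simp only [h', partialDeriv]
    rw [this, neg_neg]
  have h3 : ‖∫ y, pev q y * partialDeriv i bump y‖ ≤ M * bumpDeriv := by
    refine (norm_integral_le_of_norm_le
      ((integrable_partialDeriv_bump i).norm.const_mul M) ?_).trans ?_
    · refine Filter.Eventually.of_forall fun y => ?_
      rw [norm_mul]
      rcases le_or_gt ‖y‖ 1 with hy | hy
      · refine mul_le_mul_of_nonneg_right ?_ (norm_nonneg _)
        rw [hq, pev_affinePoly]; exact hM y hy
      · rw [partialDeriv_support (fun _ hy => bump_eq_zero hy.le) i y hy]; simp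
    · rw [integral_const_mul]
      refine mul_le_mul_of_nonneg_left ?_ hM0
      exact Finset.single_le_sum (f := fun i => ∫ x : R3, ‖partialDeriv i bump x‖)
        (fun _ _ => integral_nonneg fun _ => norm_nonneg _) (Finset.mem_univ i)
  rw [← norm_neg, ← h2, h1, h0, norm_mul, norm_mul, Complex.norm_real, Complex.norm_real,
    Real.norm_of_nonneg hδ.le, Real.norm_of_nonneg bumpMass_pos.le] at h3
  rw [le_div_iff₀ hδ, div_mul_eq_mul_div, le_div_iff₀ bumpMass_pos]
  linarith

/-! ### The supremum over the sphere -/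

/-- The restriction of a polynomial to the unit sphere. -/
def onSphere (p : Poly) : C(S2, ℂ) := ⟨fun w => pev p w, (continuous_pev p).comp continuous_subtype_val⟩

/-- The supremum of a polynomial on the unit sphere. -/
def supS (p : Poly) : ℝ := ‖onSphere p‖

theorem supS_nonneg (p : Poly) : 0 ≤ supS p := norm_nonneg _

theorem norm_pev_le_supS (p : Poly) (w : S2) : ‖pev p w‖ ≤ supS p :=
  (onSphere p).norm_coe_le_norm w

theorem supS_le {p : Poly} {M : ℝ} (hM : 0 ≤ M) (h : ∀ w : S2, ‖pev p w‖ ≤ M) : supS p ≤ M :=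
  (ContinuousMap.norm_le _ hM).2 h

theorem norm_pev_le {n : ℕ} {p : Poly} (hp : p.IsHomogeneous n) (x : R3) :
    ‖pev p x‖ ≤ ‖x‖ ^ n * supS p := by
  rcases eq_or_ne x 0 with rfl | hx
  · have h : (0 : R3) = (0 : ℝ) • EuclideanSpace.single 0 1 := by simp
    have hs : ‖pev p (EuclideanSpace.single 0 1)‖ ≤ supS p :=
      norm_pev_le_supS p ⟨EuclideanSpace.single 0 1, by simp⟩
    conv_lhs => rw [h, pev_homog hp]
    rw [norm_mul, norm_pow]
    simpa using mul_le_mul_of_nonneg_left hs (by positivity : (0 : ℝ) ≤ 0 ^ n)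
  · have hx' : ‖x‖ ≠ 0 := norm_ne_zero_iff.2 hx
    have h : x = ‖x‖ • (‖x‖⁻¹ • x) := by rw [smul_smul, mul_inv_cancel₀ hx', one_smul]
    have hs : ‖pev p (‖x‖⁻¹ • x)‖ ≤ supS p :=
      norm_pev_le_supS p ⟨‖x‖⁻¹ • x, by simp [norm_smul, hx']⟩
    conv_lhs => rw [h, pev_homog hp]
    rw [norm_mul, norm_pow, Complex.norm_real, norm_norm]
    exact mul_le_mul_of_nonneg_left hs (by positivity)

theorem one_add_inv_pow_le (n m : ℕ) (h : m ≤ 3 * (n + 1)) :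
    (1 + ((n : ℝ) + 1)⁻¹) ^ m ≤ Real.exp 3 := by
  have h0 : (0 : ℝ) < (n : ℝ) + 1 := by positivity
  calc (1 + ((n : ℝ) + 1)⁻¹) ^ m ≤ Real.exp (((n : ℝ) + 1)⁻¹) ^ m := by
        gcongr; rw [add_comm]; exact Real.add_one_le_exp _
    _ = Real.exp (m * ((n : ℝ) + 1)⁻¹) := by rw [← Real.exp_nat_mul]
    _ ≤ Real.exp 3 := by
        apply Real.exp_le_exp.2
        rw [← div_eq_mul_inv, div_le_iff₀ h0]
        exact_mod_cast h

/-- The constant of the Bernstein type inequality `supS_pderiv_le`. -/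
def bernstein : ℝ := bumpDeriv / bumpMass * Real.exp 3

theorem bernstein_nonneg : 0 ≤ bernstein := by
  have := bumpDeriv_nonneg
  have := bumpMass_pos
  rw [bernstein]; positivity

/-- The gradient estimate with δ = 1/(n+1): within that distance of the unit sphere p exceeds its
supremum there by a factor of at most (1 + 1/(n+1))^n ≤ e³. The loss is only polynomial in n, which
the geometric convergence absorbs. -/
theorem supS_pderiv_le {n : ℕ} {p : Poly} (hp : p ∈ harm n) (i : Fin 3) :
    supS (pderiv i p) ≤ bernstein * (n + 1) * supS p := by
  have hb := bernstein_nonneg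
  refine supS_le (by have := supS_nonneg p; positivity) fun w => ?_
  have h0 : (0 : ℝ) < (n : ℝ) + 1 := by positivity
  refine (norm_pev_pderiv_le (mem_harm.1 hp).2 (δ := ((n : ℝ) + 1)⁻¹) (M := Real.exp 3 * supS p)
    (inv_pos.2 h0) (fun y hy => ?_) i).trans ?_
  · refine (norm_pev_le (mem_harm.1 hp).1 _).trans
      (mul_le_mul_of_nonneg_right ?_ (supS_nonneg p))
    refine (pow_le_pow_left₀ (norm_nonneg _) ?_ n).trans (one_add_inv_pow_le n n (by omega))
    refine (norm_add_le _ _).trans ?_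
    rw [norm_eq_of_mem_sphere w, norm_smul, Real.norm_of_nonneg (inv_pos.2 h0).le]
    gcongr
    exact mul_le_of_le_one_right (inv_pos.2 h0).le hy
  · rw [bernstein, div_inv_eq_mul]
    apply le_of_eq; ring

/-- The integral of `|p|` over the unit sphere. -/
def absS (p : Poly) : ℝ := ∫ w : S2, ‖pev p w‖ ∂sigma

theorem absS_nonneg (p : Poly) : 0 ≤ absS p := integral_nonneg fun _ => norm_nonneg _

theorem integral_ball_norm_pev {n : ℕ} {p : Poly} (hp : p.IsHomogeneous n) {R : ℝ} (hR : 0 ≤ R) :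
    ∫ x in Metric.ball (0 : R3) R, ‖pev p x‖ ≤ R ^ (n + 3) * absS p := by
  set g : R3 → ℂ := (Metric.ball (0 : R3) R).indicator fun x => ((‖pev p x‖ : ℝ) : ℂ) with hg
  have hc : Continuous fun x : R3 => ((‖pev p x‖ : ℝ) : ℂ) :=
    Complex.continuous_ofReal.comp (continuous_pev p).norm
  have hgi : Integrable g := by
    rw [hg, integrable_indicator_iff Metric.isOpen_ball.measurableSet]
    exact (hc.continuousOn.integrableOn_compact (isCompact_closedBall (0 : R3) R)).mono_set
      Metric.ball_subset_closedBall
  have h1 : ∫ x, g x = ((∫ x in Metric.ball (0 : R3) R, ‖pev p x‖ : ℝ) : ℂ) := by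
    rw [hg, integral_indicator Metric.isOpen_ball.measurableSet, integral_complex_ofReal]
  have h2 : ∀ ρ ∈ Ioi (0 : ℝ), ρ ^ 2 • ∫ w : S2, g (ρ • (w : R3)) ∂sigma =
      (Iio R).indicator (fun ρ => ((ρ ^ (n + 2) * absS p : ℝ) : ℂ)) ρ := by
    intro ρ hρ
    have hρ0 : (0 : ℝ) < ρ := hρ
    by_cases h : ρ < R
    · have : ∀ w : S2, g (ρ • (w : R3)) = ((ρ ^ n * ‖pev p w‖ : ℝ) : ℂ) := fun w => by
        rw [hg, indicator_of_mem (by rw [mem_ball_zero_iff, norm_smul_S2, abs_of_pos hρ0]; exact h),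
          pev_homog hp, norm_mul, norm_pow, Complex.norm_real, Real.norm_of_nonneg hρ0.le]
      simp only [this]
      rw [integral_complex_ofReal, integral_const_mul, indicator_of_mem (mem_Iio.2 h), absS,
        Complex.real_smul]
      push_cast; ring
    · have : ∀ w : S2, g (ρ • (w : R3)) = 0 := fun w => by
        rw [hg, indicator_of_notMem (by rw [mem_ball_zero_iff, norm_smul_S2, abs_of_pos hρ0]; exact h)]
      simp only [this]
      rw [integral_zero, smul_zero, indicator_of_notMem (by exact h)]
  have h3 := integral_polar hgi
  rw [setIntegral_congr_fun measurableSet_Ioi h2, setIntegral_indicator measurableSet_Iio,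
    integral_complex_ofReal, h1] at h3
  rw [Complex.ofReal_injective h3, Ioi_inter_Iio]
  have hi : IntegrableOn (fun _ : ℝ => R ^ (n + 2) * absS p) (Ioo 0 R) :=
    integrableOn_const (by simp)
  refine (integral_mono_of_nonneg ?_ hi ?_).trans ?_
  · refine (ae_restrict_iff' measurableSet_Ioo).2 (Filter.Eventually.of_forall fun ρ hρ => ?_)
    have := hρ.1.le
    have := absS_nonneg p
    simp only [Pi.zero_apply]
    positivity
  · refine (ae_restrict_iff' measurableSet_Ioo).2 (Filter.Eventually.of_forall fun ρ hρ => ?_)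
    exact mul_le_mul_of_nonneg_right (pow_le_pow_left₀ hρ.1.le hρ.2.le _) (absS_nonneg p)
  · simp only [integral_const, MeasurableSet.univ, measureReal_restrict_apply, univ_inter,
      Real.volume_real_Ioo, smul_eq_mul]
    rw [sub_zero, max_eq_left hR]
    apply le_of_eq; ring

/-- Average p against the bump at scale δ = 1/(n+1) around a point of the sphere. The rescaling
costs δ⁻³ = (n+1)³, and the integral of |p| over the ball of radius 1 + δ is controlled by
homogeneity. -/
theorem supS_le_absS {n : ℕ} {p : Poly} (hp : p ∈ harm n) :
    supS p ≤ Real.exp 3 / bumpMass * (n + 1) ^ 3 * absS p := by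
  have hI := bumpMass_pos
  refine supS_le (by have := absS_nonneg p; positivity) fun x => ?_
  have h0 : (0 : ℝ) < (n : ℝ) + 1 := by positivity
  set δ := ((n : ℝ) + 1)⁻¹ with hδ
  have hδ0 : 0 < δ := inv_pos.2 h0
  have h1 := integral_harm_mul_bump (lap_affinePoly (x : R3) δ (mem_harm.1 hp).2)
  rw [pev_affinePoly, smul_zero, add_zero] at h1
  set G : R3 → ℝ := (Metric.ball (0 : R3) (1 + δ)).indicator fun z => ‖pev p z‖ with hG
  have hGi : Integrable G := by
    rw [hG, integrable_indicator_iff Metric.isOpen_ball.measurableSet]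
    exact ((continuous_pev p).norm.continuousOn.integrableOn_compact
      (isCompact_closedBall (0 : R3) (1 + δ))).mono_set Metric.ball_subset_closedBall
  have hGx : Integrable fun y => G ((x : R3) + y) := hGi.comp_add_left (x : R3)
  have hGxd : Integrable fun y => G ((x : R3) + δ • y) :=
    (integrable_comp_smul_iff volume (fun y => G ((x : R3) + y)) hδ0.ne').2 hGx
  have h2 : ∫ y, G ((x : R3) + δ • y) = (n + 1) ^ 3 * ∫ z in Metric.ball (0 : R3) (1 + δ), ‖pev p z‖ := by
    rw [Measure.integral_comp_smul volume (fun y => G ((x : R3) + y)) δ,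
      integral_add_left_eq_self G (x : R3), hG, integral_indicator Metric.isOpen_ball.measurableSet]
    have : |(δ ^ Module.finrank ℝ R3)⁻¹| = ((n : ℝ) + 1) ^ 3 := by
      rw [finrank_euclideanSpace_fin, hδ, inv_pow, inv_inv, abs_of_pos (by positivity)]
    rw [this, smul_eq_mul]
  have h3 : ‖∫ y, pev (affinePoly (x : R3) δ p) y * bump y‖ ≤ ∫ y, G ((x : R3) + δ • y) := by
    refine norm_integral_le_of_norm_le hGxd (Filter.Eventually.of_forall fun y => ?_)
    have hG0 : ∀ z, 0 ≤ G z := fun z => indicator_nonneg (fun _ _ => norm_nonneg _) z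
    rcases lt_or_ge ‖y‖ 1 with hy | hy
    · have hmem : (x : R3) + δ • y ∈ Metric.ball (0 : R3) (1 + δ) := by
        rw [mem_ball_zero_iff]
        refine (norm_add_le _ _).trans_lt ?_
        rw [norm_eq_of_mem_sphere x, norm_smul, Real.norm_of_nonneg hδ0.le]
        have := mul_lt_mul_of_pos_left hy hδ0
        linarith
      rw [norm_mul, pev_affinePoly, hG, indicator_of_mem hmem]
      exact mul_le_of_le_one_right (norm_nonneg _) (norm_bump_le y)
    · rw [bump_eq_zero hy, mul_zero, norm_zero]; exact hG0 _
  rw [h1, norm_mul, Complex.norm_real, Real.norm_of_nonneg hI.le, h2] at h3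
  have h4 := integral_ball_norm_pev (mem_harm.1 hp).1 (by positivity : 0 ≤ 1 + δ)
  have h5 : (1 + δ) ^ (n + 3) ≤ Real.exp 3 := one_add_inv_pow_le n (n + 3) (by omega)
  have h6 := h4.trans (mul_le_mul_of_nonneg_right h5 (absS_nonneg p))
  have h7 := h3.trans (mul_le_mul_of_nonneg_left h6 (by positivity))
  rw [div_mul_eq_mul_div, div_mul_eq_mul_div, le_div_iff₀ hI]
  linarith

/-- The integral of `|p|²` over the unit sphere. -/
def sqS (p : Poly) : ℝ := ∫ w : S2, ‖pev p w‖ ^ 2 ∂sigma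

theorem sqS_nonneg (p : Poly) : 0 ≤ sqS p := integral_nonneg fun _ => by positivity

theorem ofReal_sqS (p : Poly) :
    ((sqS p : ℝ) : ℂ) = ∫ w : S2, pev p w * pev (conjPoly p) w ∂sigma := by
  rw [sqS, ← integral_complex_ofReal]
  refine integral_congr_ae (Filter.Eventually.of_forall fun w => ?_)
  simp only [pev_conjPoly, Complex.mul_conj, Complex.normSq_eq_norm_sq]

theorem absS_sq_le (p : Poly) : absS p ^ 2 ≤ sigma.real univ * sqS p := by
  have hc : Continuous fun w : S2 => ‖pev p w‖ :=
    ((continuous_pev p).comp continuous_subtype_val).norm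
  have hi : ∀ {g : S2 → ℝ}, Continuous g → Integrable g sigma := fun hg =>
    hg.integrable_of_hasCompactSupport (HasCompactSupport.of_compactSpace _)
  -- Cauchy–Schwarz through the nonnegative quadratic t ↦ ∫ (t - |p|)².
  have key : ∀ t : ℝ, 0 ≤ t ^ 2 * sigma.real univ - 2 * t * absS p + sqS p := by
    intro t
    have h : 0 ≤ ∫ w : S2, (t - ‖pev p w‖) ^ 2 ∂sigma := integral_nonneg fun _ => sq_nonneg _
    have e : ∀ w : S2, (t - ‖pev p w‖) ^ 2 = t ^ 2 - 2 * t * ‖pev p w‖ + ‖pev p w‖ ^ 2 :=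
      fun w => by ring
    simp only [e] at h
    have i1 : Integrable (fun _ : S2 => t ^ 2) sigma := hi continuous_const
    have i2 : Integrable (fun w : S2 => 2 * t * ‖pev p w‖) sigma := hi (continuous_const.mul hc)
    have i3 : Integrable (fun w : S2 => t ^ 2 - 2 * t * ‖pev p w‖) sigma := i1.sub i2
    have i4 : Integrable (fun w : S2 => ‖pev p w‖ ^ 2) sigma := hi (hc.pow 2)
    rw [integral_add i3 i4, integral_sub i1 i2, integral_const_mul, integral_const] at h
    rw [sqS, absS]
    simpa [mul_comm] using h
  have hs : 0 ≤ sigma.real univ := measureReal_nonneg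
  rcases hs.eq_or_lt with h0 | h0
  · have : absS p = 0 := by
      by_contra hne
      have := key ((sqS p + 1) / (2 * absS p))
      have e : 2 * ((sqS p + 1) / (2 * absS p)) * absS p = sqS p + 1 := by field_simp
      rw [← h0, e] at this
      linarith
    rw [this, ← h0]; simp
  · have := key (absS p / sigma.real univ)
    have e : (absS p / sigma.real univ) ^ 2 * sigma.real univ - 2 * (absS p / sigma.real univ) * absS p
        + sqS p = (sigma.real univ * sqS p - absS p ^ 2) / sigma.real univ := by
      field_simp; ring
    rw [e] at this
    have := (div_nonneg_iff.1 this).resolve_right (by intro h; linarith [h.2])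
    linarith [this.1]

end MaxwellCorner
end

noncomputable section
namespace MaxwellCorner

open MvPolynomial (X pderiv)
open MeasureTheory Set Filter

/-! ### Completeness of the spherical harmonics -/

/-- The pairing `g ↦ ∫ D g` on the sphere. -/
def spherePairing (D : C(S2, ℂ)) : C(S2, ℂ) →L[ℂ] ℂ :=
  LinearMap.mkContinuous
    { toFun := fun g => ∫ w, D w * g w ∂sigma
      map_add' := fun g h => by
        have hg : Integrable (fun w => D w * g w) sigma :=
          integrable_S2 (D.continuous.mul g.continuous)
        have hh : Integrable (fun w => D w * h w) sigma :=
          integrable_S2 (D.continuous.mul h.continuous)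
        rw [← integral_add hg hh]
        simp only [ContinuousMap.add_apply, mul_add]
      map_smul' := fun c g => by
        rw [RingHom.id_apply, smul_eq_mul, ← integral_const_mul]
        simp only [ContinuousMap.smul_apply, smul_eq_mul, mul_left_comm] }
    (∫ w, ‖D w‖ ∂sigma) (fun g => by
      rw [← integral_mul_const]
      refine norm_integral_le_of_norm_le ((integrable_S2 D.continuous).norm.mul_const _)
        (Eventually.of_forall fun w => ?_)
      rw [norm_mul]
      exact mul_le_mul_of_nonneg_left (g.norm_coe_le_norm w) (norm_nonneg _))

theorem spherePairing_apply (D g : C(S2, ℂ)) : spherePairing D g = ∫ w, D w * g w ∂sigma := rfl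

theorem spherePairing_comm (D g : C(S2, ℂ)) : spherePairing D g = spherePairing g D := by
  simp only [spherePairing_apply, mul_comm]

/-- The polynomial functions on the sphere. -/
def polyS2 : StarSubalgebra ℂ C(S2, ℂ) where
  carrier := range onSphere
  mul_mem' := by
    rintro _ _ ⟨p, rfl⟩ ⟨q, rfl⟩; exact ⟨p * q, by ext w; exact pev_mul p q w⟩
  add_mem' := by
    rintro _ _ ⟨p, rfl⟩ ⟨q, rfl⟩; exact ⟨p + q, by ext w; exact pev_add p q w⟩
  algebraMap_mem' := fun c => ⟨MvPolynomial.C c, by ext w; exact pev_C c w⟩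
  star_mem' := by
    rintro _ ⟨p, rfl⟩; exact ⟨conjPoly p, by ext w; exact pev_conjPoly p w⟩

/-- Stone–Weierstrass: the coordinate functions separate the points of the sphere. -/
theorem polyS2_dense : polyS2.topologicalClosure = ⊤ := by
  refine ContinuousMap.starSubalgebra_topologicalClosure_eq_top_of_separatesPoints _ ?_
  intro x y hxy
  obtain ⟨i, hi⟩ : ∃ i, (x : R3) i ≠ (y : R3) i := by
    by_contra! h
    exact hxy (Subtype.ext (by ext i; exact h i))
  refine ⟨_, ⟨onSphere (X i), ⟨X i, rfl⟩, rfl⟩, ?_⟩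
  change pev (X i) x ≠ pev (X i) y
  rw [pev_X, pev_X]
  exact fun h => hi (Complex.ofReal_injective h)

/-- Orthogonality to harmonic polynomials extends to all polynomials by the decomposition in powers
of |x|², which is 1 on the sphere, then to all continuous functions by density; the conjugate of D
is the decisive test. -/
theorem eq_zero_of_spherePairing {D : C(S2, ℂ)}
    (h : ∀ n, ∀ p ∈ harm n, spherePairing D (onSphere p) = 0) : D = 0 := by
  have h1 : ∀ p, spherePairing D (onSphere p) = 0 := by
    refine linear_eq_zero_of_harm
      { toFun := fun p => spherePairing D (onSphere p)
        map_add' := fun p q => by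
          rw [← map_add]; congr 1; ext w; exact pev_add p q w
        map_smul' := fun c p => by
          rw [RingHom.id_apply, ← map_smul]; congr 1; ext w; exact pev_smul c p w } ?_ h
    intro p q hpq
    have : onSphere p = onSphere q := by ext w; exact hpq w
    simp only [LinearMap.coe_mk, AddHom.coe_mk, this]
  have h2 : ∀ g, spherePairing D g = 0 := by
    intro g
    have hg : g ∈ polyS2.topologicalClosure := by rw [polyS2_dense]; trivial
    have hcl : IsClosed {g | spherePairing D g = 0} :=
      isClosed_singleton.preimage (spherePairing D).continuous
    exact closure_minimal (by rintro _ ⟨p, rfl⟩; exact h1 p) hcl hg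
  have h3 := h2 (star D)
  rw [spherePairing_apply] at h3
  have h4 : ∫ w, ‖D w‖ ^ 2 ∂sigma = 0 := by
    have : ∀ w, D w * (star D) w = ((‖D w‖ ^ 2 : ℝ) : ℂ) := fun w => by
      rw [ContinuousMap.star_apply, Complex.star_def, Complex.mul_conj, Complex.normSq_eq_norm_sq]
    simp only [this] at h3
    rw [integral_complex_ofReal] at h3
    exact_mod_cast h3
  have hc : Continuous fun w => ‖D w‖ ^ 2 := D.continuous.norm.pow 2
  rw [integral_eq_zero_iff_of_nonneg (fun w => by positivity)
    (hc.integrable_of_hasCompactSupport (HasCompactSupport.of_compactSpace _))] at h4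
  have h5 := Continuous.ae_eq_iff_eq sigma hc continuous_const |>.1 h4
  ext w
  have h6 : ‖D w‖ ^ 2 = 0 := congrFun h5 w
  exact norm_eq_zero.1 (pow_eq_zero_iff two_ne_zero |>.1 h6)

theorem eq_zero_of_supS {n : ℕ} {p : Poly} (hp : p.IsHomogeneous n) (h : supS p = 0) : p = 0 := by
  refine pev_injective fun x => ?_
  have := norm_pev_le hp x
  rw [h, mul_zero] at this
  rw [pev_zero]; exact norm_le_zero_iff.1 this

theorem supS_eq_zero_of_sqS {n : ℕ} {p : Poly} (hp : p ∈ harm n) (h : sqS p = 0) : supS p = 0 := by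
  have h1 := absS_sq_le p
  rw [h, mul_zero] at h1
  have h2 : absS p = 0 := by nlinarith [absS_nonneg p]
  have h3 := supS_le_absS hp
  rw [h2, mul_zero] at h3
  exact le_antisymm h3 (supS_nonneg p)

/-- Every linear functional on the harmonic polynomials is an integral over the sphere. -/
theorem exists_harm_pairing {n : ℕ} (L : harm n →ₗ[ℂ] ℂ) :
    ∃ P ∈ harm n, ∀ p : harm n, L p = spherePairing (onSphere P) (onSphere p) := by
  have hadd : ∀ p q : Poly, onSphere (p + q) = onSphere p + onSphere q := fun p q => by
    ext w; exact pev_add p q w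
  have hsmul : ∀ (c : ℂ) (p : Poly), onSphere (c • p) = c • onSphere p := fun c p => by
    ext w; exact pev_smul c p w
  let B : harm n →ₗ[ℂ] Module.Dual ℂ (harm n) :=
    LinearMap.mk₂ ℂ (fun p q => spherePairing (onSphere p) (onSphere q))
      (fun p p' q => by
        rw [spherePairing_comm, Submodule.coe_add, hadd, map_add, spherePairing_comm,
          spherePairing_comm (onSphere q)])
      (fun c p q => by
        rw [spherePairing_comm, Submodule.coe_smul, hsmul, map_smul, spherePairing_comm])
      (fun p q q' => by rw [Submodule.coe_add, hadd, map_add])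
      (fun c p q => by rw [Submodule.coe_smul, hsmul, map_smul])
  -- Pairing p with its conjugate polynomial, again harmonic, gives ∫ |p|². Nondegeneracy and finite
  -- dimension then make the pairing onto the dual space.
  have hB : Function.Injective B := by
    rw [← LinearMap.ker_eq_bot, LinearMap.ker_eq_bot']
    intro p hp
    have h1 : B p ⟨conjPoly p, conjPoly_mem_harm p.2⟩ = 0 := by rw [hp]; rfl
    have h2 : ((sqS p : ℝ) : ℂ) = 0 := by rw [ofReal_sqS]; exact h1
    have h3 : sqS p = 0 := by exact_mod_cast h2
    exact Subtype.ext (eq_zero_of_supS (mem_harm.1 p.2).1 (supS_eq_zero_of_sqS p.2 h3))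
  have hs := (LinearMap.injective_iff_surjective_of_finrank_eq_finrank
    (Subspace.dual_finrank_eq (K := ℂ) (V := harm n)).symm).1 hB
  obtain ⟨P, hP⟩ := hs L
  exact ⟨P, P.2, fun p => by rw [← hP]; rfl⟩

/-! ### Expansion of solutions of the Helmholtz equation -/

/-- A family of harmonic polynomials whose Helmholtz series converges geometrically on every
smaller ball. -/
def GeomBound (r : ℝ) (P : ℕ → Poly) : Prop :=
  (∀ n, P n ∈ harm n) ∧
    ∀ ρ, 0 < ρ → ρ < r → ∃ C, ∀ n, besselCoeff n 0 * supS (P n) * ρ ^ n ≤ C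

/-- The constant in `sphPair_eq` depends linearly on p, as is seen by evaluating at a single radius
ρ₀ where b_n does not vanish; a linear functional on the harmonic polynomials is represented by one
of them. -/
theorem exists_sphPair_coeff {κ r : ℝ} (hr : 0 < r) {f : R3 → ℂ} (hf : WeakHelmholtz κ r f)
    (n : ℕ) : ∃ P ∈ harm n, ∀ p ∈ harm n, ∀ ρ ∈ Ico 0 r, sphPair f p ρ =
      spherePairing (onSphere P) (onSphere p) * (ρ : ℂ) ^ n * (redBessel n (κ * ρ ^ 2) : ℝ) := by
  obtain ⟨ρ₀, h0, hr0, hb⟩ : ∃ ρ₀, 0 < ρ₀ ∧ ρ₀ < r ∧ redBessel n (κ * ρ₀ ^ 2) ≠ 0 := by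
    have hc : Continuous fun ρ : ℝ => redBessel n (κ * ρ ^ 2) :=
      (continuous_redBessel n).comp (by fun_prop)
    have h0 : redBessel n (κ * 0 ^ 2) ≠ 0 := by
      rw [show κ * 0 ^ 2 = 0 by ring, redBessel_zero]; exact (besselCoeff_pos n 0).ne'
    have hev : ∀ᶠ ρ in nhdsWithin 0 (Ioi 0), redBessel n (κ * ρ ^ 2) ≠ 0 :=
      nhdsWithin_le_nhds (hc.continuousAt.eventually_ne h0)
    obtain ⟨ρ₀, h1, h2⟩ := (hev.and (Ioo_mem_nhdsGT hr)).exists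
    exact ⟨ρ₀, h2.1, h2.2, h1⟩
  set c : ℂ := (ρ₀ : ℂ) ^ n * (redBessel n (κ * ρ₀ ^ 2) : ℝ) with hc
  have hc0 : c ≠ 0 :=
    mul_ne_zero (pow_ne_zero _ (Complex.ofReal_ne_zero.2 h0.ne')) (Complex.ofReal_ne_zero.2 hb)
  have hi : ∀ p, Integrable (fun w : S2 => f (ρ₀ • (w : R3)) * pev p w) sigma := fun p =>
    integrable_S2 ((continuous_on_sphere hf.1 (by rw [abs_of_pos h0]; exact hr0)).mul
      ((continuous_pev p).comp continuous_subtype_val))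
  let L : harm n →ₗ[ℂ] ℂ :=
    { toFun := fun p => sphPair f p ρ₀ / c
      map_add' := fun p q => by
        rw [← add_div, sphPair, sphPair, sphPair, ← integral_add (hi _) (hi _)]
        simp only [Submodule.coe_add, pev_add, mul_add]
      map_smul' := fun a p => by
        rw [RingHom.id_apply, smul_eq_mul, ← mul_div_assoc, sphPair, sphPair, ← integral_const_mul]
        simp only [Submodule.coe_smul, pev_smul, mul_left_comm] }
  obtain ⟨P, hP, hPL⟩ := exists_harm_pairing L
  refine ⟨P, hP, fun p hp ρ hρ => ?_⟩
  obtain ⟨A, hA⟩ := sphPair_eq hr hf hp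
  have h1 : spherePairing (onSphere P) (onSphere p) = A := by
    rw [← hPL ⟨p, hp⟩]
    change sphPair f p ρ₀ / c = A
    rw [hA ρ₀ ⟨h0.le, hr0⟩, mul_assoc, ← hc, mul_div_cancel_right₀ _ hc0]
  rw [hA ρ hρ, h1]

theorem tendsto_pow_mul_geom {q : ℝ} (h0 : 0 ≤ q) (h1 : q < 1) (k : ℕ) :
    Tendsto (fun n : ℕ => ((n : ℝ) + 1) ^ k * q ^ n) atTop (nhds 0) := by
  rcases h0.eq_or_lt with rfl | h0
  · refine tendsto_const_nhds.congr' ?_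
    filter_upwards [eventually_ge_atTop 1] with n hn
    rw [zero_pow (by omega), mul_zero]
  have h := (tendsto_pow_const_mul_const_pow_of_abs_lt_one k (r := q)
    (by rw [abs_of_pos h0]; exact h1))
  have h2 := ((tendsto_add_atTop_iff_nat 1).2 h).mul_const q⁻¹
  rw [zero_mul] at h2
  refine h2.congr fun n => ?_
  push_cast
  rw [pow_succ]
  field_simp

theorem exists_forall_le_of_eventually {u : ℕ → ℝ} {C : ℝ} (h : ∀ᶠ n in atTop, u n ≤ C) :
    ∃ C', ∀ n, u n ≤ C' := by
  obtain ⟨C', hC'⟩ := (isBoundedUnder_of_eventually_le h).bddAbove_range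
  exact ⟨C', fun n => hC' ⟨n, rfl⟩⟩

/-- Pairing f with the conjugate of P_n at a radius ρ' > ρ bounds b_n ρ'^n ∫|P_n|² by M ∫|P_n|, and
b_n is at least half of b_n(0) for large n. Cauchy–Schwarz and `supS_le_absS` turn this into a bound
for the supremum with a loss (n+1)³, which disappears in the step from ρ' to ρ. -/
theorem geomBound_of_sphPair {κ r : ℝ} {f : R3 → ℂ} (hf : ContinuousOn f (Metric.ball 0 r))
    {P : ℕ → Poly} (hP : ∀ n, P n ∈ harm n)
    (h : ∀ n, ∀ p ∈ harm n, ∀ ρ ∈ Ico 0 r, sphPair f p ρ =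
      spherePairing (onSphere (P n)) (onSphere p) * (ρ : ℂ) ^ n * (redBessel n (κ * ρ ^ 2) : ℝ)) :
    GeomBound r P := by
  refine ⟨hP, fun ρ hρ0 hρr => ?_⟩
  set ρ' := (ρ + r) / 2 with hρ'
  have h1 : ρ < ρ' := by rw [hρ']; linarith
  have h2 : ρ' < r := by rw [hρ']; linarith
  have h0 : 0 < ρ' := hρ0.trans h1
  obtain ⟨M, hM⟩ : ∃ M, ∀ w : S2, ‖f (ρ' • (w : R3))‖ ≤ M := by
    have hc := continuous_on_sphere hf (by rw [abs_of_pos h0]; exact h2 : |ρ'| < r)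
    obtain ⟨M, hM⟩ := isCompact_univ.exists_bound_of_continuousOn hc.continuousOn
    exact ⟨M, fun w => hM w (mem_univ w)⟩
  set s := (sigma : Measure S2).real univ with hs
  have hs0 : 0 ≤ s := measureReal_nonneg
  set K := Real.exp 3 / bumpMass with hK
  have hK0 : 0 ≤ K := by have := bumpMass_pos; positivity
  have hM0 : 0 ≤ M := (norm_nonneg _).trans (hM ⟨EuclideanSpace.single 0 1, by simp⟩)
  have key : ∀ᶠ n : ℕ in atTop,
      besselCoeff n 0 * supS (P n) * ρ' ^ n ≤ 2 * s * M * K * ((n : ℝ) + 1) ^ 3 := by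
    filter_upwards [eventually_redBessel_ge (|κ| * ρ' ^ 2)] with n hn
    have hb := hn (κ * ρ' ^ 2) (by rw [abs_mul, abs_of_nonneg (sq_nonneg ρ')])
    have hb0 := besselCoeff_pos n 0
    have e1 := h n (conjPoly (P n)) (conjPoly_mem_harm (hP n)) ρ' ⟨h0.le, h2⟩
    have e2 : spherePairing (onSphere (P n)) (onSphere (conjPoly (P n))) = ((sqS (P n) : ℝ) : ℂ) := by
      rw [ofReal_sqS]; rfl
    have e3 : ‖sphPair f (conjPoly (P n)) ρ'‖ ≤ M * absS (P n) := by
      rw [sphPair, absS, ← integral_const_mul]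
      refine norm_integral_le_of_norm_le (((integrable_S2
        ((continuous_pev (P n)).comp continuous_subtype_val)).norm).const_mul M)
        (Eventually.of_forall fun w => ?_)
      rw [norm_mul, pev_conjPoly, RCLike.norm_conj]
      exact mul_le_mul_of_nonneg_right (hM w) (norm_nonneg _)
    rw [e1, e2, norm_mul, norm_mul, norm_pow, Complex.norm_real, Complex.norm_real, Complex.norm_real,
      Real.norm_of_nonneg (sqS_nonneg _), Real.norm_of_nonneg h0.le, Real.norm_of_nonneg (by linarith)]
      at e3
    have hp := pow_pos h0 n
    have e4 : absS (P n) * (besselCoeff n 0 * ρ' ^ n * absS (P n)) ≤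
        absS (P n) * (2 * s * M) := by
      have a1 := absS_sq_le (P n)
      calc absS (P n) * (besselCoeff n 0 * ρ' ^ n * absS (P n))
          = absS (P n) ^ 2 * (besselCoeff n 0 * ρ' ^ n) := by ring
        _ ≤ s * sqS (P n) * (besselCoeff n 0 * ρ' ^ n) := by gcongr
        _ ≤ s * sqS (P n) * ((2 * redBessel n (κ * ρ' ^ 2)) * ρ' ^ n) := by
            have := sqS_nonneg (P n)
            gcongr; linarith
        _ = 2 * s * (sqS (P n) * ρ' ^ n * redBessel n (κ * ρ' ^ 2)) := by ring
        _ ≤ 2 * s * (M * absS (P n)) := by gcongr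
        _ = _ := by ring
    have e5 : besselCoeff n 0 * ρ' ^ n * absS (P n) ≤ 2 * s * M := by
      rcases (absS_nonneg (P n)).eq_or_lt with hz | hz
      · rw [← hz]; simp; positivity
      · exact le_of_mul_le_mul_left e4 hz
    calc besselCoeff n 0 * supS (P n) * ρ' ^ n
        ≤ besselCoeff n 0 * (K * (n + 1) ^ 3 * absS (P n)) * ρ' ^ n := by
          have := supS_le_absS (hP n)
          gcongr
      _ = (besselCoeff n 0 * ρ' ^ n * absS (P n)) * (K * (n + 1) ^ 3) := by ring
      _ ≤ 2 * s * M * (K * (n + 1) ^ 3) := by gcongr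
      _ = _ := by ring
  have hq0 : 0 ≤ ρ / ρ' := by positivity
  have hq1 : ρ / ρ' < 1 := by rwa [div_lt_one h0]
  have hlim := tendsto_pow_mul_geom hq0 hq1 3
  apply exists_forall_le_of_eventually (C := 2 * s * M * K)
  filter_upwards [key, hlim.eventually (eventually_le_nhds one_pos)] with n hn hn'
  have e : ρ ^ n = ρ' ^ n * (ρ / ρ') ^ n := by
    rw [← mul_pow, mul_div_cancel₀ _ h0.ne']
  rw [e, ← mul_assoc]
  calc besselCoeff n 0 * supS (P n) * ρ' ^ n * (ρ / ρ') ^ n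
      ≤ 2 * s * M * K * ((n : ℝ) + 1) ^ 3 * (ρ / ρ') ^ n := by gcongr
    _ = 2 * s * M * K * (((n : ℝ) + 1) ^ 3 * (ρ / ρ') ^ n) := by ring
    _ ≤ 2 * s * M * K * 1 := by gcongr
    _ = _ := mul_one _

theorem norm_radTerm_le {κ R : ℝ} (n m : ℕ) {q : Poly} (hq : q.IsHomogeneous m) {x : R3}
    (hx : ‖x‖ ≤ R) :
    ‖radTerm κ n q x‖ ≤ besselCoeff n 0 * Real.exp (|κ| * R ^ 2) * (‖x‖ ^ m * supS q) := by
  rw [radTerm, norm_mul, Complex.norm_real]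
  have h : |κ * ‖x‖ ^ 2| ≤ |κ| * R ^ 2 := by
    rw [abs_mul, abs_of_nonneg (sq_nonneg ‖x‖)]; gcongr
  exact mul_le_mul (abs_redBessel_le n h) (norm_pev_le hq x) (norm_nonneg _)
    (mul_nonneg (besselCoeff_pos n 0).le (Real.exp_pos _).le)

theorem norm_radTerm_harm_le {κ ρ s C : ℝ} (hs : 0 < s) (n : ℕ) {p : Poly}
    (hp : p.IsHomogeneous n) (hC : besselCoeff n 0 * supS p * s ^ n ≤ C) {x : R3} (hx : ‖x‖ ≤ ρ) :
    ‖radTerm κ n p x‖ ≤ Real.exp (|κ| * ρ ^ 2) * C * (ρ / s) ^ n := by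
  refine (norm_radTerm_le n n hp hx).trans ?_
  have h1 := besselCoeff_pos n 0
  have h2 := supS_nonneg p
  have e : ρ ^ n = s ^ n * (ρ / s) ^ n := by rw [← mul_pow, mul_div_cancel₀ _ hs.ne']
  have hρ : 0 ≤ ρ := (norm_nonneg x).trans hx
  calc besselCoeff n 0 * Real.exp (|κ| * ρ ^ 2) * (‖x‖ ^ n * supS p)
      ≤ besselCoeff n 0 * Real.exp (|κ| * ρ ^ 2) * (ρ ^ n * supS p) := by gcongr
    _ = Real.exp (|κ| * ρ ^ 2) * (besselCoeff n 0 * supS p * s ^ n) * (ρ / s) ^ n := by rw [e]; ring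
    _ ≤ _ := by gcongr

/-- On each sphere the series converges uniformly by comparison with a geometric one. By
orthogonality its sum has the same pairings with harmonic polynomials as f, and completeness
identifies the two. -/
theorem helmholtz_expansion {κ r : ℝ} (hr : 0 < r) {f : R3 → ℂ} (hf : WeakHelmholtz κ r f) :
    ∃ P : ℕ → Poly, GeomBound r P ∧
      ∀ x ∈ Metric.ball (0 : R3) r, HasSum (fun n => radTerm κ n (P n) x) (f x) := by
  choose P hP h using exists_sphPair_coeff hr hf
  have hG := geomBound_of_sphPair hf.1 hP h
  refine ⟨P, hG, ?_⟩
  have main : ∀ ρ, 0 ≤ ρ → ρ < r → ∀ w : S2,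
      HasSum (fun n => radTerm κ n (P n) (ρ • (w : R3))) (f (ρ • (w : R3))) := by
    intro ρ hρ0 hρr
    set s := (ρ + r) / 2 with hs
    have hs0 : 0 < s := by rw [hs]; linarith
    have hsr : s < r := by rw [hs]; linarith
    have hρs : ρ < s := by rw [hs]; linarith
    obtain ⟨C, hC⟩ := hG.2 s hs0 hsr
    let T : ℕ → C(S2, ℂ) := fun n => ⟨fun w => radTerm κ n (P n) (ρ • (w : R3)),
      (differentiable_radTerm κ n (P n)).continuous.comp (by fun_prop)⟩
    have hb : ∀ n, ‖T n‖ ≤ Real.exp (|κ| * ρ ^ 2) * C * (ρ / s) ^ n := by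
      intro n
      have hx : ∀ w : S2, ‖ρ • (w : R3)‖ ≤ ρ := fun w => by rw [norm_smul_S2, abs_of_nonneg hρ0]
      refine (ContinuousMap.norm_le _ ((norm_nonneg _).trans (norm_radTerm_harm_le hs0 n
        (mem_harm.1 (hP n)).1 (hC n) (hx ⟨EuclideanSpace.single 0 1, by simp⟩)))).2 fun w => ?_
      exact norm_radTerm_harm_le hs0 n (mem_harm.1 (hP n)).1 (hC n) (hx w)
    have hsum : Summable T := Summable.of_norm_bounded
      ((summable_geometric_of_lt_one (by positivity) (by rwa [div_lt_one hs0])).mul_left _) hb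
    let F : C(S2, ℂ) := ⟨fun w => f (ρ • (w : R3)),
      continuous_on_sphere hf.1 (by rw [abs_of_nonneg hρ0]; exact hρr)⟩
    have hD : F - ∑' n, T n = 0 := by
      refine eq_zero_of_spherePairing fun m p hp => ?_
      rw [spherePairing_comm, map_sub, (spherePairing (onSphere p)).map_tsum hsum]
      have e1 : ∀ n, spherePairing (onSphere p) (T n) =
          (ρ : ℂ) ^ n * (redBessel n (κ * ρ ^ 2) : ℝ) *
            spherePairing (onSphere (P n)) (onSphere p) := by
        intro n
        rw [spherePairing_comm, spherePairing_apply, spherePairing_apply, ← integral_const_mul]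
        refine integral_congr_ae (Eventually.of_forall fun w => ?_)
        change radTerm κ n (P n) (ρ • (w : R3)) * _ = _ * (pev (P n) w * _)
        rw [radTerm, norm_smul_S2, pev_homog (mem_harm.1 (hP n)).1, sq_abs]
        ring
      rw [tsum_eq_single m fun n hn => by
        rw [e1, spherePairing_apply]
        have := harm_orthogonal hn (hP n) hp
        rw [show ∫ w, onSphere (P n) w * onSphere p w ∂sigma = 0 from this, mul_zero], e1,
        spherePairing_comm]
      have := h m p hp ρ ⟨hρ0, hρr⟩
      rw [show spherePairing F (onSphere p) = sphPair f p ρ from rfl, this]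
      ring
    intro w
    have h1 : HasSum T F := by rw [sub_eq_zero.1 hD]; exact hsum.hasSum
    exact h1.mapL (ContinuousMap.evalCLM ℂ w)
  intro x hx
  rw [mem_ball_zero_iff] at hx
  rcases eq_or_ne x 0 with rfl | hx0
  · have := main 0 le_rfl hr ⟨EuclideanSpace.single 0 1, by simp⟩
    simpa only [zero_smul] using this
  · have hx' : ‖x‖ ≠ 0 := norm_ne_zero_iff.2 hx0
    have := main ‖x‖ (norm_nonneg x) hx ⟨‖x‖⁻¹ • x, by simp [norm_smul, hx']⟩
    simpa only [smul_smul, mul_inv_cancel₀ hx', one_smul] using this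

end MaxwellCorner
end

noncomputable section
namespace MaxwellCorner

open MvPolynomial (X pderiv)
open MeasureTheory Set Filter

/-! ### Families of polynomials with convergent Bessel series -/

/-- The series of `besselCoeff n 0 * q n` converges normally on all smaller balls. -/
def Geo (r : ℝ) (q : ℕ → Poly) : Prop :=
  ∀ ρ, 0 < ρ → ρ < r → ∃ u : ℕ → ℝ, Summable u ∧
    ∀ n x, ‖x‖ ≤ ρ → besselCoeff n 0 * ‖pev (q n) x‖ ≤ u n

theorem Geo.add {r : ℝ} {p q : ℕ → Poly} (hp : Geo r p) (hq : Geo r q) :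
    Geo r fun n => p n + q n := by
  intro ρ h0 h1
  obtain ⟨u, hu, hu'⟩ := hp ρ h0 h1
  obtain ⟨v, hv, hv'⟩ := hq ρ h0 h1
  refine ⟨fun n => u n + v n, hu.add hv, fun n x hx => ?_⟩
  have hb := (besselCoeff_pos n 0).le
  rw [pev_add]
  calc _ ≤ besselCoeff n 0 * (‖pev (p n) x‖ + ‖pev (q n) x‖) := by gcongr; exact norm_add_le _ _
    _ ≤ _ := by rw [mul_add]; exact add_le_add (hu' n x hx) (hv' n x hx)

theorem Geo.mul_left {r : ℝ} {q : ℕ → Poly} (hq : Geo r q) (p : Poly) :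
    Geo r fun n => p * q n := by
  intro ρ h0 h1
  obtain ⟨u, hu, hu'⟩ := hq ρ h0 h1
  obtain ⟨M, hM⟩ := (isCompact_closedBall (0 : R3) ρ).exists_bound_of_continuousOn
    (continuous_pev p).continuousOn
  refine ⟨fun n => M * u n, hu.mul_left M, fun n x hx => ?_⟩
  have hMx := hM x (by simpa using hx)
  have hb := (besselCoeff_pos n 0).le
  rw [pev_mul, norm_mul]
  calc besselCoeff n 0 * (‖pev p x‖ * ‖pev (q n) x‖)
      = ‖pev p x‖ * (besselCoeff n 0 * ‖pev (q n) x‖) := by ring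
    _ ≤ M * u n := mul_le_mul hMx (hu' n x hx) (by positivity) ((norm_nonneg _).trans hMx)

theorem Geo.sub {r : ℝ} {p q : ℕ → Poly} (hp : Geo r p) (hq : Geo r q) :
    Geo r fun n => p n - q n := by
  have := hp.add (hq.mul_left (MvPolynomial.C (-1)))
  simpa [sub_eq_add_neg] using this

/-- A factor polynomial in n and a loss of d degrees are both absorbed by comparing ρ with the
midpoint s of ρ and r. -/
theorem geo_of_supS {r : ℝ} {P Q : ℕ → Poly} (hP : GeomBound r P) {d k : ℕ} {K : ℝ} (hK : 0 ≤ K)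
    (hd : ∀ n, (Q n).IsHomogeneous (n - d))
    (hs : ∀ n, supS (Q n) ≤ K * ((n : ℝ) + 1) ^ k * supS (P n)) : Geo r Q := by
  intro ρ h0 h1
  set s := (ρ + r) / 2 with hs'
  have h2 : ρ < s := by rw [hs']; linarith
  have h3 : s < r := by rw [hs']; linarith
  have hs0 : 0 < s := h0.trans h2
  obtain ⟨C, hC⟩ := hP.2 s hs0 h3
  -- D compensates ρ^(-d) if ρ < 1 and also covers n < d, where the truncated difference n - d is 0.
  set D := max 1 ρ⁻¹ ^ d with hD
  have hD1 : ∀ n : ℕ, ρ ^ (n - d) ≤ D * ρ ^ n := by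
    intro n
    rcases le_or_gt d n with h | h
    · have e : ρ ^ n = ρ ^ (n - d) * ρ ^ d := by rw [← pow_add]; congr 1; omega
      rw [e, hD]
      have : 1 ≤ max 1 ρ⁻¹ ^ d * ρ ^ d := by
        rw [← mul_pow]
        refine one_le_pow₀ ?_
        rw [max_mul_of_nonneg _ _ h0.le, inv_mul_cancel₀ h0.ne']
        exact le_max_right _ _
      nlinarith [pow_pos h0 (n - d)]
    · have e : n - d = 0 := by omega
      rw [e, pow_zero, hD]
      have h4 : max 1 ρ⁻¹ ^ n ≤ max 1 ρ⁻¹ ^ d := pow_le_pow_right₀ (le_max_left _ _) h.le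
      have h5 : 1 ≤ max 1 ρ⁻¹ ^ n * ρ ^ n := by
        rw [← mul_pow]
        refine one_le_pow₀ ?_
        rw [max_mul_of_nonneg _ _ h0.le, inv_mul_cancel₀ h0.ne']
        exact le_max_right _ _
      exact h5.trans (mul_le_mul_of_nonneg_right h4 (pow_pos h0 n).le)
  have hq0 : 0 ≤ ρ / s := by positivity
  have hq1 : ρ / s < 1 := by rwa [div_lt_one hs0]
  refine ⟨fun n => D * K * C * (((n : ℝ) + 1) ^ k * (ρ / s) ^ n), ?_, fun n x hx => ?_⟩
  · have h := summable_pow_mul_geometric_of_norm_lt_one k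
      (by rw [Real.norm_of_nonneg hq0]; exact hq1 : ‖ρ / s‖ < 1)
    have h' := ((summable_nat_add_iff 1).2 h).mul_left (ρ / s)⁻¹
    refine (h'.congr fun n => ?_).mul_left _
    have : ρ / s ≠ 0 := (div_pos h0 hs0).ne'
    push_cast
    rw [pow_succ]
    field_simp
  · have hb := (besselCoeff_pos n 0).le
    have hsP := supS_nonneg (P n)
    have e : ρ ^ n = s ^ n * (ρ / s) ^ n := by rw [← mul_pow, mul_div_cancel₀ _ hs0.ne']
    have hD0 : 0 ≤ D := by positivity
    calc besselCoeff n 0 * ‖pev (Q n) x‖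
        ≤ besselCoeff n 0 * (‖x‖ ^ (n - d) * supS (Q n)) := by gcongr; exact norm_pev_le (hd n) x
      _ ≤ besselCoeff n 0 * ((D * ρ ^ n) * (K * ((n : ℝ) + 1) ^ k * supS (P n))) := by
          have a1 : ‖x‖ ^ (n - d) ≤ D * ρ ^ n :=
            (pow_le_pow_left₀ (norm_nonneg x) hx _).trans (hD1 n)
          have := supS_nonneg (Q n)
          gcongr
          exact hs n
      _ = D * K * (besselCoeff n 0 * supS (P n) * s ^ n) * (((n : ℝ) + 1) ^ k * (ρ / s) ^ n) := by
          rw [e]; ring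
      _ ≤ D * K * C * (((n : ℝ) + 1) ^ k * (ρ / s) ^ n) := by
          gcongr; exact hC n

theorem supS_smul (c : ℂ) (p : Poly) : supS (c • p) ≤ ‖c‖ * supS p :=
  supS_le (mul_nonneg (norm_nonneg _) (supS_nonneg _)) fun w => by
    rw [pev_smul, norm_mul]
    exact mul_le_mul_of_nonneg_left (norm_pev_le_supS p w) (norm_nonneg _)

theorem supS_pderiv_pderiv_le {n : ℕ} {p : Poly} (hp : p ∈ harm n) (i j : Fin 3) :
    supS (pderiv i (pderiv j p)) ≤ bernstein ^ 2 * ((n : ℝ) + 1) ^ 2 * supS p := by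
  have hb := bernstein_nonneg
  have h := supS_nonneg p
  have h' := supS_nonneg (pderiv j p)
  have h1 : ((n - 1 : ℕ) : ℝ) ≤ n := by exact_mod_cast Nat.sub_le n 1
  calc _ ≤ bernstein * ((n - 1 : ℕ) + 1) * supS (pderiv j p) :=
        supS_pderiv_le (pderiv_mem_harm hp j) i
    _ ≤ bernstein * (n + 1) * (bernstein * (n + 1) * supS p) := by
        gcongr
        exact supS_pderiv_le hp j
    _ = _ := by ring

/-- A family is good when it and its derivatives have normally convergent Bessel series. -/
def GeoD (r : ℝ) (q : ℕ → Poly) : Prop := Geo r q ∧ ∀ k, Geo r fun n => pderiv k (q n)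

theorem GeoD.sub {r : ℝ} {p q : ℕ → Poly} (hp : GeoD r p) (hq : GeoD r q) :
    GeoD r fun n => p n - q n :=
  ⟨hp.1.sub hq.1, fun k => by simpa only [map_sub] using (hp.2 k).sub (hq.2 k)⟩

theorem GeoD.mul_left {r : ℝ} {q : ℕ → Poly} (hq : GeoD r q) (p : Poly) :
    GeoD r fun n => p * q n :=
  ⟨hq.1.mul_left p, fun k => by
    simpa only [MvPolynomial.pderiv_mul] using (hq.1.mul_left _).add ((hq.2 k).mul_left p)⟩

theorem norm_natCast_add_one (n : ℕ) : ‖((n : ℂ) + 1)‖ = (n : ℝ) + 1 := by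
  have : ((n : ℂ) + 1) = ((n + 1 : ℕ) : ℂ) := by push_cast; ring
  rw [this, Complex.norm_natCast]; push_cast; ring

theorem geoD_smul_pderiv {r : ℝ} {P : ℕ → Poly} (hP : GeomBound r P) (c : ℕ → ℂ)
    (hc : ∀ n, ‖c n‖ ≤ n + 1) (i : Fin 3) : GeoD r fun n => c n • pderiv i (P n) := by
  have hb := bernstein_nonneg
  refine ⟨geo_of_supS hP (d := 1) (k := 2) hb (fun n => ?_) fun n => ?_, fun k =>
    geo_of_supS hP (d := 2) (k := 3) (sq_nonneg bernstein) (fun n => ?_) fun n => ?_⟩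
  · rw [MvPolynomial.smul_eq_C_mul]
    exact (isHomogeneous_pderiv (mem_harm.1 (hP.1 n)).1 i).C_mul _
  · have h := supS_nonneg (P n)
    calc _ ≤ ‖c n‖ * supS (pderiv i (P n)) := supS_smul _ _
      _ ≤ (n + 1) * (bernstein * (n + 1) * supS (P n)) := by
          have := supS_nonneg (pderiv i (P n))
          gcongr
          · exact hc n
          · exact supS_pderiv_le (hP.1 n) i
      _ = _ := by ring
  · rw [Derivation.map_smul, MvPolynomial.smul_eq_C_mul]
    have := isHomogeneous_pderiv (isHomogeneous_pderiv (mem_harm.1 (hP.1 n)).1 i) k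
    exact (show n - 1 - 1 = n - 2 by omega) ▸ this.C_mul _
  · have h := supS_nonneg (P n)
    rw [Derivation.map_smul]
    calc _ ≤ ‖c n‖ * supS (pderiv k (pderiv i (P n))) := supS_smul _ _
      _ ≤ (n + 1) * (bernstein ^ 2 * (n + 1) ^ 2 * supS (P n)) := by
          have := supS_nonneg (pderiv k (pderiv i (P n)))
          gcongr
          · exact hc n
          · exact supS_pderiv_pderiv_le (hP.1 n) k i
      _ = _ := by ring

theorem geoD_pderiv {r : ℝ} {P : ℕ → Poly} (hP : GeomBound r P) (i : Fin 3) :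
    GeoD r fun n => pderiv i (P n) := by
  simpa using geoD_smul_pderiv hP (fun _ => 1) (fun n => by simp) i

theorem geoD_smul {r : ℝ} {P : ℕ → Poly} (hP : GeomBound r P) (c : ℕ → ℂ)
    (hc : ∀ n, ‖c n‖ ≤ n + 1) : GeoD r fun n => c n • P n := by
  refine ⟨geo_of_supS hP (d := 0) (k := 1) zero_le_one (fun n => ?_) fun n => ?_, fun k => ?_⟩
  · rw [MvPolynomial.smul_eq_C_mul]
    exact (mem_harm.1 (hP.1 n)).1.C_mul _
  · rw [one_mul, pow_one]
    exact (supS_smul _ _).trans (mul_le_mul_of_nonneg_right (hc n) (supS_nonneg _))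
  · simpa only [Derivation.map_smul] using (geoD_smul_pderiv hP c hc k).1

theorem geoD_rotPoly {r : ℝ} {P : ℕ → Poly} (hP : GeomBound r P) (i : Fin 3) :
    GeoD r fun n => rotPoly (P n) i := by
  have h : ∀ a b : Fin 3, GeoD r fun n => pderiv a (P n) * X b := fun a b => by
    simpa only [mul_comm] using (geoD_pderiv hP a).mul_left (X b)
  fin_cases i
  · exact (h 1 2).sub (h 2 1)
  · exact (h 2 0).sub (h 0 2)
  · exact (h 0 1).sub (h 1 0)

theorem geoD_gradPart {r : ℝ} {P : ℕ → Poly} (hP : GeomBound r P) (i : Fin 3) :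
    GeoD r fun n => gradPart n (P n) i :=
  geoD_smul_pderiv hP (fun n => (n : ℂ) + 1) (fun n => (norm_natCast_add_one n).le) i

theorem geoD_radialPart {r : ℝ} {P : ℕ → Poly} (hP : GeomBound r P) (i : Fin 3) :
    GeoD r fun n => radialPart n (P n) i := by
  have h := ((geoD_smul hP (fun n => (n : ℂ)) (fun n => by simp)).mul_left (X i)).sub
    ((geoD_pderiv hP i).mul_left nsq)
  simpa only [radialPart, mul_smul_comm] using h

/-! ### Termwise differentiation -/

/-- Families of functions whose sum may be differentiated term by term in a ball. -/
def SmoothFam (r : ℝ) (V : ℕ → R3 → ℂ) : Prop :=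
  (∀ n, Differentiable ℝ (V n)) ∧ ∀ ρ, 0 < ρ → ρ < r → ∃ u : ℕ → ℝ, Summable u ∧
    ∀ n x, ‖x‖ ≤ ρ → ‖V n x‖ ≤ u n ∧ ∀ i, ‖partialDeriv i (V n) x‖ ≤ u n

theorem SmoothFam.add {r : ℝ} {V W : ℕ → R3 → ℂ} (hV : SmoothFam r V) (hW : SmoothFam r W) :
    SmoothFam r fun n x => V n x + W n x := by
  refine ⟨fun n => (hV.1 n).fun_add (hW.1 n), fun ρ h0 h1 => ?_⟩
  obtain ⟨u, hu, hu'⟩ := hV.2 ρ h0 h1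
  obtain ⟨v, hv, hv'⟩ := hW.2 ρ h0 h1
  refine ⟨fun n => u n + v n, hu.add hv, fun n x hx => ⟨?_, fun i => ?_⟩⟩
  · exact (norm_add_le _ _).trans (add_le_add (hu' n x hx).1 (hv' n x hx).1)
  · rw [partialDeriv_add (hV.1 n x) (hW.1 n x)]
    exact (norm_add_le _ _).trans (add_le_add ((hu' n x hx).2 i) ((hv' n x hx).2 i))

theorem SmoothFam.const_mul {r : ℝ} {V : ℕ → R3 → ℂ} (hV : SmoothFam r V) (c : ℂ) :
    SmoothFam r fun n x => c * V n x := by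
  refine ⟨fun n => (hV.1 n).const_mul c, fun ρ h0 h1 => ?_⟩
  obtain ⟨u, hu, hu'⟩ := hV.2 ρ h0 h1
  refine ⟨fun n => ‖c‖ * u n, hu.mul_left _, fun n x hx => ⟨?_, fun i => ?_⟩⟩
  · rw [norm_mul]; exact mul_le_mul_of_nonneg_left (hu' n x hx).1 (norm_nonneg _)
  · rw [partialDeriv_const_mul (hV.1 n x), norm_mul]
    exact mul_le_mul_of_nonneg_left ((hu' n x hx).2 i) (norm_nonneg _)

theorem norm_fderiv_le (f : R3 → ℂ) (x : R3) :
    ‖fderiv ℝ f x‖ ≤ ∑ i, ‖partialDeriv i f x‖ := by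
  refine ContinuousLinearMap.opNorm_le_bound _ (Finset.sum_nonneg fun _ _ => norm_nonneg _)
    fun v => ?_
  have hv : v = ∑ i, v i • EuclideanSpace.single i (1 : ℝ) := by
    ext j; simp [Fin.sum_univ_three]; fin_cases j <;> simp
  conv_lhs => rw [hv]
  rw [map_sum, Finset.sum_mul]
  refine norm_sum_le_of_le _ fun i _ => ?_
  rw [map_smul, norm_smul, mul_comm]
  exact mul_le_mul_of_nonneg_left (PiLp.norm_apply_le v i) (norm_nonneg _)

theorem SmoothFam.summable {r : ℝ} {V : ℕ → R3 → ℂ} (hV : SmoothFam r V) {x : R3} (hx : ‖x‖ < r) :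
    Summable fun n => V n x := by
  obtain ⟨u, hu, hu'⟩ := hV.2 ((‖x‖ + r) / 2) (by linarith [norm_nonneg x]) (by linarith)
  exact Summable.of_norm_bounded hu fun n => (hu' n x (by linarith)).1

theorem SmoothFam.hasSum_partialDeriv {r : ℝ} {V : ℕ → R3 → ℂ} (hV : SmoothFam r V) {x : R3}
    (hx : ‖x‖ < r) : DifferentiableAt ℝ (fun y => ∑' n, V n y) x ∧
      ∀ i, HasSum (fun n => partialDeriv i (V n) x) (partialDeriv i (fun y => ∑' n, V n y) x) := by
  set ρ := (‖x‖ + r) / 2 with hρ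
  have h0 : 0 < ρ := by rw [hρ]; linarith [norm_nonneg x]
  have hxρ : ‖x‖ < ρ := by rw [hρ]; linarith
  obtain ⟨u, hu, hu'⟩ := hV.2 ρ h0 (by rw [hρ]; linarith)
  have hb : ∀ n, ∀ y ∈ Metric.ball (0 : R3) ρ, ‖fderiv ℝ (V n) y‖ ≤ 3 * u n := by
    intro n y hy
    refine (norm_fderiv_le _ _).trans ?_
    have := fun i => (hu' n y (mem_ball_zero_iff.1 hy).le).2 i
    rw [Fin.sum_univ_three]
    linarith [this 0, this 1, this 2]
  have hxm : x ∈ Metric.ball (0 : R3) ρ := mem_ball_zero_iff.2 hxρ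
  have h := hasFDerivAt_tsum_of_isPreconnected (hu.mul_left 3) Metric.isOpen_ball
    (convex_ball (0 : R3) ρ).isPreconnected (fun n y _ => (hV.1 n y).hasFDerivAt) hb hxm
    (hV.summable hx) hxm
  have hsum : Summable fun n => fderiv ℝ (V n) x :=
    Summable.of_norm_bounded (hu.mul_left 3) fun n => hb n x hxm
  refine ⟨h.differentiableAt, fun i => ?_⟩
  rw [partialDeriv_eq h]
  exact hsum.hasSum.mapL (ContinuousLinearMap.apply ℝ ℂ (EuclideanSpace.single i (1 : ℝ)))

theorem besselCoeff_add_zero_le (n s : ℕ) : besselCoeff (n + s) 0 ≤ besselCoeff n 0 := by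
  induction s with
  | zero => exact le_rfl
  | succ s ih => exact (besselCoeff_succ_zero_le (n + s)).trans ih

theorem norm_radTerm_le_pev {κ R : ℝ} (n s : ℕ) (q : Poly) {x : R3} (hx : ‖x‖ ≤ R) :
    ‖radTerm κ (n + s) q x‖ ≤ Real.exp (|κ| * R ^ 2) * (besselCoeff n 0 * ‖pev q x‖) := by
  rw [radTerm, norm_mul, Complex.norm_real]
  have h : |κ * ‖x‖ ^ 2| ≤ |κ| * R ^ 2 := by
    rw [abs_mul, abs_of_nonneg (sq_nonneg ‖x‖)]; gcongr
  have h1 : ‖redBessel (n + s) (κ * ‖x‖ ^ 2)‖ ≤ besselCoeff n 0 * Real.exp (|κ| * R ^ 2) :=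
    (abs_redBessel_le (n + s) h).trans
      (mul_le_mul_of_nonneg_right (besselCoeff_add_zero_le n s) (Real.exp_pos _).le)
  calc _ ≤ besselCoeff n 0 * Real.exp (|κ| * R ^ 2) * ‖pev q x‖ := by gcongr
    _ = _ := by ring

/-- A derivative of b_{n+s} q_n produces b_{n+s} ∂_i q_n and κ b_{n+s+1} x_i q_n. Both are
controlled because increasing the order only decreases the bound c_{n,0} of the Bessel factor. -/
theorem smoothFam_radTerm {r : ℝ} (κ : ℝ) (s : ℕ) {q : ℕ → Poly} (hq : GeoD r q) :
    SmoothFam r fun n x => radTerm κ (n + s) (q n) x := by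
  refine ⟨fun n => differentiable_radTerm κ (n + s) (q n), fun ρ h0 h1 => ?_⟩
  obtain ⟨u, hu, hu'⟩ := hq.1 ρ h0 h1
  choose v hv hv' using fun k => hq.2 k ρ h0 h1
  choose w hw hw' using fun k => (hq.1.mul_left (X k)) ρ h0 h1
  have hu0 : ∀ n, 0 ≤ u n := fun n =>
    (mul_nonneg (besselCoeff_pos n 0).le (norm_nonneg _)).trans (hu' n 0 (by simp [h0.le]))
  have hv0 : ∀ k n, 0 ≤ v k n := fun k n =>
    (mul_nonneg (besselCoeff_pos n 0).le (norm_nonneg _)).trans (hv' k n 0 (by simp [h0.le]))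
  have hw0 : ∀ k n, 0 ≤ w k n := fun k n =>
    (mul_nonneg (besselCoeff_pos n 0).le (norm_nonneg _)).trans (hw' k n 0 (by simp [h0.le]))
  set e := Real.exp (|κ| * ρ ^ 2) with he
  have he0 : 0 < e := Real.exp_pos _
  refine ⟨fun n => e * u n + ∑ k, (e * v k n + |κ| * (e * w k n)), ?_, fun n x hx => ⟨?_, fun i => ?_⟩⟩
  · exact (hu.mul_left e).add (summable_sum fun k _ =>
      ((hv k).mul_left e).add (((hw k).mul_left e).mul_left _))
  · refine (norm_radTerm_le_pev n s (q n) hx).trans ?_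
    have h2 : 0 ≤ ∑ k, (e * v k n + |κ| * (e * w k n)) := Finset.sum_nonneg fun k _ => by
      have := hv0 k n; have := hw0 k n; positivity
    have h3 := mul_le_mul_of_nonneg_left (hu' n x hx) he0.le
    linarith
  · have a1 : partialDeriv i (fun x => radTerm κ (n + s) (q n) x) x = _ :=
      partialDeriv_radTerm κ (n + s) (q n) i x
    rw [a1]
    have a2 := norm_radTerm_le_pev (κ := κ) n s (pderiv i (q n)) hx
    have a3 := norm_radTerm_le_pev (κ := κ) n (s + 1) (X i * q n) hx
    have a4 := mul_le_mul_of_nonneg_left (hv' i n x hx) he0.le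
    have a5 := mul_le_mul_of_nonneg_left (hw' i n x hx) he0.le
    have a6 : e * v i n + |κ| * (e * w i n) ≤ ∑ k, (e * v k n + |κ| * (e * w k n)) :=
      Finset.single_le_sum (f := fun k => e * v k n + |κ| * (e * w k n)) (fun k _ => by
        have := hv0 k n; have := hw0 k n; positivity) (Finset.mem_univ i)
    have a7 := mul_nonneg he0.le (hu0 n)
    refine (norm_sub_le _ _).trans ?_
    rw [norm_mul, Complex.norm_real, Real.norm_eq_abs]
    have a8 : |κ| * ‖radTerm κ (n + s + 1) (X i * q n) x‖ ≤ |κ| * (e * w i n) :=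
      mul_le_mul_of_nonneg_left (a3.trans a5) (abs_nonneg κ)
    linarith

theorem smoothFam_mField {r : ℝ} (κ : ℝ) {P : ℕ → Poly} (hP : GeomBound r P) (i : Fin 3) :
    SmoothFam r fun n x => mField κ n (P n) x i :=
  smoothFam_radTerm κ 0 (geoD_rotPoly hP i)

theorem smoothFam_nField {r : ℝ} (κ : ℝ) {P : ℕ → Poly} (hP : GeomBound r P) (i : Fin 3) :
    SmoothFam r fun n x => nField κ n (P n) x i :=
  (smoothFam_radTerm κ 0 (geoD_gradPart hP i)).add
    ((smoothFam_radTerm κ 1 (geoD_radialPart hP i)).const_mul κ)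

/-- Sums of vector fields may be differentiated termwise. -/
theorem hasSum_curl {r : ℝ} {V : ℕ → R3 → C3} (hV : ∀ i, SmoothFam r fun n x => V n x i) {x : R3}
    (hx : ‖x‖ < r) : DifferentiableAt ℝ (fun y i => ∑' n, V n y i) x ∧
      HasSum (fun n => V n x) (fun i => ∑' n, V n x i) ∧
      HasSum (fun n => curl (V n) x) (curl (fun y i => ∑' n, V n y i) x) := by
  refine ⟨differentiableAt_pi.2 fun i => ((hV i).hasSum_partialDeriv hx).1,
    Pi.hasSum.2 fun i => ((hV i).summable hx).hasSum, Pi.hasSum.2 fun i => ?_⟩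
  have h := fun a b => ((hV b).hasSum_partialDeriv hx).2 a
  fin_cases i
  · exact (h 1 2).sub (h 2 1)
  · exact (h 2 0).sub (h 0 2)
  · exact (h 0 1).sub (h 1 0)

end MaxwellCorner
end

noncomputable section
namespace MaxwellCorner

open MvPolynomial (X pderiv)
open MeasureTheory Set Filter

/-! ### Expansion of Maxwell solutions -/

/-- The square of the wave number. -/
def kap (ω ε₀ μ₀ : ℝ) : ℝ := waveNumber ω ε₀ μ₀ ^ 2

theorem kap_eq {ω ε₀ μ₀ : ℝ} (hε₀ : 0 < ε₀) (hμ₀ : 0 < μ₀) :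
    kap ω ε₀ μ₀ = ω ^ 2 * (μ₀ * ε₀) := by
  rw [kap, waveNumber, mul_pow, Real.sq_sqrt (by positivity)]

/-- The electric field of the multipole with potentials `A` (magnetic) and `B` (electric). -/
def poleE (ω ε₀ μ₀ : ℝ) (n : ℕ) (A B : Poly) (x : R3) : C3 :=
  mField (kap ω ε₀ μ₀) n A x + (Complex.I / (ω * ε₀)) • nField (kap ω ε₀ μ₀) n B x

/-- The magnetic field of the multipole with potentials `A` (magnetic) and `B` (electric). -/
def poleH (ω ε₀ μ₀ : ℝ) (n : ℕ) (A B : Poly) (x : R3) : C3 :=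
  (-(Complex.I / (ω * μ₀))) • nField (kap ω ε₀ μ₀) n A x + mField (kap ω ε₀ μ₀) n B x

theorem partialDeriv_lin {V W : R3 → C3} (hV : Differentiable ℝ V) (hW : Differentiable ℝ W)
    (a b : ℂ) (i j : Fin 3) (x : R3) :
    partialDeriv i (fun y => (a • V y + b • W y) j) x =
      a * partialDeriv i (fun y => V y j) x + b * partialDeriv i (fun y => W y j) x := by
  have hVj := differentiableAt_apply (hV x) j
  have hWj := differentiableAt_apply (hW x) j
  rw [← partialDeriv_const_mul hVj, ← partialDeriv_const_mul hWj,
    ← partialDeriv_add (hVj.const_mul a) (hWj.const_mul b)]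
  rfl

theorem curl_lin {V W : R3 → C3} (hV : Differentiable ℝ V) (hW : Differentiable ℝ W)
    (a b : ℂ) (x : R3) :
    curl (fun y => a • V y + b • W y) x = a • curl V x + b • curl W x := by
  ext i
  fin_cases i <;> simp [curl, -Pi.add_apply, -Pi.smul_apply, partialDeriv_lin hV hW] <;>
    ring

variable {ω ε₀ μ₀ : ℝ}

theorem curl_poleE (hω : 0 < ω) (hε₀ : 0 < ε₀) (hμ₀ : 0 < μ₀) {n : ℕ} {A B : Poly}
    (hA : A ∈ harm n) (hB : B ∈ harm n) (x : R3) :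
    curl (poleE ω ε₀ μ₀ n A B) x = (Complex.I * ω * μ₀) • poleH ω ε₀ μ₀ n A B x := by
  have e : poleE ω ε₀ μ₀ n A B = fun y => (1 : ℂ) • mField (kap ω ε₀ μ₀) n A y +
      (Complex.I / (ω * ε₀)) • nField (kap ω ε₀ μ₀) n B y := by
    funext y; rw [one_smul]; rfl
  rw [e, curl_lin (differentiable_mField _ _ _) (differentiable_nField _ _ _), curl_mField _ hA,
    curl_nField _ hB, poleH, smul_add, smul_smul, smul_smul, one_smul, kap_eq hε₀ hμ₀]
  have h1 : (ω : ℂ) ≠ 0 := Complex.ofReal_ne_zero.2 hω.ne'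
  have h2 : (ε₀ : ℂ) ≠ 0 := Complex.ofReal_ne_zero.2 hε₀.ne'
  have h3 : (μ₀ : ℂ) ≠ 0 := Complex.ofReal_ne_zero.2 hμ₀.ne'
  congr 1
  · rw [show Complex.I * ω * μ₀ * -(Complex.I / (ω * μ₀)) = 1 by
      field_simp; simp [Complex.I_sq], one_smul]
  · congr 1
    push_cast
    field_simp

theorem curl_poleH (hω : 0 < ω) (hε₀ : 0 < ε₀) (hμ₀ : 0 < μ₀) {n : ℕ} {A B : Poly}
    (hA : A ∈ harm n) (hB : B ∈ harm n) (x : R3) :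
    curl (poleH ω ε₀ μ₀ n A B) x = (-(Complex.I * ω * ε₀)) • poleE ω ε₀ μ₀ n A B x := by
  have e : poleH ω ε₀ μ₀ n A B = fun y => (-(Complex.I / (ω * μ₀))) • nField (kap ω ε₀ μ₀) n A y +
      (1 : ℂ) • mField (kap ω ε₀ μ₀) n B y := by
    funext y; rw [one_smul]; rfl
  rw [e, curl_lin (differentiable_nField _ _ _) (differentiable_mField _ _ _), curl_mField _ hB,
    curl_nField _ hA, poleE, smul_add, smul_smul, smul_smul, one_smul, kap_eq hε₀ hμ₀]
  have h1 : (ω : ℂ) ≠ 0 := Complex.ofReal_ne_zero.2 hω.ne'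
  have h2 : (ε₀ : ℂ) ≠ 0 := Complex.ofReal_ne_zero.2 hε₀.ne'
  have h3 : (μ₀ : ℂ) ≠ 0 := Complex.ofReal_ne_zero.2 hμ₀.ne'
  congr 1
  · congr 1
    push_cast
    field_simp
  · rw [show -(Complex.I * ω * ε₀) * (Complex.I / (ω * ε₀)) = 1 by
      field_simp; simp [Complex.I_sq], one_smul]

theorem dot_poleE {n : ℕ} {A B : Poly} (hB : B ∈ harm n) (x : R3) :
    ∑ i, (x i : ℂ) * poleE ω ε₀ μ₀ n A B x i =
      Complex.I / (ω * ε₀) * (n * (n + 1)) * radTerm (kap ω ε₀ μ₀) n B x := by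
  have h1 := dot_mField (kap ω ε₀ μ₀) n A x
  have h2 := dot_nField (kap ω ε₀ μ₀) hB x
  simp only [poleE, Pi.add_apply, Pi.smul_apply, smul_eq_mul, Fin.sum_univ_three] at *
  linear_combination h1 + Complex.I / (ω * ε₀) * h2

theorem dot_poleH {n : ℕ} {A B : Poly} (hA : A ∈ harm n) (x : R3) :
    ∑ i, (x i : ℂ) * poleH ω ε₀ μ₀ n A B x i =
      -(Complex.I / (ω * μ₀)) * (n * (n + 1)) * radTerm (kap ω ε₀ μ₀) n A x := by
  have h1 := dot_mField (kap ω ε₀ μ₀) n B x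
  have h2 := dot_nField (kap ω ε₀ μ₀) hA x
  simp only [poleH, Pi.add_apply, Pi.smul_apply, smul_eq_mul, Fin.sum_univ_three] at *
  linear_combination h1 - Complex.I / (ω * μ₀) * h2

theorem hasSum_dot {V : ℕ → R3 → C3} {x : R3} {s : C3} (h : HasSum (fun n => V n x) s) :
    HasSum (fun n => ∑ i, (x i : ℂ) * V n x i) (∑ i, (x i : ℂ) * s i) :=
  hasSum_sum fun i _ => (Pi.hasSum.1 h i).mul_left _

theorem curl_sub {V W : R3 → C3} {x : R3} (hV : DifferentiableAt ℝ V x)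
    (hW : DifferentiableAt ℝ W x) :
    curl (fun y => V y - W y) x = curl V x - curl W x := by
  have h : ∀ a b, partialDeriv a (fun y => (V y - W y) b) x =
      partialDeriv a (fun y => V y b) x - partialDeriv a (fun y => W y b) x := fun a b =>
    partialDeriv_sub (differentiableAt_apply hV b) (differentiableAt_apply hW b) a
  ext i
  fin_cases i <;> simp [curl, -Pi.sub_apply, h] <;> ring

theorem isMaxwellSolution_sub {U : Set R3} {E H E' H' : R3 → C3}
    (h : IsMaxwellSolution ω ε₀ μ₀ U E H) (h' : IsMaxwellSolution ω ε₀ μ₀ U E' H') :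
    IsMaxwellSolution ω ε₀ μ₀ U (fun x => E x - E' x) (fun x => H x - H' x) := by
  intro x hx
  obtain ⟨a1, a2, a3, a4⟩ := h x hx
  obtain ⟨b1, b2, b3, b4⟩ := h' x hx
  refine ⟨a1.fun_sub b1, a2.fun_sub b2, ?_, ?_⟩
  · rw [curl_sub a1 b1, smul_sub, sub_sub_sub_comm, a3, b3, sub_zero]
  · rw [curl_sub a2 b2, smul_sub, sub_add_sub_comm, a4, b4, sub_zero]

/-- Sums of multipoles solve the Maxwell system. -/
theorem isMaxwellSolution_tsum (hω : 0 < ω) (hε₀ : 0 < ε₀) (hμ₀ : 0 < μ₀) {r : ℝ} {A B : ℕ → Poly}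
    (hA : GeomBound r A) (hB : GeomBound r B) :
    IsMaxwellSolution ω ε₀ μ₀ (Metric.ball 0 r)
      (fun x i => ∑' n, poleE ω ε₀ μ₀ n (A n) (B n) x i)
      (fun x i => ∑' n, poleH ω ε₀ μ₀ n (A n) (B n) x i) ∧
    ∀ x ∈ Metric.ball (0 : R3) r,
      HasSum (fun n => poleE ω ε₀ μ₀ n (A n) (B n) x)
        (fun i => ∑' n, poleE ω ε₀ μ₀ n (A n) (B n) x i) ∧
      HasSum (fun n => poleH ω ε₀ μ₀ n (A n) (B n) x)
        (fun i => ∑' n, poleH ω ε₀ μ₀ n (A n) (B n) x i) := by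
  set κ := kap ω ε₀ μ₀ with hκ
  have hE : ∀ i, SmoothFam r fun n x => poleE ω ε₀ μ₀ n (A n) (B n) x i := fun i =>
    (smoothFam_mField κ hA i).add ((smoothFam_nField κ hB i).const_mul _)
  have hH : ∀ i, SmoothFam r fun n x => poleH ω ε₀ μ₀ n (A n) (B n) x i := fun i =>
    ((smoothFam_nField κ hA i).const_mul _).add (smoothFam_mField κ hB i)
  refine ⟨fun x hx => ?_, fun x hx => ?_⟩
  · rw [mem_ball_zero_iff] at hx
    obtain ⟨a1, a2, a3⟩ := hasSum_curl (V := fun n => poleE ω ε₀ μ₀ n (A n) (B n)) hE hx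
    obtain ⟨b1, b2, b3⟩ := hasSum_curl (V := fun n => poleH ω ε₀ μ₀ n (A n) (B n)) hH hx
    refine ⟨a1, b1, sub_eq_zero.2 (a3.unique ?_), ?_⟩
    · simp only [curl_poleE hω hε₀ hμ₀ (hA.1 _) (hB.1 _)]
      exact b2.const_smul _
    · rw [← sub_neg_eq_add, ← neg_smul]
      refine sub_eq_zero.2 (b3.unique ?_)
      simp only [curl_poleH hω hε₀ hμ₀ (hA.1 _) (hB.1 _)]
      exact a2.const_smul _
  · rw [mem_ball_zero_iff] at hx
    exact ⟨(hasSum_curl (V := fun n => poleE ω ε₀ μ₀ n (A n) (B n)) hE hx).2.1,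
      (hasSum_curl (V := fun n => poleH ω ε₀ μ₀ n (A n) (B n)) hH hx).2.1⟩

theorem GeomBound.smul {r : ℝ} {P : ℕ → Poly} (hP : GeomBound r P) (c : ℕ → ℂ) {M : ℝ}
    (hc : ∀ n, ‖c n‖ ≤ M) : GeomBound r fun n => c n • P n := by
  refine ⟨fun n => Submodule.smul_mem _ _ (hP.1 n), fun ρ h0 h1 => ?_⟩
  obtain ⟨C, hC⟩ := hP.2 ρ h0 h1
  have hM : 0 ≤ M := (norm_nonneg _).trans (hc 0)
  refine ⟨M * C, fun n => ?_⟩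
  have hb := (besselCoeff_pos n 0).le
  have hs := supS_nonneg (P n)
  calc _ ≤ besselCoeff n 0 * (M * supS (P n)) * ρ ^ n := by
        gcongr
        exact (supS_smul _ _).trans (mul_le_mul_of_nonneg_right (hc n) hs)
    _ = M * (besselCoeff n 0 * supS (P n) * ρ ^ n) := by ring
    _ ≤ _ := mul_le_mul_of_nonneg_left (hC n) hM

theorem harm_zero_eq {p : Poly} (hp : p ∈ harm 0) (h : pev p 0 = 0) : p = 0 := by
  refine pev_injective fun x => ?_
  have := pev_homog (mem_harm.1 hp).1 0 x
  rw [zero_smul, h, pow_zero, one_mul] at this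
  rw [← this, pev_zero]

/-- A function given by a Helmholtz series that vanishes at the origin, written with the
factors `n (n + 1)`. -/
theorem exists_potential {κ r : ℝ} (hr : 0 < r) {f : R3 → ℂ} (hf : WeakHelmholtz κ r f)
    (h0 : f 0 = 0) {c : ℂ} (hc : c ≠ 0) :
    ∃ A : ℕ → Poly, GeomBound r A ∧ A 0 = 0 ∧ ∀ x ∈ Metric.ball (0 : R3) r,
      HasSum (fun n : ℕ => c * (n * (n + 1)) * radTerm κ n (A n) x) (f x) := by
  obtain ⟨P, hP, hsum⟩ := helmholtz_expansion hr hf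
  -- At the origin only the term of degree 0 survives, so f(0) = 0 removes it. Otherwise it could
  -- not be written with the factor n(n+1).
  have hP0 : P 0 = 0 := by
    have h1 := hsum 0 (Metric.mem_ball_self hr)
    have h2 : ∀ n, n ≠ 0 → radTerm κ n (P n) 0 = 0 := fun n hn => by
      have := norm_pev_le (mem_harm.1 (hP.1 n)).1 0
      rw [norm_zero, zero_pow hn, zero_mul] at this
      rw [radTerm, norm_le_zero_iff.1 this, mul_zero]
    have h3 := h1.unique (hasSum_single 0 h2)
    rw [h0, radTerm, norm_zero, show κ * 0 ^ 2 = 0 by ring, redBessel_zero] at h3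
    refine harm_zero_eq (hP.1 0) ((mul_eq_zero.1 h3.symm).resolve_left ?_)
    exact Complex.ofReal_ne_zero.2 (besselCoeff_pos 0 0).ne'
  have hb : ∀ n : ℕ, ‖(c * (n * (n + 1)))⁻¹‖ ≤ ‖c‖⁻¹ := by
    intro n
    rw [norm_inv, norm_mul]
    have hcn : 0 < ‖c‖ := norm_pos_iff.2 hc
    rcases Nat.eq_zero_or_pos n with rfl | hn
    · simp
    · refine inv_anti₀ hcn (le_mul_of_one_le_right hcn.le ?_)
      have e : ((n : ℂ) * (n + 1)) = ((n * (n + 1) : ℕ) : ℂ) := by push_cast; ring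
      rw [e, Complex.norm_natCast]
      exact_mod_cast Nat.mul_pos hn (Nat.succ_pos n)
  -- For n = 0 the inverse of zero is zero by convention, consistent with P_0 = 0.
  refine ⟨fun n => (c * (n * (n + 1)))⁻¹ • P n, hP.smul _ hb, by simp [hP0], fun x hx => ?_⟩
  convert! hsum x hx using 2 with n
  rw [radTerm_smul]
  rcases Nat.eq_zero_or_pos n with rfl | hn
  · simp [hP0]
  · have hn' : (n : ℂ) * (n + 1) ≠ 0 := by
      have e : ((n : ℂ) * (n + 1)) = ((n * (n + 1) : ℕ) : ℂ) := by push_cast; ring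
      rw [e]; exact Nat.cast_ne_zero.2 (Nat.mul_pos hn (Nat.succ_pos n)).ne'
    rw [← mul_assoc, mul_inv_cancel₀ (mul_ne_zero hc hn'), one_mul]

/-- The expansions of x · E and x · H determine the only possible potentials. The multipole series
they define solves the Maxwell system with the same radial components, so it agrees with the given
solution. -/
theorem maxwell_expansion (hω : 0 < ω) (hε₀ : 0 < ε₀) (hμ₀ : 0 < μ₀) {r : ℝ} (hr : 0 < r)
    {E H : R3 → C3} (hsol : IsMaxwellSolution ω ε₀ μ₀ (Metric.ball 0 r) E H) :
    ∃ A B : ℕ → Poly, GeomBound r A ∧ GeomBound r B ∧ A 0 = 0 ∧ B 0 = 0 ∧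
      ∀ x ∈ Metric.ball (0 : R3) r,
        HasSum (fun n => poleE ω ε₀ μ₀ n (A n) (B n) x) (E x) ∧
        HasSum (fun n => poleH ω ε₀ μ₀ n (A n) (B n) x) (H x) := by
  have h1 : (ω : ℂ) ≠ 0 := Complex.ofReal_ne_zero.2 hω.ne'
  have h2 : (ε₀ : ℂ) ≠ 0 := Complex.ofReal_ne_zero.2 hε₀.ne'
  have h3 : (μ₀ : ℂ) ≠ 0 := Complex.ofReal_ne_zero.2 hμ₀.ne'
  have hI := Complex.I_ne_zero
  have cE : ∀ x ∈ Metric.ball (0 : R3) r, curl E x = (Complex.I * ω * μ₀) • H x := fun x hx =>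
    sub_eq_zero.1 (hsol x hx).2.2.1
  have cH : ∀ x ∈ Metric.ball (0 : R3) r, curl H x = (-(Complex.I * ω * ε₀)) • E x := fun x hx => by
    rw [neg_smul]; exact eq_neg_of_add_eq_zero_left (hsol x hx).2.2.2
  have hk : Complex.I * ω * μ₀ * -(Complex.I * ω * ε₀) = ((kap ω ε₀ μ₀ : ℝ) : ℂ) := by
    rw [kap_eq hε₀ hμ₀]; push_cast
    linear_combination -(ω : ℂ) ^ 2 * μ₀ * ε₀ * Complex.I_sq
  have wE := weakHelmholtz_radial (by simp [h1, h2]) hk (fun x hx => (hsol x hx).1)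
    (fun x hx => (hsol x hx).2.1) cE cH
  have wH := weakHelmholtz_radial (by simp [h1, h3]) ((mul_comm _ _).trans hk)
    (fun x hx => (hsol x hx).2.1) (fun x hx => (hsol x hx).1) cH cE
  obtain ⟨B, hB, hB0, hBs⟩ := exists_potential hr wE (by simp)
    (div_ne_zero hI (mul_ne_zero h1 h2) : Complex.I / (ω * ε₀) ≠ 0)
  obtain ⟨A, hA, hA0, hAs⟩ := exists_potential hr wH (by simp)
    (neg_ne_zero.2 (div_ne_zero hI (mul_ne_zero h1 h3)) : -(Complex.I / (ω * μ₀)) ≠ 0)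
  refine ⟨A, B, hA, hB, hA0, hB0, ?_⟩
  obtain ⟨hs, hsum⟩ := isMaxwellSolution_tsum hω hε₀ hμ₀ hA hB
  have key := maxwell_eq_zero_of_radial (isMaxwellSolution_sub hsol hs)
    (fun x hx => by
      have e1 := hasSum_dot (V := fun n => poleE ω ε₀ μ₀ n (A n) (B n)) (hsum x hx).1
      simp only [dot_poleE (hB.1 _)] at e1
      have := e1.unique (hBs x hx)
      simp only [Pi.sub_apply, mul_sub, Finset.sum_sub_distrib]
      rw [this, sub_self])
    (fun x hx => by
      have e1 := hasSum_dot (V := fun n => poleH ω ε₀ μ₀ n (A n) (B n)) (hsum x hx).2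
      simp only [dot_poleH (hA.1 _)] at e1
      have := e1.unique (hAs x hx)
      simp only [Pi.sub_apply, mul_sub, Finset.sum_sub_distrib]
      rw [this, sub_self])
  intro x hx
  rw [sub_eq_zero.1 (key x hx).1, sub_eq_zero.1 (key x hx).2]
  exact hsum x hx

end MaxwellCorner
end

noncomputable section
namespace MaxwellCorner

open MvPolynomial (X pderiv)
open MeasureTheory Set Filter

/-! ### Uniqueness of the expansion -/

/-- Convergence at t = 1 and the lower bound for b_n make c_{n,0}|d_n| bounded. If all earlier
coefficients vanish, dividing by t^n leaves d_n b_n(zt²) = O(t), and t → 0 gives d_n = 0. Only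
pointwise convergence along the segment is used. -/
theorem bessel_coeff_eq_zero {d : ℕ → ℂ} {z : ℝ}
    (h : ∀ t ∈ Ioc (0 : ℝ) 1,
      HasSum (fun n => d n * (t : ℂ) ^ n * (redBessel n (z * t ^ 2) : ℝ)) 0) (n : ℕ) : d n = 0 := by
  obtain ⟨C, hC⟩ : ∃ C, ∀ n, besselCoeff n 0 * ‖d n‖ ≤ C := by
    have hs := (h 1 ⟨one_pos, le_rfl⟩).summable.tendsto_atTop_zero.norm
    rw [norm_zero] at hs
    apply exists_forall_le_of_eventually (C := 2)
    filter_upwards [hs.eventually (eventually_le_nhds one_pos),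
      eventually_redBessel_ge |z|] with n h1 h2
    have h3 := h2 z le_rfl
    have hb := besselCoeff_pos n 0
    rw [Complex.ofReal_one, one_pow, mul_one, one_pow, mul_one, norm_mul, Complex.norm_real,
      Real.norm_of_nonneg (by linarith)] at h1
    have := mul_le_mul_of_nonneg_left h3 (norm_nonneg (d n))
    linarith
  induction n using Nat.strong_induction_on with
  | _ n ih =>
    set M := C * Real.exp |z| with hM
    have hC0 : 0 ≤ C := (mul_nonneg (besselCoeff_pos 0 0).le (norm_nonneg _)).trans (hC 0)
    have key : ∀ t ∈ Ioo (0 : ℝ) (1 / 2), ‖d n * (redBessel n (z * t ^ 2) : ℝ)‖ ≤ 2 * M * t := by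
      intro t ht
      have ht0 := ht.1
      have ht1 : t < 1 := by linarith [ht.2]
      have hs := h t ⟨ht.1, ht1.le⟩
      have hz : |z * t ^ 2| ≤ |z| := by
        rw [abs_mul, abs_of_nonneg (sq_nonneg t)]
        exact mul_le_of_le_one_right (abs_nonneg z) (pow_le_one₀ ht0.le ht1.le)
      have hsum := (hasSum_nat_add_iff' (n + 1)).2 hs
      rw [Finset.sum_range_succ, Finset.sum_eq_zero (s := Finset.range n) (fun m hm => by
        rw [ih m (Finset.mem_range.1 hm)]; simp), zero_add, zero_sub] at hsum
      have hb : ∀ m, ‖d (m + (n + 1)) * (t : ℂ) ^ (m + (n + 1)) *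
          (redBessel (m + (n + 1)) (z * t ^ 2) : ℝ)‖ ≤ M * t ^ (n + 1) * t ^ m := by
        intro m
        rw [norm_mul, norm_mul, norm_pow, Complex.norm_real, Complex.norm_real,
          Real.norm_of_nonneg ht0.le]
        have h1 := abs_redBessel_le (m + (n + 1)) hz
        rw [← Real.norm_eq_abs] at h1
        have h2 := hC (m + (n + 1))
        calc _ ≤ ‖d (m + (n + 1))‖ * t ^ (m + (n + 1)) *
              (besselCoeff (m + (n + 1)) 0 * Real.exp |z|) := by gcongr
          _ = (besselCoeff (m + (n + 1)) 0 * ‖d (m + (n + 1))‖) * Real.exp |z| *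
              (t ^ (n + 1) * t ^ m) := by rw [pow_add]; ring
          _ ≤ C * Real.exp |z| * (t ^ (n + 1) * t ^ m) := by gcongr
          _ = _ := by rw [hM]; ring
      have hg : HasSum (fun m : ℕ => M * t ^ (n + 1) * t ^ m) (M * t ^ (n + 1) * (1 - t)⁻¹) :=
        (hasSum_geometric_of_lt_one ht0.le ht1).mul_left _
      have h3 := tsum_of_norm_bounded hg hb
      rw [hsum.tsum_eq, norm_neg, mul_right_comm, norm_mul, norm_pow, Complex.norm_real,
        Real.norm_of_nonneg ht0.le] at h3
      have h4 : (1 - t)⁻¹ ≤ 2 := by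
        rw [inv_le_comm₀ (by linarith) two_pos]; linarith [ht.2]
      have hM0 : 0 ≤ M := by positivity
      have h5 : ‖d n * (redBessel n (z * t ^ 2) : ℝ)‖ * t ^ n ≤ (2 * M * t) * t ^ n := by
        refine h3.trans ?_
        calc _ ≤ M * t ^ (n + 1) * 2 := by gcongr
          _ = _ := by ring
      exact le_of_mul_le_mul_right h5 (pow_pos ht0 n)
    have hc : ContinuousAt (fun t : ℝ => ‖d n * (redBessel n (z * t ^ 2) : ℝ)‖) 0 := by
      have : Continuous fun t : ℝ => redBessel n (z * t ^ 2) :=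
        (continuous_redBessel n).comp (by fun_prop)
      exact (continuous_const.mul (Complex.continuous_ofReal.comp this)).norm.continuousAt
    have hc2 : ContinuousAt (fun t : ℝ => 2 * M * t) 0 := by fun_prop
    have hle := le_of_tendsto_of_tendsto (hc.tendsto.mono_left nhdsWithin_le_nhds)
      (hc2.tendsto.mono_left nhdsWithin_le_nhds)
      (by
        filter_upwards [Ioo_mem_nhdsGT (by norm_num : (0 : ℝ) < 1 / 2)] with t ht
        exact key t ht)
    rw [mul_zero, show z * 0 ^ 2 = 0 by ring, redBessel_zero] at hle
    have h6 := norm_le_zero_iff.1 hle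
    exact (mul_eq_zero.1 h6).resolve_right
      (Complex.ofReal_ne_zero.2 (besselCoeff_pos n 0).ne')

/-- Pointwise convergent series of multipole potentials are unique. -/
theorem potential_unique {κ r : ℝ} {c : ℂ} (hc : c ≠ 0) {D D' : ℕ → Poly} {f : R3 → ℂ}
    (hD : ∀ n, D n ∈ harm n) (hD' : ∀ n, D' n ∈ harm n) (hr : 0 < r)
    (h : ∀ x ∈ Metric.ball (0 : R3) r,
      HasSum (fun n : ℕ => c * (n * (n + 1)) * radTerm κ n (D n) x) (f x))
    (h' : ∀ x ∈ Metric.ball (0 : R3) r,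
      HasSum (fun n : ℕ => c * (n * (n + 1)) * radTerm κ n (D' n) x) (f x))
    {n : ℕ} (hn : 1 ≤ n) : D n = D' n := by
  have key : ∀ x ∈ Metric.ball (0 : R3) r, pev (D n) x = pev (D' n) x := by
    intro x hx
    rw [mem_ball_zero_iff] at hx
    -- Restricted to the segment from 0 to x, homogeneity turns the difference of the two series
    -- into a one-variable Bessel series.
    have := bessel_coeff_eq_zero (z := κ * ‖x‖ ^ 2)
      (d := fun n : ℕ => c * (n * (n + 1)) * (pev (D n) x - pev (D' n) x)) (fun t ht => ?_) n
    · have e : ((n : ℂ) * (n + 1)) = ((n * (n + 1) : ℕ) : ℂ) := by push_cast; ring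
      refine sub_eq_zero.1 ((mul_eq_zero.1 this).resolve_left (mul_ne_zero hc ?_))
      rw [e]; exact Nat.cast_ne_zero.2 (Nat.mul_pos hn (Nat.succ_pos n)).ne'
    · have htx : t • x ∈ Metric.ball (0 : R3) r := by
        rw [mem_ball_zero_iff, norm_smul, Real.norm_of_nonneg ht.1.le]
        exact (mul_le_of_le_one_left (norm_nonneg x) ht.2).trans_lt hx
      have h1 := (h _ htx).sub (h' _ htx)
      rw [sub_self] at h1
      convert! h1 using 2 with m
      rw [radTerm, radTerm, pev_homog (mem_harm.1 (hD m)).1, pev_homog (mem_harm.1 (hD' m)).1,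
        norm_smul, Real.norm_of_nonneg ht.1.le,
        show κ * (t * ‖x‖) ^ 2 = κ * ‖x‖ ^ 2 * t ^ 2 by ring]
      ring
  refine pev_injective fun x => ?_
  obtain ⟨t, ht0, ht⟩ : ∃ t : ℝ, t ≠ 0 ∧ ‖t • x‖ < r := by
    refine ⟨r / (‖x‖ + 1) / 2, by positivity, ?_⟩
    rw [norm_smul, Real.norm_of_nonneg (by positivity), div_div, div_mul_eq_mul_div,
      div_lt_iff₀ (by positivity)]
    nlinarith [norm_nonneg x]
  have h1 := key (t • x) (mem_ball_zero_iff.2 ht)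
  rw [pev_homog (mem_harm.1 (hD n)).1, pev_homog (mem_harm.1 (hD' n)).1] at h1
  exact mul_left_cancel₀ (pow_ne_zero n (Complex.ofReal_ne_zero.2 ht0)) h1

/-- Radial components of E see only B, those of H only A. The factor n(n+1) hides degree 0, whence
the restriction to n ≥ 1. -/
theorem pole_unique {ω ε₀ μ₀ : ℝ} (hω : 0 < ω) (hε₀ : 0 < ε₀) (hμ₀ : 0 < μ₀) {r : ℝ} (hr : 0 < r)
    {A B A' B' : ℕ → Poly} {E H : R3 → C3}
    (hA : ∀ n, A n ∈ harm n) (hB : ∀ n, B n ∈ harm n)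
    (hA' : ∀ n, A' n ∈ harm n) (hB' : ∀ n, B' n ∈ harm n)
    (h : ∀ x ∈ Metric.ball (0 : R3) r,
      HasSum (fun n => poleE ω ε₀ μ₀ n (A n) (B n) x) (E x) ∧
      HasSum (fun n => poleH ω ε₀ μ₀ n (A n) (B n) x) (H x))
    (h' : ∀ x ∈ Metric.ball (0 : R3) r,
      HasSum (fun n => poleE ω ε₀ μ₀ n (A' n) (B' n) x) (E x) ∧
      HasSum (fun n => poleH ω ε₀ μ₀ n (A' n) (B' n) x) (H x))
    {n : ℕ} (hn : 1 ≤ n) : A n = A' n ∧ B n = B' n := by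
  have h1 : (ω : ℂ) ≠ 0 := Complex.ofReal_ne_zero.2 hω.ne'
  have h2 : (ε₀ : ℂ) ≠ 0 := Complex.ofReal_ne_zero.2 hε₀.ne'
  have h3 : (μ₀ : ℂ) ≠ 0 := Complex.ofReal_ne_zero.2 hμ₀.ne'
  have hI := Complex.I_ne_zero
  constructor
  · refine potential_unique (κ := kap ω ε₀ μ₀)
      (neg_ne_zero.2 (div_ne_zero hI (mul_ne_zero h1 h3)) : -(Complex.I / (ω * μ₀)) ≠ 0) hA hA' hr
      (f := fun x => ∑ i, (x i : ℂ) * H x i) (fun x hx => ?_) (fun x hx => ?_) hn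
    · have := hasSum_dot (V := fun n => poleH ω ε₀ μ₀ n (A n) (B n)) (h x hx).2
      simpa only [dot_poleH (hA _)] using this
    · have := hasSum_dot (V := fun n => poleH ω ε₀ μ₀ n (A' n) (B' n)) (h' x hx).2
      simpa only [dot_poleH (hA' _)] using this
  · refine potential_unique (κ := kap ω ε₀ μ₀)
      (div_ne_zero hI (mul_ne_zero h1 h2) : Complex.I / (ω * ε₀) ≠ 0) hB hB' hr
      (f := fun x => ∑ i, (x i : ℂ) * E x i) (fun x hx => ?_) (fun x hx => ?_) hn
    · have := hasSum_dot (V := fun n => poleE ω ε₀ μ₀ n (A n) (B n)) (h x hx).1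
      simpa only [dot_poleE (hB _)] using this
    · have := hasSum_dot (V := fun n => poleE ω ε₀ μ₀ n (A' n) (B' n)) (h' x hx).1
      simpa only [dot_poleE (hB' _)] using this

end MaxwellCorner
end

noncomputable section
namespace MaxwellCorner

open MvPolynomial (X pderiv)
open Set

/-! ### Coefficients of Legendre polynomials -/

/-- Compare coefficients of degree p + 1 in (t² - 1)u' = 2n t u for u = (t² - 1)^n. -/
theorem coeff_sq_sub_one (n p : ℕ) :
    ((p : ℝ) + 2) * ((Polynomial.X ^ 2 - 1 : Polynomial ℝ) ^ n).coeff (p + 2) =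
      -(2 * n - p) * ((Polynomial.X ^ 2 - 1 : Polynomial ℝ) ^ n).coeff p := by
  set u : Polynomial ℝ := (Polynomial.X ^ 2 - 1) ^ n with hu
  have h : (Polynomial.X ^ 2 - 1) * Polynomial.derivative u =
      Polynomial.C (2 * (n : ℝ)) * (Polynomial.X * u) := by
    rw [hu, Polynomial.derivative_pow]
    cases n with
    | zero => simp
    | succ n =>
      rw [Nat.add_sub_cancel]
      have hd : Polynomial.derivative (Polynomial.X ^ 2 - 1 : Polynomial ℝ) = 2 * Polynomial.X := by
        rw [Polynomial.derivative_sub, Polynomial.derivative_X_pow, Polynomial.derivative_one]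
        norm_num
        exact map_ofNat Polynomial.C 2
      rw [hd]
      simp only [map_mul, map_natCast, map_ofNat]
      push_cast
      ring
  have h1 := congrArg (fun q => Polynomial.coeff q (p + 1)) h
  simp only [sub_mul, one_mul, Polynomial.coeff_sub, Polynomial.coeff_C_mul,
    Polynomial.coeff_X_mul, Polynomial.coeff_derivative] at h1
  have h2 : (Polynomial.X ^ 2 * Polynomial.derivative u).coeff (p + 1) = p * u.coeff p := by
    cases p with
    | zero => rw [Polynomial.coeff_X_pow_mul']; simp
    | succ p =>
      rw [show p + 1 + 1 = p + 2 by rfl, Polynomial.coeff_X_pow_mul, Polynomial.coeff_derivative]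
      push_cast; ring
  rw [h2] at h1
  push_cast at h1
  linarith

theorem coeff_iterate_derivative_rec (n k j : ℕ) :
    ((j : ℝ) + 1) * (j + 2) *
        (Polynomial.derivative^[k] ((Polynomial.X ^ 2 - 1 : Polynomial ℝ) ^ n)).coeff (j + 2) =
      -((2 * n - j - k) * (j + k + 1)) *
        (Polynomial.derivative^[k] ((Polynomial.X ^ 2 - 1 : Polynomial ℝ) ^ n)).coeff j := by
  induction k generalizing j with
  | zero =>
    have := coeff_sq_sub_one n j
    rw [Function.iterate_zero, id]
    push_cast
    linear_combination ((j : ℝ) + 1) * this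
  | succ k ih =>
    have := ih (j + 1)
    rw [Function.iterate_succ_apply', Polynomial.coeff_derivative, Polynomial.coeff_derivative]
    push_cast at this ⊢
    linear_combination ((j : ℝ) + 1) * this

/-- The coefficients of the `a`-th derivative of the Legendre polynomial `P_n`. -/
def legCoeff (n a j : ℕ) : ℝ := (Polynomial.derivative^[a] (legendre n)).coeff j

theorem legCoeff_eq (n a j : ℕ) : legCoeff n a j = (2 ^ n * (n.factorial : ℝ))⁻¹ *
    (Polynomial.derivative^[n + a] ((Polynomial.X ^ 2 - 1 : Polynomial ℝ) ^ n)).coeff j := by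
  rw [legCoeff, legendre, Polynomial.iterate_derivative_C_mul, Polynomial.coeff_C_mul,
    ← Function.iterate_add_apply, add_comm a n]

/-- The power series form of the Legendre equation differentiated a times. It is exactly the
cancellation needed in `solid_mem_harm`. -/
theorem legCoeff_rec (n a j : ℕ) : ((j : ℝ) + 1) * (j + 2) * legCoeff n a (j + 2) =
    -((n - a - j) * (n + a + j + 1)) * legCoeff n a j := by
  rw [legCoeff_eq, legCoeff_eq]
  have := coeff_iterate_derivative_rec n (n + a) j
  push_cast at this
  linear_combination (2 ^ n * (n.factorial : ℝ))⁻¹ * this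

theorem coeff_sq_sub_one_odd (n p : ℕ) (hp : ¬ 2 ∣ p) :
    ((Polynomial.X ^ 2 - 1 : Polynomial ℝ) ^ n).coeff p = 0 := by
  have h : (Polynomial.X ^ 2 - 1 : Polynomial ℝ) ^ n =
      Polynomial.expand ℝ 2 ((Polynomial.X - 1) ^ n) := by simp
  rw [h, Polynomial.coeff_expand two_pos, if_neg hp]

theorem legCoeff_eq_zero_of_odd (n a j : ℕ) (h : ¬ 2 ∣ j + n + a) : legCoeff n a j = 0 := by
  rw [legCoeff_eq, Polynomial.coeff_iterate_derivative, coeff_sq_sub_one_odd n _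
    (by rwa [← add_assoc]), smul_zero, mul_zero]

theorem monic_sq_sub_one : (Polynomial.X ^ 2 - 1 : Polynomial ℝ).Monic :=
  Polynomial.monic_X_pow_sub_C 1 two_ne_zero

theorem natDegree_sq_sub_one_pow (n : ℕ) :
    ((Polynomial.X ^ 2 - 1 : Polynomial ℝ) ^ n).natDegree = 2 * n := by
  rw [monic_sq_sub_one.natDegree_pow, show (Polynomial.X ^ 2 - 1 : Polynomial ℝ).natDegree = 2 from
    Polynomial.natDegree_X_pow_sub_C, mul_comm]

theorem legCoeff_eq_zero_of_lt (n a j : ℕ) (h : n < j + a) : legCoeff n a j = 0 := by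
  rw [legCoeff_eq, Polynomial.coeff_iterate_derivative, Polynomial.coeff_eq_zero_of_natDegree_lt,
    smul_zero, mul_zero]
  rw [natDegree_sq_sub_one_pow]; omega

theorem legCoeff_top_ne_zero {n a : ℕ} (h : a ≤ n) : legCoeff n a (n - a) ≠ 0 := by
  rw [legCoeff_eq, Polynomial.coeff_iterate_derivative, show n - a + (n + a) = 2 * n by omega]
  have h1 : ((Polynomial.X ^ 2 - 1 : Polynomial ℝ) ^ n).coeff (2 * n) = 1 := by
    have := (monic_sq_sub_one.pow n).coeff_natDegree
    rwa [natDegree_sq_sub_one_pow] at this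
  rw [h1]
  refine mul_ne_zero (by positivity) ?_
  rw [nsmul_eq_mul, mul_one, Nat.cast_ne_zero, Nat.ne_zero_iff_zero_lt, Nat.descFactorial_pos]
  omega

/-! ### Solid harmonics -/

/-- The polynomial `|x|^{n-a} (D^a P_n) (x₃ / |x|)`. -/
def zonal (n a : ℕ) : Poly :=
  ∑ j ∈ Finset.range (n - a + 1),
    MvPolynomial.C (legCoeff n a j : ℂ) * (X 2 ^ j * nsq ^ ((n - a - j) / 2))

/-- The linear form `x₁ + i x₂` or `x₁ - i x₂`, according to the sign of `m`. -/
def azimuth (m : ℤ) : Poly :=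
  X 0 + MvPolynomial.C (if 0 ≤ m then Complex.I else -Complex.I) * X 1

/-- The normalization of the spherical harmonics. -/
def harmNorm (n a : ℕ) : ℝ :=
  Real.sqrt ((2 * n + 1) / (4 * Real.pi) * (((n - a).factorial : ℝ) / ((n + a).factorial : ℝ)))

/-- The solid harmonic `|x|^n Y_n^m`. -/
def solid (n : ℕ) (m : ℤ) : Poly :=
  MvPolynomial.C (harmNorm n m.natAbs : ℂ) * (azimuth m ^ m.natAbs * zonal n m.natAbs)

/-- The rounding in the exponent of |x|² is harmless, since the coefficient vanishes when n - a - j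
is odd. -/
theorem isHomogeneous_zonal (n a : ℕ) : (zonal n a).IsHomogeneous (n - a) := by
  refine MvPolynomial.IsHomogeneous.sum _ _ _ fun j hj => ?_
  by_cases h : 2 ∣ j + n + a
  · refine MvPolynomial.IsHomogeneous.C_mul ?_ _
    have h1 := (MvPolynomial.isHomogeneous_X_pow (R := ℂ) (2 : Fin 3) j).mul
      (isHomogeneous_nsq.pow ((n - a - j) / 2))
    have hj' := Finset.mem_range.1 hj
    rcases le_or_gt a n with ha | ha
    · rwa [show j + 2 * ((n - a - j) / 2) = n - a by omega] at h1
    · rw [show j + 2 * ((n - a - j) / 2) = n - a by omega] at h1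
      exact h1
  · rw [legCoeff_eq_zero_of_odd n a j h]
    simpa using MvPolynomial.isHomogeneous_zero _ _ _

theorem isHomogeneous_azimuth (m : ℤ) : (azimuth m).IsHomogeneous 1 :=
  (MvPolynomial.isHomogeneous_X _ _).add (MvPolynomial.isHomogeneous_C_mul_X _ _)

theorem isHomogeneous_solid {n : ℕ} {m : ℤ} (hm : m.natAbs ≤ n) :
    (solid n m).IsHomogeneous n := by
  refine MvPolynomial.IsHomogeneous.C_mul ?_ _
  have := ((isHomogeneous_azimuth m).pow m.natAbs).mul (isHomogeneous_zonal n m.natAbs)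
  rwa [one_mul, Nat.add_sub_cancel' hm] at this

theorem azimuth_sq (m : ℤ) : (if 0 ≤ m then Complex.I else -Complex.I) ^ 2 = -1 := by
  split_ifs <;> simp [Complex.I_sq]

/-- The Laplacian of `ζ^a x₃^j |x|^{2e}`, where `ζ = x₁ ± i x₂`. -/
theorem lap_azimuth_term (m : ℤ) (a j e : ℕ) :
    lap (azimuth m ^ a * (X 2 ^ j * nsq ^ e)) =
      azimuth m ^ a * (((j : Poly) * ((j - 1 : ℕ) : Poly)) * (X 2 ^ (j - 2) * nsq ^ e) +
        (2 * (e : Poly) * (2 * (a : Poly) + 2 * (j : Poly) + 2 * (e : Poly) + 1)) * (X 2 ^ j * nsq ^ (e - 1))) := by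
  set c : ℂ := if 0 ≤ m then Complex.I else -Complex.I with hc
  have hc2 : (MvPolynomial.C c : Poly) ^ 2 = -1 := by
    rw [← map_pow, hc, azimuth_sq]; simp
  have hζ : azimuth m = X 0 + MvPolynomial.C c * X 1 := rfl
  have z0 : pderiv 0 (azimuth m) = 1 := by simp [hζ]
  have z1 : pderiv 1 (azimuth m) = MvPolynomial.C c := by simp [hζ]
  have z2 : pderiv 2 (azimuth m) = 0 := by simp [hζ]
  have n0 : pderiv 0 nsq = 2 * X 0 := pderiv_nsq 0
  have n1 : pderiv 1 nsq = 2 * X 1 := pderiv_nsq 1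
  have n2 : pderiv 2 nsq = 2 * X 2 := pderiv_nsq 2
  have x00 : pderiv 0 (X 0 : Poly) = 1 := MvPolynomial.pderiv_X_self 0
  have x11 : pderiv 1 (X 1 : Poly) = 1 := MvPolynomial.pderiv_X_self 1
  have x22 : pderiv 2 (X 2 : Poly) = 1 := MvPolynomial.pderiv_X_self 2
  have x02 : pderiv 0 (X 2 : Poly) = 0 := pderiv_X_ne (by decide)
  have x12 : pderiv 1 (X 2 : Poly) = 0 := pderiv_X_ne (by decide)
  have hn : nsq = X 0 ^ 2 + X 1 ^ 2 + X 2 ^ 2 := rfl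
  have cst : ∀ (i : Fin 3) (k : ℕ), pderiv i (k : Poly) = 0 := fun i k => by
    have : (k : Poly) = MvPolynomial.C (k : ℂ) := by simp
    rw [this, MvPolynomial.pderiv_C]
  have cst2 : ∀ i : Fin 3, pderiv i (2 : Poly) = 0 := fun i => cst i 2
  have he : (e : Poly) * ((e - 1 : ℕ) : Poly) * (nsq ^ (e - 1 - 1) * nsq) =
      (e : Poly) * ((e - 1 : ℕ) : Poly) * nsq ^ (e - 1) := by
    rcases e with _ | _ | e
    · simp
    · simp
    · simp only [Nat.add_sub_cancel]; rw [pow_succ]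
  have he1 : (e : Poly) * ((e - 1 : ℕ) : Poly) = (e : Poly) * (e - 1) := by
    rcases e with _ | e
    · simp
    · push_cast [Nat.add_sub_cancel]; ring
  have ha : (a : Poly) * (azimuth m ^ (a - 1) * azimuth m) = a * azimuth m ^ a := by
    rcases a with _ | a
    · simp
    · rw [Nat.add_sub_cancel, pow_succ]
  have hj : (j : Poly) * ((X 2 : Poly) ^ (j - 1) * X 2) = (j : Poly) * (X 2 : Poly) ^ j := by
    rcases j with _ | j
    · simp
    · rw [Nat.add_sub_cancel, pow_succ]
  rw [lap_apply]
  simp only [MvPolynomial.pderiv_mul, MvPolynomial.pderiv_pow, map_add, z0, z1, z2, n0, n1, n2, x00,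
    x11, x22, x02, x12, cst, cst2, mul_zero, zero_mul, add_zero, zero_add, MvPolynomial.pderiv_C,
    Derivation.map_one_eq_zero]
  rw [show j - 1 - 1 = j - 2 by omega]
  linear_combination (exp := 1)
    (a : Poly) * ((a - 1 : ℕ) : Poly) * azimuth m ^ (a - 1 - 1) * X 2 ^ j * nsq ^ e * hc2
    + 4 * e * nsq ^ (e - 1) * X 2 ^ j * ha + 4 * e * azimuth m ^ a * nsq ^ (e - 1) * hj
    + 4 * azimuth m ^ a * X 2 ^ j * he
    + 4 * azimuth m ^ a * X 2 ^ j * nsq ^ (e - 1) * he1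
    - 4 * e * ((e - 1 : ℕ) : Poly) * azimuth m ^ a * X 2 ^ j * nsq ^ (e - 1 - 1) * hn
    - 4 * e * a * nsq ^ (e - 1) * X 2 ^ j * azimuth m ^ (a - 1) * hζ

theorem zonal_eq_sum {n a : ℕ} (ha : a ≤ n) : zonal n a = ∑ j ∈ Finset.range (n - a + 3),
    MvPolynomial.C (legCoeff n a j : ℂ) * (X 2 ^ j * nsq ^ ((n - a - j) / 2)) := by
  rw [zonal, Finset.sum_range_succ _ (n - a + 2), Finset.sum_range_succ _ (n - a + 1),
    legCoeff_eq_zero_of_lt n a (n - a + 2) (by omega),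
    legCoeff_eq_zero_of_lt n a (n - a + 1) (by omega)]
  simp

/-- The power ζ^a of x₁ ± i x₂ is harmonic. The Laplacian of the j-th term of the sum has one part
with x₃^(j-2) and one with x₃^j; collecting equal powers of x₃ leaves the recursion for the Legendre
coefficients. -/
theorem solid_mem_harm {n : ℕ} {m : ℤ} (hm : m.natAbs ≤ n) : solid n m ∈ harm n := by
  refine mem_harm.2 ⟨isHomogeneous_solid hm, ?_⟩
  set a := m.natAbs with ha
  have key : lap (azimuth m ^ a * zonal n a) = 0 := by
    -- Two zero terms are appended: the part with x₃^(j-2) loses its first two terms through the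
    -- factor j(j-1), the other part its last two through the coefficient, and the two index ranges
    -- match after a shift by 2.
    rw [zonal_eq_sum hm, Finset.mul_sum, map_sum]
    have h1 : ∀ j ∈ Finset.range (n - a + 3), lap (azimuth m ^ a *
        (MvPolynomial.C (legCoeff n a j : ℂ) * (X 2 ^ j * nsq ^ ((n - a - j) / 2)))) =
        azimuth m ^ a * (MvPolynomial.C (legCoeff n a j : ℂ) *
          (((j : Poly) * ((j - 1 : ℕ) : Poly)) * (X 2 ^ (j - 2) * nsq ^ ((n - a - j) / 2)))) +
        azimuth m ^ a * (MvPolynomial.C (legCoeff n a j : ℂ) *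
          ((2 * (((n - a - j) / 2 : ℕ) : Poly) *
            (2 * (a : Poly) + 2 * (j : Poly) + 2 * (((n - a - j) / 2 : ℕ) : Poly) + 1)) *
            (X 2 ^ j * nsq ^ ((n - a - j) / 2 - 1)))) := by
      intro j _
      rw [mul_left_comm, ← MvPolynomial.smul_eq_C_mul, map_smul, lap_azimuth_term,
        MvPolynomial.smul_eq_C_mul]
      ring
    rw [Finset.sum_congr rfl h1, Finset.sum_add_distrib, Finset.sum_range_succ',
      Finset.sum_range_succ']
    rw [Finset.sum_range_succ _ (n - a + 2), Finset.sum_range_succ _ (n - a + 1),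
      legCoeff_eq_zero_of_lt n a (n - a + 2) (by omega),
      legCoeff_eq_zero_of_lt n a (n - a + 1) (by omega)]
    simp only [Complex.ofReal_zero, map_zero, zero_mul, mul_zero, add_zero, Nat.cast_zero,
      zero_add, Nat.sub_self, Nat.add_sub_cancel]
    rw [← Finset.sum_add_distrib]
    refine Finset.sum_eq_zero fun j hj => ?_
    have hj' := Finset.mem_range.1 hj
    by_cases h : 2 ∣ j + n + a
    · have e1 : (n - a - (j + 1 + 1)) / 2 = (n - a - j) / 2 - 1 := by omega
      have e2 : 2 * (((n - a - j) / 2 : ℕ) : Poly) = MvPolynomial.C ((n - a - j : ℝ) : ℂ) := by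
        have : 2 * ((n - a - j) / 2) = n - a - j := by omega
        have h' : ((2 * ((n - a - j) / 2) : ℕ) : Poly) = ((n - a - j : ℕ) : Poly) := by rw [this]
        push_cast at h'
        rw [h', Nat.cast_sub (by omega), Nat.cast_sub hm]
        simp
      have hr := legCoeff_rec n a j
      have hr' := congrArg (fun t : ℝ => (MvPolynomial.C (t : ℂ) : Poly)) hr
      rw [e1, show j + 1 + 1 - 2 = j by omega]
      simp only [e2]
      push_cast at hr' ⊢
      simp only [map_mul, map_add, map_neg, map_sub, map_natCast, map_one, map_ofNat] at hr' ⊢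
      linear_combination azimuth m ^ a * X 2 ^ j * nsq ^ ((n - a - j) / 2 - 1) * hr'
    · rw [legCoeff_eq_zero_of_odd n a j h, legCoeff_eq_zero_of_odd n a (j + 1 + 1) (by omega)]
      simp
  rw [solid, ← MvPolynomial.smul_eq_C_mul, map_smul, key, smul_zero]

end MaxwellCorner
end

noncomputable section
namespace MaxwellCorner

open MvPolynomial (X pderiv)
open Set

/-! ### The solid harmonics form a basis of the harmonic polynomials -/

/-- The exponent of the monomial `x₁^a x₂^b x₃^c`. -/
def expo (a b c : ℕ) : Fin 3 →₀ ℕ :=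
  Finsupp.single 0 a + Finsupp.single 1 b + Finsupp.single 2 c

theorem expo_zero (a b c : ℕ) : expo a b c 0 = a := by simp [expo]
theorem expo_one (a b c : ℕ) : expo a b c 1 = b := by simp [expo]
theorem expo_two (a b c : ℕ) : expo a b c 2 = c := by simp [expo]

theorem eq_expo (d : Fin 3 →₀ ℕ) : d = expo (d 0) (d 1) (d 2) := by
  ext i; fin_cases i <;> simp [expo]

theorem degree_expo (a b c : ℕ) : (expo a b c).degree = a + b + c := by
  rw [Finsupp.degree_eq_sum, Fin.sum_univ_three, expo_zero, expo_one, expo_two]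

theorem expo_add_single (a b c : ℕ) : expo a b c + Finsupp.single 0 1 = expo (a + 1) b c ∧
    expo a b c + Finsupp.single 1 1 = expo a (b + 1) c ∧
    expo a b c + Finsupp.single 2 1 = expo a b (c + 1) := by
  refine ⟨?_, ?_, ?_⟩ <;> ext i <;> fin_cases i <;> simp [expo]

theorem harm_coeff_rec {n : ℕ} {p : Poly} (hp : p ∈ harm n) (a b c : ℕ) :
    ((c : ℂ) + 2) * (c + 1) * p.coeff (expo a b (c + 2)) =
      -(((a : ℂ) + 2) * (a + 1) * p.coeff (expo (a + 2) b c) +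
        ((b : ℂ) + 2) * (b + 1) * p.coeff (expo a (b + 2) c)) := by
  have h := congrArg (MvPolynomial.coeff (expo a b c)) (mem_harm.1 hp).2
  rw [lap_apply] at h
  simp only [MvPolynomial.coeff_add, MvPolynomial.coeff_pderiv, MvPolynomial.coeff_zero,
    (expo_add_single _ _ _).1, (expo_add_single _ _ _).2.1, (expo_add_single _ _ _).2.2,
    expo_zero, expo_one, expo_two] at h
  push_cast at h
  linear_combination h

/-- The equation Δp = 0 expresses coefficients in x₃^(c+2) by coefficients in x₃^c, so p is
determined by p and ∂₃p on the plane x₃ = 0. Counting monomials there gives the dimension bound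
`finrank_harm_le`. -/
theorem harm_coeff_eq_zero {n : ℕ} {p : Poly} (hp : p ∈ harm n)
    (h0 : ∀ a b, a + b = n → p.coeff (expo a b 0) = 0)
    (h1 : ∀ a b, a + b + 1 = n → p.coeff (expo a b 1) = 0) : p = 0 := by
  have hom : ∀ a b c, a + b + c ≠ n → p.coeff (expo a b c) = 0 := fun a b c h =>
    (mem_harm.1 hp).1.coeff_eq_zero (by rwa [degree_expo])
  have key : ∀ c a b, p.coeff (expo a b c) = 0 := by
    intro c
    induction c using Nat.strong_induction_on with
    | _ c ih =>
      intro a b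
      rcases c with _ | _ | c
      · by_cases h : a + b = n
        · exact h0 a b h
        · exact hom a b 0 h
      · by_cases h : a + b + 1 = n
        · exact h1 a b h
        · exact hom a b 1 h
      · have := harm_coeff_rec hp a b c
        rw [ih c (by omega), ih c (by omega), mul_zero, mul_zero, add_zero, neg_zero] at this
        refine (mul_eq_zero.1 this).resolve_left ?_
        have e : ((c : ℂ) + 2) * (c + 1) = (((c + 2) * (c + 1) : ℕ) : ℂ) := by push_cast; ring
        rw [e]; exact Nat.cast_ne_zero.2 (by positivity)
  ext d
  rw [eq_expo d, key, MvPolynomial.coeff_zero]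

theorem finrank_harm_le (n : ℕ) : Module.finrank ℂ (harm n) ≤ 2 * n + 1 := by
  let Φ : harm n →ₗ[ℂ] (Fin (n + 1) → ℂ) × (Fin n → ℂ) :=
    { toFun := fun p => (fun i => MvPolynomial.coeff (expo i (n - i) 0) p.1,
        fun i => MvPolynomial.coeff (expo i (n - 1 - i) 1) p.1)
      map_add' := fun p q => by ext <;> simp
      map_smul' := fun c p => by ext <;> simp }
  have hΦ : Function.Injective Φ := by
    rw [← LinearMap.ker_eq_bot, LinearMap.ker_eq_bot']
    intro p hp
    have h0 := fun i => congrFun (congrArg Prod.fst hp) i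
    have h1 := fun i => congrFun (congrArg Prod.snd hp) i
    refine Subtype.ext (harm_coeff_eq_zero p.2 (fun a b hab => ?_) fun a b hab => ?_)
    · have := h0 ⟨a, by omega⟩
      rwa [show b = n - a by omega]
    · have := h1 ⟨a, by omega⟩
      rwa [show b = n - 1 - a by omega]
  have := LinearMap.finrank_le_finrank_of_injective hΦ
  simp at this
  omega

/-- The infinitesimal rotation about the third axis. -/
def rotZ : Module.End ℂ Poly where
  toFun p := X 0 * pderiv 1 p - X 1 * pderiv 0 p
  map_add' p q := by simp only [map_add]; ring
  map_smul' c p := by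
    simp only [Derivation.map_smul, RingHom.id_apply, smul_sub, mul_smul_comm]

theorem rotZ_apply (p : Poly) : rotZ p = X 0 * pderiv 1 p - X 1 * pderiv 0 p := rfl

theorem rotZ_mul (p q : Poly) : rotZ (p * q) = rotZ p * q + p * rotZ q := by
  simp only [rotZ_apply, MvPolynomial.pderiv_mul]; ring

theorem rotZ_pow_eq_zero {p : Poly} (h : rotZ p = 0) (k : ℕ) : rotZ (p ^ k) = 0 := by
  induction k with
  | zero => simp [rotZ_apply]
  | succ k ih => rw [pow_succ, rotZ_mul, ih, h]; ring

theorem rotZ_zonal (n a : ℕ) : rotZ (zonal n a) = 0 := by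
  have h1 : rotZ (X 2) = 0 := by simp [rotZ_apply]
  have h2 : rotZ nsq = 0 := by rw [rotZ_apply, pderiv_nsq, pderiv_nsq]; ring
  rw [zonal, map_sum]
  refine Finset.sum_eq_zero fun j _ => ?_
  rw [← MvPolynomial.smul_eq_C_mul, map_smul, rotZ_mul, rotZ_pow_eq_zero h1, rotZ_pow_eq_zero h2]
  simp

theorem rotZ_azimuth_pow (m : ℤ) (k : ℕ) : rotZ (azimuth m ^ k) =
    (k * (if 0 ≤ m then Complex.I else -Complex.I)) • azimuth m ^ k := by
  set c : ℂ := if 0 ≤ m then Complex.I else -Complex.I with hc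
  have h1 : rotZ (azimuth m) = MvPolynomial.C c * azimuth m := by
    have hc2 : (MvPolynomial.C c : Poly) ^ 2 = -1 := by
      rw [← map_pow, hc, azimuth_sq]; simp
    rw [rotZ_apply, azimuth, ← hc]
    simp
    linear_combination -X 1 * hc2
  induction k with
  | zero => simp [rotZ_apply]
  | succ k ih =>
    rw [pow_succ, rotZ_mul, ih, h1, MvPolynomial.smul_eq_C_mul, MvPolynomial.smul_eq_C_mul]
    push_cast
    simp only [map_mul, map_add, map_natCast, map_one]
    ring

/-- Distinct orders have distinct eigenvalues im, which yields linear independence without computing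
any integral. -/
theorem rotZ_solid (n : ℕ) (m : ℤ) : rotZ (solid n m) = (Complex.I * m) • solid n m := by
  have hm : (m.natAbs : ℂ) * (if 0 ≤ m then Complex.I else -Complex.I) = Complex.I * m := by
    rw [← Int.cast_natCast (R := ℂ), Int.natCast_natAbs]
    split_ifs with h
    · rw [abs_of_nonneg h]; ring
    · rw [abs_of_neg (not_le.1 h)]; push_cast; ring
  rw [solid, ← MvPolynomial.smul_eq_C_mul, map_smul, rotZ_mul, rotZ_zonal, rotZ_azimuth_pow, hm]
  simp only [mul_zero, add_zero, smul_mul_assoc]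
  rw [smul_comm]

theorem zonal_ne_zero {n a : ℕ} (ha : a ≤ n) : zonal n a ≠ 0 := by
  intro h
  -- At the complex point (i, 0, 1) the form |x|² vanishes, so only the top coefficient in x₃
  -- remains.
  have h1 := congrArg (MvPolynomial.eval ![Complex.I, 0, 1]) h
  rw [zonal, map_sum, map_zero, Finset.sum_range_succ, Finset.sum_eq_zero fun j hj => ?_] at h1
  · simp [nsq] at h1
    exact legCoeff_top_ne_zero ha h1
  · have hj' := Finset.mem_range.1 hj
    by_cases hd : 2 ∣ j + n + a
    · have : (n - a - j) / 2 ≠ 0 := by omega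
      simp [nsq, this]
    · rw [legCoeff_eq_zero_of_odd n a j hd]; simp

theorem azimuth_ne_zero (m : ℤ) : azimuth m ≠ 0 := by
  intro h
  have h1 := congrArg (MvPolynomial.eval ![1, 0, 0]) h
  simp [azimuth] at h1

theorem harmNorm_pos (n a : ℕ) : 0 < harmNorm n a :=
  Real.sqrt_pos.2 (by have := Real.pi_pos; positivity)

theorem solid_ne_zero {n : ℕ} {m : ℤ} (hm : m.natAbs ≤ n) : solid n m ≠ 0 := by
  refine mul_ne_zero ?_ (mul_ne_zero (pow_ne_zero _ (azimuth_ne_zero m)) (zonal_ne_zero hm))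
  rw [ne_eq, MvPolynomial.C_eq_zero, Complex.ofReal_eq_zero]
  exact (harmNorm_pos _ _).ne'

/-- The admissible orders of spherical harmonics of degree `n`. -/
def orders (n : ℕ) : Finset ℤ := Finset.Icc (-(n : ℤ)) n

theorem mem_orders {n : ℕ} {m : ℤ} : m ∈ orders n ↔ m.natAbs ≤ n := by
  rw [orders, Finset.mem_Icc]; omega

theorem linearIndependent_solid (n : ℕ) :
    LinearIndependent ℂ fun m : orders n => solid n m := by
  refine Module.End.eigenvectors_linearIndependent' rotZ (fun m : orders n => Complex.I * (m : ℤ))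
    (fun m m' h => ?_) _ fun m => ?_
  · have : ((m : ℤ) : ℂ) = (m' : ℤ) := mul_left_cancel₀ Complex.I_ne_zero h
    exact Subtype.ext (by exact_mod_cast this)
  · exact ⟨Module.End.mem_eigenspace_iff.2 (rotZ_solid n m), solid_ne_zero (mem_orders.1 m.2)⟩

/-- There are 2n + 1 independent solid harmonics in a space of dimension at most 2n + 1. -/
theorem exists_solid_sum {n : ℕ} {P : Poly} (hP : P ∈ harm n) :
    ∃ c : ℤ → ℂ, P = ∑ m ∈ orders n, c m • solid n m := by
  have hle : Submodule.span ℂ (range fun m : orders n => solid n m) ≤ harm n := by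
    rw [Submodule.span_le]
    rintro _ ⟨m, rfl⟩
    exact solid_mem_harm (mem_orders.1 m.2)
  have hcard : Fintype.card (orders n) = 2 * n + 1 := by
    rw [Fintype.card_coe, orders, Int.card_Icc]; omega
  have heq := Submodule.eq_of_le_of_finrank_le hle
    (by rw [finrank_span_eq_card (linearIndependent_solid n), hcard]; exact finrank_harm_le n)
  rw [← heq, Submodule.mem_span_range_iff_exists_fun] at hP
  obtain ⟨c, hc⟩ := hP
  refine ⟨fun m => if h : m ∈ orders n then c ⟨m, h⟩ else 0, ?_⟩
  rw [← hc, ← Finset.sum_coe_sort (orders n)]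
  refine Finset.sum_congr rfl fun m _ => ?_
  simp

/-! ### Spherical waves as multipoles -/

theorem eval_iterate_derivative_legendre (n a : ℕ) (t : ℝ) :
    (Polynomial.derivative^[a] (legendre n)).eval t =
      ∑ j ∈ Finset.range (n - a + 1), legCoeff n a j * t ^ j := by
  refine Polynomial.eval_eq_sum_range' (Nat.lt_succ_of_le ?_) t
  rw [Polynomial.natDegree_le_iff_coeff_eq_zero]
  intro N hN
  exact legCoeff_eq_zero_of_lt n a N (by omega)

theorem pev_zonal {n a : ℕ} {w : R3} (hw : ‖w‖ = 1) : pev (zonal n a) w =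
    (((Polynomial.derivative^[a] (legendre n)).eval (w 2) : ℝ) : ℂ) := by
  rw [eval_iterate_derivative_legendre, zonal, pev_sum]
  push_cast
  refine Finset.sum_congr rfl fun j _ => ?_
  rw [pev_mul, pev_mul, pev_pow, pev_pow, pev_nsq, hw, pev_C, pev_X]
  simp

/-- Polar form of x₁ + i x₂, whose modulus on the sphere is √(1 - x₃²). At the poles the modulus is
zero, so the default value of the argument does no harm. -/
theorem pev_azimuth {w : R3} (hw : ‖w‖ = 1) (m : ℤ) (k : ℕ) (hk : (k : ℤ) = |m|) :
    pev (azimuth m ^ k) w = ((Real.sqrt (1 - w 2 ^ 2) : ℝ) : ℂ) ^ k *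
      Complex.exp (Complex.I * m * (Complex.arg ((w 0 : ℂ) + Complex.I * (w 1 : ℂ)) : ℝ)) := by
  set z : ℂ := (w 0 : ℂ) + Complex.I * (w 1 : ℂ) with hz
  have hnorm : ‖z‖ = Real.sqrt (1 - w 2 ^ 2) := by
    have h1 : w 0 ^ 2 + w 1 ^ 2 + w 2 ^ 2 = 1 := by
      have := EuclideanSpace.norm_sq_eq w
      rw [hw, Fin.sum_univ_three] at this
      simp only [Real.norm_eq_abs, sq_abs] at this
      linarith
    rw [Complex.norm_def, Complex.normSq_apply]
    congr 1
    simp [hz]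
    linarith
  have hpolar := Complex.norm_mul_exp_arg_mul_I z
  rw [pev_pow, ← hnorm]
  rcases le_or_gt 0 m with h | h
  · have e1 : pev (azimuth m) w = z := by simp [azimuth, h, hz]
    have e2 : (m : ℂ) = k := by rw [abs_of_nonneg h] at hk; rw [← hk]; simp
    rw [e1, e2, show Complex.I * (k : ℂ) * (z.arg : ℂ) = k * (z.arg * Complex.I) by ring,
      Complex.exp_nat_mul, ← mul_pow, hpolar]
  · have e1 : pev (azimuth m) w = (starRingEnd ℂ) z := by
      simp [azimuth, not_le.2 h, hz]
    have e2 : (m : ℂ) = -k := by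
      rw [abs_of_neg h] at hk
      have : m = -(k : ℤ) := by omega
      rw [this]; simp
    have h3 : (starRingEnd ℂ) z = (‖z‖ : ℂ) * Complex.exp (-(z.arg * Complex.I)) := by
      conv_lhs => rw [← hpolar]
      rw [map_mul, Complex.conj_ofReal, ← Complex.exp_conj]
      simp
    rw [e1, e2, show Complex.I * (-(k : ℂ)) * (z.arg : ℂ) = k * (-(z.arg * Complex.I)) by ring,
      Complex.exp_nat_mul, ← mul_pow, h3]

theorem sphHarm_eq {w : R3} (hw : ‖w‖ = 1) (n : ℕ) (m : ℤ) :
    sphHarm n m w = pev (solid n m) w := by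
  have hw2 : |w 2| ≤ 1 := by
    have := PiLp.norm_apply_le w 2
    rwa [hw, Real.norm_eq_abs] at this
  rw [sphHarm, sphHarmAngle, Real.cos_arccos (abs_le.1 hw2).1 (abs_le.1 hw2).2, assocLegendre, solid,
    pev_mul, pev_mul, pev_C, pev_azimuth hw m m.natAbs (Int.natCast_natAbs m), pev_zonal hw, harmNorm]
  push_cast
  ring

theorem norm_dir {x : R3} (hx : x ≠ 0) : ‖dir x‖ = 1 := by
  rw [dir, norm_smul, norm_inv, norm_norm, inv_mul_cancel₀ (norm_ne_zero_iff.2 hx)]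

theorem pev_dir {n : ℕ} {p : Poly} (hp : p.IsHomogeneous n) {x : R3} (hx : x ≠ 0) :
    pev p x = (‖x‖ : ℂ) ^ n * pev p (dir x) := by
  rw [← pev_homog hp, dir, smul_smul, mul_inv_cancel₀ (norm_ne_zero_iff.2 hx), one_smul]

theorem partialDeriv_norm_pow (n : ℕ) (i : Fin 3) {w : R3} (hw : ‖w‖ = 1) :
    DifferentiableAt ℝ (fun y : R3 => ((‖y‖ : ℝ) : ℂ) ^ n) w ∧
    partialDeriv i (fun y : R3 => ((‖y‖ : ℝ) : ℂ) ^ n) w = n * w i := by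
  have hw0 : w ≠ 0 := by intro h; rw [h, norm_zero] at hw; exact zero_ne_one hw
  have h1 : HasFDerivAt (fun y : R3 => ‖y‖) (innerSL ℝ w) w := by
    have := ((hasStrictFDerivAt_norm_sq w).hasFDerivAt).sqrt (by rw [hw]; norm_num)
    have e : (fun y : R3 => Real.sqrt (‖y‖ ^ 2)) = fun y => ‖y‖ :=
      funext fun y => Real.sqrt_sq (norm_nonneg y)
    rw [e] at this
    convert! this using 1
    ext v
    simp [hw]
  have h2 := (Complex.ofRealCLM.hasFDerivAt.comp w (h1.pow n))
  have e : (fun y : R3 => ((‖y‖ : ℝ) : ℂ) ^ n) = Complex.ofRealCLM ∘ fun y : R3 => ‖y‖ ^ n := by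
    funext y; simp
  rw [e]
  refine ⟨h2.differentiableAt, ?_⟩
  rw [partialDeriv_eq h2]
  simp [hw, EuclideanSpace.inner_single_right]

/-- Differentiate S(y) = |y|^n f(y), with f constant along rays, at |w| = 1. The subtracted multiple
of w disappears in the cross product that defines `sphT`. -/
theorem surfaceGrad_eq {n : ℕ} {m : ℤ} (hm : m.natAbs ≤ n) {w : R3} (hw : ‖w‖ = 1) (i : Fin 3) :
    surfaceGrad (sphHarm n m) w i =
      pev (pderiv i (solid n m)) w - n * w i * pev (solid n m) w := by
  have hw0 : w ≠ 0 := by intro h; rw [h, norm_zero] at hw; exact zero_ne_one hw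
  set f : R3 → ℂ := fun y => sphHarm n m (dir y) with hf
  have hfd : DifferentiableAt ℝ f w := by
    have h1 : f =ᶠ[nhds w] fun y => pev (solid n m) (dir y) := by
      filter_upwards [isOpen_ne.mem_nhds hw0] with y hy
      exact sphHarm_eq (norm_dir hy) n m
    refine DifferentiableAt.congr_of_eventuallyEq ?_ h1
    refine (differentiable_pev (solid n m) _).comp w ?_
    exact ((contDiffAt_norm ℝ hw0 (n := 1)).differentiableAt (by simp)).inv (by rw [hw]; norm_num)
      |>.smul differentiableAt_id
  have h1 : pev (solid n m) =ᶠ[nhds w] fun y => ((‖y‖ : ℝ) : ℂ) ^ n * f y := by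
    filter_upwards [isOpen_ne.mem_nhds hw0] with y hy
    rw [pev_dir (isHomogeneous_solid hm) hy, hf]
    simp only [sphHarm_eq (norm_dir hy)]
  have h2 := partialDeriv_congr h1 i
  obtain ⟨d1, d2⟩ := partialDeriv_norm_pow n i hw
  rw [partialDeriv_pev, partialDeriv_mul d1 hfd, d2, hw] at h2
  have h3 : f w = pev (solid n m) w := by
    have := h1.self_of_nhds
    simpa [hw] using this.symm
  rw [h3] at h2
  simp only [Complex.ofReal_one, one_pow, one_mul] at h2
  change partialDeriv i f w = _
  rw [h2]; ring

theorem sphT_eq {n : ℕ} {m : ℤ} (hm : m.natAbs ≤ n) {w : R3} (hw : ‖w‖ = 1) (i : Fin 3) :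
    sphT n m w i = (((Real.sqrt ((n : ℝ) * (n + 1)))⁻¹ : ℝ) : ℂ) * pev (rotPoly (solid n m) i) w := by
  have h := surfaceGrad_eq hm hw
  rw [sphT, Pi.smul_apply, smul_eq_mul]
  congr 1
  fin_cases i <;> simp [crossProduct, rotPoly, toC3, h] <;> ring

/-- The factor between the vector spherical waves and the multipoles of the solid harmonics. -/
def waveFactor (ω ε₀ μ₀ : ℝ) (n : ℕ) : ℂ :=
  (((Real.sqrt ((n : ℝ) * (n + 1)))⁻¹ * waveNumber ω ε₀ μ₀ ^ n : ℝ) : ℂ)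

theorem isHomogeneous_rotPoly {n : ℕ} {P : Poly} (hP : P.IsHomogeneous n) (hn : 1 ≤ n) (i : Fin 3) :
    (rotPoly P i).IsHomogeneous n := by
  have h : ∀ a b : Fin 3, (pderiv a P * X b).IsHomogeneous n := fun a b => by
    have := (isHomogeneous_pderiv hP a).mul (MvPolynomial.isHomogeneous_X ℂ b)
    rwa [Nat.sub_add_cancel hn] at this
  fin_cases i
  · exact (h 1 2).sub (h 2 1)
  · exact (h 2 0).sub (h 0 2)
  · exact (h 0 1).sub (h 1 0)

/-- Here j_n(k|x|) = k^n |x|^n b_n(κ|x|²), and |x|^n times the polynomial ∇S ∧ x at x/|x| is its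
value at x. At the origin, where `dir` takes the default value 0, both sides vanish by positivity of
the degree. -/
theorem waveE_eq (ω ε₀ μ₀ : ℝ) {l : ℕ} {m : ℤ} (hm : m.natAbs ≤ l + 1) (x : R3) :
    waveE ω ε₀ μ₀ l m x = waveFactor ω ε₀ μ₀ (l + 1) •
      mField (kap ω ε₀ μ₀) (l + 1) (solid (l + 1) m) x := by
  have hhom := isHomogeneous_rotPoly (isHomogeneous_solid hm) (Nat.succ_pos l)
  ext i
  rw [waveE, Pi.smul_apply, Pi.smul_apply, smul_eq_mul, smul_eq_mul, mField, radTerm, sphBessel_eq]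
  rcases eq_or_ne x 0 with rfl | hx
  · have h0 : pev (rotPoly (solid (l + 1) m) i) 0 = 0 := by
      have := norm_pev_le (hhom i) 0
      rw [norm_zero, zero_pow (Nat.succ_ne_zero l), zero_mul] at this
      exact norm_le_zero_iff.1 this
    rw [h0, norm_zero]
    simp
  · rw [sphT_eq hm (norm_dir hx), pev_dir (hhom i) hx, waveFactor, kap, mul_pow, mul_pow]
    push_cast
    ring

theorem waveH_eq (ω ε₀ μ₀ : ℝ) {l : ℕ} {m : ℤ} (hm : m.natAbs ≤ l + 1) (x : R3) :
    waveH ω ε₀ μ₀ l m x = (-(Complex.I / (ω * μ₀))) • waveFactor ω ε₀ μ₀ (l + 1) •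
      nField (kap ω ε₀ μ₀) (l + 1) (solid (l + 1) m) x := by
  have e : waveE ω ε₀ μ₀ l m = fun y => waveFactor ω ε₀ μ₀ (l + 1) •
      mField (kap ω ε₀ μ₀) (l + 1) (solid (l + 1) m) y +
      (0 : ℂ) • mField (kap ω ε₀ μ₀) (l + 1) (solid (l + 1) m) y :=
    funext fun y => by rw [zero_smul, add_zero]; exact waveE_eq ω ε₀ μ₀ hm y
  rw [waveH, e, curl_lin (differentiable_mField _ _ _) (differentiable_mField _ _ _),
    curl_mField _ (solid_mem_harm hm), zero_smul, add_zero]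

/-- The multipole fields as a linear function of the pair of potentials. -/
def poleMap (ω ε₀ μ₀ : ℝ) (n : ℕ) (x : R3) : Poly × Poly →ₗ[ℂ] C3 × C3 where
  toFun q := (poleE ω ε₀ μ₀ n q.1 q.2 x, poleH ω ε₀ μ₀ n q.1 q.2 x)
  map_add' p q := by
    have h1 : ∀ (P Q : Poly) i, mField (kap ω ε₀ μ₀) n (P + Q) x i =
        mField (kap ω ε₀ μ₀) n P x i + mField (kap ω ε₀ μ₀) n Q x i := fun P Q i => by
      fin_cases i <;> simp [mField, rotPoly, radTerm] <;> ring
    have h2 : ∀ (P Q : Poly) i, nField (kap ω ε₀ μ₀) n (P + Q) x i =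
        nField (kap ω ε₀ μ₀) n P x i + nField (kap ω ε₀ μ₀) n Q x i := fun P Q i => by
      simp [nField, gradPart, radialPart, radTerm]; ring
    ext i
    · simp [poleE, h1, h2]; ring
    · simp [poleH, h1, h2]; ring
  map_smul' c p := by
    have h1 : ∀ (P : Poly) i, mField (kap ω ε₀ μ₀) n (c • P) x i =
        c * mField (kap ω ε₀ μ₀) n P x i := fun P i => by
      fin_cases i <;> simp [mField, rotPoly, radTerm, Derivation.map_smul] <;> ring
    have h2 : ∀ (P : Poly) i, nField (kap ω ε₀ μ₀) n (c • P) x i =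
        c * nField (kap ω ε₀ μ₀) n P x i := fun P i => by
      simp [nField, gradPart, radialPart, radTerm, Derivation.map_smul]; ring
    ext i
    · simp [poleE, h1, h2]; ring
    · simp [poleH, h1, h2]; ring

theorem poleMap_apply (ω ε₀ μ₀ : ℝ) (n : ℕ) (x : R3) (A B : Poly) :
    poleMap ω ε₀ μ₀ n x (A, B) = (poleE ω ε₀ μ₀ n A B x, poleH ω ε₀ μ₀ n A B x) := rfl

theorem mField_zero (κ : ℝ) (n : ℕ) (x : R3) : mField κ n 0 x = 0 := by
  ext i; fin_cases i <;> simp [mField, rotPoly, radTerm]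

theorem nField_zero (κ : ℝ) (n : ℕ) (x : R3) : nField κ n 0 x = 0 := by
  ext i; simp [nField, gradPart, radialPart, radTerm]

theorem waveEH_eq (ω ε₀ μ₀ : ℝ) {l : ℕ} {m : ℤ} (hm : m.natAbs ≤ l + 1) (x : R3) :
    waveEH ω ε₀ μ₀ l m x = poleMap ω ε₀ μ₀ (l + 1) x
      (waveFactor ω ε₀ μ₀ (l + 1) • solid (l + 1) m, 0) := by
  have e : ((waveFactor ω ε₀ μ₀ (l + 1) • solid (l + 1) m, 0) : Poly × Poly) =
      waveFactor ω ε₀ μ₀ (l + 1) • (solid (l + 1) m, 0) := by simp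
  rw [e, map_smul, poleMap_apply, waveEH, waveE_eq ω ε₀ μ₀ hm, waveH_eq ω ε₀ μ₀ hm, poleE, poleH,
    mField_zero, nField_zero, smul_zero, add_zero, add_zero, Prod.smul_mk]
  rw [smul_comm]

theorem waveHE_eq {ω ε₀ μ₀ : ℝ} (hμ₀ : 0 < μ₀) {l : ℕ} {m : ℤ} (hm : m.natAbs ≤ l + 1) (x : R3) :
    waveHE ω ε₀ μ₀ l m x = poleMap ω ε₀ μ₀ (l + 1) x
      (0, waveFactor ω ε₀ μ₀ (l + 1) • solid (l + 1) m) := by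
  have e : ((0, waveFactor ω ε₀ μ₀ (l + 1) • solid (l + 1) m) : Poly × Poly) =
      waveFactor ω ε₀ μ₀ (l + 1) • (0, solid (l + 1) m) := by simp
  rw [e, map_smul, poleMap_apply, waveHE, waveE_eq ω ε₀ μ₀ hm, waveH_eq ω ε₀ μ₀ hm, poleE, poleH,
    mField_zero, nField_zero, smul_zero, zero_add, zero_add, Prod.smul_mk]
  have h3 : (μ₀ : ℂ) ≠ 0 := Complex.ofReal_ne_zero.2 hμ₀.ne'
  have : -((μ₀ : ℂ) / ε₀) * -(Complex.I / (ω * μ₀)) = Complex.I / (ω * ε₀) := by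
    rw [neg_mul_neg, div_mul_div_comm, mul_comm (μ₀ : ℂ), mul_comm (ε₀ : ℂ), mul_right_comm,
      mul_div_mul_right _ _ h3]
  rw [smul_smul, this, smul_comm]

theorem waveFactor_ne_zero {ω ε₀ μ₀ : ℝ} (hω : 0 < ω) (hε₀ : 0 < ε₀) (hμ₀ : 0 < μ₀) {n : ℕ}
    (hn : 1 ≤ n) : waveFactor ω ε₀ μ₀ n ≠ 0 := by
  have hn' : (0 : ℝ) < n := by exact_mod_cast hn
  rw [waveFactor, Complex.ofReal_ne_zero, waveNumber]
  positivity

end MaxwellCorner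
end

noncomputable section
namespace MaxwellCorner

open MvPolynomial (X pderiv)
open Set

/-! ### Reflections -/

/-- The reflection in the `i`-th coordinate, acting on polynomials. -/
def refl (i : Fin 3) : Poly →ₐ[ℂ] Poly :=
  MvPolynomial.bind₁ fun k => if k = i then -X k else X k

theorem refl_X (i k : Fin 3) : refl i (X k) = if k = i then -X k else X k := by
  simp [refl]

theorem refl_C (i : Fin 3) (c : ℂ) : refl i (MvPolynomial.C c) = MvPolynomial.C c := by
  simp [refl]

theorem coeff_refl (i : Fin 3) (p : Poly) (d : Fin 3 →₀ ℕ) :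
    (refl i p).coeff d = (-1) ^ d i * p.coeff d := by
  induction p using MvPolynomial.induction_on' with
  | add p q hp hq => rw [map_add, MvPolynomial.coeff_add, MvPolynomial.coeff_add, hp, hq]; ring
  | monomial e c =>
    have h : refl i (MvPolynomial.monomial e c) =
        MvPolynomial.C ((-1) ^ e i) * MvPolynomial.monomial e c := by
      rw [MvPolynomial.monomial_eq, map_mul, refl_C, Finsupp.prod_fintype _ _ (fun _ => pow_zero _),
        map_prod, Fin.prod_univ_three, Fin.prod_univ_three, map_pow, map_pow, map_pow, refl_X,
        refl_X, refl_X]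
      fin_cases i <;> simp [neg_pow (X _ : Poly)] <;> ring
    rw [h, MvPolynomial.coeff_C_mul, MvPolynomial.coeff_monomial]
    by_cases hd : e = d <;> simp [hd]

theorem refl_nsq (i : Fin 3) : refl i nsq = nsq := by
  rw [nsq, map_add, map_add, map_pow, map_pow, map_pow, refl_X, refl_X, refl_X]
  fin_cases i <;> simp

theorem refl_zonal_of_ne {i : Fin 3} (hi : i ≠ 2) (n a : ℕ) : refl i (zonal n a) = zonal n a := by
  rw [zonal, map_sum]
  refine Finset.sum_congr rfl fun j _ => ?_
  rw [map_mul, refl_C, map_mul, map_pow, map_pow, refl_nsq, refl_X, if_neg hi.symm]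

theorem refl_zonal_two (n a : ℕ) :
    refl 2 (zonal n a) = (-1 : ℂ) ^ (n + a) • zonal n a := by
  rw [zonal, map_sum, Finset.smul_sum]
  refine Finset.sum_congr rfl fun j _ => ?_
  rw [map_mul, refl_C, map_mul, map_pow, map_pow, refl_nsq, refl_X, if_pos rfl, neg_pow]
  by_cases h : 2 ∣ j + n + a
  · have e : ((-1 : ℂ)) ^ (n + a) = (-1) ^ j :=
      neg_one_pow_congr (by rw [Nat.even_add, Nat.even_iff, Nat.even_iff, Nat.even_iff]; omega)
    rw [e, MvPolynomial.smul_eq_C_mul, map_pow, map_neg, map_one]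
    ring
  · rw [legCoeff_eq_zero_of_odd n a j h]; simp

theorem azimuth_neg_of_ne {m : ℤ} (hm : m ≠ 0) : azimuth (-m) =
    X 0 - MvPolynomial.C (if 0 ≤ m then Complex.I else -Complex.I) * X 1 := by
  rw [azimuth, sub_eq_add_neg]
  congr 1
  rcases lt_or_gt_of_ne hm with h | h
  · rw [if_pos (by omega), if_neg (by omega)]; simp
  · rw [if_neg (by omega), if_pos (by omega)]; simp

theorem refl_azimuth_pow (m : ℤ) :
    refl 0 (azimuth m ^ m.natAbs) = (-1) ^ m.natAbs * azimuth (-m) ^ m.natAbs ∧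
    refl 1 (azimuth m ^ m.natAbs) = azimuth (-m) ^ m.natAbs ∧
    refl 2 (azimuth m ^ m.natAbs) = azimuth m ^ m.natAbs := by
  rcases eq_or_ne m 0 with rfl | hm
  · simp
  · simp only [map_pow]
    rw [azimuth_neg_of_ne hm]
    refine ⟨?_, ?_, ?_⟩
    · rw [← mul_pow]
      congr 1
      simp [azimuth, refl_X]; ring
    · congr 1
      simp [azimuth, refl_X, sub_eq_add_neg]
    · congr 1
      simp [azimuth, refl_X]

/-- Changing the sign of x₂ exchanges x₁ + i x₂ and x₁ - i x₂, changing that of x₁ does the same up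
to sign, and the zonal factor has parity n + |m| in x₃. -/
theorem refl_solid (n : ℕ) (m : ℤ) :
    refl 0 (solid n m) = (-1 : ℂ) ^ m.natAbs • solid n (-m) ∧
    refl 1 (solid n m) = solid n (-m) ∧
    refl 2 (solid n m) = (-1 : ℂ) ^ (n + m.natAbs) • solid n m := by
  obtain ⟨h0, h1, h2⟩ := refl_azimuth_pow m
  simp only [solid, map_mul, refl_C, Int.natAbs_neg]
  rw [h0, h1, h2, refl_zonal_of_ne (by decide), refl_zonal_of_ne (by decide), refl_zonal_two _ _]
  refine ⟨?_, rfl, ?_⟩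
  · rw [MvPolynomial.smul_eq_C_mul, map_pow, map_neg, map_one]; ring
  · rw [MvPolynomial.smul_eq_C_mul, MvPolynomial.smul_eq_C_mul]; ring

/-- The combinations `S_n^{2m} + (-1)^n S_n^{-2m}` of solid harmonics. -/
def leadSolid (n m : ℕ) : Poly := solid n (2 * m) + (-1 : ℂ) ^ n • solid n (-(2 * m))

/-- The range of `m` in the leading part of degree `n`. -/
def leadRange (n : ℕ) : Finset ℕ := Finset.Icc (n % 2) (n / 2)

theorem natAbs_two_mul_le {n m : ℕ} (hm : m ∈ leadRange n) :
    (2 * (m : ℤ)).natAbs ≤ n ∧ (-(2 * (m : ℤ))).natAbs ≤ n := by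
  rw [leadRange, Finset.mem_Icc] at hm
  omega

theorem leadSolid_mem_harm {n m : ℕ} (hm : m ∈ leadRange n) : leadSolid n m ∈ harm n :=
  add_mem (solid_mem_harm (natAbs_two_mul_le hm).1)
    (Submodule.smul_mem _ _ (solid_mem_harm (natAbs_two_mul_le hm).2))

theorem neg_one_pow_mul_self (n : ℕ) : (-1 : ℂ) ^ n * (-1) ^ n = 1 := by
  rw [← mul_pow]; simp

theorem refl_leadSolid {n m : ℕ} (hm : m ∈ leadRange n) (i : Fin 3) :
    refl i (leadSolid n m) = (-1 : ℂ) ^ n • leadSolid n m := by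
  obtain ⟨h1, h2⟩ := natAbs_two_mul_le hm
  have e1 : (2 * (m : ℤ)).natAbs = 2 * m := by omega
  have e2 : (-(2 * (m : ℤ))).natAbs = 2 * m := by omega
  obtain ⟨a0, a1, a2⟩ := refl_solid n (2 * m)
  obtain ⟨b0, b1, b2⟩ := refl_solid n (-(2 * m))
  rw [neg_neg] at b0 b1
  rw [e1] at a0 a2
  rw [e2] at b0 b2
  have e : (-1 : ℂ) ^ (2 * m) = 1 := by rw [pow_mul]; simp
  rw [leadSolid, map_add, map_smul, smul_add, smul_smul, neg_one_pow_mul_self, one_smul]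
  fin_cases i
  · change refl 0 _ + _ • refl 0 _ = _
    rw [a0, b0, e, one_smul, one_smul, add_comm]
  · change refl 1 _ + _ • refl 1 _ = _
    rw [a1, b1, add_comm]
  · change refl 2 _ + _ • refl 2 _ = _
    rw [a2, b2, pow_add, e, mul_one, smul_smul, neg_one_pow_mul_self, one_smul]

/-- Symmetrize an expansion of P in solid harmonics: in x₃, which cancels odd orders, then in x₂,
which pairs m with -m. On even orders the reflections in x₁ and x₂ act alike, so the first
coordinate need not be used. -/
theorem exists_lead_sum {n : ℕ} {P : Poly} (hP : P ∈ harm n)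
    (h : ∀ i, refl i P = (-1 : ℂ) ^ n • P) :
    ∃ c : ℕ → ℂ, P = ∑ m ∈ leadRange n, c m • leadSolid n m := by
  obtain ⟨c, hc⟩ := exists_solid_sum hP
  set L := Submodule.span ℂ (range fun m : leadRange n => leadSolid n m) with hL
  have hTpos : ∀ m : ℕ, m ∈ leadRange n → leadSolid n m ∈ L := fun m hm =>
    Submodule.subset_span ⟨⟨m, hm⟩, rfl⟩
  have hT : ∀ m ∈ orders n, m % 2 = 0 → solid n m + (-1 : ℂ) ^ n • solid n (-m) ∈ L := by
    intro m hm h2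
    have hm' := mem_orders.1 hm
    have hpos : ∀ k : ℤ, 0 < k → k.natAbs ≤ n → k % 2 = 0 →
        solid n k + (-1 : ℂ) ^ n • solid n (-k) ∈ L := by
      intro k hk hkn hk2
      have := hTpos (k.natAbs / 2) (by rw [leadRange, Finset.mem_Icc]; omega)
      rwa [leadSolid, show 2 * ((k.natAbs / 2 : ℕ) : ℤ) = k by omega] at this
    rcases lt_trichotomy m 0 with h0 | rfl | h0
    · have := Submodule.smul_mem L ((-1 : ℂ) ^ n) (hpos (-m) (by omega) (by omega) (by omega))
      rw [smul_add, smul_smul, neg_one_pow_mul_self, one_smul, neg_neg, add_comm] at this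
      exact this
    -- For m = 0 and n odd the combination is zero; this is why the range starts at n % 2.
    · rcases Nat.even_or_odd n with hn | hn
      · have := hTpos 0 (by rw [leadRange, Finset.mem_Icc, Nat.even_iff.1 hn]; omega)
        simpa [leadSolid] using this
      · rw [hn.neg_one_pow]; simp
    · exact hpos m h0 hm' h2
  have hmem : P ∈ L := by
    have e1 : refl 2 P + (-1 : ℂ) ^ n • P = (2 * (-1 : ℂ) ^ n) • P := by
      rw [h 2, ← add_smul, two_mul]
    have e2 : P + (-1 : ℂ) ^ n • refl 1 P = (2 : ℂ) • P := by
      rw [h 1, smul_smul, neg_one_pow_mul_self, one_smul, two_smul]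
    have e3 : (4 * (-1 : ℂ) ^ n) • P = ∑ m ∈ orders n,
        (c m * ((-1) ^ (n + m.natAbs) + (-1) ^ n)) • (solid n m + (-1 : ℂ) ^ n • solid n (-m)) := by
      set Q := refl 2 P + (-1 : ℂ) ^ n • P with hQ
      have hQ1 : Q + (-1 : ℂ) ^ n • refl 1 Q = (4 * (-1 : ℂ) ^ n) • P := by
        rw [e1, map_smul, smul_comm, ← smul_add, e2, smul_smul]; congr 1; ring
      have hQ2 : Q = ∑ m ∈ orders n, (c m * ((-1) ^ (n + m.natAbs) + (-1) ^ n)) • solid n m := by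
        rw [hQ, hc, map_sum, Finset.smul_sum, ← Finset.sum_add_distrib]
        refine Finset.sum_congr rfl fun m hm => ?_
        rw [map_smul, (refl_solid n _).2.2, smul_smul, smul_smul, ← add_smul]
        congr 1; ring
      rw [← hQ1, hQ2, map_sum, Finset.smul_sum, ← Finset.sum_add_distrib]
      refine Finset.sum_congr rfl fun m hm => ?_
      rw [map_smul, (refl_solid n _).2.1, smul_add, smul_comm ((-1 : ℂ) ^ n)]
    have e4 : (4 * (-1 : ℂ) ^ n) • P ∈ L := by
      rw [e3]
      refine Submodule.sum_mem _ fun m hm => ?_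
      by_cases h2 : m % 2 = 0
      · exact Submodule.smul_mem _ _ (hT m hm h2)
      · have : ((-1 : ℂ) ^ (n + m.natAbs) + (-1) ^ n) = 0 := by
          rw [pow_add, (Nat.odd_iff.2 (by omega : m.natAbs % 2 = 1)).neg_one_pow]; ring
        rw [this, mul_zero, zero_smul]
        exact Submodule.zero_mem _
    have hne : (4 * (-1 : ℂ) ^ n) ≠ 0 := by simp
    exact (Submodule.smul_mem_iff L hne).1 e4
  rw [hL, Submodule.mem_span_range_iff_exists_fun] at hmem
  obtain ⟨a, ha⟩ := hmem
  refine ⟨fun m => if h : m ∈ leadRange n then a ⟨m, h⟩ else 0, ?_⟩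
  rw [← ha, ← Finset.sum_coe_sort (leadRange n)]
  exact Finset.sum_congr rfl fun m _ => by simp

/-- The combinations are eigenvectors of the square of `rotZ` with the distinct eigenvalues -(2m)².
-/
theorem linearIndependent_leadSolid (n : ℕ) :
    LinearIndependent ℂ fun m : leadRange n => leadSolid n m := by
  have hrot : ∀ k : ℕ, rotZ (leadSolid n k) = (Complex.I * (2 * k)) •
      (solid n (2 * k) - (-1 : ℂ) ^ n • solid n (-(2 * k))) := fun k => by
    rw [leadSolid, map_add, map_smul, rotZ_solid, rotZ_solid, smul_sub, smul_comm ((-1 : ℂ) ^ n),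
      sub_eq_add_neg, ← neg_smul]
    push_cast
    rw [mul_neg]
  have hrot2 : ∀ k : ℕ, rotZ (rotZ (leadSolid n k)) =
      (-(((2 * k : ℕ) : ℂ) ^ 2)) • leadSolid n k := fun k => by
    rw [hrot, map_smul, map_sub, map_smul, rotZ_solid, rotZ_solid, leadSolid]
    simp only [smul_sub, smul_add, smul_smul]
    push_cast
    rw [sub_eq_add_neg, ← neg_smul]
    congr 2
    · linear_combination 4 * (k : ℂ) ^ 2 * Complex.I_sq
    · linear_combination 4 * (k : ℂ) ^ 2 * (-1) ^ n * Complex.I_sq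
  refine Module.End.eigenvectors_linearIndependent' (rotZ * rotZ)
    (fun m : leadRange n => -(((2 * m : ℕ) : ℂ) ^ 2)) (fun m m' h => ?_) _ fun m => ?_
  · have h1 : ((2 * m : ℕ) : ℂ) ^ 2 = ((2 * m' : ℕ) : ℂ) ^ 2 := neg_injective h
    have h2 : (2 * (m : ℕ)) ^ 2 = (2 * (m' : ℕ)) ^ 2 := by exact_mod_cast h1
    have h3 := Nat.pow_left_injective two_ne_zero h2
    exact Subtype.ext (by simpa using h3)
  · refine ⟨Module.End.mem_eigenspace_iff.2 (hrot2 m), fun h0 => ?_⟩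
    have hm : (m : ℕ) ∈ leadRange n := m.2
    obtain ⟨h1, -⟩ := natAbs_two_mul_le hm
    have hb : n % 2 ≤ (m : ℕ) ∧ (m : ℕ) ≤ n / 2 := Finset.mem_Icc.1 hm
    rcases Nat.eq_zero_or_pos (m : ℕ) with hz | hz
    · rw [hz] at h0 hb
      have hn : Even n := Nat.even_iff.2 (by omega)
      rw [leadSolid, hn.neg_one_pow, one_smul] at h0
      simp only [Nat.cast_zero, mul_zero, neg_zero] at h0
      rw [← two_smul ℂ] at h0
      exact solid_ne_zero (by simp) ((smul_eq_zero.1 h0).resolve_left two_ne_zero)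
    · have h2 := hrot m
      rw [h0, map_zero] at h2
      have h3 := (smul_eq_zero.1 h2.symm).resolve_left (by
        have : ((m : ℕ) : ℂ) ≠ 0 := Nat.cast_ne_zero.2 hz.ne'
        simp [this])
      have h4 : (2 : ℂ) • solid n (2 * (m : ℕ)) = 0 := by
        have h5 : leadSolid n m + (solid n (2 * (m : ℕ)) -
            (-1 : ℂ) ^ n • solid n (-(2 * (m : ℕ)))) = 0 := by rw [h0, h3, add_zero]
        rw [two_smul, ← h5, leadSolid]; abel
      exact solid_ne_zero h1 ((smul_eq_zero.1 h4).resolve_left two_ne_zero)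

theorem lead_sum_ne_zero {n : ℕ} {c : ℕ → ℂ} {m : ℕ} (hm : m ∈ leadRange n) (hc : c m ≠ 0) :
    ∑ m ∈ leadRange n, c m • leadSolid n m ≠ 0 := by
  intro h
  rw [← Finset.sum_coe_sort (leadRange n)] at h
  exact hc (Fintype.linearIndependent_iff.1 (linearIndependent_leadSolid n)
    (fun m : leadRange n => c m) h ⟨m, hm⟩)

end MaxwellCorner
end

noncomputable section
namespace MaxwellCorner

open MvPolynomial (X pderiv)
open Set

/-! ### Divisibility of the gradient and parity -/

theorem step_ne_zero (a : ℕ) : ((a : ℂ) + 2) * (a + 1) ≠ 0 := by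
  have h : (a : ℂ) + 2 = ((a + 2 : ℕ) : ℂ) := by push_cast; ring
  rw [h]
  exact mul_ne_zero (Nat.cast_ne_zero.2 (by omega)) (Nat.cast_add_one_ne_zero a)

/-- The relation Δp = 0 expresses a coefficient with exponent e + 2 in one variable through two
coefficients with exponent e in that variable. Vanishing at exponent e thus spreads to all e + 2k.
-/
theorem harm_coeff_eq_zero_of_parity {n : ℕ} {p : Poly} (hp : p ∈ harm n) {e : ℕ}
    (h : ∀ (d : Fin 3 →₀ ℕ) (i : Fin 3), d i = e → p.coeff d = 0) (d : Fin 3 →₀ ℕ) (i : Fin 3)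
    (k : ℕ) (hd : d i = e + 2 * k) : p.coeff d = 0 := by
  have h0 : ∀ k b c, p.coeff (expo (e + 2 * k) b c) = 0 := fun k => by
    induction k with
    | zero => exact fun b c => h _ 0 (by simp [expo])
    | succ k ih =>
      intro b c
      have := harm_coeff_rec hp (e + 2 * k) b c
      rw [ih, ih, mul_zero, mul_zero, add_zero, zero_eq_neg] at this
      exact (mul_eq_zero.1 this).resolve_left (step_ne_zero _)
  have h1 : ∀ k a c, p.coeff (expo a (e + 2 * k) c) = 0 := fun k => by
    induction k with
    | zero => exact fun a c => h _ 1 (by simp [expo])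
    | succ k ih =>
      intro a c
      have := harm_coeff_rec hp a (e + 2 * k) c
      rw [ih, ih, mul_zero, mul_zero, zero_add, zero_eq_neg] at this
      exact (mul_eq_zero.1 this).resolve_left (step_ne_zero _)
  have h2 : ∀ k a b, p.coeff (expo a b (e + 2 * k)) = 0 := fun k => by
    induction k with
    | zero => exact fun a b => h _ 2 (by simp [expo])
    | succ k ih =>
      intro a b
      have := harm_coeff_rec hp a b (e + 2 * k)
      rw [ih, ih, mul_zero, mul_zero, add_zero, neg_zero] at this
      exact (mul_eq_zero.1 this).resolve_left (step_ne_zero _)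
  rw [eq_expo d]
  fin_cases i
  · have hd' : d 0 = e + 2 * k := hd
    rw [hd']; exact h0 k _ _
  · have hd' : d 1 = e + 2 * k := hd
    rw [hd']; exact h1 k _ _
  · have hd' : d 2 = e + 2 * k := hd
    rw [hd']; exact h2 k _ _

theorem refl_eq_iff (n : ℕ) (p : Poly) : (∀ i, refl i p = (-1 : ℂ) ^ n • p) ↔
    ∀ d, p.coeff d ≠ 0 → ∀ i, (n + d i) % 2 = 0 := by
  constructor
  · intro h d hd i
    have := congrArg (MvPolynomial.coeff d) (h i)
    rw [coeff_refl, MvPolynomial.coeff_smul, smul_eq_mul] at this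
    have h1 : (-1 : ℂ) ^ (n + d i) = 1 := by
      rw [pow_add, mul_right_cancel₀ hd this, ← pow_add, ← two_mul, pow_mul]; simp
    exact Nat.even_iff.1 ((neg_one_pow_eq_one_iff_even (by norm_num)).1 h1)
  · intro h i
    ext d
    rw [coeff_refl, MvPolynomial.coeff_smul, smul_eq_mul]
    by_cases hd : p.coeff d = 0
    · rw [hd, mul_zero, mul_zero]
    · congr 1
      exact neg_one_pow_congr (by
        have := h d hd i
        rw [Nat.even_iff, Nat.even_iff]; omega)

theorem exists_monomial_factor {N : ℕ} {p : Poly} (hp : p.IsHomogeneous N) {s : Fin 3 →₀ ℕ}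
    (h : ∀ d, p.coeff d ≠ 0 → s ≤ d) :
    ∃ Q : Poly, Q.IsHomogeneous (N - s.degree) ∧ p = MvPolynomial.monomial s 1 * Q := by
  refine ⟨p.divMonomial s, fun d hd => ?_, ?_⟩
  · rw [MvPolynomial.coeff_divMonomial] at hd
    have := hp hd
    rw [Finsupp.weight_apply] at this ⊢
    simp only [Pi.one_apply, smul_eq_mul, mul_one] at this ⊢
    rw [Finsupp.sum_add_index' (fun _ => rfl) (fun _ _ _ => rfl)] at this
    rw [Finsupp.degree_apply]
    exact Nat.eq_sub_of_add_eq' this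
  · ext d
    rw [MvPolynomial.coeff_monomial_mul', one_mul, MvPolynomial.coeff_divMonomial]
    split_ifs with hs
    · rw [add_tsub_cancel_of_le hs]
    · by_contra hd
      exact hs (h d hd)

/-- The exponent of `∏_{i ≠ j} x_i`. -/
def offExpo (j : Fin 3) : Fin 3 →₀ ℕ := ∑ i ∈ Finset.univ.erase j, Finsupp.single i 1

theorem offExpo_apply (j i : Fin 3) : offExpo j i = if i = j then 0 else 1 := by
  rw [offExpo, Finsupp.finsetSum_apply]
  simp only [Finsupp.single_apply, Finset.sum_ite_eq', Finset.mem_erase, Finset.mem_univ, and_true]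
  by_cases h : i = j <;> simp [h]

theorem degree_offExpo (j : Fin 3) : (offExpo j).degree = 2 := by
  rw [Finsupp.degree_eq_sum, Fin.sum_univ_three, offExpo_apply, offExpo_apply, offExpo_apply]
  fin_cases j <;> simp

theorem pev_monomial_offExpo (j : Fin 3) (x : R3) :
    pev (MvPolynomial.monomial (offExpo j) 1) x = ∏ i ∈ Finset.univ.erase j, (x i : ℂ) := by
  rw [offExpo, MvPolynomial.monomial_sum_one, pev, map_prod]
  exact Finset.prod_congr rfl fun i _ => MvPolynomial.eval_X i

theorem oddForm_iff {N : ℕ} (hN : Odd N) {P : Poly} (hP : P ∈ harm (N + 1)) {c : ℂ} (hc : c ≠ 0) :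
    OddForm N (fun x i => c * pev (pderiv i P) x) ↔ ∀ i, refl i P = (-1 : ℂ) ^ (N + 1) • P := by
  have hN2 := Nat.odd_iff.1 hN
  rw [refl_eq_iff]
  constructor
  · rintro ⟨Q, -, hQ⟩ d hd i
    by_contra hdi
    -- The degree N + 1 is even, so the exponents to exclude are the odd ones. Divisibility of ∂_j P
    -- by x_j excludes exponent 1 of x_j, since such a monomial would leave a term free of x_j.
    refine hd (harm_coeff_eq_zero_of_parity hP (e := 1) (fun d j hj => ?_) d i (d i / 2) (by omega))
    have h1 : MvPolynomial.C c * pderiv j P = X j * Q j := pev_injective fun x => by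
      rw [pev_mul, pev_mul, pev_C, pev_X]
      exact hQ x j
    have h2 := congrArg (MvPolynomial.coeff (d - Finsupp.single j 1)) h1
    rw [MvPolynomial.coeff_C_mul, MvPolynomial.coeff_pderiv, MvPolynomial.coeff_X_mul',
      if_neg (by simp [hj]), tsub_add_cancel_of_le (Finsupp.single_le_iff.2 hj.ge)] at h2
    simpa [hj, hc] using h2
  · intro h
    have h1 : ∀ j, ∃ Q : Poly, Q.IsHomogeneous (N - 1) ∧ pderiv j P = X j * Q := fun j => by
      obtain ⟨Q, hQ, e⟩ := exists_monomial_factor (s := Finsupp.single j 1)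
        (isHomogeneous_pderiv (mem_harm.1 hP).1 j) (fun d hd => by
          rw [MvPolynomial.coeff_pderiv] at hd
          have := h _ (left_ne_zero_of_mul hd) j
          rw [Finsupp.add_apply, Finsupp.single_eq_same] at this
          exact Finsupp.single_le_iff.2 (by omega))
      exact ⟨Q, by simpa using hQ, e⟩
    choose Q hQ hQ' using h1
    refine ⟨fun j => MvPolynomial.C c * Q j, fun j => ?_, fun x j => ?_⟩
    · simpa using (MvPolynomial.isHomogeneous_C (Fin 3) c).mul (hQ j)
    · simp only [hQ']
      rw [← pev]
      simp only [pev_mul, pev_C, pev_X]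
      ring

theorem evenForm_iff {N : ℕ} (hN : Even N) {P : Poly} (hP : P ∈ harm (N + 1)) {c : ℂ} (hc : c ≠ 0) :
    EvenForm N (fun x i => c * pev (pderiv i P) x) ↔ ∀ i, refl i P = (-1 : ℂ) ^ (N + 1) • P := by
  have hN2 := Nat.even_iff.1 hN
  rw [refl_eq_iff]
  constructor
  · rintro ⟨Q, -, hQ⟩ d hd i
    by_contra hdi
    -- The degree N + 1 is odd, so the exponents to exclude are the even ones. A monomial without
    -- x_j has positive degree and so contains some other x_k; its ∂_k derivative would not be
    -- divisible by x_j.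
    refine hd (harm_coeff_eq_zero_of_parity hP (e := 0) (fun d j hj => ?_) d i (d i / 2) (by omega))
    by_contra hd
    have hdeg : d 0 + d 1 + d 2 = N + 1 := by
      have := (mem_harm.1 hP).1 hd
      rw [Finsupp.weight_apply, Finsupp.sum_fintype _ _ (fun _ => by simp), Fin.sum_univ_three] at this
      simpa using this
    obtain ⟨k, hk⟩ : ∃ k, d k ≠ 0 := by
      by_contra! h0
      rw [h0, h0, h0] at hdeg
      omega
    have hjk : j ≠ k := fun h => hk (h ▸ hj)
    have h1 : MvPolynomial.C c * pderiv k P = MvPolynomial.monomial (offExpo k) 1 * Q k :=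
      pev_injective fun x => by
        rw [pev_mul, pev_mul, pev_monomial_offExpo, pev_C, mul_comm (∏ i ∈ _, _)]
        exact hQ x k
    have h2 := congrArg (MvPolynomial.coeff (d - Finsupp.single k 1)) h1
    rw [MvPolynomial.coeff_C_mul, MvPolynomial.coeff_pderiv, MvPolynomial.coeff_monomial_mul',
      if_neg, tsub_add_cancel_of_le (Finsupp.single_le_iff.2 (Nat.one_le_iff_ne_zero.2 hk))] at h2
    · refine mul_ne_zero hc (mul_ne_zero hd ?_) h2
      exact Nat.cast_add_one_ne_zero _
    · intro hle
      have := hle j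
      rw [offExpo_apply, if_neg hjk, Finsupp.tsub_apply, hj] at this
      omega
  · intro h
    have h1 : ∀ j, ∃ Q : Poly, Q.IsHomogeneous (N - 2) ∧
        pderiv j P = MvPolynomial.monomial (offExpo j) 1 * Q := fun j => by
      obtain ⟨Q, hQ, e⟩ := exists_monomial_factor (s := offExpo j)
        (isHomogeneous_pderiv (mem_harm.1 hP).1 j) (fun d hd => by
          rw [MvPolynomial.coeff_pderiv] at hd
          intro i
          rw [offExpo_apply]
          split_ifs with hij
          · exact Nat.zero_le _
          · have := h _ (left_ne_zero_of_mul hd) i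
            rw [Finsupp.add_apply, Finsupp.single_eq_of_ne hij] at this
            omega)
      rw [degree_offExpo] at hQ
      exact ⟨Q, hQ, e⟩
    choose Q hQ hQ' using h1
    refine ⟨fun j => MvPolynomial.C c * Q j, fun j => ?_, fun x j => ?_⟩
    · simpa using (MvPolynomial.isHomogeneous_C (Fin 3) c).mul (hQ j)
    · simp only [hQ']
      rw [← pev, ← pev_monomial_offExpo]
      simp only [pev_mul, pev_C]
      ring

end MaxwellCorner
end

noncomputable section
namespace MaxwellCorner

open MvPolynomial (X pderiv)
open Set

/-! ### Power series from homogeneous polynomials -/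

/-- `p` is the diagonal of a `k`-linear form of norm at most `M`. -/
def MultiBound (k : ℕ) (p : Poly) (M : ℝ) : Prop :=
  ∃ m : ContinuousMultilinearMap ℝ (fun _ : Fin k => R3) ℂ,
    (∀ x, m (fun _ => x) = pev p x) ∧ ‖m‖ ≤ M

namespace MultiBound

variable {k : ℕ} {p q : Poly} {M M' : ℝ}

theorem nonneg (h : MultiBound k p M) : 0 ≤ M := by
  obtain ⟨m, -, hm⟩ := h
  exact (norm_nonneg m).trans hm

theorem mono (h : MultiBound k p M) (hM : M ≤ M') : MultiBound k p M' := by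
  obtain ⟨m, h1, h2⟩ := h
  exact ⟨m, h1, h2.trans hM⟩

theorem zero (hM : 0 ≤ M) : MultiBound k 0 M := ⟨0, by simp, by simpa using hM⟩

theorem add (hp : MultiBound k p M) (hq : MultiBound k q M') : MultiBound k (p + q) (M + M') := by
  obtain ⟨m, h1, h2⟩ := hp
  obtain ⟨m', h1', h2'⟩ := hq
  exact ⟨m + m', fun x => by simp [h1, h1'], (norm_add_le _ _).trans (add_le_add h2 h2')⟩

theorem smul (hp : MultiBound k p M) (c : ℂ) : MultiBound k (c • p) (‖c‖ * M) := by
  obtain ⟨m, h1, h2⟩ := hp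
  exact ⟨c • m, fun x => by simp [h1], by rw [norm_smul]; gcongr⟩

theorem sub (hp : MultiBound k p M) (hq : MultiBound k q M') : MultiBound k (p - q) (M + M') := by
  have := hp.add (hq.smul (-1))
  simpa [sub_eq_add_neg] using this

theorem X_mul (hp : MultiBound k p M) (i : Fin 3) : MultiBound (k + 1) (X i * p) M := by
  obtain ⟨m, h1, h2⟩ := hp
  refine ⟨((EuclideanSpace.proj i : R3 →L[ℝ] ℝ).smulRight m).uncurryLeft, fun x => ?_, ?_⟩
  · rw [ContinuousLinearMap.uncurryLeft_apply]
    have : Fin.tail (fun _ : Fin (k + 1) => x) = fun _ => x := rfl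
    simp [this, h1]
  · rw [ContinuousLinearMap.uncurryLeft_norm, ContinuousLinearMap.norm_smulRight_apply]
    refine (mul_le_of_le_one_left (norm_nonneg m) ?_).trans h2
    refine ContinuousLinearMap.opNorm_le_bound _ zero_le_one fun x => ?_
    simpa using PiLp.norm_apply_le x i

theorem nsq_pow_mul (hp : MultiBound k p M) (j : ℕ) : MultiBound (k + 2 * j) (nsq ^ j * p) (3 ^ j * M) := by
  induction j with
  | zero => simpa using hp
  | succ j ih =>
    have h := (((ih.X_mul 0).X_mul 0).add ((ih.X_mul 1).X_mul 1)).add ((ih.X_mul 2).X_mul 2)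
    convert! h using 1
    · rw [nsq]; ring
    · ring

end MultiBound

/-- Euler's identity writes p as the sum of x_i ∂_i p divided by its degree, so a multilinear form
is built by induction on the degree. The Bernstein factor grows like the degree and is balanced by
this division, so each step costs the fixed factor 6 `bernstein` + 1. -/
theorem multiBound_harm {n : ℕ} : ∀ {p : Poly}, p ∈ harm n →
    MultiBound n p ((6 * bernstein + 1) ^ n * supS p) := by
  have hb := bernstein_nonneg
  induction n with
  | zero =>
    intro p hp
    obtain ⟨c, rfl⟩ : ∃ c, p = MvPolynomial.C c :=
      ⟨p.coeff 0, MvPolynomial.totalDegree_eq_zero_iff_eq_C.1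
        (Nat.le_zero.1 (mem_harm.1 hp).1.totalDegree_le)⟩
    refine ⟨ContinuousMultilinearMap.constOfIsEmpty ℝ _ c, by simp, ?_⟩
    rw [pow_zero, one_mul, ContinuousMultilinearMap.norm_constOfIsEmpty]
    simpa using norm_pev_le (mem_harm.1 hp).1 (EuclideanSpace.single 0 1)
  | succ n ih =>
    intro p hp
    have hn : ((n + 1 : ℕ) : ℂ) ≠ 0 := Nat.cast_ne_zero.2 n.succ_ne_zero
    have hn' : (0 : ℝ) < (n + 1 : ℕ) := by positivity
    have h : ∀ i, MultiBound (n + 1) (X i * pderiv i p)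
        ((6 * bernstein + 1) ^ n * (bernstein * ((n + 1 : ℕ) + 1) * supS p)) := fun i =>
      ((ih (pderiv_mem_harm hp i)).mono (by gcongr; exact supS_pderiv_le hp i)).X_mul i
    have h' := (((h 0).add (h 1)).add (h 2)).smul ((n + 1 : ℕ) : ℂ)⁻¹
    rw [euler (mem_harm.1 hp).1] at h'
    have e : ((n + 1 : ℕ) : ℂ)⁻¹ • (((n + 1 : ℕ) : Poly) * p) = p := by
      rw [← nsmul_eq_mul, ← Nat.cast_smul_eq_nsmul ℂ, inv_smul_smul₀ hn]
    rw [e] at h'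
    refine h'.mono ?_
    rw [norm_inv, Complex.norm_natCast, inv_mul_le_iff₀ hn']
    have h1 : (1 : ℝ) ≤ (n + 1 : ℕ) := by push_cast; linarith [(Nat.cast_nonneg n : (0 : ℝ) ≤ n)]
    have h2 : 3 * bernstein * ((n + 1 : ℕ) + 1) ≤ (n + 1 : ℕ) * (6 * bernstein + 1) := by nlinarith
    have h3 : 0 ≤ (6 * bernstein + 1) ^ n * supS p := by have := supS_nonneg p; positivity
    calc _ = (6 * bernstein + 1) ^ n * supS p * (3 * bernstein * ((n + 1 : ℕ) + 1)) := by ring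
      _ ≤ (6 * bernstein + 1) ^ n * supS p * ((n + 1 : ℕ) * (6 * bernstein + 1)) := by gcongr
      _ = _ := by ring

/-- A normally convergent series of homogeneous polynomials is a power series, whose homogeneous parts
are obtained by grouping terms of equal degree. -/
theorem hasFPowerSeries_of_multiBound {ι : Type*} {q : ι → Poly} {d : ι → ℕ} {M : ι → ℝ}
    (h : ∀ i, MultiBound (d i) (q i) (M i)) {R : ℝ} (hR : 0 < R)
    (hs : Summable fun i => M i * R ^ d i) :
    ∃ p : FormalMultilinearSeries ℝ R3 ℂ,
      HasFPowerSeriesAt (fun x => ∑' i, pev (q i) x) p 0 ∧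
      (∀ x, ‖x‖ < R → Summable fun i => pev (q i) x) ∧
      ∀ k x, p k (fun _ => x) = ∑' i, if d i = k then pev (q i) x else 0 := by
  -- Using the zero form when d i ≠ k makes the coefficient of degree k an unrestricted sum over the
  -- index type.
  have h' : ∀ i k, ∃ m : ContinuousMultilinearMap ℝ (fun _ : Fin k => R3) ℂ,
      (∀ x, m (fun _ => x) = if d i = k then pev (q i) x else 0) ∧
      ‖m‖ * R ^ k ≤ M i * R ^ d i := fun i k => by
    by_cases hk : d i = k
    · subst hk
      obtain ⟨m, h1, h2⟩ := h i
      exact ⟨m, fun x => by simp [h1], by gcongr⟩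
    · exact ⟨0, fun x => by simp [hk], by simpa using by have := (h i).nonneg; positivity⟩
  choose m hm hm' using h'
  have hle : ∀ i k, ‖m i k‖ ≤ M i * R ^ d i * (R ^ k)⁻¹ := fun i k => by
    rw [← div_eq_mul_inv, le_div_iff₀ (by positivity)]; exact hm' i k
  have hsm : ∀ k, Summable fun i => m i k := fun k =>
    Summable.of_norm_bounded (hs.mul_right _) fun i => hle i k
  have hpk : ∀ k x, (∑' i, m i k) (fun _ => x) = ∑' i, if d i = k then pev (q i) x else 0 :=
    fun k x => by
      rw [ContinuousMultilinearMap.tsum_eval (hsm k)]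
      exact tsum_congr fun i => hm i k x
  have hnorm : ∀ x, ‖x‖ < R → ∀ i, ‖pev (q i) x‖ ≤ M i * R ^ d i := fun x hx i => by
    have h1 := hm i (d i) x
    rw [if_pos rfl] at h1
    rw [← h1]
    refine ((m i (d i)).le_opNorm _).trans ?_
    rw [Finset.prod_const, Finset.card_univ, Fintype.card_fin]
    refine le_trans ?_ (hm' i (d i))
    gcongr
  have hsum : ∀ x, ‖x‖ < R → Summable fun i => pev (q i) x := fun x hx =>
    Summable.of_norm_bounded hs (hnorm x hx)
  refine ⟨fun k => ∑' i, m i k, ⟨ENNReal.ofReal R, ?_, ENNReal.ofReal_pos.2 hR, fun {y} hy => ?_⟩,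
    hsum, hpk⟩
  · refine FormalMultilinearSeries.le_radius_of_bound _ (∑' i, M i * R ^ d i) fun k => ?_
    rw [Real.coe_toNNReal R hR.le, ← le_div_iff₀ (by positivity), div_eq_mul_inv, ← tsum_mul_right]
    exact tsum_of_norm_bounded (hs.mul_right _).hasSum fun i => hle i k
  · rw [Metric.eball_ofReal, mem_ball_zero_iff] at hy
    rw [zero_add]
    have h1 := (hsum y hy).hasSum.tsum_fiberwise d
    convert! h1 using 2 with k
    rw [hpk, tsum_subtype (d ⁻¹' {k}) fun i => pev (q i) y]
    refine tsum_congr fun i => ?_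
    by_cases hi : d i = k
    · rw [if_pos hi, Set.indicator_of_mem (show i ∈ d ⁻¹' {k} from hi)]
    · rw [if_neg hi, Set.indicator_of_notMem (show i ∉ d ⁻¹' {k} from hi)]

end MaxwellCorner
end

noncomputable section
namespace MaxwellCorner

open MvPolynomial (X pderiv)
open Set

/-! ### Leading homogeneous parts -/

/-- `f` is a power series at the origin that starts in degree at least `N`, where it is `c`. -/
def HasLead (f : R3 → ℂ) (N : ℕ) (c : R3 → ℂ) : Prop :=
  ∃ p : FormalMultilinearSeries ℝ R3 ℂ, HasFPowerSeriesAt f p 0 ∧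
    (∀ k < N, ∀ x, p k (fun _ => x) = 0) ∧ ∀ x, p N (fun _ => x) = c x

namespace HasLead

variable {f g : R3 → ℂ} {N : ℕ} {c d : R3 → ℂ}

theorem congr (h : HasLead f N c) (hfg : f =ᶠ[nhds 0] g) : HasLead g N c := by
  obtain ⟨p, h1, h2⟩ := h
  exact ⟨p, h1.congr hfg, h2⟩

theorem congr_lead (h : HasLead f N c) (hcd : ∀ x, c x = d x) : HasLead f N d := by
  obtain ⟨p, h1, h2, h3⟩ := h
  exact ⟨p, h1, h2, fun x => (h3 x).trans (hcd x)⟩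

theorem of_lt {N' : ℕ} (h : HasLead f N' c) (hN : N < N') : HasLead f N fun _ => 0 := by
  obtain ⟨p, h1, h2, -⟩ := h
  exact ⟨p, h1, fun k hk => h2 k (hk.trans hN), h2 N hN⟩

theorem add (hf : HasLead f N c) (hg : HasLead g N d) :
    HasLead (fun x => f x + g x) N fun x => c x + d x := by
  obtain ⟨p, h1, h2, h3⟩ := hf
  obtain ⟨q, k1, k2, k3⟩ := hg
  refine ⟨p + q, h1.add k1, fun k hk x => ?_, fun x => ?_⟩
  · simp [h2 k hk x, k2 k hk x]
  · simp [h3 x, k3 x]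

theorem const_mul (hf : HasLead f N c) (a : ℂ) : HasLead (fun x => a * f x) N fun x => a * c x := by
  obtain ⟨p, h1, h2, h3⟩ := hf
  refine ⟨a • p, HasFPowerSeriesAt.const_smul (c := a) h1, fun k hk x => ?_, fun x => ?_⟩
  · simp [h2 k hk x]
  · simp [h3 x]

end HasLead

theorem norm_besselTerm_le {κ : ℝ} (hκ : 0 ≤ κ) (n j : ℕ) :
    ‖(-1 : ℂ) ^ j * besselCoeff n j * (κ : ℂ) ^ j‖ ≤ besselCoeff n 0 * (κ ^ j / j.factorial) := by
  rw [norm_mul, norm_mul, norm_pow, norm_neg, norm_one, one_pow, one_mul, norm_pow, Complex.norm_real,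
    Complex.norm_real, Real.norm_of_nonneg hκ, Real.norm_of_nonneg (besselCoeff_pos n j).le]
  calc besselCoeff n j * κ ^ j ≤ besselCoeff n 0 / j.factorial * κ ^ j := by
        gcongr; exact besselCoeff_le n j
    _ = _ := by ring

/-- Expanding b_{n+s} in powers of κ|x|² gives a double series with terms of degree d n + 2j,
majorized by u times an exponential series in 3κR²; the 3 counts the squares in |x|². By `h0`, no
nonzero term other than (n₀, 0) has degree at most d n₀. -/
theorem hasLead_radTerm {κ : ℝ} (hκ : 0 ≤ κ) (s : ℕ) {q : ℕ → Poly} {d : ℕ → ℕ} {M u : ℕ → ℝ}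
    {R : ℝ} (h : ∀ n, MultiBound (d n) (q n) (M n)) (hR : 0 < R) (hu : Summable u)
    (hle : ∀ n, besselCoeff (n + s) 0 * M n * R ^ d n ≤ u n) {n₀ : ℕ}
    (h0 : ∀ n, n ≠ n₀ → q n = 0 ∨ d n₀ < d n) :
    (∀ᶠ x in nhds (0 : R3), Summable fun n => radTerm κ (n + s) (q n) x) ∧
    HasLead (fun x => ∑' n, radTerm κ (n + s) (q n) x) (d n₀)
      fun x => besselCoeff (n₀ + s) 0 * pev (q n₀) x := by
  set Q : ℕ × ℕ → Poly := fun i =>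
    ((-1 : ℂ) ^ i.2 * besselCoeff (i.1 + s) i.2 * (κ : ℂ) ^ i.2) • (nsq ^ i.2 * q i.1) with hQ
  have hu0 : ∀ n, 0 ≤ u n := fun n => by
    have h1 := besselCoeff_pos (n + s) 0
    have h2 := (h n).nonneg
    exact le_trans (by positivity) (hle n)
  have hexp : Summable fun j : ℕ => (3 * κ * R ^ 2) ^ j / j.factorial :=
    Real.summable_pow_div_factorial _
  obtain ⟨p, hp, hs, hk⟩ := hasFPowerSeries_of_multiBound (q := Q) (d := fun i => d i.1 + 2 * i.2)
    (fun i => ((h i.1).nsq_pow_mul i.2).smul _) hR (by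
      refine Summable.of_nonneg_of_le (fun i => ?_) (fun i => ?_)
        (hu.mul_of_nonneg hexp hu0 fun j => by positivity)
      · have := (h i.1).nonneg
        positivity
      · have h2 := (h i.1).nonneg
        calc _ ≤ besselCoeff (i.1 + s) 0 * (κ ^ i.2 / i.2.factorial) * (3 ^ i.2 * M i.1) *
              R ^ (d i.1 + 2 * i.2) := by gcongr; exact norm_besselTerm_le hκ _ _
          _ = (besselCoeff (i.1 + s) 0 * M i.1 * R ^ d i.1) *
              ((3 * κ * R ^ 2) ^ i.2 / i.2.factorial) := by
            rw [pow_add, pow_mul, mul_pow, mul_pow]; ring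
          _ ≤ _ := by gcongr; exact hle _)
  have hin : ∀ n x, ∑' j, pev (Q (n, j)) x = radTerm κ (n + s) (q n) x := fun n x => by
    rw [radTerm, redBessel, Complex.ofReal_tsum, ← tsum_mul_right]
    refine tsum_congr fun j => ?_
    simp only [hQ, pev_smul, pev_mul, pev_pow, pev_nsq]
    push_cast
    ring
  have hball : ∀ᶠ x in nhds (0 : R3), ‖x‖ < R := by
    filter_upwards [Metric.ball_mem_nhds (0 : R3) hR] with x hx using mem_ball_zero_iff.1 hx
  have hz : ∀ (i : ℕ × ℕ) (x : R3), i ≠ (n₀, 0) → d i.1 + 2 * i.2 ≤ d n₀ → pev (Q i) x = 0 :=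
    fun i x hi hd => by
      rcases eq_or_ne i.1 n₀ with h1 | h1
      · rw [h1] at hd
        exact absurd (Prod.ext h1 (by simp only; omega)) hi
      · rcases h0 i.1 h1 with h2 | h2
        · simp [hQ, h2]
        · omega
  refine ⟨hball.mono fun x hx => ?_, HasLead.congr ⟨p, hp, fun k hk' x => ?_, fun x => ?_⟩
    (hball.mono fun x hx => ?_)⟩
  · simpa only [hin] using (hs x hx).prod
  · rw [hk]
    refine (tsum_congr fun i => ?_).trans tsum_zero
    split_ifs with hd
    · refine hz i x (fun hi => ?_) (hd.trans_lt hk').le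
      rw [hi] at hd
      simp only at hd
      omega
    · rfl
  · rw [hk, tsum_eq_single (n₀, 0) fun i hi => ?_]
    · simp only [hQ, mul_zero, add_zero, if_true, pev_smul, pow_zero, one_mul, mul_one]
    · split_ifs with hd
      · exact hz i x hi hd.le
      · rfl
  · simp only
    rw [(hs x hx).tsum_prod]
    exact tsum_congr fun n => hin n x

end MaxwellCorner
end

noncomputable section
namespace MaxwellCorner

open MvPolynomial (X pderiv)
open Set

/-! ### Leading parts of multipole expansions -/

/-- A bound for the multilinear forms of the polynomials that make up the multipole of `P`. -/
def formBound (n : ℕ) (P : Poly) : ℝ := 4 * ((n : ℝ) + 1) ^ 2 * (6 * bernstein + 1) ^ n * supS P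

theorem formBound_nonneg (n : ℕ) (P : Poly) : 0 ≤ formBound n P := by
  have := bernstein_nonneg
  have := supS_nonneg P
  rw [formBound]; positivity

section

variable {n : ℕ} {P : Poly}

theorem multiBound_pderiv (hP : P ∈ harm (n + 1)) (i : Fin 3) : MultiBound n (pderiv i P)
    ((((n + 1 : ℕ) : ℝ) + 1) * ((6 * bernstein + 1) ^ (n + 1) * supS P)) := by
  have hb := bernstein_nonneg
  have hs := supS_nonneg P
  refine (multiBound_harm (pderiv_mem_harm hP i)).mono ?_
  rw [Nat.add_sub_cancel]
  calc (6 * bernstein + 1) ^ n * supS (pderiv i P) ≤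
      (6 * bernstein + 1) ^ n * ((6 * bernstein + 1) * ((n + 1 : ℕ) + 1) * supS P) := by
        gcongr
        refine (supS_pderiv_le hP i).trans ?_
        gcongr
        linarith
    _ = _ := by ring

theorem multiBound_gradPart (hP : P ∈ harm (n + 1)) (i : Fin 3) :
    MultiBound n (gradPart (n + 1) P i) (formBound (n + 1) P) := by
  have hb := bernstein_nonneg
  have hs := supS_nonneg P
  refine ((multiBound_pderiv hP i).smul _).mono ?_
  have h1 : ‖(((n + 1 : ℕ) : ℂ) + 1)‖ = ((n + 1 : ℕ) : ℝ) + 1 := by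
    exact_mod_cast Complex.norm_natCast (n + 1 + 1)
  rw [h1, formBound]
  have : 0 ≤ ((((n + 1 : ℕ) : ℝ) + 1) ^ 2 * ((6 * bernstein + 1) ^ (n + 1) * supS P)) := by positivity
  nlinarith

theorem multiBound_rotPoly (hP : P ∈ harm (n + 1)) (i : Fin 3) :
    MultiBound (n + 1) (rotPoly P i) (formBound (n + 1) P) := by
  have hb := bernstein_nonneg
  have hs := supS_nonneg P
  have key : ∀ j k l m : Fin 3, MultiBound (n + 1) (pderiv j P * X k - pderiv l P * X m)
      (formBound (n + 1) P) := fun j k l m => by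
    rw [mul_comm _ (X k), mul_comm _ (X m)]
    refine (((multiBound_pderiv hP j).X_mul k).sub ((multiBound_pderiv hP l).X_mul m)).mono ?_
    rw [formBound]
    have h0 : 0 ≤ (6 * bernstein + 1) ^ (n + 1) * supS P := by positivity
    have h1 : (0 : ℝ) ≤ ((n + 1 : ℕ) : ℝ) := Nat.cast_nonneg _
    nlinarith [mul_nonneg h1 h0, mul_nonneg (mul_nonneg h1 h1) h0]
  fin_cases i
  · exact key 1 2 2 1
  · exact key 2 0 0 2
  · exact key 0 1 1 0

theorem multiBound_radialPart (hP : P ∈ harm (n + 1)) (i : Fin 3) :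
    MultiBound (n + 2) (radialPart (n + 1) P i) (formBound (n + 1) P) := by
  have hb := bernstein_nonneg
  have hs := supS_nonneg P
  have h2 := (multiBound_pderiv hP i).nsq_pow_mul 1
  rw [pow_one] at h2
  refine ((((multiBound_harm hP).X_mul i).smul _).sub h2).mono ?_
  rw [formBound, Complex.norm_natCast]
  have h0 : 0 ≤ (6 * bernstein + 1) ^ (n + 1) * supS P := by positivity
  have h1 : (0 : ℝ) ≤ ((n + 1 : ℕ) : ℝ) := Nat.cast_nonneg _
  nlinarith [mul_nonneg h1 h0, mul_nonneg (mul_nonneg h1 h1) h0]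

end

/-- The multilinear bounds exceed the supremum by (n+1)² K^n, K = 6 `bernstein` + 1. Shrinking the
radius r/2 by 8K pays for K^n, for (n+1)² ≤ 4^n, and leaves the factor 2^(-n). Analyticity is needed
near 0 only. -/
theorem GeomBound.exists_formBound {r : ℝ} (hr : 0 < r) {P : ℕ → Poly} (hP : GeomBound r P) :
    ∃ R, 0 < R ∧ R ≤ 1 ∧ ∃ C, 0 ≤ C ∧
      ∀ n, besselCoeff n 0 * formBound n (P n) * R ^ n ≤ C * (1 / 2) ^ n := by
  have hb := bernstein_nonneg
  obtain ⟨C, hC⟩ := hP.2 (r / 2) (by linarith) (by linarith)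
  have hC0 : 0 ≤ C := by
    have h1 := besselCoeff_pos 0 0
    have h2 := supS_nonneg (P 0)
    exact le_trans (by positivity) (hC 0)
  set K := 6 * bernstein + 1 with hK
  have hK0 : 0 < K := by positivity
  refine ⟨min 1 (r / 2 / (8 * K)), lt_min one_pos (by positivity), min_le_left _ _, 4 * C,
    by positivity, fun n => ?_⟩
  have h1 := besselCoeff_pos n 0
  have h2 := supS_nonneg (P n)
  have h3 : ((n : ℝ) + 1) ^ 2 ≤ 4 ^ n := by
    have h4 : ((n : ℝ) + 1) ≤ 2 ^ n := by exact_mod_cast Nat.lt_two_pow_self (n := n)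
    calc ((n : ℝ) + 1) ^ 2 ≤ (2 ^ n) ^ 2 := by gcongr
      _ = 4 ^ n := by rw [← pow_mul, mul_comm, pow_mul]; norm_num
  have h5 : min 1 (r / 2 / (8 * K)) ≤ r / 2 / (8 * K) := min_le_right _ _
  have h6 : 0 ≤ min 1 (r / 2 / (8 * K)) := (lt_min one_pos (by positivity)).le
  calc besselCoeff n 0 * formBound n (P n) * (min 1 (r / 2 / (8 * K))) ^ n
      ≤ besselCoeff n 0 * (4 * 4 ^ n * K ^ n * supS (P n)) * (r / 2 / (8 * K)) ^ n := by
        rw [formBound]; gcongr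
    _ = 4 * (besselCoeff n 0 * supS (P n) * (r / 2) ^ n) * (1 / 2) ^ n := by
        rw [div_pow, mul_pow, one_div, inv_pow]
        have : (8 : ℝ) ^ n = 4 ^ n * 2 ^ n := by rw [← mul_pow]; norm_num
        rw [this]
        field_simp
    _ ≤ _ := by gcongr; exact hC n

theorem GeomBound.hasLead {r : ℝ} (hr : 0 < r) {P : ℕ → Poly} (hP : GeomBound r P) (hP0 : P 0 = 0)
    {κ : ℝ} (hκ : 0 ≤ κ) {n₀ : ℕ} (hlow : ∀ n < n₀, P n = 0) {s : ℕ} (hs : s ≤ 1) {d : ℕ → ℕ}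
    (hd : ∀ n, n ≤ d n + 1) (hd' : ∀ n, n₀ < n → d n₀ < d n) {q : ℕ → Poly}
    (hq : ∀ n, P (n + 1) ∈ harm (n + 1) →
      MultiBound (d (n + 1)) (q (n + 1)) (formBound (n + 1) (P (n + 1))))
    (hq0 : ∀ n, P n = 0 → q n = 0) :
    (∀ᶠ x in nhds (0 : R3), Summable fun n => radTerm κ (n + s) (q n) x) ∧
    HasLead (fun x => ∑' n, radTerm κ (n + s) (q n) x) (d n₀)
      fun x => besselCoeff (n₀ + s) 0 * pev (q n₀) x := by
  obtain ⟨R, hR, hR1, C, hC0, hC⟩ := hP.exists_formBound hr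
  refine hasLead_radTerm hκ s (M := fun n => formBound n (P n)) (u := fun n => C / R * (1 / 2) ^ n)
    (fun n => ?_) hR
    ((summable_geometric_of_lt_one (by norm_num) (by norm_num)).mul_left _) (fun n => ?_)
    fun n hn => ?_
  · rcases n with _ | n
    · rw [hq0 0 hP0]
      exact MultiBound.zero (formBound_nonneg _ _)
    · exact hq n (hP.1 _)
  · have h1 : besselCoeff (n + s) 0 ≤ besselCoeff n 0 := by
      interval_cases s
      · exact le_rfl
      · exact besselCoeff_succ_zero_le n
    -- The gradient part lowers the degree by one, so at most one factor R is lost; this uses R ≤ 1.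
    have h2 : R ^ d n ≤ R ^ n / R := by
      rw [le_div_iff₀ hR, ← pow_succ]
      exact pow_le_pow_of_le_one hR.le hR1 (hd n)
    have h3 := formBound_nonneg n (P n)
    have h4 := besselCoeff_pos n 0
    calc besselCoeff (n + s) 0 * formBound n (P n) * R ^ d n ≤
        besselCoeff n 0 * formBound n (P n) * (R ^ n / R) := by gcongr
      _ = besselCoeff n 0 * formBound n (P n) * R ^ n / R := by ring
      _ ≤ C * (1 / 2) ^ n / R := div_le_div_of_nonneg_right (hC n) hR.le
      _ = _ := by ring
  · rcases lt_or_gt_of_ne hn with h | h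
    · exact Or.inl (hq0 n (hlow n h))
    · exact Or.inr (hd' n h)

/-- A multipole of degree n has pieces of polynomial degree n (`rotPoly`), n - 1 (`gradPart`) and n
+ 1 (`radialPart`). With lowest n = N + 1 only the gradient piece of B reaches degree N; the factor
N + 2 is the n + 1 in `gradPart`. -/
theorem hasLead_multipole {r : ℝ} (hr : 0 < r) {κ : ℝ} (hκ : 0 ≤ κ) {A B : ℕ → Poly}
    (hA : GeomBound r A) (hB : GeomBound r B) (hA0 : A 0 = 0) (hB0 : B 0 = 0) {N : ℕ}
    (hlA : ∀ n ≤ N, A n = 0) (hlB : ∀ n ≤ N, B n = 0) (a b : ℂ) {f : R3 → C3}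
    (hf : ∀ x ∈ Metric.ball (0 : R3) r,
      HasSum (fun n => a • mField κ n (A n) x + b • nField κ n (B n) x) (f x)) (i : Fin 3) :
    HasLead (fun x => f x i) N
      fun x => b * (besselCoeff (N + 1) 0 * ((N : ℂ) + 2)) * pev (pderiv i (B (N + 1))) x := by
  obtain ⟨s1, l1⟩ := hA.hasLead hr hA0 hκ (fun n hn => hlA n (Nat.lt_succ_iff.1 hn)) (n₀ := N + 1)
    (s := 0) (by omega) (d := fun n => n) (fun n => by omega) (fun n hn => hn)
    (q := fun n => rotPoly (A n) i) (fun n h => multiBound_rotPoly h i)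
    (fun n h => by simp only [h]; fin_cases i <;> simp [rotPoly])
  obtain ⟨s2, l2⟩ := hB.hasLead hr hB0 hκ (fun n hn => hlB n (Nat.lt_succ_iff.1 hn)) (n₀ := N + 1)
    (s := 0) (by omega) (d := fun n => n - 1) (fun n => by omega) (fun n hn => by omega)
    (q := fun n => gradPart n (B n) i) (fun n h => multiBound_gradPart h i)
    (fun n h => by simp only [h]; simp [gradPart])
  obtain ⟨s3, l3⟩ := hB.hasLead hr hB0 hκ (fun n hn => hlB n (Nat.lt_succ_iff.1 hn)) (n₀ := N + 1)
    (s := 1) (by omega) (d := fun n => n + 1) (fun n => by omega) (fun n hn => by omega)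
    (q := fun n => radialPart n (B n) i) (fun n h => multiBound_radialPart h i)
    (fun n h => by simp only [h]; simp [radialPart])
  have l := ((l1.of_lt (Nat.lt_succ_self N)).const_mul a).add
    ((l2.add ((l3.of_lt (N := N) (by omega)).const_mul κ)).const_mul b)
  refine (l.congr ?_).congr_lead fun x => ?_
  · filter_upwards [s1, s2, s3, Metric.ball_mem_nhds (0 : R3) hr] with x h1 h2 h3 hx
    have h4 := (h1.hasSum.mul_left a).add
      ((h2.hasSum.add (h3.hasSum.mul_left (κ : ℂ))).mul_left b)
    exact h4.unique (Pi.hasSum.1 (hf x hx) i)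
  · simp only [gradPart, pev_smul]
    push_cast
    ring

theorem taylorPart_of_hasLead {f : R3 → C3} {N : ℕ} {c : Fin 3 → R3 → ℂ}
    (h : ∀ i, HasLead (fun x => f x i) N (c i)) :
    AnalyticAt ℝ f 0 ∧ (∀ k < N, taylorPart f k = 0) ∧ taylorPart f N = fun x i => c i x := by
  choose p h1 h2 h3 using h
  have hp : HasFPowerSeriesAt f (FormalMultilinearSeries.pi p) 0 :=
    hasFPowerSeriesAt_pi_iff.2 h1
  have ht : ∀ k x, taylorPart f k x = fun i => p i k fun _ => x := fun k x => by
    obtain ⟨R, hR⟩ := hp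
    rw [taylorPart, ← hR.factorial_smul, ← Nat.cast_smul_eq_nsmul ℝ,
      inv_smul_smul₀ (Nat.cast_ne_zero.2 k.factorial_ne_zero)]
    rfl
  refine ⟨hp.analyticAt, fun k hk => ?_, ?_⟩
  · funext x
    rw [ht]
    exact funext fun i => h2 i k hk x
  · funext x
    rw [ht]
    exact funext fun i => h3 i x

end MaxwellCorner
end

noncomputable section
namespace MaxwellCorner

open MvPolynomial (X pderiv)
open Set

/-! ### Inadmissibility in terms of the potentials -/

theorem lowestOrder_eq_iff {V : R3 → C3} {N : ℕ} (h : ∀ k < N, taylorPart V k = 0) :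
    (N : ℕ∞) ≤ lowestOrder V ∧ (lowestOrder V = N ↔ taylorPart V N ≠ 0) := by
  have hle : (N : ℕ∞) ≤ lowestOrder V := by
    refine le_sInf ?_
    rintro _ ⟨n, hn, rfl⟩
    by_contra hlt
    exact hn (h n (Nat.cast_lt.1 (not_le.1 hlt)))
  refine ⟨hle, fun he h0 => ?_, fun hN => le_antisymm (sInf_le ⟨N, hN, rfl⟩) hle⟩
  have hne : ((fun n : ℕ => (n : ℕ∞)) '' {n : ℕ | taylorPart V n ≠ 0}).Nonempty := by
    by_contra hem
    rw [not_nonempty_iff_eq_empty] at hem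
    rw [lowestOrder, hem, sInf_empty] at he
    exact ENat.natCast_ne_top N he.symm
  obtain ⟨n, hn, hn'⟩ := csInf_mem hne
  have h1 : ((n : ℕ) : ℕ∞) = N := hn'.trans he
  exact hn (by rw [Nat.cast_inj.1 h1]; exact h0)

theorem eq_zero_of_pderiv {n : ℕ} {P : Poly} (hP : P.IsHomogeneous (n + 1))
    (h : ∀ i, pderiv i P = 0) : P = 0 := by
  have h1 := euler hP
  rw [h, h, h, mul_zero, mul_zero, mul_zero, add_zero, add_zero] at h1
  exact (mul_eq_zero.1 h1.symm).resolve_left (Nat.cast_ne_zero.2 n.succ_ne_zero)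

theorem gradField_ne_zero_iff {n : ℕ} {P : Poly} (hP : P.IsHomogeneous (n + 1)) {c : ℂ} (hc : c ≠ 0) :
    (fun (x : R3) (i : Fin 3) => c * pev (pderiv i P) x) ≠ 0 ↔ P ≠ 0 := by
  refine not_congr ⟨fun h => eq_zero_of_pderiv hP fun i => pev_injective fun x => ?_, ?_⟩
  · have := congrFun (congrFun h x) i
    rw [pev_zero]
    exact (mul_eq_zero.1 this).resolve_left hc
  · rintro rfl
    funext x i
    simp

theorem form_iff {N : ℕ} {P : Poly} (hP : P ∈ harm (N + 1)) {c : ℂ} (hc : c ≠ 0) :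
    ((Odd N → OddForm N (fun x i => c * pev (pderiv i P) x)) ∧
      (Even N → EvenForm N (fun x i => c * pev (pderiv i P) x))) ↔
    ∀ i, refl i P = (-1 : ℂ) ^ (N + 1) • P := by
  rcases Nat.even_or_odd N with hN | hN
  · have : ¬ Odd N := Nat.not_odd_iff_even.2 hN
    simp only [this, hN, false_imp_iff, true_imp_iff, true_and]
    exact evenForm_iff hN hP hc
  · have : ¬ Even N := Nat.not_even_iff_odd.2 hN
    simp only [this, hN, false_imp_iff, true_imp_iff, and_true]
    exact oddForm_iff hN hP hc

/-- E has order N exactly when B ≠ 0, and H exactly when A ≠ 0. A field of higher order is exempt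
from the divisibility condition, and correspondingly the symmetry condition on its vanishing
potential is empty. -/
theorem inadmissible_iff_of_taylorPart {E H : R3 → C3} {N : ℕ} {A B : Poly} (hA : A ∈ harm (N + 1))
    (hB : B ∈ harm (N + 1)) (hAB : A ≠ 0 ∨ B ≠ 0) {a b : ℂ} (ha : a ≠ 0) (hb : b ≠ 0)
    (hE : AnalyticAt ℝ E 0 ∧ (∀ k < N, taylorPart E k = 0) ∧
      taylorPart E N = fun x i => b * pev (pderiv i B) x)
    (hH : AnalyticAt ℝ H 0 ∧ (∀ k < N, taylorPart H k = 0) ∧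
      taylorPart H N = fun x i => a * pev (pderiv i A) x) :
    Inadmissible E H ↔ 1 ≤ N ∧ (∀ i, refl i A = (-1 : ℂ) ^ (N + 1) • A) ∧
      ∀ i, refl i B = (-1 : ℂ) ^ (N + 1) • B := by
  obtain ⟨leE, eqE⟩ := lowestOrder_eq_iff hE.2.1
  obtain ⟨leH, eqH⟩ := lowestOrder_eq_iff hH.2.1
  rw [hE.2.2, gradField_ne_zero_iff (mem_harm.1 hB).1 hb] at eqE
  rw [hH.2.2, gradField_ne_zero_iff (mem_harm.1 hA).1 ha] at eqH
  have hmin : min (lowestOrder E) (lowestOrder H) = N := by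
    refine le_antisymm ?_ (le_min leE leH)
    rcases hAB with h | h
    · exact (min_le_right _ _).trans (eqH.2 h).le
    · exact (min_le_left _ _).trans (eqE.2 h).le
  constructor
  · rintro ⟨-, -, N', hN', h1, hform⟩
    obtain rfl : N' = N := by exact_mod_cast hN'.trans hmin
    refine ⟨h1, ?_, ?_⟩
    · rcases eq_or_ne A 0 with rfl | h
      · simp
      · have := hform H (Or.inr rfl) (eqH.2 h)
        rw [hH.2.2] at this
        exact (form_iff hA ha).1 this
    · rcases eq_or_ne B 0 with rfl | h
      · simp
      · have := hform E (Or.inl rfl) (eqE.2 h)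
        rw [hE.2.2] at this
        exact (form_iff hB hb).1 this
  · rintro ⟨h1, h2, h3⟩
    refine ⟨hE.1, hH.1, N, hmin.symm, h1, ?_⟩
    rintro S (rfl | rfl) -
    · rw [hE.2.2]
      exact (form_iff hB hb).2 h3
    · rw [hH.2.2]
      exact (form_iff hA ha).2 h2

/-- The same computation serves both fields: E and H have the same shape with A and B interchanged
and other nonzero constants. -/
theorem inadmissible_iff {ω ε₀ μ₀ : ℝ} (hω : 0 < ω) (hε₀ : 0 < ε₀) (hμ₀ : 0 < μ₀) {r : ℝ} (hr : 0 < r)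
    {E H : R3 → C3} {A B : ℕ → Poly} (hA : GeomBound r A) (hB : GeomBound r B)
    (hA0 : A 0 = 0) (hB0 : B 0 = 0)
    (h : ∀ x ∈ Metric.ball (0 : R3) r,
      HasSum (fun n => poleE ω ε₀ μ₀ n (A n) (B n) x) (E x) ∧
      HasSum (fun n => poleH ω ε₀ μ₀ n (A n) (B n) x) (H x))
    {N : ℕ} (hlA : ∀ n ≤ N, A n = 0) (hlB : ∀ n ≤ N, B n = 0)
    (hAB : A (N + 1) ≠ 0 ∨ B (N + 1) ≠ 0) :
    Inadmissible E H ↔ 1 ≤ N ∧ (∀ i, refl i (A (N + 1)) = (-1 : ℂ) ^ (N + 1) • A (N + 1)) ∧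
      ∀ i, refl i (B (N + 1)) = (-1 : ℂ) ^ (N + 1) • B (N + 1) := by
  have h1 : (ω : ℂ) ≠ 0 := Complex.ofReal_ne_zero.2 hω.ne'
  have h2 : (ε₀ : ℂ) ≠ 0 := Complex.ofReal_ne_zero.2 hε₀.ne'
  have h3 : (μ₀ : ℂ) ≠ 0 := Complex.ofReal_ne_zero.2 hμ₀.ne'
  have hI := Complex.I_ne_zero
  have hκ : 0 ≤ kap ω ε₀ μ₀ := by rw [kap]; positivity
  have hc : ((besselCoeff (N + 1) 0 : ℝ) : ℂ) * ((N : ℂ) + 2) ≠ 0 := by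
    refine mul_ne_zero (Complex.ofReal_ne_zero.2 (besselCoeff_pos _ _).ne') ?_
    exact_mod_cast (Nat.succ_ne_zero (N + 1))
  have hE := taylorPart_of_hasLead (f := E) (N := N)
    (hasLead_multipole hr hκ hA hB hA0 hB0 hlA hlB 1 (Complex.I / (ω * ε₀))
      fun x hx => by
        convert! (h x hx).1 using 2 with n
        rw [one_smul, poleE])
  have hH := taylorPart_of_hasLead (f := H) (N := N)
    (hasLead_multipole hr hκ hB hA hB0 hA0 hlB hlA 1 (-(Complex.I / (ω * μ₀)))
      fun x hx => by
        convert! (h x hx).2 using 2 with n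
        rw [one_smul, poleH, add_comm])
  exact inadmissible_iff_of_taylorPart (hA.1 _) (hB.1 _) hAB
    (mul_ne_zero (neg_ne_zero.2 (div_ne_zero hI (mul_ne_zero h1 h3))) hc)
    (mul_ne_zero (div_ne_zero hI (mul_ne_zero h1 h2)) hc) hE hH

/-! ### Wave expansions as multipole expansions -/

theorem leadSum_waveEH (ω ε₀ μ₀ : ℝ) (l : ℕ) (c : ℕ → ℂ) (x : R3) :
    leadSum (waveEH ω ε₀ μ₀) l c x = poleMap ω ε₀ μ₀ (l + 1) x
      (waveFactor ω ε₀ μ₀ (l + 1) • ∑ m ∈ leadRange (l + 1), c m • leadSolid (l + 1) m, 0) := by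
  have e : ((waveFactor ω ε₀ μ₀ (l + 1) • ∑ m ∈ leadRange (l + 1), c m • leadSolid (l + 1) m, 0) :
      Poly × Poly) = ∑ m ∈ leadRange (l + 1), c m •
        ((waveFactor ω ε₀ μ₀ (l + 1) • solid (l + 1) (2 * m), 0) + (-1 : ℂ) ^ (l + 1) •
          (waveFactor ω ε₀ μ₀ (l + 1) • solid (l + 1) (-(2 * m)), 0)) := by
    refine Prod.ext ?_ ?_
    · rw [Prod.fst_sum]
      dsimp only
      rw [Finset.smul_sum]
      refine Finset.sum_congr rfl fun m _ => ?_
      simp only [leadSolid, Prod.smul_fst, Prod.fst_add, smul_add, smul_comm (waveFactor ω ε₀ μ₀ _)]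
    · rw [Prod.snd_sum]; simp
  rw [e, map_sum]
  refine Finset.sum_congr rfl fun m hm => ?_
  rw [map_smul, map_add, map_smul, ← waveEH_eq _ _ _ (natAbs_two_mul_le hm).1,
    ← waveEH_eq _ _ _ (natAbs_two_mul_le hm).2]

theorem leadSum_waveHE {ω ε₀ μ₀ : ℝ} (hμ₀ : 0 < μ₀) (l : ℕ) (c : ℕ → ℂ) (x : R3) :
    leadSum (waveHE ω ε₀ μ₀) l c x = poleMap ω ε₀ μ₀ (l + 1) x
      (0, waveFactor ω ε₀ μ₀ (l + 1) • ∑ m ∈ leadRange (l + 1), c m • leadSolid (l + 1) m) := by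
  have e : ((0, waveFactor ω ε₀ μ₀ (l + 1) • ∑ m ∈ leadRange (l + 1), c m • leadSolid (l + 1) m) :
      Poly × Poly) = ∑ m ∈ leadRange (l + 1), c m •
        ((0, waveFactor ω ε₀ μ₀ (l + 1) • solid (l + 1) (2 * m)) + (-1 : ℂ) ^ (l + 1) •
          (0, waveFactor ω ε₀ μ₀ (l + 1) • solid (l + 1) (-(2 * m)))) := by
    refine Prod.ext ?_ ?_
    · rw [Prod.fst_sum]; simp
    · rw [Prod.snd_sum]
      dsimp only
      rw [Finset.smul_sum]
      refine Finset.sum_congr rfl fun m _ => ?_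
      simp only [leadSolid, Prod.smul_snd, Prod.snd_add, smul_add, smul_comm (waveFactor ω ε₀ μ₀ _)]
  rw [e, map_sum]
  refine Finset.sum_congr rfl fun m hm => ?_
  rw [map_smul, map_add, map_smul, ← waveHE_eq hμ₀ (natAbs_two_mul_le hm).1,
    ← waveHE_eq hμ₀ (natAbs_two_mul_le hm).2]

/-- The potential of degree `n` of a combination of vector spherical waves. -/
def solidSum (ω ε₀ μ₀ : ℝ) (n : ℕ) (c : ℤ → ℂ) : Poly :=
  waveFactor ω ε₀ μ₀ n • ∑ m ∈ orders n, c m • solid n m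

theorem solidSum_mem_harm (ω ε₀ μ₀ : ℝ) (n : ℕ) (c : ℤ → ℂ) : solidSum ω ε₀ μ₀ n c ∈ harm n :=
  (harm n).smul_mem _ (Submodule.sum_mem _ fun _ hm =>
    (harm n).smul_mem _ (solid_mem_harm (mem_orders.1 hm)))

theorem waveBlock_eq {ω ε₀ μ₀ : ℝ} (hμ₀ : 0 < μ₀) (a b : ℕ → ℤ → ℂ) (l : ℕ) (x : R3) :
    waveBlock ω ε₀ μ₀ a b l x = poleMap ω ε₀ μ₀ (l + 1) x
      (solidSum ω ε₀ μ₀ (l + 1) (a l), solidSum ω ε₀ μ₀ (l + 1) (b l)) := by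
  have e : ((solidSum ω ε₀ μ₀ (l + 1) (a l), solidSum ω ε₀ μ₀ (l + 1) (b l)) : Poly × Poly) =
      ∑ m ∈ orders (l + 1), (a l m • (waveFactor ω ε₀ μ₀ (l + 1) • solid (l + 1) m, 0) +
        b l m • (0, waveFactor ω ε₀ μ₀ (l + 1) • solid (l + 1) m)) := by
    refine Prod.ext ?_ ?_
    · rw [Prod.fst_sum]
      dsimp only
      rw [solidSum, Finset.smul_sum]
      refine Finset.sum_congr rfl fun m _ => ?_
      simp only [Prod.smul_fst, Prod.fst_add, smul_zero, add_zero, smul_comm (waveFactor ω ε₀ μ₀ _)]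
    · rw [Prod.snd_sum]
      dsimp only
      rw [solidSum, Finset.smul_sum]
      refine Finset.sum_congr rfl fun m _ => ?_
      simp only [Prod.smul_snd, Prod.snd_add, smul_zero, zero_add, smul_comm (waveFactor ω ε₀ μ₀ _)]
  have ho : Finset.Icc (-((l : ℤ) + 1)) ((l : ℤ) + 1) = orders (l + 1) := by
    rw [orders]; push_cast; rfl
  rw [e, map_sum, waveBlock, ho]
  refine Finset.sum_congr rfl fun m hm => ?_
  rw [map_add, map_smul, map_smul, ← waveEH_eq _ _ _ (mem_orders.1 hm),
    ← waveHE_eq hμ₀ (mem_orders.1 hm)]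

theorem exists_solidSum {ω ε₀ μ₀ : ℝ} (hω : 0 < ω) (hε₀ : 0 < ε₀) (hμ₀ : 0 < μ₀) {n : ℕ} (hn : 1 ≤ n)
    {P : Poly} (hP : P ∈ harm n) : ∃ c, solidSum ω ε₀ μ₀ n c = P := by
  obtain ⟨c, hc⟩ := exists_solid_sum hP
  refine ⟨fun m => (waveFactor ω ε₀ μ₀ n)⁻¹ * c m, ?_⟩
  simp only [solidSum, mul_smul]
  rw [← Finset.smul_sum, smul_inv_smul₀ (waveFactor_ne_zero hω hε₀ hμ₀ hn), ← hc]

/-- Bookkeeping between the two indexings: waves of index l have potentials of degree l + 1, and the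
leading block l is split off. -/
theorem hasSum_Ioi_iff {M : Type*} [NormedAddCommGroup M] {G : ℕ → M} {l : ℕ}
    (h0 : ∀ n ≤ l, G n = 0) (s : M) :
    HasSum G s ↔ HasSum (fun k : Ioi l => G (k + 1)) (s - G (l + 1)) := by
  have h1 : HasSum (fun n => G (n + 1)) s ↔ HasSum G s := by
    have := hasSum_nat_add_iff' (f := G) (g := s) 1
    rwa [Finset.sum_range_one, h0 0 (Nat.zero_le _), sub_zero] at this
  have h2 := hasSum_ite_eq l (G (l + 1))
  rw [← h1]
  change _ ↔ HasSum ((fun n => G (n + 1)) ∘ ((↑) : Ioi l → ℕ)) _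
  rw [hasSum_subtype_iff_indicator]
  have e : ∀ n, G (n + 1) = (Ioi l).indicator (fun n => G (n + 1)) n +
      if n = l then G (l + 1) else 0 := fun n => by
    rcases lt_trichotomy n l with h | rfl | h
    · rw [indicator_of_notMem (by simpa using h.le), if_neg h.ne, h0 _ h, add_zero]
    · rw [indicator_of_notMem (by simp), if_pos rfl, zero_add]
    · rw [indicator_of_mem (mem_Ioi.2 h), if_neg h.ne', add_zero]
  constructor
  · intro h
    convert! h.sub h2 using 2 with n
    rw [e n, add_sub_cancel_right]
  · intro h
    convert! h.add h2 using 1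
    · exact funext e
    · rw [sub_add_cancel]

theorem hasSum_poleMap_iff (ω ε₀ μ₀ : ℝ) (A B : ℕ → Poly) (x : R3) (u v : C3) :
    HasSum (fun n => poleMap ω ε₀ μ₀ n x (A n, B n)) (u, v) ↔
      HasSum (fun n => poleE ω ε₀ μ₀ n (A n) (B n) x) u ∧
      HasSum (fun n => poleH ω ε₀ μ₀ n (A n) (B n) x) v :=
  ⟨fun h => ⟨h.map (AddMonoidHom.fst C3 C3) continuous_fst, h.map (AddMonoidHom.snd C3 C3) continuous_snd⟩,
    fun h => h.1.prodMk h.2⟩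

/-- The potentials of a wave expansion whose part of lowest degree `l + 1` is symmetrized. -/
def wavePotential (ω ε₀ μ₀ : ℝ) (l : ℕ) (c₀ : ℕ → ℂ) (c : ℕ → ℤ → ℂ) (n : ℕ) : Poly :=
  if n ≤ l then 0
  else if n = l + 1 then waveFactor ω ε₀ μ₀ (l + 1) • ∑ m ∈ leadRange (l + 1), c₀ m • leadSolid (l + 1) m
  else solidSum ω ε₀ μ₀ n (c (n - 1))

section

variable (ω ε₀ μ₀ : ℝ) (l : ℕ) (c₀ : ℕ → ℂ) (c : ℕ → ℤ → ℂ)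

theorem wavePotential_of_le {n : ℕ} (h : n ≤ l) : wavePotential ω ε₀ μ₀ l c₀ c n = 0 := if_pos h

theorem wavePotential_lead : wavePotential ω ε₀ μ₀ l c₀ c (l + 1) =
    waveFactor ω ε₀ μ₀ (l + 1) • ∑ m ∈ leadRange (l + 1), c₀ m • leadSolid (l + 1) m := by
  rw [wavePotential, if_neg (by omega), if_pos rfl]

theorem wavePotential_of_lt {k : ℕ} (h : l < k) : wavePotential ω ε₀ μ₀ l c₀ c (k + 1) =
    solidSum ω ε₀ μ₀ (k + 1) (c k) := by
  rw [wavePotential, if_neg (by omega), if_neg (by omega), Nat.add_sub_cancel]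

theorem wavePotential_mem_harm (n : ℕ) : wavePotential ω ε₀ μ₀ l c₀ c n ∈ harm n := by
  rw [wavePotential]
  split_ifs with h1 h2
  · exact zero_mem _
  · subst h2
    exact (harm _).smul_mem _ (Submodule.sum_mem _ fun m hm =>
      (harm _).smul_mem _ (leadSolid_mem_harm hm))
  · exact solidSum_mem_harm _ _ _ _ _

theorem refl_wavePotential_lead (i : Fin 3) : refl i (wavePotential ω ε₀ μ₀ l c₀ c (l + 1)) =
    (-1 : ℂ) ^ (l + 1) • wavePotential ω ε₀ μ₀ l c₀ c (l + 1) := by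
  rw [wavePotential_lead, map_smul, map_sum, smul_comm ((-1 : ℂ) ^ (l + 1))]
  congr 1
  rw [Finset.smul_sum]
  refine Finset.sum_congr rfl fun m hm => ?_
  rw [map_smul, refl_leadSolid hm, smul_comm]

end

/-- A wave expansion with symmetrized lowest part is the multipole expansion of its potentials. -/
theorem wave_expansion_iff {ω ε₀ μ₀ : ℝ} (hμ₀ : 0 < μ₀) (l : ℕ) (a₀ b₀ : ℕ → ℂ) (a b : ℕ → ℤ → ℂ)
    (x : R3) (s : C3 × C3) :
    HasSum (fun n => poleMap ω ε₀ μ₀ n x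
      (wavePotential ω ε₀ μ₀ l a₀ a n, wavePotential ω ε₀ μ₀ l b₀ b n)) s ↔
    HasSum (fun k : Ioi l => waveBlock ω ε₀ μ₀ a b k x)
      (s - (leadSum (waveEH ω ε₀ μ₀) l a₀ x + leadSum (waveHE ω ε₀ μ₀) l b₀ x)) := by
  rw [hasSum_Ioi_iff (l := l) fun n hn => by
    rw [wavePotential_of_le _ _ _ _ _ _ hn, wavePotential_of_le _ _ _ _ _ _ hn]
    exact map_zero _]
  have e : leadSum (waveEH ω ε₀ μ₀) l a₀ x + leadSum (waveHE ω ε₀ μ₀) l b₀ x =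
      poleMap ω ε₀ μ₀ (l + 1) x
        (wavePotential ω ε₀ μ₀ l a₀ a (l + 1), wavePotential ω ε₀ μ₀ l b₀ b (l + 1)) := by
    rw [leadSum_waveEH, leadSum_waveHE hμ₀, ← map_add, wavePotential_lead, wavePotential_lead,
      Prod.mk_add_mk, add_zero, zero_add]
  rw [e]
  refine iff_of_eq (congrArg (fun f => HasSum f _) (funext fun k => ?_))
  rw [wavePotential_of_lt _ _ _ _ _ _ (mem_Ioi.1 k.2), wavePotential_of_lt _ _ _ _ _ _ (mem_Ioi.1 k.2),
    waveBlock_eq hμ₀]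

theorem wavePotential_lead_ne_zero {ω ε₀ μ₀ : ℝ} (hω : 0 < ω) (hε₀ : 0 < ε₀) (hμ₀ : 0 < μ₀) (l : ℕ)
    (c₀ : ℕ → ℂ) (c : ℕ → ℤ → ℂ) {m : ℕ} (hm : m ∈ leadRange (l + 1)) (hc : c₀ m ≠ 0) :
    wavePotential ω ε₀ μ₀ l c₀ c (l + 1) ≠ 0 := by
  rw [wavePotential_lead]
  exact smul_ne_zero (waveFactor_ne_zero hω hε₀ hμ₀ (by omega)) (lead_sum_ne_zero hm hc)

theorem exists_wavePotential {ω ε₀ μ₀ : ℝ} (hω : 0 < ω) (hε₀ : 0 < ε₀) (hμ₀ : 0 < μ₀) {l : ℕ}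
    {P : ℕ → Poly} (hP : ∀ n, P n ∈ harm n) (hl : ∀ n ≤ l, P n = 0)
    (hr : ∀ i, refl i (P (l + 1)) = (-1 : ℂ) ^ (l + 1) • P (l + 1)) :
    ∃ c₀ c, wavePotential ω ε₀ μ₀ l c₀ c = P := by
  obtain ⟨c₀, hc₀⟩ := exists_lead_sum (hP _) hr
  choose c hc using fun k => exists_solidSum hω hε₀ hμ₀ (Nat.le_add_left 1 k) (hP (k + 1))
  refine ⟨fun m => (waveFactor ω ε₀ μ₀ (l + 1))⁻¹ * c₀ m, c, funext fun n => ?_⟩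
  rcases le_or_gt n l with h | h
  · rw [wavePotential_of_le _ _ _ _ _ _ h, hl n h]
  · obtain ⟨k, rfl⟩ : ∃ k, n = k + 1 := ⟨n - 1, by omega⟩
    rcases (Nat.lt_succ_iff.1 h).eq_or_lt with rfl | h'
    · rw [wavePotential_lead]
      simp only [mul_smul]
      rw [← Finset.smul_sum, smul_inv_smul₀ (waveFactor_ne_zero hω hε₀ hμ₀ (by omega)), ← hc₀]
    · rw [wavePotential_of_lt _ _ _ _ _ _ h', hc]

end MaxwellCorner
end

/-! ### The characterization of inadmissible pairs -/

theorem theorem2p3 (ω ε₀ μ₀ : ℝ) (hω : 0 < ω) (hε₀ : 0 < ε₀) (hμ₀ : 0 < μ₀)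
    (r : ℝ) (hr : 0 < r) (E H : MaxwellCorner.R3 → MaxwellCorner.C3)
    (hsol : MaxwellCorner.IsMaxwellSolution ω ε₀ μ₀ (Metric.ball 0 r) E H)
    (hnontriv : ∃ x ∈ Metric.ball (0 : MaxwellCorner.R3) r, E x ≠ 0 ∨ H x ≠ 0) :
    MaxwellCorner.Inadmissible E H ↔
      ∃ (l₀ : ℕ) (a₀ b₀ : ℕ → ℂ) (a b : ℕ → ℤ → ℂ)
        (tail : MaxwellCorner.R3 → MaxwellCorner.C3 × MaxwellCorner.C3),
        1 ≤ l₀ ∧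
        ∑ m ∈ MaxwellCorner.leadIndices l₀, (‖a₀ m‖ ^ 2 + ‖b₀ m‖ ^ 2) ≠ 0 ∧
        (∀ x ∈ Metric.ball (0 : MaxwellCorner.R3) r,
          HasSum (fun l : Set.Ioi l₀ => MaxwellCorner.waveBlock ω ε₀ μ₀ a b l x) (tail x)) ∧
        ∀ x ∈ Metric.ball (0 : MaxwellCorner.R3) r,
          (E x, H x) =
            MaxwellCorner.leadSum (MaxwellCorner.waveEH ω ε₀ μ₀) l₀ a₀ x +
            MaxwellCorner.leadSum (MaxwellCorner.waveHE ω ε₀ μ₀) l₀ b₀ x + tail x := by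
  obtain ⟨A, B, hA, hB, hA0, hB0, hexp⟩ := MaxwellCorner.maxwell_expansion hω hε₀ hμ₀ hr hsol
  constructor
  · intro hin
    have hex : ∃ n, A n ≠ 0 ∨ B n ≠ 0 := by
      by_contra! hall
      obtain ⟨x, hx, hne⟩ := hnontriv
      have h0 := (MaxwellCorner.hasSum_poleMap_iff ω ε₀ μ₀ A B x _ _).2 (hexp x hx)
      have hz : ∀ n, MaxwellCorner.poleMap ω ε₀ μ₀ n x (A n, B n) = 0 := fun n => by
        rw [(hall n).1, (hall n).2]
        exact map_zero _
      simp only [hz] at h0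
      have h1 := h0.unique hasSum_zero
      rw [Prod.mk_eq_zero] at h1
      exact hne.elim (fun h => h h1.1) fun h => h h1.2
    classical
    obtain ⟨n, hn, hlow⟩ : ∃ n, (A n ≠ 0 ∨ B n ≠ 0) ∧ ∀ k < n, A k = 0 ∧ B k = 0 :=
      -- The lowest degree carrying a nonzero potential. It is positive since A 0 = B 0 = 0, and one
      -- less than it is the lowest Taylor order, which becomes l₀.
      ⟨Nat.find hex, Nat.find_spec hex, fun k hk => by simpa using Nat.find_min hex hk⟩
    rcases n with _ | N
    · exact absurd hn (by simp [hA0, hB0])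
    have hlA : ∀ k ≤ N, A k = 0 := fun k hk => (hlow k (Nat.lt_succ_of_le hk)).1
    have hlB : ∀ k ≤ N, B k = 0 := fun k hk => (hlow k (Nat.lt_succ_of_le hk)).2
    obtain ⟨h1, hrA, hrB⟩ :=
      (MaxwellCorner.inadmissible_iff hω hε₀ hμ₀ hr hA hB hA0 hB0 hexp hlA hlB hn).1 hin
    obtain ⟨a₀, a, hAeq⟩ := MaxwellCorner.exists_wavePotential hω hε₀ hμ₀ hA.1 hlA hrA
    obtain ⟨b₀, b, hBeq⟩ := MaxwellCorner.exists_wavePotential hω hε₀ hμ₀ hB.1 hlB hrB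
    -- The tail is taken to be whatever the leading part leaves, so the required identity is trivial
    -- and all content lies in the convergence of the blocks to it.
    refine ⟨N, a₀, b₀, a, b, fun x => (E x, H x) -
      (MaxwellCorner.leadSum (MaxwellCorner.waveEH ω ε₀ μ₀) N a₀ x +
        MaxwellCorner.leadSum (MaxwellCorner.waveHE ω ε₀ μ₀) N b₀ x), h1, ?_, fun x hx => ?_,
      fun x _ => (add_sub_cancel _ _).symm⟩
    · intro hsum
      rw [Finset.sum_eq_zero_iff_of_nonneg fun m _ => by positivity] at hsum
      have hz : ∀ m ∈ MaxwellCorner.leadRange (N + 1), a₀ m = 0 ∧ b₀ m = 0 := fun m hm => by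
        have := hsum m hm
        rw [add_eq_zero_iff_of_nonneg (by positivity) (by positivity)] at this
        simpa using this
      rw [← hAeq, ← hBeq, MaxwellCorner.wavePotential_lead, MaxwellCorner.wavePotential_lead,
        Finset.sum_eq_zero fun m hm => by rw [(hz m hm).1, zero_smul],
        Finset.sum_eq_zero fun m hm => by rw [(hz m hm).2, zero_smul]] at hn
      simp at hn
    · rw [← MaxwellCorner.wave_expansion_iff hμ₀, hAeq, hBeq]
      exact (MaxwellCorner.hasSum_poleMap_iff ω ε₀ μ₀ A B x _ _).2 (hexp x hx)
  · rintro ⟨l, a₀, b₀, a, b, tail, hl, hsum, htail, heq⟩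
    have hexp' : ∀ x ∈ Metric.ball (0 : MaxwellCorner.R3) r, _ := fun x hx =>
      (MaxwellCorner.hasSum_poleMap_iff ω ε₀ μ₀ (MaxwellCorner.wavePotential ω ε₀ μ₀ l a₀ a)
        (MaxwellCorner.wavePotential ω ε₀ μ₀ l b₀ b) x (E x) (H x)).1
        ((MaxwellCorner.wave_expansion_iff hμ₀ l a₀ b₀ a b x _).2 (by
          rw [heq x hx, add_sub_cancel_left]
          exact htail x hx))
    -- The given wave series is only known to converge pointwise. Uniqueness identifies its
    -- potentials with A and B, for which the geometric bounds, and hence the analyticity at 0, are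
    -- already available.
    have huniq : ∀ n, 1 ≤ n → A n = MaxwellCorner.wavePotential ω ε₀ μ₀ l a₀ a n ∧
        B n = MaxwellCorner.wavePotential ω ε₀ μ₀ l b₀ b n := fun n hn =>
      MaxwellCorner.pole_unique hω hε₀ hμ₀ hr hA.1 hB.1
        (MaxwellCorner.wavePotential_mem_harm ω ε₀ μ₀ l a₀ a)
        (MaxwellCorner.wavePotential_mem_harm ω ε₀ μ₀ l b₀ b) hexp hexp' hn
    have hlow : ∀ n ≤ l, A n = 0 ∧ B n = 0 := fun n hn => by
      rcases Nat.eq_zero_or_pos n with rfl | h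
      · exact ⟨hA0, hB0⟩
      · rw [(huniq n h).1, (huniq n h).2]
        exact ⟨MaxwellCorner.wavePotential_of_le _ _ _ _ _ _ hn,
          MaxwellCorner.wavePotential_of_le _ _ _ _ _ _ hn⟩
    obtain ⟨eA, eB⟩ := huniq (l + 1) (Nat.le_add_left 1 l)
    obtain ⟨m, hm, hne⟩ := Finset.exists_ne_zero_of_sum_ne_zero hsum
    refine (MaxwellCorner.inadmissible_iff hω hε₀ hμ₀ hr hA hB hA0 hB0 hexp
      (fun n hn => (hlow n hn).1) (fun n hn => (hlow n hn).2) ?_).2 ⟨hl, ?_, ?_⟩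
    · rw [eA, eB]
      by_cases ha : a₀ m = 0
      · have hb : b₀ m ≠ 0 := fun hb => hne (by simp [ha, hb])
        exact Or.inr (MaxwellCorner.wavePotential_lead_ne_zero hω hε₀ hμ₀ l b₀ b hm hb)
      · exact Or.inl (MaxwellCorner.wavePotential_lead_ne_zero hω hε₀ hμ₀ l a₀ a hm ha)
    · rw [eA]
      exact MaxwellCorner.refl_wavePotential_lead ω ε₀ μ₀ l a₀ a
    · rw [eB]
      exact MaxwellCorner.refl_wavePotential_lead ω ε₀ μ₀ l b₀ b
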